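/- \textbf{Theorem (Lower Bound on Firms).} \emph{Setting.} There are $n\ge 1$ workers, the vertices of an undirected graph $G=(W,E)$, and firms $f_1,\dots,f_{n_f}$ with $k\ge 1$ positions each, where $n=k\,n_f$. A matching assigns each worker to at most one firm so that no firm has more than $k$ employees; it is complete if every worker is employed. All workers prefer $f_i$ to $f_j$ if and only if $i<j$ and prefer any firm to unemployment; all firms share one strict ranking of the workers and prefer any worker to an empty position. Local Gale--Shapley dynamics: start from an initial matching; in each round $q=0,1,2,\dots$ an active worker $w$ is drawn uniformly at random from $W$, independently of everything else. She applies to every firm that currently employs one of her neighbours in $G$ and that she strictly prefers to her current situation. A firm makes her an offer if it has a free position or if it prefers her to its least preferred current employee. If she gets an offer, she leaves her job (if any) and joins the best firm that made an offer, and if that firm was full, its least preferred employee becomes unemployed; otherwise nothing changes. Let $N_{\mathrm{fob}}$ be the number of firms that end with no employees (i.e. have no employees from some round on). \emph{Claim.} Let $\Delta$ be the maximum degree of $G$ and let $M$ be a maximum matching in $G$. Then there is a probability distribution $\mathcal P_M$ over complete matchings of workers to firms, which does not depend on the firms' ranking of the workers, such that for every ranking of the workers \[ \mathbb E[N_{\mathrm{fob}}]\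 \ge\ \left\lfloor\frac{|M|}{k(2\Delta)}\right\rfloor\frac{1}{2^k\,k!\,(2\Delta-1)^k}, \] where the expectation is over the initial matching drawn from $\mathcal P_M$ and over the activation process (if $G$ has no edges, the right-hand side is read as $0$). Further, $\mathcal P_M$ can be found in time polynomial in $n$: there is a single program which, given $G$, $k$ and polynomially many (in $n$) independent fair random bits, halts within a number of steps polynomial in $n$ and outputs a matching whose distribution is exactly $\mathcal P_M$. -/

import Mathlib

open MeasureTheory Filter

/-! ### Job market: assignments, matchings, rankings

There are `n` workers (`Fin n`) and `nf` firms (`Fin nf`), each firm with `k` positions.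
All workers prefer firm `f` to firm `g` iff `f < g`.  The common ranking of the firms over the
workers is a labelling `rank : Fin n ≃ Fin n`: worker `w` is preferred to `w'` iff
`rank w < rank w'`. -/

namespace JobMarket

/-- `μ w = some f`: worker `w` is employed by firm `f`; `μ w = none`: `w` is unemployed. -/
abbrev Assignment (n nf : ℕ) : Type := Fin n → Option (Fin nf)

variable {n nf : ℕ}

/-- The set `μ(f)` of employees of firm `f`. -/
def employees (μ : Assignment n nf) (f : Fin nf) : Finset (Fin n) :=
  Finset.univ.filter fun w => μ w = some f

/-- An assignment is a matching if no firm has more than `k` employees. -/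
def IsMatching (k : ℕ) (μ : Assignment n nf) : Prop :=
  ∀ f, (employees μ f).card ≤ k

/-- A matching is complete if the firms together employ all workers. -/
def IsComplete (μ : Assignment n nf) : Prop :=
  Finset.univ.biUnion (employees μ) = Finset.univ

/-! ### The local Gale-Shapley dynamics -/

/-- Strict preference of a worker for firm `f` over her current situation (`none` is
unemployment, which is worse than every firm). -/
def Prefers (f : Fin nf) : Option (Fin nf) → Prop
  | none => True
  | some g => f < g

instance (f : Fin nf) (o : Option (Fin nf)) : Decidable (Prefers f o) :=
  match o with
  | none => isTrue trivial
  | some g => inferInstanceAs (Decidable (f < g))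

/-- Firm `f` would make an offer to `w`: it has a free position, or it prefers `w` to its least
preferred employee (equivalently, to some employee). -/
def MakesOffer (k : ℕ) (rank : Fin n ≃ Fin n) (μ : Assignment n nf) (f : Fin nf) (w : Fin n) :
    Prop :=
  (employees μ f).card < k ∨ ∃ w' ∈ employees μ f, rank w < rank w'

instance (k : ℕ) (rank : Fin n ≃ Fin n) (μ : Assignment n nf) (f : Fin nf) (w : Fin n) :
    Decidable (MakesOffer k rank μ f w) :=
  inferInstanceAs (Decidable (_ ∨ _))

/-- The firms from which the active worker `w` gets an offer: `w` applies to all firms that employ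
one of her neighbours and that she strictly prefers to her current situation. -/
def offers (G : SimpleGraph (Fin n)) [DecidableRel G.Adj] (k : ℕ) (rank : Fin n ≃ Fin n)
    (μ : Assignment n nf) (w : Fin n) : Finset (Fin nf) :=
  Finset.univ.filter fun f =>
    (∃ v, G.Adj w v ∧ μ v = some f) ∧ Prefers f (μ w) ∧ MakesOffer k rank μ f w

/-- `w` is the least preferred employee of the fully staffed firm `f`. -/
def IsWorstOfFull (k : ℕ) (rank : Fin n ≃ Fin n) (μ : Assignment n nf) (f : Fin nf) (w : Fin n) :
    Prop :=
  k ≤ (employees μ f).card ∧ w ∈ employees μ f ∧ ∀ w' ∈ employees μ f, rank w' ≤ rank w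

instance (k : ℕ) (rank : Fin n ≃ Fin n) (μ : Assignment n nf) (f : Fin nf) (w : Fin n) :
    Decidable (IsWorstOfFull k rank μ f w) :=
  inferInstanceAs (Decidable (_ ∧ _ ∧ _))

/-- One round with active worker `w`.  If she gets an offer, she quits her job and joins the best
firm that sent an offer; if that firm was fully staffed, its least preferred employee loses her
job.  Otherwise nothing changes. -/
def step (G : SimpleGraph (Fin n)) [DecidableRel G.Adj] (k : ℕ) (rank : Fin n ≃ Fin n)
    (μ : Assignment n nf) (w : Fin n) : Assignment n nf :=
  if h : (offers G k rank μ w).Nonempty then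
    fun x =>
      if x = w then some ((offers G k rank μ w).min' h)
      else if IsWorstOfFull k rank μ ((offers G k rank μ w).min' h) x then none
      else μ x
  else μ

/-- The matching at the beginning of round `q`, started at `μ` and with active workers
`ω 0, ω 1, …`. -/
def traj (G : SimpleGraph (Fin n)) [DecidableRel G.Adj] (k : ℕ) (rank : Fin n ≃ Fin n)
    (μ : Assignment n nf) (ω : ℕ → Fin n) : ℕ → Assignment n nf
  | 0 => μ
  | q + 1 => step G k rank (traj G k rank μ ω q) (ω q)

/-- `N_fob`: the number of firms that end with no employees, i.e. that have no employees from some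
round on. -/
noncomputable def numOutOfBusiness (G : SimpleGraph (Fin n)) [DecidableRel G.Adj] (k : ℕ)
    (rank : Fin n ≃ Fin n) (μ : Assignment n nf) (ω : ℕ → Fin n) : ℕ :=
  Set.ncard {f : Fin nf | ∀ᶠ q in atTop, employees (traj G k rank μ ω q) f = ∅}

/-- The law of the activation process: the active workers of the rounds are independent and
uniformly distributed over all workers. -/
noncomputable def activation (n : ℕ) [NeZero n] : Measure (ℕ → Fin n) :=
  Measure.infinitePi fun _ : ℕ => (PMF.uniformOfFintype (Fin n)).toMeasure

/-- `E[N_fob]`, over an initial matching drawn from `P` and an independent activation process. -/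
noncomputable def expectedOutOfBusiness [NeZero n] (G : SimpleGraph (Fin n)) [DecidableRel G.Adj]
    (k : ℕ) (rank : Fin n ≃ Fin n) (P : PMF (Assignment n nf)) : ℝ :=
  ∑ μ : Assignment n nf,
    (P μ).toReal * ∫ ω, (numOutOfBusiness G k rank μ ω : ℝ) ∂(activation n)

/-- `M` is a matching of the graph `G` with the largest possible number of edges. -/
def IsMaximumMatching {V : Type} {G : SimpleGraph V} (M : G.Subgraph) : Prop :=
  M.IsMatching ∧ ∀ M' : G.Subgraph, M'.IsMatching → M'.edgeSet.ncard ≤ M.edgeSet.ncard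

/-! ### Random access programs with a step count

A machine has variables and arrays, which hold natural numbers; a program is a finite text and so
uses finitely many of them.  Assignments of constants, sums and (truncated) differences, array
reads, array writes and tests cost one step each. -/

/-- The store of a machine. -/
structure Store where
  var : ℕ → ℕ
  arr : ℕ → ℕ → ℕ

/-- `x := v`. -/
def Store.setVar (s : Store) (x v : ℕ) : Store :=
  { s with var := Function.update s.var x v }

/-- `a[i] := v`. -/
def Store.setArr (s : Store) (a i v : ℕ) : Store :=
  { s with arr := Function.update s.arr a (Function.update (s.arr a) i v) }

/-- Programs.  Variables and arrays are named by natural numbers. -/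
inductive Prog : Type
  /-- `x := c` -/
  | const (x c : ℕ)
  /-- `x := y + z` -/
  | add (x y z : ℕ)
  /-- `x := y - z`, or `0` if `y < z` -/
  | sub (x y z : ℕ)
  /-- `x := a[y]` -/
  | load (x a y : ℕ)
  /-- `a[x] := y` -/
  | store (a x y : ℕ)
  /-- `p; q` -/
  | seq (p q : Prog)
  /-- `if x ≠ 0 then p else q` -/
  | ite (x : ℕ) (p q : Prog)
  /-- `while x ≠ 0 do p` -/
  | loop (x : ℕ) (p : Prog)

/-- `Exec p s t s'`: started in the store `s`, the program `p` halts after exactly `t` steps in the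
store `s'`. -/
inductive Exec : Prog → Store → ℕ → Store → Prop
  | const (x c : ℕ) (s : Store) : Exec (.const x c) s 1 (s.setVar x c)
  | add (x y z : ℕ) (s : Store) : Exec (.add x y z) s 1 (s.setVar x (s.var y + s.var z))
  | sub (x y z : ℕ) (s : Store) : Exec (.sub x y z) s 1 (s.setVar x (s.var y - s.var z))
  | load (x a y : ℕ) (s : Store) : Exec (.load x a y) s 1 (s.setVar x (s.arr a (s.var y)))
  | store (a x y : ℕ) (s : Store) : Exec (.store a x y) s 1 (s.setArr a (s.var x) (s.var y))
  | seq {p q : Prog} {s s' s'' : Store} {t t' : ℕ} :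
      Exec p s t s' → Exec q s' t' s'' → Exec (.seq p q) s (t + t') s''
  | ite_true {x : ℕ} {p q : Prog} {s s' : Store} {t : ℕ} :
      s.var x ≠ 0 → Exec p s t s' → Exec (.ite x p q) s (t + 1) s'
  | ite_false {x : ℕ} {p q : Prog} {s s' : Store} {t : ℕ} :
      s.var x = 0 → Exec q s t s' → Exec (.ite x p q) s (t + 1) s'
  | loop_stop {x : ℕ} {p : Prog} {s : Store} :
      s.var x = 0 → Exec (.loop x p) s 1 s
  | loop_next {x : ℕ} {p : Prog} {s s' s'' : Store} {t t' : ℕ} :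
      s.var x ≠ 0 → Exec p s t s' → Exec (.loop x p) s' t' s'' →
        Exec (.loop x p) s (t + t' + 1) s''

/-- The initial store.  Input: variable `0` holds the number `n` of workers, variable `1` the
number `k` of positions per firm, array `0` the adjacency matrix of `G` (row by row), array `1` the
random bits `r`.  Everything else is `0`. -/
def inputStore (G : SimpleGraph (Fin n)) [DecidableRel G.Adj] (k : ℕ) {m : ℕ} (r : Fin m → Bool) :
    Store where
  var x := if x = 0 then n else if x = 1 then k else 0
  arr a i :=
    if a = 0 then (if ∃ u v : Fin n, i = u * n + v ∧ G.Adj u v then 1 else 0)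
    else if a = 1 then (if h : i < m then (r ⟨i, h⟩).toNat else 0)
    else 0

/-- The output of a halted program: worker `w` is assigned to the firm whose number is the entry
`w` of array `2` (to no firm, if there is no firm of that number). -/
def output (n nf : ℕ) (s : Store) : Assignment n nf := fun w =>
  if h : s.arr 2 w < nf then some ⟨s.arr 2 w, h⟩ else none

/-- The program `p` samples exactly from `P`, given `G`, `k` and `m` independent fair random bits,
and always halts within `T` steps. -/
def Samples (p : Prog) (G : SimpleGraph (Fin n)) [DecidableRel G.Adj] (k m T : ℕ)
    (P : PMF (Assignment n nf)) : Prop :=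
  ∃ final : (Fin m → Bool) → Store,
    (∀ r, ∃ t ≤ T, Exec p (inputStore G k r) t (final r)) ∧
    P = (PMF.uniformOfFintype (Fin m → Bool)).map fun r => output n nf (final r)

end JobMarket

/-! Write `D` for the maximum degree and `q` for the floor in the claim. Then `G` has a matching
with at least `2 * D * k * q` edges, enough for about `2 * D * q` firms, while only `q` firms have
to contribute `1 / (2 ^ k * k! * (2 * D - 1) ^ k)` each. This surplus of a factor `2 * D` pays for
all the losses below.

The initial matching puts one end of certain disjoint edges, the leader, into a bad firm and the
other end, her partner, into a good firm; a fair coin decides which end is which. With probability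
`2 ^ (-k)` all employees of a given bad firm are ranked above their partners. Such an employee gets
a better offer whenever she is active while her partner keeps the job. Applicants need a neighbour
in the firm, so an empty firm stays empty, and it remains to bound the probability that all `k`
leaders leave before somebody joins them or a partner is dismissed.

There are two ways to do this. The first follows a single bad firm (`GroupSystem`). As long as the
good firms involved employ only workers of fixed sets, no needed partner is dismissed (`not_worst`),
few workers can spoil this when active (`card_harm_le`), and a minimum principle (`le_of_hitting`)
yields a product of factors `1 / harmBound`. If the `k` partners share one good firm, the loss
against `k! * (2 * D - 1) ^ k` is less than a factor `(2k).choose k / 2 ^ k` or so, which the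
surplus covers for `D = 1`, for `D = 2` and `k ≤ 4`, and for `k ≤ 5` if `3 ≤ D`. For `D = 2` and `5
≤ k ≤ 10` the partners are spread over several good firms; this needs the edges in an order in which
leading edges have no neighbours in later chunks (`noCross_orderedPairs`).

In all other cases the leaders are scattered at random over `F` bad firms. The best `F` firms evolve
without regard to the others (`trunc_step`), so the set of successful leaders is independent of who
shares a bad firm. If `S` leaders succeed, the expected number of emptied firms is about `F *
S.choose k / (k * F).choose k`. The `k`-th binomial moment of `S` satisfies first-step equations
that give the recursive bound `wbound` (`wbound_le_moments`). An explicit estimate of it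
(`oddProd_choose_le_wbound`), averaged over the coins, reduces the claim to numerical inequalities
(`ScatterRange.le`).

For the running time, no maximum matching is computed. Local search by insertion of up to 4003 edges
loses at most a factor `2001 / 2002` (`LocallyOptimal.matched_ge`), which the estimates tolerate.
The sampler is written in a small language with a verified, polynomially bounded compilation. It
never looks at the ranking of the workers. -/

namespace JobMarket

/-! ### Means over finite words of active workers. -/

section Averages

variable {n : ℕ}

/-- The mean of `F` over all words of length `T`. -/
noncomputable def avg : ℕ → (List (Fin n) → ℝ) → ℝ
  | 0, F => F []
  | T + 1, F => (∑ w : Fin n, avg T fun l => F (w :: l)) / n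

theorem avg_mono (T : ℕ) {F H : List (Fin n) → ℝ} (h : ∀ l, F l ≤ H l) : avg T F ≤ avg T H := by
  induction T generalizing F H with
  | zero => exact h []
  | succ T ih =>
    simp only [avg]
    gcongr with w
    exact ih fun l => h _

theorem avg_add (T : ℕ) (F H : List (Fin n) → ℝ) :
    avg T (fun l => F l + H l) = avg T F + avg T H := by
  induction T generalizing F H with
  | zero => rfl
  | succ T ih => simp only [avg, ih, Finset.sum_add_distrib, add_div]

theorem avg_mul_left (T : ℕ) (c : ℝ) (F : List (Fin n) → ℝ) :
    avg T (fun l => c * F l) = c * avg T F := by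
  induction T generalizing F with
  | zero => rfl
  | succ T ih => simp only [avg, ih, ← Finset.mul_sum, mul_div_assoc]

theorem avg_sum (T : ℕ) {ι : Type*} (s : Finset ι) (F : ι → List (Fin n) → ℝ) :
    avg T (fun l => ∑ i ∈ s, F i l) = ∑ i ∈ s, avg T (F i) := by
  induction T generalizing F with
  | zero => rfl
  | succ T ih => simp only [avg, ih, Finset.sum_comm (s := Finset.univ), Finset.sum_div]

theorem avg_const [NeZero n] (T : ℕ) (c : ℝ) : avg T (fun _ : List (Fin n) => c) = c := by
  induction T with
  | zero => rfl
  | succ T ih =>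
    have : (n : ℝ) ≠ 0 := by exact_mod_cast NeZero.ne n
    simp only [avg, ih]
    simp [this]

theorem avg_eq_sum_ofFn (T : ℕ) (F : List (Fin n) → ℝ) :
    avg T F = ∑ x : Fin T → Fin n, ((1 : ℝ) / n) ^ T * F (List.ofFn x) := by
  induction T generalizing F with
  | zero => simp [avg]
  | succ T ih =>
    simp only [avg, ih]
    rw [← (Fin.consEquiv fun _ => Fin n).sum_comp, Fintype.sum_prod_type, Finset.sum_div]
    refine Finset.sum_congr rfl fun w _ => ?_
    rw [Finset.sum_div]
    refine Finset.sum_congr rfl fun x _ => ?_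
    have hx : List.ofFn ((Fin.consEquiv fun _ => Fin n) (w, x)) = w :: List.ofFn x :=
      List.ofFn_cons w x
    rw [hx, pow_succ]
    ring

end Averages

/-! ### From finite words to the activation process. -/

section Expectation

variable {n nf : ℕ} (G : SimpleGraph (Fin n)) [DecidableRel G.Adj] (k : ℕ) (rank : Fin n ≃ Fin n)

/-- The matching after the rounds with the active workers of a word. -/
def run (μ : Assignment n nf) (l : List (Fin n)) : Assignment n nf := l.foldl (step G k rank) μ

theorem traj_eq_run (μ : Assignment n nf) (ω : ℕ → Fin n) (q : ℕ) :
    traj G k rank μ ω q = run G k rank μ (List.ofFn fun i : Fin q => ω i) := by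
  induction q with
  | zero => rfl
  | succ q ih =>
    rw [traj, ih, run, run, List.ofFn_succ', List.concat_eq_append, List.foldl_append]
    rfl

theorem step_eq_some {μ : Assignment n nf} {w x : Fin n} {f : Fin nf}
    (h : step G k rank μ w x = some f) :
    μ x = some f ∨ x = w ∧ f ∈ offers G k rank μ w := by
  unfold step at h
  split_ifs at h with h1
  · beta_reduce at h
    by_cases hx : x = w
    · rw [if_pos hx] at h
      right
      refine ⟨hx, ?_⟩
      have := Finset.min'_mem _ h1
      rwa [Option.some.inj h] at this
    · rw [if_neg hx] at h
      split_ifs at h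
      left; exact h
  · left; exact h

/-- A worker applies only to firms that employ one of her neighbours, so nobody applies to an empty
firm. -/
theorem step_employees_empty {μ : Assignment n nf} {f : Fin nf} (h : employees μ f = ∅)
    (w : Fin n) : employees (step G k rank μ w) f = ∅ := by
  rw [Finset.eq_empty_iff_forall_notMem] at h ⊢
  intro x hx
  simp only [employees, Finset.mem_filter, Finset.mem_univ, true_and] at h hx
  rcases step_eq_some G k rank hx with h1 | ⟨-, h1⟩
  · exact h x h1
  · simp only [offers, Finset.mem_filter, Finset.mem_univ, true_and] at h1
    obtain ⟨⟨v, -, hv⟩, -⟩ := h1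
    exact h v hv

theorem run_employees_empty {μ : Assignment n nf} {f : Fin nf} (h : employees μ f = ∅)
    (l : List (Fin n)) : employees (run G k rank μ l) f = ∅ := by
  induction l generalizing μ with
  | nil => exact h
  | cons w l ih => exact ih (step_employees_empty G k rank h w)

theorem traj_employees_empty_of_le {μ : Assignment n nf} {ω : ℕ → Fin n} {f : Fin nf} {q q' : ℕ}
    (hq : q ≤ q') (h : employees (traj G k rank μ ω q) f = ∅) :
    employees (traj G k rank μ ω q') f = ∅ := by
  induction q', hq using Nat.le_induction with
  | base => exact h
  | succ q' _ ih => exact step_employees_empty G k rank ih _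

theorem measurableSet_traj (μ : Assignment n nf) (f : Fin nf) (q : ℕ) :
    MeasurableSet {ω : ℕ → Fin n | employees (traj G k rank μ ω q) f = ∅} := by
  have : {ω : ℕ → Fin n | employees (traj G k rank μ ω q) f = ∅} =
      (fun (ω : ℕ → Fin n) (i : Fin q) => ω i) ⁻¹'
        {x | employees (run G k rank μ (List.ofFn x)) f = ∅} := by
    ext ω
    simp [traj_eq_run]
  rw [this]
  exact (measurable_pi_lambda _ fun i => measurable_pi_apply _) (Set.toFinite _).measurableSet

theorem activation_cylinder [NeZero n] (T : ℕ) (x : Fin T → Fin n) :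
    (activation n).real {ω | (fun i : Fin T => ω i) = x} = ((1 : ℝ) / n) ^ T := by
  -- The box form makes the product formula for `Measure.infinitePi` applicable; the guard `i < T`
  -- only serves to index `x`.
  have hset : {ω : ℕ → Fin n | (fun i : Fin T => ω i) = x} =
      Set.pi (Finset.range T : Set ℕ) fun i => {y | ∀ h : i < T, y = x ⟨i, h⟩} := by
    ext ω
    simp only [Set.mem_ofPred_eq, funext_iff, Set.mem_pi, Finset.coe_range, Set.mem_Iio]
    exact ⟨fun h i hi _ => h ⟨i, hi⟩, fun h i => h i i.2 i.2⟩
  rw [measureReal_def, hset, activation, Measure.infinitePi_pi]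
  · rw [Finset.prod_congr rfl (g := fun _ => (n : ENNReal)⁻¹)]
    · simp
    · intro i hi
      have hi' : i < T := Finset.mem_range.mp hi
      have : {y : Fin n | ∀ h : i < T, y = x ⟨i, h⟩} = {x ⟨i, hi'⟩} := by
        ext y; simp [hi']
      rw [this, PMF.toMeasure_apply_singleton _ _ (MeasurableSet.singleton _)]
      simp
  · intro i _
    exact (Set.toFinite _).measurableSet

theorem integral_word [NeZero n] (T : ℕ) (F : List (Fin n) → ℝ) :
    ∫ ω, F (List.ofFn fun i : Fin T => ω i) ∂(activation n) = avg T F := by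
  have hm : Measurable (fun (ω : ℕ → Fin n) (i : Fin T) => ω i) :=
    measurable_pi_lambda _ fun i => measurable_pi_apply _
  have : IsProbabilityMeasure (activation n) := by unfold activation; infer_instance
  rw [avg_eq_sum_ofFn,
    ← integral_map (φ := fun (ω : ℕ → Fin n) (i : Fin T) => ω i)
      (f := fun x => F (List.ofFn x)) hm.aemeasurable
      (measurable_of_finite _).aestronglyMeasurable,
    integral_fintype Integrable.of_finite]
  refine Finset.sum_congr rfl fun x _ => ?_
  rw [smul_eq_mul, map_measureReal_apply hm (Set.toFinite _).measurableSet,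
    ← activation_cylinder T x]
  rfl

/-- The number of firms without employees. -/
def numEmpty (μ : Assignment n nf) : ℕ := (Finset.univ.filter fun f => employees μ f = ∅).card

open scoped Classical in
-- Emptiness is absorbing, so the firms that are empty after `T` rounds are among those counted in
-- the end. All later estimates are made for finite `T` and then passed to the limit.
theorem avg_numEmpty_le [NeZero n] (μ : Assignment n nf) (T : ℕ) :
    avg T (fun l => (numEmpty (run G k rank μ l) : ℝ)) ≤
      ∫ ω, (numOutOfBusiness G k rank μ ω : ℝ) ∂(activation n) := by
  have : IsProbabilityMeasure (activation n) := by unfold activation; infer_instance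
  have hle : ∀ ω, numOutOfBusiness G k rank μ ω ≤ nf := by
    intro ω
    unfold numOutOfBusiness
    calc _ ≤ Set.ncard (Set.univ : Set (Fin nf)) := Set.ncard_le_ncard (Set.subset_univ _)
      _ = nf := by simp [Set.ncard_univ]
  have hms : ∀ f : Fin nf, MeasurableSet
      {ω : ℕ → Fin n | ∀ᶠ q in atTop, employees (traj G k rank μ ω q) f = ∅} := by
    intro f
    have : {ω : ℕ → Fin n | ∀ᶠ q in atTop, employees (traj G k rank μ ω q) f = ∅} =
        ⋃ q, {ω : ℕ → Fin n | employees (traj G k rank μ ω q) f = ∅} := by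
      ext ω
      simp only [Set.mem_ofPred_eq, Set.mem_iUnion, eventually_atTop]
      exact ⟨fun ⟨q, h⟩ => ⟨q, h q le_rfl⟩,
        fun ⟨q, h⟩ => ⟨q, fun q' hq => traj_employees_empty_of_le G k rank hq h⟩⟩
    rw [this]
    exact MeasurableSet.iUnion fun q => measurableSet_traj G k rank μ f q
  have hmeas : Measurable fun ω : ℕ → Fin n => (numOutOfBusiness G k rank μ ω : ℝ) := by
    have : (fun ω : ℕ → Fin n => (numOutOfBusiness G k rank μ ω : ℝ)) = fun ω =>
        ∑ f : Fin nf, Set.indicator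
          {ω : ℕ → Fin n | ∀ᶠ q in atTop, employees (traj G k rank μ ω q) f = ∅}
          (fun _ => (1 : ℝ)) ω := by
      funext ω
      rw [numOutOfBusiness, Set.ncard_eq_toFinset_card']
      simp only [Set.toFinset_ofPred, Finset.card_filter, Set.indicator_apply, Set.mem_ofPred_eq]
      push_cast
      rfl
    rw [this]
    exact Finset.measurable_sum _ fun f _ => measurable_const.indicator (hms f)
  have hint : Integrable (fun ω : ℕ → Fin n => (numOutOfBusiness G k rank μ ω : ℝ))
      (activation n) := by
    refine Integrable.of_bound hmeas.aestronglyMeasurable nf (Eventually.of_forall fun ω => ?_)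
    rw [Real.norm_of_nonneg (by positivity)]
    exact_mod_cast hle ω
  rw [← integral_word T]
  refine integral_mono_of_nonneg (Eventually.of_forall fun ω => by positivity) hint
    (Eventually.of_forall fun ω => ?_)
  simp only
  norm_cast
  rw [← traj_eq_run, numEmpty, ← Set.ncard_coe_finset, numOutOfBusiness]
  refine Set.ncard_le_ncard (fun f hf => ?_) (Set.toFinite _)
  simp only [Finset.coe_filter, Finset.mem_univ, true_and, Set.mem_ofPred_eq] at hf ⊢
  exact eventually_atTop.mpr ⟨T, fun q hq => traj_employees_empty_of_le G k rank hq hf⟩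

end Expectation

/-! ### The effect of one round. -/

section Step

variable {n nf : ℕ} (G : SimpleGraph (Fin n)) [DecidableRel G.Adj] (k : ℕ) (rank : Fin n ≃ Fin n)

theorem mem_employees {μ : Assignment n nf} {f : Fin nf} {x : Fin n} :
    x ∈ employees μ f ↔ μ x = some f := by
  simp [employees]

theorem mem_offers {μ : Assignment n nf} {f : Fin nf} {w : Fin n} :
    f ∈ offers G k rank μ w ↔
      (∃ v, G.Adj w v ∧ μ v = some f) ∧ Prefers f (μ w) ∧ MakesOffer k rank μ f w := by
  simp [offers]

/-- The matching after `w` has joined `f`. -/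
def join (μ : Assignment n nf) (w : Fin n) (f : Fin nf) : Assignment n nf := fun x =>
  if x = w then some f else if IsWorstOfFull k rank μ f x then none else μ x

theorem step_cases (μ : Assignment n nf) (w : Fin n) :
    (offers G k rank μ w = ∅ ∧ step G k rank μ w = μ) ∨
      ∃ f ∈ offers G k rank μ w, (∀ g ∈ offers G k rank μ w, f ≤ g) ∧
        step G k rank μ w = join k rank μ w f := by
  unfold step
  split_ifs with h
  · exact Or.inr ⟨_, Finset.min'_mem _ h, fun g hg => Finset.min'_le _ _ hg, rfl⟩
  · exact Or.inl ⟨Finset.not_nonempty_iff_eq_empty.mp h, rfl⟩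

variable {k rank}

theorem join_self (μ : Assignment n nf) (w : Fin n) (f : Fin nf) :
    join k rank μ w f w = some f := by simp [join]

theorem join_of_ne {μ : Assignment n nf} {w x : Fin n} {f : Fin nf} (hx : x ≠ w)
    (h : ¬ IsWorstOfFull k rank μ f x) : join k rank μ w f x = μ x := by
  simp [join, hx, h]

theorem join_eq_some {μ : Assignment n nf} {w x : Fin n} {f g : Fin nf}
    (h : join k rank μ w f x = some g) : (x = w ∧ g = f) ∨ (x ≠ w ∧ μ x = some g) := by
  unfold join at h
  split_ifs at h with h1
  · exact Or.inl ⟨h1, (Option.some.inj h).symm⟩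
  · exact Or.inr ⟨h1, h⟩

theorem exists_worst {μ : Assignment n nf} {f : Fin nf} (hk : 0 < k)
    (h : k ≤ (employees μ f).card) : ∃ x, IsWorstOfFull k rank μ f x := by
  obtain ⟨x, hx, hmax⟩ := Finset.exists_max_image (employees μ f) (fun w => rank w)
    (Finset.card_pos.mp (hk.trans_le h))
  exact ⟨x, h, hx, hmax⟩

/-- Since `k` is positive, a full firm has a least preferred employee, and her departure makes room.
-/
theorem IsMatching.join {μ : Assignment n nf} (hk : 0 < k) (hμ : IsMatching k μ) (w : Fin n)
    {f : Fin nf} : IsMatching k (JobMarket.join k rank μ w f) := by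
  intro g
  by_cases hg : g = f
  · subst hg
    by_cases hfull : k ≤ (employees μ g).card
    · obtain ⟨z, hz⟩ := exists_worst (rank := rank) hk hfull
      have hsub : employees (JobMarket.join k rank μ w g) g ⊆ insert w ((employees μ g).erase z) := by
        intro x hx
        rw [mem_employees] at hx
        rcases join_eq_some hx with ⟨h1, -⟩ | ⟨h1, h2⟩
        · simp [h1]
        · refine Finset.mem_insert_of_mem (Finset.mem_erase.mpr ⟨?_, mem_employees.mpr h2⟩)
          rintro rfl
          simp [JobMarket.join, h1, hz] at hx
      calc _ ≤ _ := Finset.card_le_card hsub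
        _ ≤ ((employees μ g).erase z).card + 1 := Finset.card_insert_le _ _
        _ ≤ k := by
          rw [Finset.card_erase_of_mem hz.2.1]
          have := hμ g
          omega
    · have hsub : employees (JobMarket.join k rank μ w g) g ⊆ insert w (employees μ g) := by
        intro x hx
        rw [mem_employees] at hx
        rcases join_eq_some hx with ⟨h1, -⟩ | ⟨h1, h2⟩
        · simp [h1]
        · exact Finset.mem_insert_of_mem (mem_employees.mpr h2)
      calc _ ≤ _ := Finset.card_le_card hsub
        _ ≤ (employees μ g).card + 1 := Finset.card_insert_le _ _
        _ ≤ k := by omega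
  · refine le_trans (Finset.card_le_card fun x hx => ?_) (hμ g)
    rw [mem_employees] at hx ⊢
    rcases join_eq_some hx with ⟨-, h1⟩ | ⟨-, h2⟩
    · exact absurd h1 hg
    · exact h2

theorem IsMatching.step {μ : Assignment n nf} (hk : 0 < k) (hμ : IsMatching k μ) (w : Fin n) :
    IsMatching k (step G k rank μ w) := by
  rcases step_cases G k rank μ w with ⟨-, h⟩ | ⟨f, -, -, h⟩
  · rw [h]; exact hμ
  · rw [h]; exact hμ.join hk w

end Step

/-! ### A minimum principle for hitting probabilities. -/

section Hitting

theorem exists_limit {σ : Type*} (v : ℕ → σ → ℝ) (hmono : ∀ T x, v T x ≤ v (T + 1) x)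
    (C : ℝ) (hC : ∀ T x, v T x ≤ C) :
    ∃ p : σ → ℝ, (∀ x, Tendsto (fun T => v T x) atTop (nhds (p x))) ∧ ∀ T x, v T x ≤ p x := by
  have hb : ∀ x, BddAbove (Set.range fun T => v T x) := fun x => ⟨C, by rintro _ ⟨T, rfl⟩; exact hC T x⟩
  refine ⟨fun x => ⨆ T, v T x, fun x =>
    tendsto_atTop_ciSup (monotone_nat_of_le_succ fun T => hmono T x) (hb x),
    fun T x => le_ciSup (hb x) T⟩

/-- Induct on `S` and look at a state where `p` is least among those with the invariant. Workers
outside `H` keep the invariant, so they contribute at least the minimum to the mean value equation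
and cancel. What remains is `|H| * p` on one side and at least the values after the good moves,
hence at least `|H| * Q S`, on the other. It is not necessary to know that the process ever leaves
the set `Inv S`. -/
theorem le_of_hitting {n : ℕ} {σ ι : Type*} [Finite σ] [DecidableEq ι] (s : σ → Fin n → σ)
    (p : σ → ℝ) (hp : ∀ x, 0 ≤ p x) (harm : ∀ x, n * p x = ∑ w, p (s x w))
    (Inv : Finset ι → σ → Prop) (Q : Finset ι → ℝ) (h0 : ∀ x, Inv ∅ x → Q ∅ ≤ p x)
    (hstep : ∀ S x, S.Nonempty → Inv S x → ∃ (H : Finset (Fin n)) (N : Finset ι) (mv : ι → Fin n),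
      N.Nonempty ∧ N ⊆ S ∧ (∀ i ∈ N, mv i ∈ H ∧ Inv (S.erase i) (s x (mv i))) ∧
      Set.InjOn mv N ∧ (∀ w ∉ H, Inv S (s x w)) ∧ H.card * Q S ≤ ∑ i ∈ N, Q (S.erase i)) :
    ∀ S x, Inv S x → Q S ≤ p x := by
  intro S
  induction S using Finset.strongInduction with
  | H S ih =>
  intro x hx
  rcases S.eq_empty_or_nonempty with rfl | hS
  · exact h0 x hx
  -- Finiteness of the state space provides the minimiser.
  obtain ⟨y, hy, hmin⟩ := Set.exists_min_image {x | Inv S x} p (Set.toFinite _) ⟨x, hx⟩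
  refine le_trans ?_ (hmin x hx)
  obtain ⟨H, N, mv, hN, hNS, hmv, hinj, hout, hcard⟩ := hstep S y hS hy
  have hH : 0 < (H.card : ℝ) := by
    obtain ⟨i, hi⟩ := hN
    exact_mod_cast Finset.card_pos.mpr ⟨_, (hmv i hi).1⟩
  have h1 : ∑ i ∈ N, Q (S.erase i) ≤ ∑ w ∈ H, p (s y w) := by
    calc ∑ i ∈ N, Q (S.erase i) ≤ ∑ i ∈ N, p (s y (mv i)) :=
          Finset.sum_le_sum fun i hi => ih _ (Finset.erase_ssubset (hNS hi)) _ (hmv i hi).2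
      _ = ∑ w ∈ N.image mv, p (s y w) := (Finset.sum_image (f := fun w => p (s y w)) hinj).symm
      _ ≤ ∑ w ∈ H, p (s y w) := by
          refine Finset.sum_le_sum_of_subset_of_nonneg ?_ fun _ _ _ => hp _
          intro w hw
          obtain ⟨i, hi, rfl⟩ := Finset.mem_image.mp hw
          exact (hmv i hi).1
  have h2 : (n - H.card : ℝ) * p y ≤ ∑ w ∈ Hᶜ, p (s y w) := by
    have : (n - H.card : ℝ) = ((Hᶜ).card : ℝ) := by
      rw [Finset.card_compl, Fintype.card_fin, Nat.cast_sub]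
      exact (Finset.card_le_univ H).trans_eq (Fintype.card_fin n)
    rw [this, ← nsmul_eq_mul]
    refine Finset.card_nsmul_le_sum _ _ _ fun w hw => hmin _ (hout w (Finset.mem_compl.mp hw))
  have h3 := harm y
  rw [← Finset.sum_add_sum_compl H] at h3
  have : (H.card : ℝ) * Q S ≤ H.card * p y := by nlinarith
  exact le_of_mul_le_mul_left this hH

end Hitting

/-! ### The race for a single firm. -/

variable {n nf : ℕ}

/-- A firm `f` and workers `u i` in it, each with a less preferred neighbour `v i` in a better firm
`h i`.  The employees of the firm `g` of some `h i` together with all `u i` such that `h i = g` form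
the set `C g`, in which every worker has a partner. -/
structure GroupSystem (G : SimpleGraph (Fin n)) (k nf : ℕ) (rank : Fin n ≃ Fin n) (ι : Type)
    [Fintype ι] [DecidableEq ι] where
  f : Fin nf
  u : ι → Fin n
  v : ι → Fin n
  h : ι → Fin nf
  C : Fin nf → Finset (Fin n)
  p : Fin n → Fin n
  u_inj : Function.Injective u
  v_inj : Function.Injective v
  adj : ∀ i, G.Adj (u i) (v i)
  better : ∀ i, rank (u i) < rank (v i)
  lt : ∀ i, h i < f
  u_ne_v : ∀ i j, u i ≠ v j
  u_mem : ∀ i, u i ∈ C (h i)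
  v_mem : ∀ i, v i ∈ C (h i)
  p_mem : ∀ i, ∀ y ∈ C (h i), p y ∈ C (h i)
  p_adj : ∀ i, ∀ y ∈ C (h i), G.Adj y (p y)
  -- A leader who moves joins the best firm that makes an offer; this keeps her out of the better
  -- firms on which other leaders depend.
  cross : ∀ i j, h j < h i → ∀ y ∈ C (h j), ¬ G.Adj (u i) y
  -- The set `C` has just enough members for the `k` positions and the leaders aiming at the firm.
  -- The count in `not_worst` exceeds this by one.
  card : ∀ i, (C (h i)).card = k + (Finset.univ.filter fun j => h j = h i).card

namespace GroupSystem

variable {G : SimpleGraph (Fin n)} [DecidableRel G.Adj] {k : ℕ} {rank : Fin n ≃ Fin n}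
  {ι : Type} [Fintype ι] [DecidableEq ι] (Γ : GroupSystem G k nf rank ι)

/-- The situation in which exactly the `u i` with `i ∈ S` have not moved yet. -/
structure Inv (S : Finset ι) (μ : Assignment n nf) : Prop where
  matching : IsMatching k μ
  f_eq : ∀ x, μ x = some Γ.f ↔ ∃ i ∈ S, Γ.u i = x
  v_eq : ∀ i ∈ S, μ (Γ.v i) = some (Γ.h i)
  sub : ∀ i ∈ S, ∀ y, μ y = some (Γ.h i) → y ∈ Γ.C (Γ.h i)
  -- Leaders who aim at the same firm have to leave in the order of their partners, the least
  -- preferred partner first. Hence the partners still needed outrank the others.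
  order : ∀ i ∈ S, ∀ j ∉ S, Γ.h j = Γ.h i → rank (Γ.v i) < rank (Γ.v j)

omit [DecidableRel G.Adj] in
-- Suppose `v i` were dismissed when `w` joins the full firm. Then `w` outranks `v i`, and the
-- partners `v j` of the leaders already gone rank below `v i`, so these are not employed there. The
-- `k` employees, `w`, those `v j`, and the remaining leaders `u j` are distinct members of `C g`:
-- one more than its cardinality allows.
theorem not_worst {S : Finset ι} {μ : Assignment n nf} {g : Fin nf} {w : Fin n} {i : ι}
    (hg : Γ.h i = g) (hsub : ∀ y, μ y = some g → y ∈ Γ.C g ∧ ∀ j ∈ S, Γ.u j ≠ y)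
    (horder : ∀ j ∉ S, Γ.h j = g → rank (Γ.v i) < rank (Γ.v j))
    (hwC : w ∈ Γ.C g) (hwS : ∀ j ∈ S, Γ.u j ≠ w) (hw : μ w ≠ some g)
    (hoff : MakesOffer k rank μ g w) : ¬ IsWorstOfFull k rank μ g (Γ.v i) := by
  rintro ⟨hfull, hmem, hmax⟩
  subst hg
  have hwlt : rank w < rank (Γ.v i) := by
    rcases hoff with h | ⟨w', hw', h⟩
    · exact absurd h (by omega)
    · exact h.trans_le (hmax _ hw')
  set J := Finset.univ.filter fun j => Γ.h j = Γ.h i with hJ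
  set B := employees μ (Γ.h i) ∪ insert w ((J \ S).image Γ.v) ∪ (J ∩ S).image Γ.u with hB
  have hBC : B ⊆ Γ.C (Γ.h i) := by
    intro y hy
    simp only [hB, Finset.mem_union, Finset.mem_insert, Finset.mem_image, Finset.mem_sdiff,
      Finset.mem_inter, hJ, Finset.mem_filter, Finset.mem_univ, true_and, mem_employees] at hy
    rcases hy with (hy | rfl | ⟨j, ⟨hj, -⟩, rfl⟩) | ⟨j, ⟨hj, -⟩, rfl⟩
    · exact (hsub y hy).1
    · exact hwC
    · exact hj ▸ Γ.v_mem j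
    · exact hj ▸ Γ.u_mem j
  have hd1 : w ∉ (J \ S).image Γ.v := by
    intro h
    simp only [Finset.mem_image, Finset.mem_sdiff, hJ, Finset.mem_filter, Finset.mem_univ,
      true_and] at h
    obtain ⟨j, ⟨hj, hjS⟩, rfl⟩ := h
    exact absurd hwlt (horder j hjS hj).asymm
  have hd2 : Disjoint (employees μ (Γ.h i)) (insert w ((J \ S).image Γ.v)) := by
    rw [Finset.disjoint_left]
    intro y hy hy'
    rcases Finset.mem_insert.mp hy' with rfl | hy'
    · exact hw (mem_employees.mp hy)
    · simp only [Finset.mem_image, Finset.mem_sdiff, hJ, Finset.mem_filter, Finset.mem_univ,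
        true_and] at hy'
      obtain ⟨j, ⟨hj, hjS⟩, rfl⟩ := hy'
      exact absurd (hmax _ hy) (not_le.mpr (horder j hjS hj))
  have hd3 : Disjoint (employees μ (Γ.h i) ∪ insert w ((J \ S).image Γ.v))
      ((J ∩ S).image Γ.u) := by
    rw [Finset.disjoint_right]
    intro y hy hy'
    simp only [Finset.mem_image, Finset.mem_inter] at hy
    obtain ⟨j, ⟨-, hjS⟩, rfl⟩ := hy
    rcases Finset.mem_union.mp hy' with h | h
    · exact (hsub _ (mem_employees.mp h)).2 j hjS rfl
    · rcases Finset.mem_insert.mp h with h | h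
      · exact hwS j hjS h
      · obtain ⟨j', -, h⟩ := Finset.mem_image.mp h
        exact Γ.u_ne_v j j' h.symm
  have hcard := Finset.card_le_card hBC
  rw [hB, Finset.card_union_of_disjoint hd3, Finset.card_union_of_disjoint hd2,
    Finset.card_insert_of_notMem hd1, Finset.card_image_of_injective _ Γ.v_inj,
    Finset.card_image_of_injective _ Γ.u_inj, Γ.card i, ← hJ] at hcard
  have := Finset.card_sdiff_add_card_inter J S
  omega

/-- The workers whose activation may spoil the situation. -/
def harm (S : Finset ι) (μ : Assignment n nf) : Finset (Fin n) :=
  -- In turn: the remaining leaders; those who could follow them into `f`; for each needed partner,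
  -- either the partner herself if a better firm is in sight, or her neighbours who could come to
  -- her firm; and the strangers who could reach that firm through another employee. The mate `p y`
  -- of an employee `y` is exempt, since she belongs to `C`.
  S.image Γ.u ∪ S.biUnion (fun i => (G.neighborFinset (Γ.u i)).erase (Γ.v i)) ∪
    S.biUnion (fun i => Finset.univ.filter fun w =>
      (w = Γ.v i ∧ ∃ x, G.Adj w x ∧ ∃ g, μ x = some g ∧ g < Γ.h i) ∨
      (w ≠ Γ.u i ∧ G.Adj (Γ.v i) w ∧ ¬ ∃ g, μ w = some g ∧ g < Γ.h i)) ∪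
    (S.image Γ.h).biUnion fun g => (employees μ g \ S.image Γ.v).biUnion fun y =>
      (G.neighborFinset y).erase (Γ.p y)

theorem prefers_of_eq_some {f g : Fin nf} {o : Option (Fin nf)} (h : Prefers f o)
    (ho : o = some g) : f < g := by
  subst ho; exact h

/-- Whoever joins the firm of a needed partner through an employee does so from inside `C`, unless
she is in `harm`; then `not_worst` protects the partner. No one joins `f`, no remaining leader
moves, and no needed partner quits. -/
theorem inv_step_of_notMem {S : Finset ι} {μ : Assignment n nf} (hk : 0 < k) (hI : Γ.Inv S μ)
    {w : Fin n} (hw : w ∉ Γ.harm S μ) : Γ.Inv S (step G k rank μ w) := by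
  simp only [harm, Finset.mem_union, not_or] at hw
  obtain ⟨⟨⟨hw1, hw2⟩, hw3⟩, hw4⟩ := hw
  have hw1' : ∀ i ∈ S, Γ.u i ≠ w := fun i hi h =>
    hw1 (Finset.mem_image.mpr ⟨i, hi, h⟩)
  rcases step_cases G k rank μ w with ⟨-, h⟩ | ⟨F, hF, -, h⟩
  · rw [h]; exact hI
  have hm := hI.matching.step (G := G) (rank := rank) hk w
  rw [h] at hm ⊢
  obtain ⟨⟨y, hwy, hy⟩, hpref, hoff⟩ := (mem_offers G k rank).mp hF
  have hwF : μ w ≠ some F := fun h => lt_irrefl _ (prefers_of_eq_some hpref h)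
  -- The only exempt neighbour of `u i` is `v i`, who already holds a better job than one in `f`.
  have hFf : F ≠ Γ.f := by
    rintro rfl
    obtain ⟨i, hi, rfl⟩ := (hI.f_eq y).mp hy
    refine hw2 (Finset.mem_biUnion.mpr ⟨i, hi, Finset.mem_erase.mpr ⟨?_, ?_⟩⟩)
    · rintro rfl
      exact absurd (prefers_of_eq_some hpref (hI.v_eq i hi)) (Γ.lt i).asymm
    · rw [SimpleGraph.mem_neighborFinset]; exact hwy.symm
  have hvw : ∀ i ∈ S, Γ.v i ≠ w := by
    rintro i hi rfl
    refine hw3 (Finset.mem_biUnion.mpr ⟨i, hi, ?_⟩)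
    simp only [Finset.mem_filter, Finset.mem_univ, true_and]
    exact Or.inl ⟨y, hwy, F, hy, prefers_of_eq_some hpref (hI.v_eq i hi)⟩
  -- If the contact `y` is a needed partner, then `w` is harmful because she has no better job; if
  -- not, the only harmless neighbour of `y` is her mate.
  have hwC : ∀ i ∈ S, Γ.h i = F → w ∈ Γ.C F := by
    intro i hi hiF
    have hyC := hI.sub i hi y (hiF ▸ hy)
    rw [← hiF]
    by_cases hyv : y ∈ S.image Γ.v
    · exfalso
      obtain ⟨j, hj, rfl⟩ := Finset.mem_image.mp hyv
      refine hw3 (Finset.mem_biUnion.mpr ⟨j, hj, ?_⟩)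
      simp only [Finset.mem_filter, Finset.mem_univ, true_and]
      refine Or.inr ⟨(hw1' j hj).symm, hwy.symm, ?_⟩
      rintro ⟨g, hg, hlt⟩
      have : F = Γ.h j := by rw [hI.v_eq j hj] at hy; exact (Option.some.inj hy).symm
      exact absurd (prefers_of_eq_some hpref hg) (this ▸ hlt).asymm
    · by_cases hwp : w = Γ.p y
      · rw [hwp]; exact Γ.p_mem i y hyC
      · exfalso
        refine hw4 (Finset.mem_biUnion.mpr ⟨F, Finset.mem_image.mpr ⟨i, hi, hiF⟩,
          Finset.mem_biUnion.mpr ⟨y, Finset.mem_sdiff.mpr ⟨mem_employees.mpr hy, hyv⟩, ?_⟩⟩)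
        exact Finset.mem_erase.mpr ⟨hwp, by rw [SimpleGraph.mem_neighborFinset]; exact hwy.symm⟩
  refine ⟨hm, ?_, ?_, ?_, hI.order⟩
  · intro x
    rw [← hI.f_eq x]
    constructor
    · intro hx
      rcases join_eq_some hx with ⟨-, h1⟩ | ⟨-, h1⟩
      · exact absurd h1.symm hFf
      · exact h1
    · intro hx
      rw [join_of_ne, hx]
      · rintro rfl
        obtain ⟨i, hi, hiw⟩ := (hI.f_eq x).mp hx
        exact hw1' i hi hiw
      · intro hworst
        have := mem_employees.mp hworst.2.1
        rw [hx] at this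
        exact hFf (Option.some.inj this).symm
  · intro i hi
    rw [join_of_ne (hvw i hi), hI.v_eq i hi]
    intro hworst
    have hiF : Γ.h i = F := by
      have := mem_employees.mp hworst.2.1
      rw [hI.v_eq i hi] at this
      exact Option.some.inj this
    refine Γ.not_worst hiF (fun y hy => ⟨hiF ▸ hI.sub i hi y (hiF ▸ hy), ?_⟩)
      (fun j hj hjF => hI.order i hi j hj (hjF.trans hiF.symm)) (hwC i hi hiF) hw1' hwF hoff hworst
    rintro j hj rfl
    have := (hI.f_eq (Γ.u j)).mpr ⟨j, hj, rfl⟩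
    rw [hy] at this
    exact hFf (Option.some.inj this)
  · intro i hi y hy
    rcases join_eq_some hy with ⟨rfl, h1⟩ | ⟨-, h1⟩
    · rw [h1]; exact hwC i hi h1
    · exact hI.sub i hi y h1

/-- The firm `h i` makes an offer to `u i` because it employs the less preferred `v i`. She joins
that firm or a better one. By the choice of `i`, no partner still needed is worse than `v i`, which
restores the order for `S.erase i`. -/
theorem inv_step_u {S : Finset ι} {μ : Assignment n nf} (hk : 0 < k) (hI : Γ.Inv S μ) {i : ι}
    (hi : i ∈ S) (hmax : ∀ j ∈ S, Γ.h j = Γ.h i → rank (Γ.v j) ≤ rank (Γ.v i)) :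
    Γ.Inv (S.erase i) (step G k rank μ (Γ.u i)) := by
  have hui : μ (Γ.u i) = some Γ.f := (hI.f_eq _).mpr ⟨i, hi, rfl⟩
  have hoffer : Γ.h i ∈ offers G k rank μ (Γ.u i) := by
    rw [mem_offers]
    refine ⟨⟨_, Γ.adj i, hI.v_eq i hi⟩, ?_, Or.inr ⟨_, mem_employees.mpr (hI.v_eq i hi), Γ.better i⟩⟩
    rw [hui]; exact Γ.lt i
  rcases step_cases G k rank μ (Γ.u i) with ⟨h, -⟩ | ⟨F, hF, hFmin, h⟩
  · rw [h] at hoffer; simp at hoffer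
  have hm := hI.matching.step (G := G) (rank := rank) hk (Γ.u i)
  rw [h] at hm ⊢
  obtain ⟨⟨y, hwy, hy⟩, hpref, hoff⟩ := (mem_offers G k rank).mp hF
  have hFi := hFmin _ hoffer
  have hFf : F ≠ Γ.f := (hFi.trans_lt (Γ.lt i)).ne
  have hwF : μ (Γ.u i) ≠ some F := fun h => lt_irrefl _ (prefers_of_eq_some hpref h)
  -- If the firm she joins is one on which another leader depends, then `cross` forces it to be her
  -- own target.
  have hother : ∀ j ∈ S, Γ.h j = F → Γ.h i = F := by
    intro j hj hjF
    by_contra hne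
    have hlt : Γ.h j < Γ.h i := hjF ▸ lt_of_le_of_ne hFi (Ne.symm hne)
    exact Γ.cross i j hlt y (hI.sub j hj y (hjF ▸ hy)) hwy
  refine ⟨hm, ?_, ?_, ?_, ?_⟩
  · intro x
    constructor
    · intro hx
      rcases join_eq_some hx with ⟨-, h1⟩ | ⟨h0, h1⟩
      · exact absurd h1.symm hFf
      · obtain ⟨j, hj, rfl⟩ := (hI.f_eq x).mp h1
        refine ⟨j, Finset.mem_erase.mpr ⟨?_, hj⟩, rfl⟩
        rintro rfl; exact h0 rfl
    · rintro ⟨j, hj, rfl⟩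
      obtain ⟨hji, hj⟩ := Finset.mem_erase.mp hj
      have hx := (hI.f_eq _).mpr ⟨j, hj, rfl⟩
      rw [join_of_ne (fun h => hji (Γ.u_inj h)), hx]
      intro hworst
      have := mem_employees.mp hworst.2.1
      rw [hx] at this
      exact hFf (Option.some.inj this).symm
  · intro j hj
    obtain ⟨hji, hjS⟩ := Finset.mem_erase.mp hj
    rw [join_of_ne (Γ.u_ne_v i j).symm, hI.v_eq j hjS]
    intro hworst
    have hjF : Γ.h j = F := by
      have := mem_employees.mp hworst.2.1
      rw [hI.v_eq j hjS] at this
      exact Option.some.inj this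
    have hiF := hother j hjS hjF
    refine Γ.not_worst (S := S.erase i) hjF (fun y hy => ⟨hjF ▸ hI.sub j hjS y (hjF ▸ hy), ?_⟩) ?_
      (hiF ▸ Γ.u_mem i) (fun j' hj' h => (Finset.mem_erase.mp hj').1 (Γ.u_inj h)) hwF hoff hworst
    · rintro j' hj' rfl
      have := (hI.f_eq (Γ.u j')).mpr ⟨j', (Finset.mem_erase.mp hj').2, rfl⟩
      rw [hy] at this
      exact hFf (Option.some.inj this)
    · intro j' hj' hj'F
      by_cases h1 : j' = i
      · subst h1
        exact lt_of_le_of_ne (hmax j hjS (hjF.trans hiF.symm))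
          fun h => hji (Γ.v_inj (rank.injective h))
      · exact hI.order j hjS j' (fun h2 => hj' (Finset.mem_erase.mpr ⟨h1, h2⟩))
          (hj'F.trans hjF.symm)
  · intro j hj y hy
    obtain ⟨hji, hj⟩ := Finset.mem_erase.mp hj
    rcases join_eq_some hy with ⟨rfl, h1⟩ | ⟨-, h1⟩
    · rw [h1, ← hother j hj h1]; exact Γ.u_mem i
    · exact hI.sub j hj y h1
  · intro j hj j' hj' hh
    obtain ⟨hji, hjS⟩ := Finset.mem_erase.mp hj
    by_cases h1 : j' = i
    · subst h1
      exact lt_of_le_of_ne (hmax j hjS hh.symm) fun h => hji (Γ.v_inj (rank.injective h))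
    · exact hI.order j hjS j' (fun h2 => hj' (Finset.mem_erase.mpr ⟨h1, h2⟩)) hh

end GroupSystem

/-! ### The probability that the firm of a group empties. -/

namespace GroupSystem

variable {n nf : ℕ} {G : SimpleGraph (Fin n)} [DecidableRel G.Adj] {k : ℕ} {rank : Fin n ≃ Fin n}
  {ι : Type} [Fintype ι] [DecidableEq ι] (Γ : GroupSystem G k nf rank ι)

/-- The number of the `i ∈ S` with firm `g`. -/
def cnt (S : Finset ι) (g : Fin nf) : ℕ := (S.filter fun i => Γ.h i = g).card

/-- The bound on the number of harmful workers of a firm with `t` remaining workers. -/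
def harmBound (k E t : ℕ) : ℕ := t * (2 * E + 1) + (k - t) * E

theorem harmBound_pos (k E : ℕ) {t : ℕ} (ht : 0 < t) : 0 < harmBound k E t := by
  unfold harmBound; positivity

/-- Every vertex that enters `harm` through its neighbours has one exempt neighbour, so it costs at
most `E`. A remaining leader thus costs `1 + E`, her partner `E`, and each of the other employees of
the firm, at most `k - cnt` in number, again `E`. -/
theorem card_harm_le {S : Finset ι} {μ : Assignment n nf} (hI : Γ.Inv S μ) {E : ℕ}
    (hE : ∀ x, G.degree x ≤ E + 1) :
    (Γ.harm S μ).card ≤ ∑ g ∈ S.image Γ.h, harmBound k E (Γ.cnt S g) := by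
  have herase : ∀ {x y : Fin n}, G.Adj x y → ((G.neighborFinset x).erase y).card ≤ E := by
    intro x y hxy
    rw [Finset.card_erase_of_mem (by rw [SimpleGraph.mem_neighborFinset]; exact hxy),
      SimpleGraph.card_neighborFinset_eq_degree]
    have := hE x
    omega
  have h1 : (S.image Γ.u).card ≤ S.card * 1 := by simpa using Finset.card_image_le
  have h2 : (S.biUnion fun i => (G.neighborFinset (Γ.u i)).erase (Γ.v i)).card ≤ S.card * E :=
    Finset.card_biUnion_le_card_mul _ _ _ fun i _ => herase (Γ.adj i)
  have h3 : (S.biUnion (fun i => Finset.univ.filter fun w =>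
      (w = Γ.v i ∧ ∃ x, G.Adj w x ∧ ∃ g, μ x = some g ∧ g < Γ.h i) ∨
      (w ≠ Γ.u i ∧ G.Adj (Γ.v i) w ∧ ¬ ∃ g, μ w = some g ∧ g < Γ.h i))).card ≤ S.card * E := by
    refine Finset.card_biUnion_le_card_mul _ _ _ fun i hi => ?_
    -- If `v i` herself counts, then her neighbour `x` in a better firm does not, so the total is
    -- still at most `E`.
    by_cases hx : ∃ x, G.Adj (Γ.v i) x ∧ ∃ g, μ x = some g ∧ g < Γ.h i
    · obtain ⟨x, hvx, g, hxg, hg⟩ := hx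
      have hxu : x ≠ Γ.u i := by
        rintro rfl
        rw [(hI.f_eq _).mpr ⟨i, hi, rfl⟩] at hxg
        exact absurd (Γ.lt i) (by rw [Option.some.inj hxg]; exact hg.asymm)
      have hxm : x ∈ (G.neighborFinset (Γ.v i)).erase (Γ.u i) :=
        Finset.mem_erase.mpr ⟨hxu, by rw [SimpleGraph.mem_neighborFinset]; exact hvx⟩
      calc _ ≤ (insert (Γ.v i) (((G.neighborFinset (Γ.v i)).erase (Γ.u i)).erase x)).card := by
            refine Finset.card_le_card fun w hw => ?_
            simp only [Finset.mem_filter, Finset.mem_univ, true_and] at hw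
            rcases hw with ⟨rfl, -⟩ | ⟨hwu, hvw, hwg⟩
            · exact Finset.mem_insert_self _ _
            · refine Finset.mem_insert_of_mem (Finset.mem_erase.mpr ⟨?_, Finset.mem_erase.mpr
                ⟨hwu, by rw [SimpleGraph.mem_neighborFinset]; exact hvw⟩⟩)
              rintro rfl
              exact hwg ⟨g, hxg, hg⟩
        _ ≤ _ + 1 := Finset.card_insert_le _ _
        _ ≤ E := by
            rw [Finset.card_erase_of_mem hxm]
            have := herase (Γ.adj i).symm
            have := Finset.card_pos.mpr ⟨x, hxm⟩
            omega
    · refine le_trans (Finset.card_le_card fun w hw => ?_) (herase (Γ.adj i).symm)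
      simp only [Finset.mem_filter, Finset.mem_univ, true_and] at hw
      rcases hw with ⟨rfl, h⟩ | ⟨hwu, hvw, -⟩
      · exact absurd h hx
      · exact Finset.mem_erase.mpr ⟨hwu, by rw [SimpleGraph.mem_neighborFinset]; exact hvw⟩
  have h4 : ((S.image Γ.h).biUnion fun g => (employees μ g \ S.image Γ.v).biUnion fun y =>
      (G.neighborFinset y).erase (Γ.p y)).card ≤ ∑ g ∈ S.image Γ.h, (k - Γ.cnt S g) * E := by
    refine Finset.card_biUnion_le.trans (Finset.sum_le_sum fun g hg => ?_)
    obtain ⟨i, hi, rfl⟩ := Finset.mem_image.mp hg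
    refine (Finset.card_biUnion_le_card_mul _ _ E fun y hy => ?_).trans
      (Nat.mul_le_mul_right _ ?_)
    · have hy' := mem_employees.mp (Finset.mem_sdiff.mp hy).1
      exact herase (Γ.p_adj i y (hI.sub i hi y hy'))
    · have hsub : (S.filter fun j => Γ.h j = Γ.h i).image Γ.v ⊆
          employees μ (Γ.h i) ∩ S.image Γ.v := by
        intro x hx
        obtain ⟨j, hj, rfl⟩ := Finset.mem_image.mp hx
        obtain ⟨hj, hji⟩ := Finset.mem_filter.mp hj
        exact Finset.mem_inter.mpr ⟨mem_employees.mpr (hji ▸ hI.v_eq j hj),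
          Finset.mem_image_of_mem _ hj⟩
      have := Finset.card_le_card hsub
      rw [Finset.card_image_of_injective _ Γ.v_inj] at this
      have h5 := Finset.card_sdiff_add_card_inter (employees μ (Γ.h i)) (S.image Γ.v)
      have h6 := hI.matching (Γ.h i)
      unfold cnt
      omega
  have hS : S.card = ∑ g ∈ S.image Γ.h, Γ.cnt S g :=
    Finset.card_eq_sum_card_fiberwise fun i hi => Finset.mem_image_of_mem _ hi
  have hsum : ∑ g ∈ S.image Γ.h, harmBound k E (Γ.cnt S g) =
      S.card * (2 * E + 1) + ∑ g ∈ S.image Γ.h, (k - Γ.cnt S g) * E := by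
    rw [hS, Finset.sum_mul, ← Finset.sum_add_distrib]
    rfl
  rw [hsum]
  unfold harm
  refine (Finset.card_union_le _ _).trans (Nat.add_le_add ((Finset.card_union_le _ _).trans ?_) h4)
  have := Finset.card_union_le (S.image Γ.u)
    (S.biUnion fun i => (G.neighborFinset (Γ.u i)).erase (Γ.v i))
  nlinarith

/-- The lower bound on the probability that `f` empties if the `u i` with `i ∈ S` remain. -/
noncomputable def value (E : ℕ) (S : Finset ι) : ℝ :=
  ∏ g : Fin nf, ∏ t ∈ Finset.Icc 1 (Γ.cnt S g), (1 : ℝ) / harmBound k E t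

omit [DecidableRel G.Adj] in
theorem value_nonneg (E : ℕ) (S : Finset ι) : 0 ≤ Γ.value E S :=
  Finset.prod_nonneg fun _ _ => Finset.prod_nonneg fun _ _ => by positivity

omit [DecidableRel G.Adj] in
theorem value_erase (E : ℕ) {S : Finset ι} {i : ι} (hi : i ∈ S) :
    Γ.value E (S.erase i) = harmBound k E (Γ.cnt S (Γ.h i)) * Γ.value E S := by
  unfold value
  rw [← Finset.mul_prod_erase Finset.univ _ (Finset.mem_univ (Γ.h i)),
    ← Finset.mul_prod_erase Finset.univ (fun g => ∏ t ∈ Finset.Icc 1 (Γ.cnt S g), _)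
      (Finset.mem_univ (Γ.h i)), ← mul_assoc]
  have hself : Γ.cnt S (Γ.h i) = Γ.cnt (S.erase i) (Γ.h i) + 1 := by
    unfold cnt
    rw [Finset.filter_erase, Finset.card_erase_of_mem (by simp [hi])]
    have : 0 < (S.filter fun j => Γ.h j = Γ.h i).card := Finset.card_pos.mpr ⟨i, by simp [hi]⟩
    omega
  congr 1
  · rw [hself, Finset.prod_Icc_succ_top (by omega)]
    have := harmBound_pos k E (Nat.succ_pos (Γ.cnt (S.erase i) (Γ.h i)))
    have h0 : (harmBound k E (Γ.cnt (S.erase i) (Γ.h i) + 1) : ℝ) ≠ 0 := by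
      exact_mod_cast this.ne'
    field_simp
  · refine Finset.prod_congr rfl fun g hg => ?_
    have : Γ.cnt (S.erase i) g = Γ.cnt S g := by
      unfold cnt
      rw [Finset.filter_erase, Finset.erase_eq_of_notMem]
      simp [(Finset.ne_of_mem_erase hg).symm]
    rw [this]

/-- The indicator function of the firm `f` having no employees. -/
def emptyInd (f : Fin nf) (μ : Assignment n nf) : ℝ := if employees μ f = ∅ then 1 else 0

theorem avg_emptyInd_succ [NeZero n] (f : Fin nf) (T : ℕ) (μ : Assignment n nf) :
    avg T (fun l => emptyInd f (run G k rank μ l)) ≤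
      avg (T + 1) (fun l => emptyInd f (run G k rank μ l)) := by
  induction T generalizing μ with
  | zero =>
    have hn : (0 : ℝ) < n := by exact_mod_cast Nat.pos_of_ne_zero (NeZero.ne n)
    simp only [avg]
    rw [le_div_iff₀ hn]
    have : ∀ w : Fin n, emptyInd f (run G k rank μ []) ≤ emptyInd f (run G k rank μ [w]) := by
      intro w
      unfold emptyInd
      split_ifs with h1 h2 h2
      · exact le_rfl
      · exact absurd (run_employees_empty G k rank h1 [w]) h2
      · exact zero_le_one
      · exact le_rfl
    calc _ = ∑ w : Fin n, emptyInd f (run G k rank μ []) := by simp [mul_comm]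
      _ ≤ _ := Finset.sum_le_sum fun w _ => this w
  | succ T ih =>
    rw [avg, avg]
    gcongr with w
    exact ih (step G k rank μ w)

/-- The limit of the probabilities of being empty after `T` rounds is harmonic, so `le_of_hitting`
applies with `harm` as the exceptional set. The good moves are those of one leader for each target
firm, the one with the least preferred partner. -/
theorem exists_limit_ge [NeZero n] (hk : 0 < k) {μ : Assignment n nf}
    (hI : Γ.Inv Finset.univ μ) {E : ℕ} (hE : ∀ x, G.degree x ≤ E + 1) :
    ∃ p ≥ Γ.value E Finset.univ,
      Tendsto (fun T => avg T fun l => emptyInd Γ.f (run G k rank μ l)) atTop (nhds p) := by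
  have hn : (0 : ℝ) < n := by exact_mod_cast Nat.pos_of_ne_zero (NeZero.ne n)
  have hle1 : ∀ ν : Assignment n nf, emptyInd Γ.f ν ≤ 1 := by
    intro ν; unfold emptyInd; split_ifs <;> norm_num
  obtain ⟨p, hlim, hp⟩ := exists_limit
    (fun T μ => avg T fun l => emptyInd Γ.f (run G k rank μ l))
    (fun T μ => avg_emptyInd_succ Γ.f T μ) 1 (fun T μ =>
      (avg_mono T fun l => hle1 _).trans_eq (avg_const T 1))
  refine ⟨p μ, ?_, hlim μ⟩
  have hp0 : ∀ x, emptyInd Γ.f x ≤ p x := fun x => hp 0 x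
  refine le_of_hitting (step G k rank) p (fun x => ?_) (fun x => ?_) Γ.Inv (Γ.value E)
    (fun x hx => ?_) (fun S x hS hx => ?_) _ _ hI
  · refine le_trans ?_ (hp0 x)
    unfold emptyInd; split_ifs <;> norm_num
  · have h1 := (hlim x).comp (tendsto_add_atTop_nat 1)
    have h2 : Tendsto (fun T => (∑ w : Fin n,
        avg T fun l => emptyInd Γ.f (run G k rank (step G k rank x w) l)) / n) atTop
        (nhds ((∑ w, p (step G k rank x w)) / n)) :=
      (tendsto_finsetSum _ fun w _ => hlim _).div_const _
    have h3 := tendsto_nhds_unique h1 h2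
    rw [h3]
    field_simp
  · refine le_trans (le_of_eq ?_) (hp0 x)
    have : employees x Γ.f = ∅ := by
      rw [Finset.eq_empty_iff_forall_notMem]
      intro y hy
      obtain ⟨i, hi, -⟩ := (hx.f_eq y).mp (mem_employees.mp hy)
      simp at hi
    simp [emptyInd, this, value, cnt]
  · refine ⟨Γ.harm S x, S.filter fun i => ∀ j ∈ S, Γ.h j = Γ.h i → rank (Γ.v j) ≤ rank (Γ.v i),
      Γ.u, ?_, Finset.filter_subset _ _, fun i hi => ?_, Γ.u_inj.injOn,
      fun w hw => Γ.inv_step_of_notMem hk hx hw, ?_⟩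
    · obtain ⟨i, hi, hmax⟩ := Finset.exists_max_image S (fun i => rank (Γ.v i)) hS
      exact ⟨i, Finset.mem_filter.mpr ⟨hi, fun j hj _ => hmax j hj⟩⟩
    · obtain ⟨hi, hmax⟩ := Finset.mem_filter.mp hi
      exact ⟨by simp only [harm, Finset.mem_union]; exact Or.inl (Or.inl (Or.inl (Finset.mem_image_of_mem _ hi))),
        Γ.inv_step_u hk hx hi hmax⟩
    -- Erasing a leader multiplies `value` by the `harmBound` of her target firm. With one leader
    -- per firm, these factors add up to the bound in `card_harm_le`.
    · rw [Finset.sum_congr rfl fun i hi => Γ.value_erase E (Finset.mem_filter.mp hi).1,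
        ← Finset.sum_mul]
      refine mul_le_mul_of_nonneg_right ?_ (Γ.value_nonneg E S)
      refine le_trans (Nat.cast_le.mpr (Γ.card_harm_le hx hE)) (le_of_eq ?_)
      rw [← Nat.cast_sum]
      congr 1
      rw [← Finset.sum_image (f := fun g => harmBound k E (Γ.cnt S g)) (g := Γ.h)]
      · refine Finset.sum_congr (Finset.Subset.antisymm (fun g hg => ?_)
          (Finset.image_subset_image (Finset.filter_subset _ _))) fun _ _ => rfl
        obtain ⟨i, hi, rfl⟩ := Finset.mem_image.mp hg
        obtain ⟨j, hj, hmax⟩ := Finset.exists_max_image (S.filter fun j => Γ.h j = Γ.h i)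
          (fun i => rank (Γ.v i)) ⟨i, by simp [hi]⟩
        obtain ⟨hj, hji⟩ := Finset.mem_filter.mp hj
        rw [← hji]
        refine Finset.mem_image_of_mem _ (Finset.mem_filter.mpr ⟨hj, fun l hl hlj => ?_⟩)
        exact hmax l (by simp [hl, hlj, hji])
      · intro i hi j hj hij
        obtain ⟨hi, hi'⟩ := Finset.mem_filter.mp (Finset.mem_coe.mp hi)
        obtain ⟨hj, hj'⟩ := Finset.mem_filter.mp (Finset.mem_coe.mp hj)
        exact Γ.v_inj (rank.injective (le_antisymm (hj' i hi hij) (hi' j hj hij.symm)))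

end GroupSystem

/-! ### The best firms evolve autonomously. -/

section Truncation

variable {n nf : ℕ} {G : SimpleGraph (Fin n)} [DecidableRel G.Adj] {k : ℕ} {rank : Fin n ≃ Fin n}

/-- The assignment restricted to the best `F` firms. -/
def trunc (F : ℕ) (μ : Assignment n nf) : Assignment n nf := fun w =>
  (μ w).filter fun g => decide (g.val < F)

theorem trunc_eq_some {F : ℕ} {μ : Assignment n nf} {w : Fin n} {g : Fin nf} :
    trunc F μ w = some g ↔ μ w = some g ∧ g.val < F := by
  simp [trunc, Option.filter_eq_some_iff]

theorem trunc_eq_none {F : ℕ} {μ : Assignment n nf} {w : Fin n} {g : Fin nf} (h : μ w = some g)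
    (hg : F ≤ g.val) : trunc F μ w = none := by
  simp [trunc, h, hg]

theorem trunc_of_none {F : ℕ} {μ : Assignment n nf} {w : Fin n} (h : μ w = none) :
    trunc F μ w = none := by
  simp [trunc, h]

theorem employees_trunc {F : ℕ} {μ : Assignment n nf} {g : Fin nf} (hg : g.val < F) :
    employees (trunc F μ) g = employees μ g := by
  ext x; simp [mem_employees, trunc_eq_some, hg]

theorem mem_offers_trunc {F : ℕ} {μ : Assignment n nf} {w : Fin n} {g : Fin nf} :
    g ∈ offers G k rank (trunc F μ) w ↔ g ∈ offers G k rank μ w ∧ g.val < F := by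
  simp only [mem_offers, trunc_eq_some]
  by_cases hg : g.val < F
  · simp only [hg, and_true]
    have h1 : Prefers g (trunc F μ w) ↔ Prefers g (μ w) := by
      rcases hw : μ w with _ | g'
      · simp [trunc, hw]
      · by_cases hg' : g'.val < F
        · rw [trunc_eq_some.mpr ⟨hw, hg'⟩]
        · have : trunc F μ w = none := trunc_eq_none hw (not_lt.mp hg')
          rw [this]
          refine ⟨fun _ => ?_, fun _ => trivial⟩
          change g < g'
          rw [Fin.lt_def]
          omega
    rw [h1]
    simp only [MakesOffer, employees_trunc hg]
  · simp [hg]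

theorem join_trunc {F : ℕ} {μ : Assignment n nf} {w : Fin n} {g : Fin nf} (hg : g.val < F) :
    trunc F (join k rank μ w g) = join k rank (trunc F μ) w g := by
  funext x
  have hW : IsWorstOfFull k rank (trunc F μ) g x ↔ IsWorstOfFull k rank μ g x := by
    simp only [IsWorstOfFull, employees_trunc hg]
  by_cases h1 : x = w
  · simp [join, trunc, h1, hg]
  · by_cases h2 : IsWorstOfFull k rank μ g x
    · simp [join, trunc, h1, h2, hW]
    · rw [join_of_ne h1 (hW.not.mpr h2)]
      simp [trunc, join_of_ne h1 h2]

/-- A worker in a worse firm prefers each of the best `F` firms, exactly as if she were unemployed,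
and offers of these firms depend only on their own employees. If her best offer comes from a worse
firm, then she gets none from the best `F`, and the truncated state does not change. -/
theorem trunc_step (F : ℕ) (μ : Assignment n nf) (w : Fin n) :
    trunc F (step G k rank μ w) = step G k rank (trunc F μ) w := by
  rcases step_cases G k rank (trunc F μ) w with ⟨he, h⟩ | ⟨g, hg, hmin, h⟩
  · rw [h]
    rcases step_cases G k rank μ w with ⟨-, h'⟩ | ⟨g', hg', -, h'⟩
    · rw [h']
    · rw [h']
      have hF : ¬ g'.val < F := fun hF => by
        have := mem_offers_trunc.mpr ⟨hg', hF⟩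
        rw [he] at this; simp at this
      have hpref := ((mem_offers G k rank).mp hg').2.1
      funext x
      by_cases h1 : x = w
      · subst h1
        have h2 : trunc F (join k rank μ x g') x = none := trunc_eq_none (join_self _ _ _) (not_lt.mp hF)
        rw [h2]
        rcases hx : μ x with _ | g''
        · simp [trunc, hx]
        · have hlt : g' < g'' := GroupSystem.prefers_of_eq_some hpref hx
          rw [Fin.lt_def] at hlt
          exact (trunc_eq_none hx (by omega)).symm
      · by_cases h2 : IsWorstOfFull k rank μ g' x
        · have h3 := mem_employees.mp h2.2.1
          rw [trunc_eq_none h3 (not_lt.mp hF), trunc_of_none]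
          simp [join, h1, h2]
        · simp [trunc, join_of_ne h1 h2]
  · rw [h]
    obtain ⟨hg1, hgF⟩ := mem_offers_trunc.mp hg
    rcases step_cases G k rank μ w with ⟨he, -⟩ | ⟨g', hg', hmin', h'⟩
    · rw [he] at hg1; simp at hg1
    · have h1 : g' ≤ g := hmin' g hg1
      have h2 : g'.val < F := by rw [Fin.le_def] at h1; omega
      have h3 : g = g' := le_antisymm (hmin _ (mem_offers_trunc.mpr ⟨hg', h2⟩)) h1
      rw [h', ← h3, join_trunc hgF]

theorem step_self_ne_none {μ : Assignment n nf} {w : Fin n}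
    (h : μ w ≠ none ∨ (offers G k rank μ w).Nonempty) : step G k rank μ w w ≠ none := by
  rcases step_cases G k rank μ w with ⟨he, h'⟩ | ⟨g, -, -, h'⟩
  · rw [h']
    rcases h with h | h
    · exact h
    · rw [he] at h; simp at h
  · rw [h', join_self]; simp

end Truncation

/-! ### Successful pairs in the truncated dynamics. -/

section Success

variable {n nf : ℕ} (G : SimpleGraph (Fin n)) [DecidableRel G.Adj] (k : ℕ) (rank : Fin n ≃ Fin n)
  {ι : Type} [Fintype ι] [DecidableEq ι] (u v : ι → Fin n)

/-- The pairs whose worker `u e` could still take the place next to `v e`. -/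
def alive (x : Assignment n nf × Finset ι) : Finset ι :=
  Finset.univ.filter fun e => e ∉ x.2 ∧ rank (u e) < rank (v e) ∧ x.1 (v e) ≠ none ∧ x.1 (u e) = none

/-- A round, together with the pairs `e` such that `u e` was active or may have a follower. -/
def pstep (x : Assignment n nf × Finset ι) (w : Fin n) : Assignment n nf × Finset ι :=
  (step G k rank x.1 w, x.2 ∪ Finset.univ.filter fun e =>
    w = u e ∨ step G k rank x.1 w w = none ∧ G.Adj w (u e))

/-- The pairs `e` such that `u e` is active while `e` is alive. -/
def succs : Assignment n nf × Finset ι → List (Fin n) → Finset ι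
  | _, [] => ∅
  | x, w :: l => (alive rank u v x).filter (fun e => w = u e) ∪ succs (pstep G k rank u x w) l

variable {u}

theorem notMem_of_mem_succs {x : Assignment n nf × Finset ι} {l : List (Fin n)} {e : ι}
    (h : e ∈ succs G k rank u v x l) : e ∉ x.2 := by
  induction l generalizing x with
  | nil => simp [succs] at h
  | cons w l ih =>
    rcases Finset.mem_union.mp h with h | h
    · exact (Finset.mem_filter.mp (Finset.mem_filter.mp h).1).2.1
    · exact fun h' => ih h (Finset.mem_union_left _ h')

theorem card_succs_cons (x : Assignment n nf × Finset ι) (w : Fin n) (l : List (Fin n)) :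
    (succs G k rank u v x (w :: l)).card =
      ((alive rank u v x).filter fun e => w = u e).card +
        (succs G k rank u v (pstep G k rank u x w) l).card := by
  rw [succs, Finset.card_union_of_disjoint]
  rw [Finset.disjoint_left]
  intro e he he'
  refine notMem_of_mem_succs G k rank v he' (Finset.mem_union_right _ ?_)
  simp [(Finset.mem_filter.mp he).2]

variable {v} in
theorem step_self_ne_none_of_mem_alive (hadj : ∀ e, G.Adj (u e) (v e))
    {x : Assignment n nf × Finset ι} {e : ι} (he : e ∈ alive rank u v x) : step G k rank x.1 (u e) (u e) ≠ none := by
  obtain ⟨-, -, hlt, hv, hu⟩ := Finset.mem_filter.mp he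
  obtain ⟨g, hg⟩ := Option.ne_none_iff_exists'.mp hv
  refine step_self_ne_none (Or.inr ⟨g, (mem_offers G k rank).mpr ⟨⟨_, hadj e, hg⟩, ?_,
    Or.inr ⟨_, mem_employees.mpr hg, hlt⟩⟩⟩)
  rw [hu]
  trivial

variable {v} in
/-- If all pairs of the employees of a firm succeed, then the firm is empty. -/
theorem employees_run_eq_empty (hadj : ∀ e, G.Adj (u e) (v e)) {F : ℕ} {f : Fin nf} (hf : F ≤ f.val) {μ : Assignment n nf}
    {D : Finset ι} {K : Finset ι} (hK : ∀ x, μ x = some f → ∃ e ∈ K, u e = x) {l : List (Fin n)}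
    (hs : K ⊆ succs G k rank u v (trunc F μ, D) l) : employees (run G k rank μ l) f = ∅ := by
  induction l generalizing μ D K with
  | nil =>
    rw [Finset.eq_empty_iff_forall_notMem]
    intro x hx
    obtain ⟨e, he, -⟩ := hK x (mem_employees.mp hx)
    exact absurd (hs he) (by simp [succs])
  | cons w l ih =>
    rw [run, List.foldl_cons]
    have hps : pstep G k rank u (trunc F μ, D) w = (trunc F (step G k rank μ w),
        (pstep G k rank u (trunc F μ, D) w).2) := by
      rw [trunc_step]; rfl
    refine ih (D := (pstep G k rank u (trunc F μ, D) w).2)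
      (K := K.filter fun e => u e ≠ w) ?_ ?_
    · intro x hx
      rcases step_eq_some G k rank hx with h | ⟨rfl, h⟩
      · obtain ⟨e, he, rfl⟩ := hK x h
        refine ⟨e, Finset.mem_filter.mpr ⟨he, ?_⟩, rfl⟩
        rintro rfl
        -- An employee active while her pair is alive moves to one of the best `F` firms; if it is
        -- not alive at that moment, the activation excludes a later success.
        rcases Finset.mem_union.mp (hs he) with h1 | h1
        · have h2 := step_self_ne_none_of_mem_alive G k rank hadj (Finset.mem_filter.mp h1).1
          exact h2 (by rw [← trunc_step]; exact trunc_eq_none hx hf)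
        · refine notMem_of_mem_succs G k rank v h1 (Finset.mem_union_right _ ?_)
          simp
      -- A newcomer needs a neighbour `u e` in `f`. After her round she is outside the best `F`
      -- firms, so `pstep` marks `e` as dead, against the assumption that `e` succeeds.
      · obtain ⟨⟨y, hxy, hy⟩, -⟩ := (mem_offers G k rank).mp h
        obtain ⟨e, he, rfl⟩ := hK y hy
        rcases Finset.mem_union.mp (hs he) with h1 | h1
        · rw [(Finset.mem_filter.mp h1).2] at hxy
          exact absurd hxy (G.loopless.irrefl _)
        · refine absurd (Finset.mem_union_right _ ?_) (notMem_of_mem_succs G k rank v h1)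
          simp only [Finset.mem_filter, Finset.mem_univ, true_and]
          refine Or.inr ⟨?_, hxy⟩
          rw [← trunc_step]
          exact trunc_eq_none hx hf
    · intro e he
      obtain ⟨heK, hew⟩ := Finset.mem_filter.mp he
      rcases Finset.mem_union.mp (hs heK) with h1 | h1
      · exact absurd (Finset.mem_filter.mp h1).2.symm hew
      · rw [← hps]; exact h1

end Success

/-- Lower bounds for the `j`-th binomial moment of the number of successes of `m` pairs. -/
noncomputable def wbound (D N : ℕ) : ℕ → ℕ → ℝ
  | 0, _ => 1
  | _ + 1, 0 => 0
  -- With `m + 1` pairs alive, the losses summed over the choices of the active worker are at most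
  -- `D * (N + m + 1)`, and `m + 1` choices are successes. A success uses up at most two pairs,
  -- hence the index `m + 1 - 2`.
  | j + 1, m + 1 => wbound D N (j + 1) m + (m + 1) * wbound D N j (m - 1) / (D * (N + m + 1))

/-! ### Monotonicity and convexity of the recursion. -/

section WBound

variable (D N : ℕ)

theorem wbound_nonneg (j m : ℕ) : 0 ≤ wbound D N j m := by
  induction j generalizing m with
  | zero => simp [wbound]
  | succ j ih =>
    induction m with
    | zero => simp [wbound]
    | succ m ihm =>
      rw [wbound]
      have := ih (m - 1)
      positivity

theorem wbound_mono (j : ℕ) : Monotone (wbound D N j) := by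
  refine monotone_nat_of_le_succ fun m => ?_
  cases j with
  | zero => simp [wbound]
  | succ j =>
    rw [wbound]
    have := wbound_nonneg D N j (m - 1)
    have : 0 ≤ (m + 1) * wbound D N j (m - 1) / ((D : ℝ) * (N + m + 1)) := by positivity
    linarith

/-- The difference between `wbound` at `m` and at `m - 1`. -/
noncomputable def wdiff (j m : ℕ) : ℝ := m * wbound D N j (m - 2) / (D * (N + m))

theorem wbound_succ (j m : ℕ) :
    wbound D N (j + 1) (m + 1) = wbound D N (j + 1) m + wdiff D N j (m + 1) := by
  rw [wbound, wdiff]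
  push_cast
  rw [← add_assoc]

theorem wdiff_mono (j : ℕ) : Monotone (wdiff D N j) := by
  refine monotone_nat_of_le_succ fun m => ?_
  unfold wdiff
  rcases Nat.eq_zero_or_pos D with rfl | hD
  · simp
  have h1 : wbound D N j (m - 2) ≤ wbound D N j (m + 1 - 2) := wbound_mono D N j (by omega)
  have h2 := wbound_nonneg D N j (m - 2)
  have hD' : (0 : ℝ) < D := by exact_mod_cast hD
  rcases Nat.eq_zero_or_pos (N + m) with h0 | h0
  · have hN : N = 0 := by omega
    have hm : m = 0 := by omega
    subst hN hm
    have := wbound_nonneg D 0 j 0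
    simp only [Nat.cast_zero, zero_mul, zero_div]
    positivity
  have h0' : (0 : ℝ) < N + m := by exact_mod_cast h0
  have h3 : (m : ℝ) / (D * (N + m)) ≤ (m + 1) / (D * (N + (m + 1))) := by
    rw [div_le_div_iff₀ (by positivity) (by positivity)]
    have : (0 : ℝ) ≤ D * N := by positivity
    nlinarith
  calc (m : ℝ) * wbound D N j (m - 2) / (D * (N + m))
      = m / (D * (N + m)) * wbound D N j (m - 2) := by ring
    _ ≤ (m + 1) / (D * (N + (m + 1))) * wbound D N j (m + 1 - 2) := by gcongr
    _ = _ := by push_cast; ring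

/-- By `wdiff_mono` the bound is convex in `m`, so each of `l` lost pairs costs at most the last
difference. This linearity is what allows losses to be summed over the active workers. -/
theorem wbound_sub_le (j m l : ℕ) (hl : l ≤ m) :
    wbound D N (j + 1) m - l * wdiff D N j m ≤ wbound D N (j + 1) (m - l) := by
  induction l with
  | zero => simp
  | succ l ih =>
    have h1 := ih (by omega)
    obtain ⟨a, rfl⟩ : ∃ a, m = a + (l + 1) := ⟨m - (l + 1), by omega⟩
    have h2 := wbound_succ D N j a
    have h3 : wdiff D N j (a + 1) ≤ wdiff D N j (a + (l + 1)) := wdiff_mono D N j (by omega)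
    rw [show a + (l + 1) - l = a + 1 by omega] at h1
    rw [show a + (l + 1) - (l + 1) = a by omega]
    push_cast
    linarith

end WBound

/-! ### First-step equations for the binomial moments. -/

section Moments

variable {n nf : ℕ} (G : SimpleGraph (Fin n)) [DecidableRel G.Adj] (k : ℕ) (rank : Fin n ≃ Fin n)
  {ι : Type} [Fintype ι] [DecidableEq ι] {u v : ι → Fin n}

theorem card_filter_alive_le_one (hu : Function.Injective u) (x : Assignment n nf × Finset ι)
    (w : Fin n) : ((alive rank u v x).filter fun e => w = u e).card ≤ 1 := by
  refine Finset.card_le_one.mpr fun a ha b hb => hu ?_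
  rw [← (Finset.mem_filter.mp ha).2, ← (Finset.mem_filter.mp hb).2]

theorem avg_succs_mono [NeZero n] {φ : ℕ → ℝ} (hφ : Monotone φ) (T : ℕ)
    (x : Assignment n nf × Finset ι) (c : ℕ) :
    avg T (fun l => φ (c + (succs G k rank u v x l).card)) ≤
      avg (T + 1) (fun l => φ (c + (succs G k rank u v x l).card)) := by
  induction T generalizing x c with
  | zero =>
    refine le_trans (le_of_eq (avg_const (n := n) 1 (φ c)).symm) (avg_mono 1 fun l => hφ (by omega))
  | succ T ih =>
    rw [avg, avg]
    gcongr with w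
    simp only [card_succs_cons, ← add_assoc]
    exact ih _ _

/-- The limits of the binomial moments of the number of successes. -/
theorem exists_moments [NeZero n] (hu : Function.Injective u) :
    ∃ p : ℕ → Assignment n nf × Finset ι → ℝ,
      (∀ j x, Tendsto (fun T => avg T fun l => ((succs G k rank u v x l).card.choose j : ℝ)) atTop
        (nhds (p j x))) ∧ (∀ x, p 0 x = 1) ∧ (∀ j x, 0 ≤ p j x) ∧
      ∀ j x, n * p (j + 1) x = ∑ w, (p (j + 1) (pstep G k rank u x w) +
        ((alive rank u v x).filter fun e => w = u e).card * p j (pstep G k rank u x w)) := by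
  have hn : (n : ℝ) ≠ 0 := by exact_mod_cast NeZero.ne n
  have hex : ∀ j, ∃ p : Assignment n nf × Finset ι → ℝ, ∀ x, Tendsto
      (fun T => avg T fun l => ((succs G k rank u v x l).card.choose j : ℝ)) atTop (nhds (p x)) := by
    intro j
    obtain ⟨p, hp, -⟩ := exists_limit
      (fun T (x : Assignment n nf × Finset ι) =>
        avg T fun l => ((succs G k rank u v x l).card.choose j : ℝ))
      (fun T x => by
        simpa using avg_succs_mono G k rank (v := v) (φ := fun a => (a.choose j : ℝ))
          (fun a b hab => Nat.cast_le.mpr (Nat.choose_le_choose j hab)) T x 0)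
      ((Fintype.card ι).choose j) (fun T x => (avg_mono T fun l => Nat.cast_le.mpr
        (Nat.choose_le_choose j (Finset.card_le_univ _))).trans_eq (avg_const T _))
    exact ⟨p, hp⟩
  choose p hp using hex
  refine ⟨p, hp, fun x => ?_, fun j x => ?_, fun j x => ?_⟩
  · refine tendsto_nhds_unique (hp 0 x) ?_
    simp only [Nat.choose_zero_right, Nat.cast_one, avg_const]
    exact tendsto_const_nhds
  · refine ge_of_tendsto' (hp j x) fun T => ?_
    exact (avg_const (n := n) T 0).symm.le.trans (avg_mono T fun l => Nat.cast_nonneg _)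
  · have h1 := (hp (j + 1) x).comp (tendsto_add_atTop_nat 1)
    have h2 : Tendsto (fun T => (∑ w : Fin n,
        ((avg T fun l => ((succs G k rank u v (pstep G k rank u x w) l).card.choose (j + 1) : ℝ)) +
        ((alive rank u v x).filter fun e => w = u e).card *
          avg T fun l => ((succs G k rank u v (pstep G k rank u x w) l).card.choose j : ℝ))) / n)
        atTop (nhds ((∑ w, (p (j + 1) (pstep G k rank u x w) +
        ((alive rank u v x).filter fun e => w = u e).card * p j (pstep G k rank u x w))) / n)) :=
      (tendsto_finsetSum _ fun w _ => (hp _ _).add ((hp _ _).const_mul _)).div_const _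
    have h3 : (fun T => avg T fun l => ((succs G k rank u v x l).card.choose (j + 1) : ℝ)) ∘
        (fun T => T + 1) = (fun T => (∑ w : Fin n,
        ((avg T fun l => ((succs G k rank u v (pstep G k rank u x w) l).card.choose (j + 1) : ℝ)) +
        ((alive rank u v x).filter fun e => w = u e).card *
          avg T fun l => ((succs G k rank u v (pstep G k rank u x w) l).card.choose j : ℝ))) / n) := by
      funext T
      simp only [Function.comp, avg]
      congr 1
      refine Finset.sum_congr rfl fun w _ => ?_
      rw [← avg_mul_left, ← avg_add]
      congr 1
      funext l
      rw [card_succs_cons]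
      -- At most one pair succeeds in a round, so the count grows by 0 or 1 and Pascal's rule
      -- applies.
      have := card_filter_alive_le_one rank (v := v) hu x w
      interval_cases ((alive rank u v x).filter fun e => w = u e).card
      · simp
      · rw [add_comm 1, Nat.choose_succ_succ]
        push_cast
        ring
    rw [h3] at h1
    have h4 := tendsto_nhds_unique h1 h2
    rw [h4]
    field_simp

end Moments

/-! ### Losses in a round and the lower bound for the moments. -/

section Loss

variable {n nf : ℕ} (G : SimpleGraph (Fin n)) [DecidableRel G.Adj] (k : ℕ) (rank : Fin n ≃ Fin n)
  {ι : Type} [Fintype ι] [DecidableEq ι] (u v : ι → Fin n)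

/-- The pairs of `X` that may die when `w` is active. -/
def loss (ν : Assignment n nf) (X : Finset ι) (w : Fin n) : Finset ι :=
  X.filter fun e => w = u e ∨ (step G k rank ν w w = none ∧ G.Adj w (u e)) ∨
    step G k rank ν w (v e) = none

variable {u v}

theorem sdiff_loss_subset {ν : Assignment n nf} {A X : Finset ι} (hX : X ⊆ alive rank u v (ν, A))
    (w : Fin n) : X \ loss G k rank u v ν X w ⊆ alive rank u v (pstep G k rank u (ν, A) w) := by
  intro e he
  obtain ⟨heX, hel⟩ := Finset.mem_sdiff.mp he
  obtain ⟨-, h1, h2, h3, h4⟩ := Finset.mem_filter.mp (hX heX)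
  simp only [loss, Finset.mem_filter, heX, true_and, not_or] at hel
  obtain ⟨h5, h6, h7⟩ := hel
  refine Finset.mem_filter.mpr ⟨Finset.mem_univ _, ?_, h2, h7, ?_⟩
  · simp only [pstep, Finset.mem_union, Finset.mem_filter, Finset.mem_univ, true_and, not_or]
    exact ⟨h1, h5, h6⟩
  · by_contra hne
    obtain ⟨g, hg⟩ := Option.ne_none_iff_exists'.mp hne
    rcases step_eq_some G k rank hg with h | ⟨h, -⟩
    · exact absurd (h4.symm.trans h) (by simp)
    · exact h5 h.symm

theorem displaced {ν : Assignment n nf} {w x : Fin n} (hx : ν x ≠ none)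
    (h : step G k rank ν w x = none) :
    ∃ f ∈ offers G k rank ν w, IsWorstOfFull k rank ν f x ∧ step G k rank ν w = join k rank ν w f := by
  rcases step_cases G k rank ν w with ⟨-, h'⟩ | ⟨f, hf, -, h'⟩
  · rw [h'] at h; exact absurd h hx
  · refine ⟨f, hf, ?_, h'⟩
    rw [h'] at h
    unfold join at h
    split_ifs at h with h1 h2
    · exact h2
    · exact absurd h hx

omit [Fintype ι] [DecidableEq ι] in
-- A round dismisses only the least preferred employee of a single firm, and the ranking is strict.
theorem card_displaced_le_one (hv : Function.Injective v) {ν : Assignment n nf} {X : Finset ι}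
    (hX : ∀ e ∈ X, ν (v e) ≠ none) (w : Fin n) :
    (X.filter fun e => step G k rank ν w (v e) = none).card ≤ 1 := by
  refine Finset.card_le_one.mpr fun a ha b hb => hv ?_
  obtain ⟨haX, ha⟩ := Finset.mem_filter.mp ha
  obtain ⟨hbX, hb⟩ := Finset.mem_filter.mp hb
  obtain ⟨f, hf, h1, h2⟩ := displaced G k rank (hX a haX) ha
  rw [h2] at hb
  have h3 : IsWorstOfFull k rank ν f (v b) := by
    unfold join at hb
    split_ifs at hb with h3 h4
    · exact h4
    · exact absurd hb (hX b hbX)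
  exact rank.injective (le_antisymm (h3.2.2 _ h1.2.1) (h1.2.2 _ h3.2.1))

omit [Fintype ι] in
-- Through `u e`, a pair is lost if she or a neighbour who stays unemployed is active. Her neighbour
-- `v e` is employed, so this makes at most `D` workers per pair. Through dismissal, a round loses
-- at most one pair, and its active worker has a neighbour among the at most `N` employed workers,
-- which makes at most `N * D` rounds.
theorem sum_card_loss_le (hadj : ∀ e, G.Adj (u e) (v e))
    (hv : Function.Injective v) {D N : ℕ} (hD : ∀ x, G.degree x ≤ D) {ν : Assignment n nf}
    (hN : (Finset.univ.filter fun y => ν y ≠ none).card ≤ N) {X : Finset ι}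
    (hX : ∀ e ∈ X, ν (v e) ≠ none) :
    ∑ w, (loss G k rank u v ν X w).card ≤ D * (N + X.card) := by
  have h1 : ∀ w, (loss G k rank u v ν X w).card ≤
      (X.filter fun e => w = u e ∨ (step G k rank ν w w = none ∧ G.Adj w (u e))).card +
      (X.filter fun e => step G k rank ν w (v e) = none).card := by
    intro w
    refine le_trans (Finset.card_le_card ?_) (Finset.card_union_le _ _)
    intro e he
    simp only [loss, Finset.mem_filter, Finset.mem_union] at he ⊢
    tauto
  have h2 : ∑ w, (X.filter fun e => w = u e ∨
      (step G k rank ν w w = none ∧ G.Adj w (u e))).card ≤ X.card * D := by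
    refine (Finset.sum_card_bipartiteAbove_eq_sum_card_bipartiteBelow (s := Finset.univ) (t := X)
      fun w e => w = u e ∨ (step G k rank ν w w = none ∧ G.Adj w (u e))).trans_le ?_
    rw [← smul_eq_mul]
    refine Finset.sum_le_card_nsmul _ _ _ fun e he => ?_
    have hvm : v e ∈ G.neighborFinset (u e) := by
      rw [SimpleGraph.mem_neighborFinset]; exact hadj e
    calc _ ≤ (insert (u e) ((G.neighborFinset (u e)).erase (v e))).card := by
          refine Finset.card_le_card fun w hw => ?_
          simp only [Finset.bipartiteBelow, Finset.mem_filter, Finset.mem_univ, true_and] at hw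
          rcases hw with rfl | ⟨h3, h4⟩
          · exact Finset.mem_insert_self _ _
          · refine Finset.mem_insert_of_mem (Finset.mem_erase.mpr ⟨?_, ?_⟩)
            · rintro rfl
              exact step_self_ne_none (Or.inl (hX e he)) h3
            · rw [SimpleGraph.mem_neighborFinset]; exact h4.symm
      _ ≤ _ := Finset.card_insert_le _ _
      _ ≤ D := by
          rw [Finset.card_erase_of_mem hvm, SimpleGraph.card_neighborFinset_eq_degree]
          have := hD (u e)
          have := Finset.card_pos.mpr ⟨_, hvm⟩
          rw [SimpleGraph.card_neighborFinset_eq_degree] at this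
          omega
  have h3 : ∑ w, (X.filter fun e => step G k rank ν w (v e) = none).card ≤ N * D := by
    calc _ ≤ ∑ w, if ∃ y, ν y ≠ none ∧ G.Adj w y then 1 else 0 := by
          refine Finset.sum_le_sum fun w _ => ?_
          split_ifs with h
          · exact card_displaced_le_one G k rank hv hX w
          · rw [Nat.le_zero, Finset.card_eq_zero, Finset.filter_eq_empty_iff]
            intro e he hs
            obtain ⟨f, hf, -⟩ := displaced G k rank (hX e he) hs
            obtain ⟨⟨y, hwy, hy⟩, -⟩ := (mem_offers G k rank).mp hf
            exact h ⟨y, by rw [hy]; simp, hwy⟩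
      _ = (Finset.univ.filter fun w => ∃ y, ν y ≠ none ∧ G.Adj w y).card := by
          rw [Finset.card_filter]
      _ ≤ ((Finset.univ.filter fun y => ν y ≠ none).biUnion fun y => G.neighborFinset y).card := by
          refine Finset.card_le_card fun w hw => ?_
          obtain ⟨y, hy, hwy⟩ := (Finset.mem_filter.mp hw).2
          refine Finset.mem_biUnion.mpr ⟨y, by simp [hy], ?_⟩
          rw [SimpleGraph.mem_neighborFinset]; exact hwy.symm
      _ ≤ _ * D := Finset.card_biUnion_le_card_mul _ _ _ fun y _ => by
          rw [SimpleGraph.card_neighborFinset_eq_degree]; exact hD y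
      _ ≤ N * D := Nat.mul_le_mul_right _ hN
  calc _ ≤ _ := Finset.sum_le_sum fun w _ => h1 w
    _ = _ := Finset.sum_add_distrib
    _ ≤ X.card * D + N * D := Nat.add_le_add h2 h3
    _ = _ := by ring

/-- A successful leader uses up her own pair and possibly one more by dismissing its partner. Being
employed afterwards in the truncated state, she kills no pair as a potential follower. -/
theorem card_loss_u_le_two (hadj : ∀ e, G.Adj (u e) (v e)) (hu : Function.Injective u)
    (hv : Function.Injective v) {ν : Assignment n nf} {A X : Finset ι}
    (hX : X ⊆ alive rank u v (ν, A)) {e : ι} (he : e ∈ X) :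
    (loss G k rank u v ν X (u e)).card ≤ 2 := by
  have h1 : loss G k rank u v ν X (u e) ⊆
      {e} ∪ X.filter fun e' => step G k rank ν (u e) (v e') = none := by
    intro e' he'
    obtain ⟨h1, h2⟩ := Finset.mem_filter.mp he'
    rcases h2 with h2 | ⟨h2, -⟩ | h2
    · simp [hu h2]
    · exact absurd h2 (step_self_ne_none_of_mem_alive G k rank hadj (hX he))
    · simp [h1, h2]
  have h2 := card_displaced_le_one G k rank hv (ν := ν) (X := X)
    (fun e he => (Finset.mem_filter.mp (hX he)).2.2.2.1) (u e)
  calc _ ≤ _ := Finset.card_le_card h1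
    _ ≤ _ := Finset.card_union_le _ _
    _ ≤ 2 := by rw [Finset.card_singleton]; omega

/-- The employed workers of a matching in which only the best `F` firms have employees. -/
theorem card_employed_le {F : ℕ} {ν : Assignment n nf} (hm : IsMatching k ν)
    (hF : ∀ w g, ν w = some g → g.val < F) :
    (Finset.univ.filter fun y => ν y ≠ none).card ≤ k * F := by
  calc _ ≤ ((Finset.univ.filter fun g : Fin nf => g.val < F).biUnion (employees ν)).card := by
        refine Finset.card_le_card fun y hy => ?_
        obtain ⟨g, hg⟩ := Option.ne_none_iff_exists'.mp (Finset.mem_filter.mp hy).2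
        exact Finset.mem_biUnion.mpr ⟨g, by simp [hF y g hg], mem_employees.mpr hg⟩
    _ ≤ (Finset.univ.filter fun g : Fin nf => g.val < F).card * k :=
        Finset.card_biUnion_le_card_mul _ _ _ fun g _ => hm g
    _ ≤ F * k := by
        refine Nat.mul_le_mul_right _ ?_
        calc _ = ((Finset.univ.filter fun g : Fin nf => g.val < F).map Fin.valEmbedding).card :=
              (Finset.card_map _).symm
          _ ≤ (Finset.range F).card := Finset.card_le_card fun x hx => by
              obtain ⟨g, hg, rfl⟩ := Finset.mem_map.mp hx
              simpa using hg
          _ = F := Finset.card_range F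
    _ = k * F := mul_comm _ _

/-- A minimum principle on triples of a matching, a set of dead pairs and a set `X` of `m` pairs
alive. Consider a triple with the least gap `p - wbound` and, among these, the smallest `X`. If `X`
is not empty, convexity charges `wdiff` for every lost pair, in total at most `D * (N + m) * wdiff =
m * wbound j (m - 2)`. This is no more than what the `m` successes contribute to the first-step
equation. Everything cancels except for a strict gain, a contradiction. So `X` is empty, where the
bound is 0. -/
theorem wbound_le_moments [NeZero n] (hk : 0 < k) (hadj : ∀ e, G.Adj (u e) (v e))
    (hu : Function.Injective u) (hv : Function.Injective v) {D F : ℕ} (hD0 : 0 < D)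
    (hD : ∀ x, G.degree x ≤ D) {p : ℕ → Assignment n nf × Finset ι → ℝ} (hp0 : ∀ x, p 0 x = 1)
    (hpos : ∀ j x, 0 ≤ p j x)
    (harm : ∀ j x, n * p (j + 1) x = ∑ w, (p (j + 1) (pstep G k rank u x w) +
        ((alive rank u v x).filter fun e => w = u e).card * p j (pstep G k rank u x w)))
    (j : ℕ) : ∀ (ν : Assignment n nf) (A X : Finset ι), IsMatching k ν →
      (∀ w g, ν w = some g → g.val < F) → X ⊆ alive rank u v (ν, A) →
      wbound D (k * F) j X.card ≤ p j (ν, A) := by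
  have hn : (0 : ℝ) < n := by exact_mod_cast Nat.pos_of_ne_zero (NeZero.ne n)
  induction j with
  | zero => intro ν A X _ _ _; rw [hp0]; simp [wbound]
  | succ j ih =>
  set P : Set (Assignment n nf × Finset ι × Finset ι) := {t | IsMatching k t.1 ∧
    (∀ w g, t.1 w = some g → g.val < F) ∧ t.2.2 ⊆ alive rank u v (t.1, t.2.1)} with hP
  have hstepP : ∀ t ∈ P, ∀ w, (step G k rank t.1 w, (pstep G k rank u (t.1, t.2.1) w).2,
      t.2.2 \ loss G k rank u v t.1 t.2.2 w) ∈ P := by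
    rintro ⟨ν, A, X⟩ ⟨h1, h2, h3⟩ w
    refine ⟨h1.step G hk w, fun x g hx => ?_, sdiff_loss_subset G k rank h3 w⟩
    rcases step_eq_some G k rank hx with h | ⟨-, h⟩
    · exact h2 x g h
    · obtain ⟨⟨y, -, hy⟩, -⟩ := (mem_offers G k rank).mp h
      exact h2 y g hy
  intro ν A X hm hF hX
  -- The second lexicographic component makes the inequality strict as soon as `X` shrinks.
  obtain ⟨⟨ν₀, A₀, X₀⟩, h0P, hmin⟩ := Set.exists_min_image P
    (fun t => toLex (p (j + 1) (t.1, t.2.1) - wbound D (k * F) (j + 1) t.2.2.card, t.2.2.card))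
    (Set.toFinite _) ⟨(ν, A, X), hm, hF, hX⟩
  have hle : ∀ t ∈ P, p (j + 1) (ν₀, A₀) - wbound D (k * F) (j + 1) X₀.card ≤
      p (j + 1) (t.1, t.2.1) - wbound D (k * F) (j + 1) t.2.2.card := fun t ht => by
    rcases Prod.Lex.le_iff.mp (hmin t ht) with h | ⟨h, -⟩
    · exact h.le
    · exact h.le
  have hlt : ∀ t ∈ P, t.2.2.card < X₀.card →
      p (j + 1) (ν₀, A₀) - wbound D (k * F) (j + 1) X₀.card <
      p (j + 1) (t.1, t.2.1) - wbound D (k * F) (j + 1) t.2.2.card := fun t ht hc => by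
    rcases Prod.Lex.le_iff.mp (hmin t ht) with h | ⟨-, h⟩
    · exact h
    · exact absurd hc (not_lt.mpr h)
  suffices h : 0 ≤ p (j + 1) (ν₀, A₀) - wbound D (k * F) (j + 1) X₀.card by
    have := hle (ν, A, X) ⟨hm, hF, hX⟩
    simp only at this
    linarith
  obtain ⟨hm0, hF0, hX0⟩ := h0P
  simp only at hm0 hF0 hX0
  rcases X₀.eq_empty_or_nonempty with rfl | ⟨e₀, he₀⟩
  · simp only [Finset.card_empty, wbound, sub_zero]
    exact hpos _ _
  exfalso
  set m := X₀.card with hmdef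
  set c := p (j + 1) (ν₀, A₀) - wbound D (k * F) (j + 1) m with hc
  have hcard : ∀ w, (X₀ \ loss G k rank u v ν₀ X₀ w).card =
      m - (loss G k rank u v ν₀ X₀ w).card := fun w => by
    rw [loss, Finset.card_sdiff_of_subset (Finset.filter_subset _ _)]
  have hlm : ∀ w, (loss G k rank u v ν₀ X₀ w).card ≤ m := fun w =>
    Finset.card_le_card (Finset.filter_subset _ _)
  have hlow : ∀ w, wbound D (k * F) (j + 1) m -
      (loss G k rank u v ν₀ X₀ w).card * wdiff D (k * F) j m + c ≤
      p (j + 1) (pstep G k rank u (ν₀, A₀) w) := fun w => by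
    have h1 := hle _ (hstepP (ν₀, A₀, X₀) ⟨hm0, hF0, hX0⟩ w)
    have h2 := wbound_sub_le D (k * F) j m _ (hlm w)
    simp only [hcard] at h1
    have h3 : pstep G k rank u (ν₀, A₀) w =
      (step G k rank ν₀ w, (pstep G k rank u (ν₀, A₀) w).2) := rfl
    rw [h3]
    linarith
  -- Activating `u e₀` always removes `e₀` from `X₀`, which is the source of the strict inequality.
  have hlow0 : wbound D (k * F) (j + 1) m -
      (loss G k rank u v ν₀ X₀ (u e₀)).card * wdiff D (k * F) j m + c <
      p (j + 1) (pstep G k rank u (ν₀, A₀) (u e₀)) := by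
    have h4 : 0 < (loss G k rank u v ν₀ X₀ (u e₀)).card :=
      Finset.card_pos.mpr ⟨e₀, by simp [loss, he₀]⟩
    have h5 := hlm (u e₀)
    have h1 := hlt _ (hstepP (ν₀, A₀, X₀) ⟨hm0, hF0, hX0⟩ (u e₀))
      (by simp only [hcard]; omega)
    have h2 := wbound_sub_le D (k * F) j m _ (hlm (u e₀))
    simp only [hcard] at h1
    have h3 : pstep G k rank u (ν₀, A₀) (u e₀) =
      (step G k rank ν₀ (u e₀), (pstep G k rank u (ν₀, A₀) (u e₀)).2) := rfl
    rw [h3]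
    linarith
  have hsum : ∑ w, (wbound D (k * F) (j + 1) m -
      (loss G k rank u v ν₀ X₀ w).card * wdiff D (k * F) j m + c) <
      ∑ w, p (j + 1) (pstep G k rank u (ν₀, A₀) w) :=
    Finset.sum_lt_sum (fun w _ => hlow w) ⟨u e₀, Finset.mem_univ _, hlow0⟩
  have hrew : (m : ℝ) * wbound D (k * F) j (m - 2) ≤
      ∑ w, ((alive rank u v (ν₀, A₀)).filter fun e => w = u e).card *
        p j (pstep G k rank u (ν₀, A₀) w) := by
    have h1 : ∀ e ∈ X₀, wbound D (k * F) j (m - 2) ≤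
        ((alive rank u v (ν₀, A₀)).filter fun e' => u e = u e').card *
          p j (pstep G k rank u (ν₀, A₀) (u e)) := by
      intro e he
      have h2 : ((alive rank u v (ν₀, A₀)).filter fun e' => u e = u e').card = 1 := by
        refine le_antisymm (card_filter_alive_le_one rank hu _ _) (Finset.card_pos.mpr ⟨e, ?_⟩)
        simp [hX0 he]
      rw [h2, Nat.cast_one, one_mul]
      obtain ⟨h3, h4, h5⟩ := hstepP (ν₀, A₀, X₀) ⟨hm0, hF0, hX0⟩ (u e)
      refine le_trans (wbound_mono D (k * F) j ?_) (ih _ _ _ h3 h4 h5)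
      simp only [hcard]
      have := card_loss_u_le_two G k rank hadj hu hv hX0 he
      omega
    calc _ = ∑ _e ∈ X₀, wbound D (k * F) j (m - 2) := by rw [Finset.sum_const, nsmul_eq_mul]
      _ ≤ _ := Finset.sum_le_sum h1
      _ = ∑ w ∈ X₀.image u, ((alive rank u v (ν₀, A₀)).filter fun e => w = u e).card *
          p j (pstep G k rank u (ν₀, A₀) w) := (Finset.sum_image (f := fun w =>
            (((alive rank u v (ν₀, A₀)).filter fun e => w = u e).card : ℝ) *
          p j (pstep G k rank u (ν₀, A₀) w)) hu.injOn).symm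
      _ ≤ _ := Finset.sum_le_sum_of_subset_of_nonneg (Finset.subset_univ _) fun w _ _ =>
          mul_nonneg (Nat.cast_nonneg _) (hpos _ _)
  have hloss : (∑ w, ((loss G k rank u v ν₀ X₀ w).card : ℝ)) * wdiff D (k * F) j m ≤
      m * wbound D (k * F) j (m - 2) := by
    have h1 := sum_card_loss_le G k rank hadj hv hD (card_employed_le k hm0 hF0)
      (X := X₀) (fun e he => (Finset.mem_filter.mp (hX0 he)).2.2.2.1)
    have h2 : (∑ w, ((loss G k rank u v ν₀ X₀ w).card : ℝ)) ≤ D * ((k * F : ℕ) + m) := by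
      exact_mod_cast h1
    have hmpos : 0 < m := Finset.card_pos.mpr ⟨e₀, he₀⟩
    have h3 : (0 : ℝ) < D * ((k * F : ℕ) + m) := by positivity
    have h4 : 0 ≤ (m : ℝ) * wbound D (k * F) j (m - 2) :=
      mul_nonneg (Nat.cast_nonneg _) (wbound_nonneg _ _ _ _)
    rw [wdiff, ← mul_div_assoc, div_le_iff₀ h3]
    nlinarith
  have hh := harm j (ν₀, A₀)
  rw [Finset.sum_add_distrib] at hh
  have hs2 : ∑ w : Fin n, (wbound D (k * F) (j + 1) m -
      (loss G k rank u v ν₀ X₀ w).card * wdiff D (k * F) j m + c) =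
      n * (wbound D (k * F) (j + 1) m + c) -
        (∑ w, ((loss G k rank u v ν₀ X₀ w).card : ℝ)) * wdiff D (k * F) j m := by
    rw [Finset.sum_add_distrib, Finset.sum_sub_distrib, ← Finset.sum_mul]
    simp
    ring
  rw [hs2] at hsum
  have : wbound D (k * F) (j + 1) m + c = p (j + 1) (ν₀, A₀) := by rw [hc]; ring
  rw [this] at hsum
  linarith

end Loss

/-! ### An explicit lower bound for the recursion. -/

/-- The product of the first `j` odd numbers. -/
def oddProd (j : ℕ) : ℕ := ∏ i ∈ Finset.range j, (2 * i + 1)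

theorem oddProd_succ (j : ℕ) : oddProd (j + 1) = oddProd j * (2 * j + 1) :=
  Finset.prod_range_succ _ _

theorem oddProd_mul (j : ℕ) : oddProd j * (2 ^ j * j.factorial) = (2 * j).factorial := by
  induction j with
  | zero => rfl
  | succ j ih =>
    rw [oddProd_succ, show 2 * (j + 1) = 2 * j + 1 + 1 by ring,
      Nat.factorial_succ (2 * j + 1), Nat.factorial_succ (2 * j), ← ih, Nat.factorial_succ j]
    ring

/-- Both powers are bounded below by Bernoulli's inequality. With `3 * s - τ = 3 * j`, all
first-order terms cancel and the surplus left over is `τ * s`. -/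
theorem wbound_step_aux {y s τ a b c : ℝ} {j : ℕ} (hy : 1 < y) (hs : 0 ≤ s) (hτ : 0 ≤ τ)
    (hsτ : 3 * s - τ = 3 * j) (ha : 0 ≤ a) (hb : 0 ≤ b) (hab : 2 * (j + 1) * b = τ * a)
    (hc : c = a + b) :
    c ≤ b * (y / (y - 2 / 3)) ^ (j + 1) + a * (y / (y - 1)) ^ j * (y / (y + s)) := by
  have h1 : 1 + 2 * (j + 1) / (3 * y) ≤ (y / (y - 2 / 3)) ^ (j + 1) := by
    have hb1 : (1 : ℝ) + (j + 1 : ℕ) * (2 / (3 * y)) ≤ (1 + 2 / (3 * y)) ^ (j + 1) :=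
      one_add_mul_le_pow (le_trans (by norm_num) (by positivity : (0 : ℝ) ≤ 2 / (3 * y))) _
    have hb2 : 1 + 2 / (3 * y) ≤ y / (y - 2 / 3) := by
      rw [le_div_iff₀ (by linarith)]
      field_simp
      nlinarith
    calc _ = (1 : ℝ) + (j + 1 : ℕ) * (2 / (3 * y)) := by push_cast; ring
      _ ≤ _ := hb1
      _ ≤ _ := by gcongr
  have h2 : 1 + j / y ≤ (y / (y - 1)) ^ j := by
    have hb1 : (1 : ℝ) + j * (1 / y) ≤ (1 + 1 / y) ^ j :=
      one_add_mul_le_pow (le_trans (by norm_num) (by positivity : (0 : ℝ) ≤ 1 / y)) _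
    have hb2 : 1 + 1 / y ≤ y / (y - 1) := by
      rw [le_div_iff₀ (by linarith)]
      field_simp
      nlinarith
    calc _ = (1 : ℝ) + j * (1 / y) := by ring
      _ ≤ _ := hb1
      _ ≤ _ := by gcongr
  have h3 : 1 ≤ τ / (3 * y) + (1 + j / y) * (y / (y + s)) := by
    have hys : 0 < y + s := by linarith
    have : τ / (3 * y) + (1 + j / y) * (y / (y + s)) =
        (τ * (y + s) + 3 * y * (y + j)) / (3 * y * (y + s)) := by
      field_simp
    rw [this, le_div_iff₀ (by positivity)]
    nlinarith [mul_nonneg hτ hs]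
  have hys : 0 < y / (y + s) := by positivity
  calc c = b + a * 1 := by rw [hc]; ring
    _ ≤ b + a * (τ / (3 * y) + (1 + j / y) * (y / (y + s))) := by gcongr
    _ = b * (1 + 2 * (j + 1) / (3 * y)) + a * (1 + j / y) * (y / (y + s)) := by
        have : b * (2 * (j + 1) / (3 * y)) = a * (τ / (3 * y)) := by
          rw [mul_div_assoc', mul_div_assoc']
          congr 1
          linarith
        rw [mul_add b, this]
        ring
    _ ≤ _ := by gcongr

/-- Without denominators, the recursion counts the matchings with `j` edges in the complete graph on
`m + 1` vertices: the last vertex is free, or it has one of the others as its mate. Their number is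
`oddProd j * (m + 1).choose (2 * j)`. The denominators `N + i` are replaced by the common value `N +
(2 * m - j + 2) / 3`, which for `j = 1` is their weighted mean. The induction on `j` and `m` is the
estimate `wbound_step_aux`. -/
theorem oddProd_choose_le_wbound {D N : ℕ} (hD : 0 < D) (hN : 0 < N) (j m : ℕ)
    (hm : 2 * j ≤ m + 1) :
    (oddProd j : ℝ) * ((m + 1).choose (2 * j) : ℝ) ≤
      wbound D N j m * (D * (N + (2 * m - j + 2) / 3)) ^ j := by
  have hD' : (0 : ℝ) < D := by exact_mod_cast hD
  have hN' : (1 : ℝ) ≤ N := by exact_mod_cast hN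
  induction j generalizing m with
  | zero => simp [oddProd, wbound]
  | succ j ihj =>
    induction m with
    | zero => omega
    | succ m ihm =>
      set y : ℝ := N + (2 * ((m + 1 : ℕ) : ℝ) - ((j + 1 : ℕ) : ℝ) + 2) / 3 with hy
      have hmj : (2 * (j + 1) : ℝ) ≤ m + 2 := by exact_mod_cast hm
      have hj0 : (0 : ℝ) ≤ j := Nat.cast_nonneg j
      have hy1 : 1 < y := by rw [hy]; push_cast; linarith
      set s : ℝ := (m + j) / 3 with hs
      set τ : ℝ := m - 2 * j with hτ
      have hys : (N : ℝ) + m + 1 = y + s := by rw [hy, hs]; push_cast; ring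
      have hτ0 : 0 ≤ τ := by rw [hτ]; linarith
      set a : ℝ := ((m + 1).choose (2 * j + 1) : ℝ) with ha
      set b : ℝ := ((m + 1).choose (2 * j + 2) : ℝ) with hb
      have hab : 2 * (j + 1) * b = τ * a := by
        have h := Nat.choose_succ_right_eq (m + 1) (2 * j + 1)
        have h' : ((m + 1).choose (2 * j + 1 + 1) : ℝ) * (2 * j + 1 + 1) =
            (m + 1).choose (2 * j + 1) * (m - 2 * j) := by
          have h2 : (((m + 1) - (2 * j + 1) : ℕ) : ℝ) = m - 2 * j := by
            rw [Nat.cast_sub (by omega)]; push_cast; ring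
          rw [← h2]
          exact_mod_cast h
        rw [hb, ha, hτ]
        linarith
      have hc : ((m + 1 + 1).choose (2 * (j + 1)) : ℝ) = a + b := by
        rw [ha, hb, show 2 * (j + 1) = 2 * j + 1 + 1 by ring, Nat.choose_succ_succ]
        push_cast; rfl
      have haux := wbound_step_aux (j := j) hy1 (s := s) (by rw [hs]; positivity) hτ0
        (by rw [hs, hτ]; ring) (Nat.cast_nonneg _) (Nat.cast_nonneg _) hab hc
      have hW1 : (oddProd (j + 1) : ℝ) * b ≤
          wbound D N (j + 1) m * (D * (y - 2 / 3)) ^ (j + 1) := by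
        by_cases h : 2 * (j + 1) ≤ m + 1
        · have := ihm h
          have e : (N + (2 * (m : ℝ) - ((j + 1 : ℕ) : ℝ) + 2) / 3) = y - 2 / 3 := by
            rw [hy]; push_cast; ring
          rw [e] at this
          exact this
        · have : b = 0 := by
            rw [hb, Nat.choose_eq_zero_of_lt (by omega), Nat.cast_zero]
          rw [this, mul_zero]
          have h2 := wbound_nonneg D N (j + 1) m
          have h3 : 0 ≤ (D : ℝ) * (y - 2 / 3) := mul_nonneg hD'.le (by linarith)
          positivity
      have hW2 : (oddProd j : ℝ) * (m.choose (2 * j) : ℝ) ≤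
          wbound D N j (m - 1) * (D * (y - 1)) ^ j := by
        rcases Nat.eq_zero_or_pos m with rfl | hm0
        · have : j = 0 := by omega
          subst this
          simp [oddProd, wbound]
        · have := ihj (m - 1) (by omega)
          rw [Nat.sub_add_cancel hm0] at this
          convert this using 3
          rw [hy, Nat.cast_sub hm0]; push_cast; ring
      have hid : ((m + 1 : ℕ) : ℝ) * (m.choose (2 * j) : ℝ) = (2 * j + 1) * a := by
        have := Nat.add_one_mul_choose_eq m (2 * j)
        rw [ha]
        have h' : ((m + 1 : ℕ) : ℝ) * (m.choose (2 * j) : ℝ) =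
          ((m + 1).choose (2 * j + 1) : ℝ) * ((2 * j + 1 : ℕ) : ℝ) := by exact_mod_cast this
        rw [h']; push_cast; ring
      have hy23 : 0 < y - 2 / 3 := by linarith
      have hym1 : 0 < y - 1 := by linarith
      have hypos : 0 < y := by linarith
      have hspos : 0 < y + s := by rw [hs]; positivity
      rw [hc]
      calc (oddProd (j + 1) : ℝ) * (a + b)
          ≤ oddProd (j + 1) * (b * (y / (y - 2 / 3)) ^ (j + 1) +
              a * (y / (y - 1)) ^ j * (y / (y + s))) := by
            rw [hc] at haux
            gcongr
        _ = oddProd (j + 1) * b * (y / (y - 2 / 3)) ^ (j + 1) +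
            oddProd j * (m.choose (2 * j) : ℝ) * (m + 1 : ℕ) * (y / (y - 1)) ^ j *
              (y / (y + s)) := by
            rw [mul_assoc (oddProd j : ℝ), mul_comm (m.choose (2 * j) : ℝ), hid, oddProd_succ]
            push_cast
            ring
        _ ≤ wbound D N (j + 1) m * (D * (y - 2 / 3)) ^ (j + 1) * (y / (y - 2 / 3)) ^ (j + 1) +
            wbound D N j (m - 1) * (D * (y - 1)) ^ j * (m + 1 : ℕ) * (y / (y - 1)) ^ j *
              (y / (y + s)) := by gcongr
        _ = _ := by
            rw [wbound, show (N : ℝ) + m + 1 = y + s from hys]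
            have e1 : (D * (y - 2 / 3)) ^ (j + 1) * (y / (y - 2 / 3)) ^ (j + 1) =
                (D * y) ^ (j + 1) := by
              rw [← mul_pow, mul_assoc (D : ℝ), mul_div_assoc', mul_comm (y - 2 / 3) y, mul_div_assoc,
                div_self hy23.ne', mul_one]
            have e2 : (D * (y - 1)) ^ j * (y / (y - 1)) ^ j = (D * y) ^ j := by
              rw [← mul_pow]; congr 1; field_simp
            rw [mul_assoc (wbound D N (j + 1) m), e1, add_mul]
            congr 1
            calc _ = wbound D N j (m - 1) * ((D * (y - 1)) ^ j * (y / (y - 1)) ^ j) *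
                  (m + 1 : ℕ) * (y / (y + s)) := by ring
              _ = _ := by
                rw [e2, pow_succ]
                push_cast
                field_simp

/-! ### Averaging over the number of well oriented pairs. -/

section Binomial

theorem sum_choose_mul_choose (N l : ℕ) :
    ∑ x ∈ Finset.range (N + 1), (N.choose x : ℝ) * (x.choose l : ℝ) =
      (N.choose l : ℝ) * 2 ^ N / 2 ^ l := by
  rcases Nat.lt_or_ge N l with h | h
  · rw [Nat.choose_eq_zero_of_lt h]
    simp only [Nat.cast_zero, zero_mul, zero_div]
    refine Finset.sum_eq_zero fun x hx => ?_
    rw [Nat.choose_eq_zero_of_lt (show x < l by simp at hx; omega)]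
    simp
  · obtain ⟨t, rfl⟩ := Nat.exists_eq_add_of_le h
    rw [show l + t + 1 = l + (t + 1) by ring, Finset.sum_range_add]
    have h1 : ∑ x ∈ Finset.range l, ((l + t).choose x : ℝ) * (x.choose l : ℝ) = 0 :=
      Finset.sum_eq_zero fun x hx => by
        rw [Nat.choose_eq_zero_of_lt (Finset.mem_range.mp hx)]; simp
    have h2 : ∀ x ∈ Finset.range (t + 1), ((l + t).choose (l + x) : ℝ) * ((l + x).choose l : ℝ) =
        ((l + t).choose l : ℝ) * (t.choose x : ℝ) := fun x hx => by
      have := Nat.choose_mul (n := l + t) (k := l + x) (s := l)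
      rw [Nat.add_sub_cancel_left, Nat.add_sub_cancel_left] at this
      exact_mod_cast this (by omega)
    rw [h1, zero_add, Finset.sum_congr rfl h2, ← Finset.mul_sum]
    have h3 : ∑ x ∈ Finset.range (t + 1), (t.choose x : ℝ) = 2 ^ t := by
      exact_mod_cast Nat.sum_range_choose t
    rw [h3, pow_add]
    field_simp

/-- For `l ≤ N` the weights `N.choose x * x.choose l` describe `l` plus a binomial variable with
parameters `N - l` and `1/2`, so their mean is `(N + l) / 2`. -/
theorem sum_choose_mul_choose_mul (N l : ℕ) :
    ∑ x ∈ Finset.range (N + 1), (N.choose x : ℝ) * (x.choose l : ℝ) * x =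
      (N + l) / 2 * ((N.choose l : ℝ) * 2 ^ N / 2 ^ l) := by
  have h1 : ∀ x : ℕ, (x.choose l : ℝ) * x = l * (x.choose l : ℝ) +
      (l + 1) * (x.choose (l + 1) : ℝ) := fun x => by
    rcases Nat.lt_or_ge x l with h | h
    · rw [Nat.choose_eq_zero_of_lt h, Nat.choose_eq_zero_of_lt (by omega)]; simp
    · have h2 := Nat.choose_succ_right_eq x l
      have h3 : (x.choose (l + 1) : ℝ) * (l + 1) = x.choose l * (x - l) := by
        rw [← Nat.cast_sub h]; exact_mod_cast h2
      linarith
  have h2 : ((l : ℝ) + 1) * (N.choose (l + 1) : ℝ) = (N.choose l : ℝ) * (N - l) := by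
    rcases Nat.lt_or_ge N l with h | h
    · rw [Nat.choose_eq_zero_of_lt h, Nat.choose_eq_zero_of_lt (by omega)]; simp
    · rw [← Nat.cast_sub h]
      have h2 := Nat.choose_succ_right_eq N l
      rw [mul_comm]
      exact_mod_cast h2
  calc _ = ∑ x ∈ Finset.range (N + 1), (l * ((N.choose x : ℝ) * (x.choose l : ℝ)) +
        (l + 1) * ((N.choose x : ℝ) * (x.choose (l + 1) : ℝ))) := by
          refine Finset.sum_congr rfl fun x _ => ?_
          rw [mul_assoc, h1]; ring
    _ = l * ((N.choose l : ℝ) * 2 ^ N / 2 ^ l) +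
        (((l : ℝ) + 1) * (N.choose (l + 1) : ℝ)) * 2 ^ N / 2 ^ (l + 1) := by
          rw [Finset.sum_add_distrib, ← Finset.mul_sum, ← Finset.mul_sum, sum_choose_mul_choose,
            sum_choose_mul_choose]
          ring
    _ = _ := by rw [h2, pow_succ]; field_simp; ring

/-- The power of the denominator in `oddProd_choose_le_wbound` depends on `x`. Bernoulli's
inequality makes it linear in `x`, after which the weighted sums are known exactly. The linear term
vanishes for the weights with `2 * k` and is nonnegative for those with `2 * k - 1`. -/
theorem sum_choose_mul_wbound_ge {D N k : ℕ} (hD : 0 < D) (hN : 0 < N) (hk : 0 < k) :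
    (oddProd k : ℝ) * ((N.choose (2 * k) : ℝ) + 2 * (N.choose (2 * k - 1) : ℝ)) * 2 ^ N /
        (4 ^ k * (D * ((4 * N + k + 2) / 3)) ^ k) ≤
      ∑ x ∈ Finset.range (N + 1), (N.choose x : ℝ) * wbound D N k x := by
  -- The value of the averaged denominator at `x = N / 2 + k`, the mean under the weights with `2 *
  -- k`.
  set c : ℝ := (4 * N + k + 2) / 3 with hc
  have hD' : (0 : ℝ) < D := by exact_mod_cast hD
  have hc0 : 0 < c := by rw [hc]; positivity
  clear_value c
  have hpt : ∀ x : ℕ, (oddProd k : ℝ) / (D * c) ^ k * (((x + 1).choose (2 * k) : ℝ) *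
      (1 - 2 * k / (3 * c) * (x - N / 2 - k))) ≤ wbound D N k x := by
    intro x
    by_cases hx : 2 * k ≤ x + 1
    · have h1 := oddProd_choose_le_wbound hD hN k x hx
      set z : ℝ := N + (2 * x - k + 2) / 3 with hz
      have hz0 : 0 < z := by
        rw [hz]
        have h2 : (2 * k : ℝ) ≤ x + 1 := by exact_mod_cast hx
        have h3 : (1 : ℝ) ≤ k := by exact_mod_cast hk
        have h4 : (0 : ℝ) < N := by exact_mod_cast hN
        linarith
      have h2 : 1 - 2 * k / (3 * c) * (x - N / 2 - k) ≤ (c / z) ^ k := by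
        have h3 : (1 : ℝ) + k * (c / z - 1) ≤ (1 + (c / z - 1)) ^ k := by
          refine one_add_mul_le_pow ?_ k
          have : 0 < c / z := by positivity
          linarith
        rw [add_sub_cancel] at h3
        refine le_trans ?_ h3
        have h4 : c / z - 1 ≥ (c - z) / c := by
          rw [ge_iff_le, div_le_iff₀ hc0]
          have : (c / z - 1) * c - (c - z) = (c - z) ^ 2 / z := by field_simp
          have h5 : 0 ≤ (c - z) ^ 2 / z := by positivity
          linarith
        have h5 : 1 - 2 * k / (3 * c) * (x - N / 2 - k) = 1 + k * ((c - z) / c) := by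
          have : c - z = -(2 / 3) * (x - N / 2 - k) := by rw [hc, hz]; ring
          rw [this]; field_simp; ring
        rw [h5]
        gcongr
      calc _ ≤ (oddProd k : ℝ) / (D * c) ^ k * (((x + 1).choose (2 * k) : ℝ) * (c / z) ^ k) := by
            gcongr
        _ = (oddProd k : ℝ) * ((x + 1).choose (2 * k) : ℝ) / (D * z) ^ k := by
            rw [mul_pow (D : ℝ) c, mul_pow (D : ℝ) z, div_pow]; field_simp
        _ ≤ _ := by rw [div_le_iff₀ (by positivity)]; exact h1
    · rw [Nat.choose_eq_zero_of_lt (by omega)]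
      simpa using wbound_nonneg D N k x
  have hw : ∀ x : ℕ, ((x + 1).choose (2 * k) : ℝ) =
      (x.choose (2 * k) : ℝ) + (x.choose (2 * k - 1) : ℝ) := fun x => by
    obtain ⟨l, hl⟩ : ∃ l, 2 * k = l + 1 := ⟨2 * k - 1, by omega⟩
    rw [hl, Nat.choose_succ_succ]
    push_cast
    rw [add_comm]
  have h0 := sum_choose_mul_choose N (2 * k)
  have h1 := sum_choose_mul_choose N (2 * k - 1)
  have h2 := sum_choose_mul_choose_mul N (2 * k)
  have h3 := sum_choose_mul_choose_mul N (2 * k - 1)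
  set B0 := (N.choose (2 * k) : ℝ) * 2 ^ N / 2 ^ (2 * k) with hB0
  set B1 := (N.choose (2 * k - 1) : ℝ) * 2 ^ N / 2 ^ (2 * k - 1) with hB1
  have hB1n : 0 ≤ B1 := by positivity
  have hcast : ((2 * k - 1 : ℕ) : ℝ) = 2 * k - 1 := by rw [Nat.cast_sub (by omega)]; push_cast; ring
  have hsum : ∑ x ∈ Finset.range (N + 1), (N.choose x : ℝ) * (((x + 1).choose (2 * k) : ℝ) *
      (1 - 2 * k / (3 * c) * (x - N / 2 - k))) = B0 + B1 + 2 * k / (3 * c) * (B1 / 2) := by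
    set t : ℝ := 2 * k / (3 * c) with ht
    calc _ = ∑ x ∈ Finset.range (N + 1), ((1 + t * (N / 2 + k)) *
          ((N.choose x : ℝ) * (x.choose (2 * k) : ℝ) +
            (N.choose x : ℝ) * (x.choose (2 * k - 1) : ℝ)) -
          t * ((N.choose x : ℝ) * (x.choose (2 * k) : ℝ) * x +
            (N.choose x : ℝ) * (x.choose (2 * k - 1) : ℝ) * x)) := by
            refine Finset.sum_congr rfl fun x _ => ?_
            rw [hw]; ring
      _ = _ := by
            rw [Finset.sum_sub_distrib, ← Finset.mul_sum, ← Finset.mul_sum,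
              Finset.sum_add_distrib, Finset.sum_add_distrib, h0, h1, h2, h3, hcast]
            push_cast
            ring
  calc _ = (oddProd k : ℝ) / (D * c) ^ k * (B0 + B1) := by
        have e1 : (2 : ℝ) ^ (2 * k) = 4 ^ k := by rw [pow_mul]; norm_num
        have e2 : (2 : ℝ) ^ (2 * k - 1) = 4 ^ k / 2 := by
          rw [← e1]
          obtain ⟨l, hl⟩ : ∃ l, 2 * k = l + 1 := ⟨2 * k - 1, by omega⟩
          rw [hl, Nat.add_sub_cancel, pow_succ]; ring
        rw [hB0, hB1, e1, e2]
        field_simp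
    _ ≤ (oddProd k : ℝ) / (D * c) ^ k * ∑ x ∈ Finset.range (N + 1), (N.choose x : ℝ) *
        (((x + 1).choose (2 * k) : ℝ) * (1 - 2 * k / (3 * c) * (x - N / 2 - k))) := by
        rw [hsum]
        have : 0 ≤ 2 * k / (3 * c) * (B1 / 2) := by positivity
        exact mul_le_mul_of_nonneg_left (by linarith) (by positivity)
    _ = ∑ x ∈ Finset.range (N + 1), (N.choose x : ℝ) * ((oddProd k : ℝ) / (D * c) ^ k *
        (((x + 1).choose (2 * k) : ℝ) * (1 - 2 * k / (3 * c) * (x - N / 2 - k)))) := by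
        rw [Finset.mul_sum]
        exact Finset.sum_congr rfl fun x _ => by ring
    _ ≤ _ := Finset.sum_le_sum fun x _ => mul_le_mul_of_nonneg_left (hpt x) (Nat.cast_nonneg _)

end Binomial

/-! ### Numerical inequalities for the scattered layout. -/

/-- From `1 + x ≤ exp x` and `exp (1 / 6) ≤ 1 / (1 - 1 / 6) = 12 / 10`. -/
theorem one_add_div_pow_le {k c : ℝ} (n : ℕ) (hk : 0 < k) (hc : 0 < c) (hn : k = n) (h : 12 ≤ c) :
    (c * k + 2) ^ n ≤ 12 / 10 * (c * k) ^ n := by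
  have h1 : (c * k + 2) = c * k * (1 + 2 / (c * k)) := by field_simp
  have h2 : (1 + 2 / (c * k)) ^ n ≤ Real.exp (1 / 6) := by
    calc (1 + 2 / (c * k)) ^ n ≤ (Real.exp (2 / (c * k))) ^ n := by
          gcongr
          rw [add_comm]
          exact Real.add_one_le_exp _
      _ = Real.exp (2 / c) := by
          rw [← Real.exp_nat_mul, ← hn]
          congr 1
          field_simp
      _ ≤ Real.exp (1 / 6) := by
          refine Real.exp_le_exp.mpr ?_
          rw [div_le_div_iff₀ hc (by norm_num)]
          linarith
  have h3 : Real.exp (1 / 6) ≤ 12 / 10 := by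
    have := Real.exp_bound_div_one_sub_of_interval (x := 1 / 6) (by norm_num) (by norm_num)
    linarith
  rw [h1, mul_pow, mul_comm]
  exact mul_le_mul_of_nonneg_right (h2.trans h3) (by positivity)

/-- The final inequality at the least number `F₀` of firms. -/
def BaseIneq (F₀ ρ β : ℝ) (k : ℕ) : Prop :=
  ((4 * F₀ + 1) * k + 2) ^ k ≤ β * k.factorial * ρ ^ k *
    (∏ i ∈ Finset.range (k - 2), ((F₀ - 1) * k - i)) * (((F₀ + 2) * k + 1) * ((F₀ - 2) * k + 2))

/-- Each factor of the product is at least `(F₀ - 2) * k`; after division by a power of `k`, a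
geometric sequence is compared with the factorial. -/
theorem baseIneq_of_factorial {F₀ ρ β : ℝ} {k : ℕ} (hF : 3 ≤ F₀) (hρ : 0 < ρ) (hβ : 0 < β)
    (hk : 3 ≤ k) (h : 12 / 10 * ((4 * F₀ + 1) / (ρ * (F₀ - 2))) ^ k ≤
      β * ((F₀ + 2) / (F₀ - 2)) * k.factorial) : BaseIneq F₀ ρ β k := by
  have hk' : (0 : ℝ) < k := by exact_mod_cast (by omega : 0 < k)
  have hF2 : 0 < F₀ - 2 := by linarith
  have h1 := one_add_div_pow_le (c := 4 * F₀ + 1) k hk' (by linarith) rfl (by linarith)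
  have h2 : ((F₀ - 2) * k) ^ (k - 2) ≤ ∏ i ∈ Finset.range (k - 2), ((F₀ - 1) * k - i) := by
    have e : ((F₀ - 2) * (k : ℝ)) ^ (k - 2) = ∏ _i ∈ Finset.range (k - 2), (F₀ - 2) * (k : ℝ) := by
      rw [Finset.prod_const, Finset.card_range]
    rw [e]
    refine Finset.prod_le_prod (fun i _ => by positivity) fun i hi => ?_
    have : (i : ℝ) ≤ k := by
      have := Finset.mem_range.mp hi
      exact_mod_cast (by omega : i ≤ k)
    linarith
  have h3 : ((F₀ + 2) * k) * ((F₀ - 2) * k) ≤ ((F₀ + 2) * k + 1) * ((F₀ - 2) * k + 2) := by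
    gcongr <;> linarith
  unfold BaseIneq
  refine h1.trans ?_
  have h4 : ((F₀ - 2) * (k : ℝ)) ^ k = ((F₀ - 2) * k) ^ (k - 2) * ((F₀ - 2) * k) ^ 2 := by
    rw [← pow_add, Nat.sub_add_cancel (by omega)]
  calc 12 / 10 * ((4 * F₀ + 1) * k) ^ k
      = 12 / 10 * ((4 * F₀ + 1) / (ρ * (F₀ - 2))) ^ k * (ρ ^ k * ((F₀ - 2) * k) ^ k) := by
        rw [div_pow, mul_pow, mul_pow, mul_pow]; field_simp
    _ ≤ β * ((F₀ + 2) / (F₀ - 2)) * k.factorial * (ρ ^ k * ((F₀ - 2) * k) ^ k) := by gcongr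
    _ = β * k.factorial * ρ ^ k * ((F₀ - 2) * k) ^ (k - 2) *
        (((F₀ + 2) * k) * ((F₀ - 2) * k)) := by rw [h4]; field_simp
    _ ≤ _ := by
        have h5 : 0 ≤ ∏ i ∈ Finset.range (k - 2), ((F₀ - 1) * (k : ℝ) - i) :=
          le_trans (by positivity) h2
        gcongr

/-- From `k` to `k + 1` the left side gains the factor `a` and the right side the factor `k + 1 ≥
a`. -/
theorem twelve_mul_pow_le {a b : ℝ} {k₀ k : ℕ} (ha : 0 < a) (hak : a ≤ k₀ + 1) (hb : 0 < b)
    (h0 : 12 / 10 * a ^ k₀ ≤ b * k₀.factorial) (hk : k₀ ≤ k) :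
    12 / 10 * a ^ k ≤ b * k.factorial := by
  induction k, hk using Nat.le_induction with
  | base => exact h0
  | succ k hk ih =>
    rw [Nat.factorial_succ, pow_succ]
    push_cast
    have hk' : (k₀ : ℝ) ≤ k := by exact_mod_cast hk
    calc 12 / 10 * (a ^ k * a) = 12 / 10 * a ^ k * a := by ring
      _ ≤ b * k.factorial * (k + 1) := by gcongr; linarith
      _ = _ := by ring

/-- Here `5 / 4` is the value of `3 * (2 * D - 1) / (4 * D)` at `D = 3`, and `5.742 = 0.99 * 5.8` is
the ratio of firms to `q` that remains of `2 * D = 6`, reduced by the chance of coinciding keys. -/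
theorem baseIneq_six {k : ℕ} (hk : 6 ≤ k) : BaseIneq 6 (5 / 4) (5742 / 1000) k := by
  rcases Nat.lt_or_ge k 12 with h | h
  · unfold BaseIneq
    interval_cases k <;> norm_num [Finset.prod_range_succ, Nat.factorial]
  · refine baseIneq_of_factorial (by norm_num) (by norm_num) (by norm_num) (by omega) ?_
    refine twelve_mul_pow_le (k₀ := 12) (by norm_num) (by norm_num) (by norm_num) ?_ h
    norm_num [Nat.factorial]

/-- The constants for `D = 2`: `9 / 8 = 3 * 3 / 8` and `3.762 = 0.99 * 3.8`, with 3.8 in place of `2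
* D = 4`. -/
theorem baseIneq_four {k : ℕ} (hk : 11 ≤ k) : BaseIneq 4 (9 / 8) (3762 / 1000) k := by
  rcases Nat.lt_or_ge k 17 with h | h
  · unfold BaseIneq
    interval_cases k <;> norm_num [Finset.prod_range_succ, Nat.factorial]
  · refine baseIneq_of_factorial (by norm_num) (by norm_num) (by norm_num) (by omega) ?_
    refine twelve_mul_pow_le (k₀ := 17) (by norm_num) (by norm_num) (by norm_num) ?_ h
    norm_num [Nat.factorial]

/-- The case of many positions in few firms, where rounding may cost a whole firm: `2.97 = 0.99 *
3`. -/
theorem baseIneq_three {k : ℕ} (hk : 27 ≤ k) : BaseIneq 3 (9 / 8) (297 / 100) k := by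
  refine baseIneq_of_factorial (by norm_num) (by norm_num) (by norm_num) (by omega) ?_
  refine twelve_mul_pow_le (k₀ := 27) (by norm_num) (by norm_num) (by norm_num) ?_ hk
  norm_num [Nat.factorial]

/-- After division by `((4 * F + 1) * k + 2) ^ k`, the right side increases with `F`: each of the `k
- 2` linear factors does so relative to its own denominator, and the last two factors do so together
because `2 * k - 8` is nonnegative. -/
theorem BaseIneq.of_le {F₀ F ρ β : ℝ} {k : ℕ} (h : BaseIneq F₀ ρ β k) (hρ : 0 ≤ ρ) (hβ : 0 ≤ β)
    (hF₀ : 3 ≤ F₀) (hF : F₀ ≤ F) (hk : 4 ≤ k) :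
    ((4 * F + 1) * k + 2) ^ k ≤ β * k.factorial * ρ ^ k *
      (∏ i ∈ Finset.range (k - 2), ((F - 1) * k - i)) *
      (((F + 2) * k + 1) * ((F - 2) * k + 2)) := by
  have hk' : (4 : ℝ) ≤ k := by exact_mod_cast hk
  set M₀ := (4 * F₀ + 1) * (k : ℝ) + 2 with hM₀
  set M := (4 * F + 1) * (k : ℝ) + 2 with hM
  have hM0 : 0 < M₀ := by rw [hM₀]; nlinarith
  have hMM : M₀ ≤ M := by rw [hM₀, hM]; nlinarith
  have hM1 : 0 < M := hM0.trans_le hMM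
  have hik : ∀ i ∈ Finset.range (k - 2), (i : ℝ) ≤ k - 2 := fun i hi => by
    have h1 : i + 2 ≤ k := by have := Finset.mem_range.mp hi; omega
    have : ((i + 2 : ℕ) : ℝ) ≤ k := by exact_mod_cast h1
    push_cast at this
    linarith
  have h1 : (∏ i ∈ Finset.range (k - 2), ((F₀ - 1) * k - i)) * M ^ (k - 2) ≤
      (∏ i ∈ Finset.range (k - 2), ((F - 1) * k - i)) * M₀ ^ (k - 2) := by
    have e : ∀ x : ℝ, x ^ (k - 2) = ∏ _i ∈ Finset.range (k - 2), x := fun x => by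
      rw [Finset.prod_const, Finset.card_range]
    rw [e, e, ← Finset.prod_mul_distrib, ← Finset.prod_mul_distrib]
    refine Finset.prod_le_prod (fun i hi => mul_nonneg ?_ hM1.le) fun i hi => ?_
    · have := hik i hi
      nlinarith
    · have h2 : (0 : ℝ) ≤ i := Nat.cast_nonneg i
      have h3 : ((F - 1) * k - i) * M₀ - ((F₀ - 1) * k - i) * M =
          (F - F₀) * k * (5 * k + 2 + 4 * i) := by rw [hM, hM₀]; ring
      have h4 : 0 ≤ (F - F₀) * k * (5 * k + 2 + 4 * i) := by
        have : 0 ≤ F - F₀ := by linarith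
        positivity
      linarith
  have h2 : ((F₀ + 2) * k + 1) * ((F₀ - 2) * k + 2) * M ^ 2 ≤
      ((F + 2) * k + 1) * ((F - 2) * k + 2) * M₀ ^ 2 := by
    have e1 : ∀ x : ℝ, 16 * (((x + 2) * k + 1) * ((x - 2) * k + 2)) =
        ((4 * x + 1) * k + 2) ^ 2 - (2 * k - 8) * ((4 * x + 1) * k + 2) -
          (7 * k + 2) * (9 * k - 6) := fun x => by ring
    have e2 := e1 F₀
    have e3 := e1 F
    rw [← hM₀] at e2
    rw [← hM] at e3
    have h3 : 0 ≤ (2 * (k : ℝ) - 8) * (M * M₀ * (M - M₀)) := by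
      have : 0 ≤ 2 * (k : ℝ) - 8 := by linarith
      have : 0 ≤ M - M₀ := by linarith
      positivity
    have h4 : 0 ≤ (7 * (k : ℝ) + 2) * (9 * k - 6) * (M ^ 2 - M₀ ^ 2) := by
      have h5 : 0 ≤ 9 * (k : ℝ) - 6 := by linarith
      have h6 : 0 ≤ M ^ 2 - M₀ ^ 2 := by nlinarith
      positivity
    have h5 : 16 * (((F + 2) * k + 1) * ((F - 2) * k + 2) * M₀ ^ 2 -
        ((F₀ + 2) * k + 1) * ((F₀ - 2) * k + 2) * M ^ 2) =
        (2 * (k : ℝ) - 8) * (M * M₀ * (M - M₀)) +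
        (7 * (k : ℝ) + 2) * (9 * k - 6) * (M ^ 2 - M₀ ^ 2) := by
      calc _ = 16 * (((F + 2) * k + 1) * ((F - 2) * k + 2)) * M₀ ^ 2 -
          16 * (((F₀ + 2) * k + 1) * ((F₀ - 2) * k + 2)) * M ^ 2 := by ring
        _ = _ := by rw [e2, e3]; ring
    linarith
  have hpow : ∀ x : ℝ, x ^ k = x ^ (k - 2) * x ^ 2 := fun x => by
    rw [← pow_add, Nat.sub_add_cancel (by omega)]
  have h6 : 0 ≤ ∏ i ∈ Finset.range (k - 2), ((F - 1) * (k : ℝ) - i) :=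
    Finset.prod_nonneg fun i hi => by have := hik i hi; nlinarith
  have h7 : 0 ≤ ((F₀ + 2) * (k : ℝ) + 1) * ((F₀ - 2) * k + 2) := by
    have : 0 ≤ F₀ - 2 := by linarith
    positivity
  unfold BaseIneq at h
  rw [← hM₀] at h
  refine le_of_mul_le_mul_right ?_ (pow_pos hM0 k)
  calc M ^ k * M₀ ^ k ≤ M ^ k * (β * k.factorial * ρ ^ k *
        (∏ i ∈ Finset.range (k - 2), ((F₀ - 1) * k - i)) *
        (((F₀ + 2) * k + 1) * ((F₀ - 2) * k + 2))) := by gcongr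
    _ = β * k.factorial * ρ ^ k * (((∏ i ∈ Finset.range (k - 2), ((F₀ - 1) * k - i)) *
        M ^ (k - 2)) * (((F₀ + 2) * k + 1) * ((F₀ - 2) * k + 2) * M ^ 2)) := by
        rw [hpow M]; ring
    _ ≤ β * k.factorial * ρ ^ k * (((∏ i ∈ Finset.range (k - 2), ((F - 1) * k - i)) *
        M₀ ^ (k - 2)) * (((F + 2) * k + 1) * ((F - 2) * k + 2) * M₀ ^ 2)) := by gcongr
    _ = _ := by rw [hpow M₀]; ring

theorem choose_add_two_mul_choose_mul_factorial {N k : ℕ} (hk : 0 < k) (hN : 2 * k ≤ N) :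
    ((N.choose (2 * k) : ℝ) + 2 * (N.choose (2 * k - 1) : ℝ)) * (2 * k).factorial =
      N.descFactorial (2 * k - 1) * (N + 2 * k + 1) := by
  obtain ⟨l, rfl⟩ : ∃ l, k = l + 1 := ⟨k - 1, by omega⟩
  have e1 : 2 * (l + 1) - 1 = 2 * l + 1 := by omega
  have e2 : 2 * (l + 1) = 2 * l + 1 + 1 := by ring
  have h1 : ((2 * l + 1).factorial : ℝ) * N.choose (2 * l + 1) = N.descFactorial (2 * l + 1) := by
    exact_mod_cast (Nat.descFactorial_eq_factorial_mul_choose N (2 * l + 1)).symm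
  have h2 : ((2 * l + 1 + 1).factorial : ℝ) * N.choose (2 * l + 1 + 1) =
      ((N : ℝ) - (2 * l + 1)) * N.descFactorial (2 * l + 1) := by
    have h3 : (2 * l + 1 + 1).factorial * N.choose (2 * l + 1 + 1) =
        (N - (2 * l + 1)) * N.descFactorial (2 * l + 1) := by
      rw [← Nat.descFactorial_eq_factorial_mul_choose, Nat.descFactorial_succ]
    have h4 : ((N - (2 * l + 1) : ℕ) : ℝ) = (N : ℝ) - (2 * l + 1) := by
      rw [Nat.cast_sub (by omega)]; push_cast; ring
    rw [← h4]
    exact_mod_cast h3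
  rw [e1, e2, add_mul, mul_comm _ (((2 * l + 1 + 1).factorial : ℕ) : ℝ), h2, Nat.factorial_succ]
  push_cast
  rw [← h1]
  ring

/-- In the bound of `sum_choose_mul_wbound_ge`, the descending factorial of length `2 * k - 1`
splits off the one of length `k`, which cancels `N.choose k`. With `N = k * F` this leaves
`BaseIneq.of_le`; `ρ` accounts for the powers of `D` and `β` for the ratio of `0.99 * F` to `q`. -/
theorem le_of_baseIneq {F₀ ρ β : ℝ} {D F k q : ℕ} (h : BaseIneq F₀ ρ β k) (hρ : 0 ≤ ρ)
    (hβ : 0 ≤ β) (hF₀ : 3 ≤ F₀) (hF : F₀ ≤ F) (hk : 4 ≤ k) (hD : 0 < D)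
    (hρD : ρ * (4 * D) ≤ 3 * (2 * D - 1)) (hq : q * β ≤ 99 / 100 * F) :
    (q : ℝ) / (2 ^ k * k.factorial * (2 * D - 1) ^ k) * (k * F).choose k ≤
      99 / 100 * F * ((∑ x ∈ Finset.range (k * F + 1), ((k * F).choose x : ℝ) *
        wbound D (k * F) k x) / 2 ^ (k * F)) := by
  have hF3 : 3 ≤ F := by exact_mod_cast hF₀.trans hF
  have hkF : k * 3 ≤ k * F := Nat.mul_le_mul_left k hF3
  have key := h.of_le hρ hβ hF₀ hF hk
  set N := k * F with hN
  have hNr : (N : ℝ) = k * F := by rw [hN]; push_cast; ring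
  have hD1 : (1 : ℝ) ≤ D := by exact_mod_cast hD
  have hd : (0 : ℝ) < 2 * D - 1 := by linarith
  have hQ : ((N - k).descFactorial (k - 1) : ℝ) =
      (∏ i ∈ Finset.range (k - 2), (((F : ℝ) - 1) * k - i)) * (((F : ℝ) - 2) * k + 2) := by
    rw [Nat.descFactorial_eq_prod_range, show k - 1 = k - 2 + 1 by omega, Finset.prod_range_succ]
    have e : ∀ i, i ≤ k - 2 → ((N - k - i : ℕ) : ℝ) = ((F : ℝ) - 1) * k - i := fun i hi => by
      rw [Nat.cast_sub (by omega), Nat.cast_sub (by omega), hNr]; ring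
    push_cast
    rw [e (k - 2) le_rfl, Nat.cast_sub (by omega), Finset.prod_congr rfl fun i hi =>
      e i (Finset.mem_range.mp hi).le]
    push_cast
    ring
  have key2 : ((4 * N + k + 2 : ℝ)) ^ k ≤ β * k.factorial * ρ ^ k *
      ((N - k).descFactorial (k - 1) * (N + 2 * k + 1)) := by
    refine (le_of_eq ?_).trans (key.trans (le_of_eq ?_))
    · rw [hNr]; ring
    · rw [hQ, hNr]; ring
  have key3 : (q : ℝ) * (4 * (D * ((4 * N + k + 2) / 3))) ^ k ≤ 99 / 100 * F * k.factorial *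
      (2 * D - 1) ^ k * ((N - k).descFactorial (k - 1) * (N + 2 * k + 1)) := by
    have e : (4 * ((D : ℝ) * ((4 * N + k + 2) / 3))) ^ k = (4 * D / 3) ^ k * (4 * N + k + 2) ^ k := by
      rw [← mul_pow]; congr 1; ring
    have h1 : (ρ * (4 * D / 3)) ^ k ≤ (2 * D - 1 : ℝ) ^ k := by
      gcongr
      linarith
    rw [e]
    calc (q : ℝ) * ((4 * D / 3) ^ k * (4 * N + k + 2) ^ k)
        ≤ q * ((4 * D / 3) ^ k * (β * k.factorial * ρ ^ k *
          ((N - k).descFactorial (k - 1) * (N + 2 * k + 1)))) := by gcongr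
      _ = (q * β) * k.factorial * (ρ * (4 * D / 3)) ^ k *
          ((N - k).descFactorial (k - 1) * (N + 2 * k + 1)) := by rw [mul_pow]; ring
      _ ≤ _ := by gcongr
  have hL := sum_choose_mul_wbound_ge (D := D) (N := N) (k := k) hD (by omega) (by omega)
  set c : ℝ := (D * ((4 * N + k + 2) / 3)) with hc
  have hc0 : 0 < c := by
    have : (0 : ℝ) < D := by linarith
    positivity
  have hdesc : (N.descFactorial (2 * k - 1) : ℝ) =
      (N - k).descFactorial (k - 1) * N.descFactorial k := by
    have := Nat.descFactorial_mul_descFactorial (n := N) (k := k) (m := 2 * k - 1) (by omega)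
    rw [show 2 * k - 1 - k = k - 1 by omega] at this
    exact_mod_cast this.symm
  have hodd : (oddProd k : ℝ) * (2 ^ k * k.factorial) = (2 * k).factorial := by
    exact_mod_cast oddProd_mul k
  have hch := choose_add_two_mul_choose_mul_factorial (N := N) (k := k) (by omega) (by omega)
  have hck : (k.factorial : ℝ) * N.choose k = N.descFactorial k := by
    exact_mod_cast (Nat.descFactorial_eq_factorial_mul_choose N k).symm
  have hfac : (0 : ℝ) < k.factorial := by positivity
  refine le_trans ?_ (mul_le_mul_of_nonneg_left
    (div_le_div_of_nonneg_right hL (by positivity : (0 : ℝ) ≤ 2 ^ N)) (by positivity))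
  have e2 : (oddProd k : ℝ) * ((N.choose (2 * k) : ℝ) + 2 * (N.choose (2 * k - 1) : ℝ)) * 2 ^ N /
      (4 ^ k * c ^ k) / 2 ^ N = (N - k).descFactorial (k - 1) * (k.factorial * N.choose k) *
        (N + 2 * k + 1) / (2 ^ k * k.factorial * (4 * c) ^ k) := by
    clear_value c
    rw [hck, ← hdesc, ← hch, ← hodd, mul_pow]
    field_simp
  rw [e2, div_mul_eq_mul_div, mul_div_assoc', div_le_div_iff₀ (by positivity) (by positivity)]
  calc (q : ℝ) * N.choose k * (2 ^ k * k.factorial * (4 * c) ^ k)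
      = N.choose k * (2 ^ k * k.factorial) * (q * (4 * c) ^ k) := by ring
    _ ≤ N.choose k * (2 ^ k * k.factorial) * (99 / 100 * F * k.factorial *
      (2 * D - 1) ^ k * ((N - k).descFactorial (k - 1) * (N + 2 * k + 1))) := by gcongr
    _ = _ := by ring

/-- The range of parameters in which scattering the leaders at random pays off. -/
def ScatterRange (D F k q : ℕ) : Prop :=
  (3 ≤ D ∧ 6 ≤ k ∧ 6 ≤ F ∧ 58 * q ≤ 10 * F) ∨ (2 ≤ D ∧ 11 ≤ k ∧ 4 ≤ F ∧ 38 * q ≤ 10 * F) ∨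
    (2 ≤ D ∧ 27 ≤ k ∧ 3 ≤ F ∧ 3 * q ≤ F)

theorem ScatterRange.le {D F k q : ℕ} (h : ScatterRange D F k q) :
    (q : ℝ) / (2 ^ k * k.factorial * (2 * D - 1) ^ k) * (k * F).choose k ≤
      99 / 100 * F * ((∑ x ∈ Finset.range (k * F + 1), ((k * F).choose x : ℝ) *
        wbound D (k * F) k x) / 2 ^ (k * F)) := by
  rcases h with ⟨hD, hk, hF, hq⟩ | ⟨hD, hk, hF, hq⟩ | ⟨hD, hk, hF, hq⟩
  all_goals
    have hD' := (Nat.cast_le (α := ℝ)).mpr hD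
    have hF' := (Nat.cast_le (α := ℝ)).mpr hF
    have hq' := (Nat.cast_le (α := ℝ)).mpr hq
    push_cast at hD' hF' hq'
  · exact le_of_baseIneq (baseIneq_six hk) (by norm_num) (by norm_num) (by norm_num) hF'
      (by omega) (by omega) (by linarith) (by linarith)
  · exact le_of_baseIneq (baseIneq_four hk) (by norm_num) (by norm_num) (by norm_num) hF'
      (by omega) (by omega) (by linarith) (by linarith)
  · exact le_of_baseIneq (baseIneq_three hk) (by norm_num) (by norm_num) (by norm_num) hF'
      (by omega) (by omega) (by linarith) (by linarith)

/-! ### Assigning workers to positions by sorting. -/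

section Sorting

variable {n : ℕ}

/-- The workers that come before `w` if the workers are sorted by `val`. -/
def before (val : Fin n → ℕ) (w : Fin n) : Finset (Fin n) :=
  Finset.univ.filter fun x => val x < val w ∨ (val x = val w ∧ x < w)

/-- The position of `w` if the workers are sorted by `val`. -/
def sortPos (val : Fin n → ℕ) (w : Fin n) : ℕ := (before val w).card

theorem mem_before {val : Fin n → ℕ} {w x : Fin n} :
    x ∈ before val w ↔ val x < val w ∨ (val x = val w ∧ x < w) := by simp [before]

theorem sortPos_lt (val : Fin n → ℕ) (w : Fin n) : sortPos val w < n := by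
  have h : before val w ⊂ Finset.univ := by
    rw [Finset.ssubset_univ_iff]
    intro h
    have := h ▸ Finset.mem_univ w
    rw [mem_before] at this
    omega
  have := Finset.card_lt_card h
  rwa [Finset.card_univ, Fintype.card_fin] at this

theorem sortPos_lt_of_mem {val : Fin n → ℕ} {w x : Fin n} (h : x ∈ before val w) :
    sortPos val x < sortPos val w := by
  refine Finset.card_lt_card ?_
  rw [Finset.ssubset_iff_of_subset]
  · refine ⟨x, h, ?_⟩
    rw [mem_before]
    omega
  · intro y hy
    rw [mem_before] at *
    omega

theorem sortPos_injective (val : Fin n → ℕ) : Function.Injective (sortPos val) := by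
  intro x y h
  by_contra hne
  rcases lt_or_gt_of_ne hne with h' | h' <;>
  rcases lt_trichotomy (val x) (val y) with h'' | h'' | h'' <;>
  first
  | exact absurd (sortPos_lt_of_mem (mem_before.mpr (Or.inl h''))) (by omega)
  | exact absurd (sortPos_lt_of_mem (mem_before.mpr (Or.inr ⟨h'', h'⟩))) (by omega)
  | exact absurd (sortPos_lt_of_mem (mem_before.mpr (Or.inr ⟨h''.symm, h'⟩))) (by omega)

/-- The assignment that gives the positions to the workers in the order of `val`. -/
def sortAssign (k nf : ℕ) (val : Fin n → ℕ) : Assignment n nf := fun w =>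
  if h : sortPos val w / k < nf then some ⟨sortPos val w / k, h⟩ else none

variable {k nf : ℕ}

theorem sortPos_div_lt (hn : n = k * nf) (val : Fin n → ℕ) (w : Fin n) :
    sortPos val w / k < nf := by
  refine Nat.div_lt_of_lt_mul ?_
  exact (sortPos_lt val w).trans_eq hn

theorem sortAssign_eq_some (hn : n = k * nf) {val : Fin n → ℕ} {w : Fin n} {f : Fin nf} :
    sortAssign k nf val w = some f ↔ sortPos val w / k = f.val := by
  have := sortPos_div_lt hn val w
  simp [sortAssign, this, Fin.ext_iff]

theorem isMatching_sortAssign (hk : 0 < k) (hn : n = k * nf) (val : Fin n → ℕ) :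
    IsMatching k (sortAssign k nf val) := by
  intro f
  have h : (employees (sortAssign k nf val) f).image (sortPos val) ⊆
      Finset.Ico (k * f) (k * f + k) := by
    intro y hy
    obtain ⟨x, hx, rfl⟩ := Finset.mem_image.mp hy
    rw [mem_employees, sortAssign_eq_some hn] at hx
    rw [Finset.mem_Ico, ← hx]
    have h1 := Nat.div_add_mod (sortPos val x) k
    have h2 := Nat.mod_lt (sortPos val x) hk
    omega
  have := Finset.card_le_card h
  rw [Finset.card_image_of_injective _ (sortPos_injective val), Nat.card_Ico] at this
  omega

theorem isComplete_sortAssign (hn : n = k * nf) (val : Fin n → ℕ) :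
    IsComplete (sortAssign k nf val) := by
  rw [IsComplete, Finset.eq_univ_iff_forall]
  intro w
  rw [Finset.mem_biUnion]
  exact ⟨⟨_, sortPos_div_lt hn val w⟩, Finset.mem_univ _, by
    rw [mem_employees, sortAssign_eq_some hn]⟩

theorem card_filter_val_lt {val : Fin n → ℕ} {J : ℕ}
    (h : ∀ j < J, (Finset.univ.filter fun x => val x = j).card = k) :
    ∀ j ≤ J, (Finset.univ.filter fun x => val x < j).card = k * j := by
  intro j hj
  induction j with
  | zero => simp
  | succ j ih =>
    have : (Finset.univ.filter fun x => val x < j + 1) =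
        (Finset.univ.filter fun x => val x < j) ∪ (Finset.univ.filter fun x => val x = j) := by
      ext x; simp; omega
    rw [this, Finset.card_union_of_disjoint, ih (by omega), h j (by omega), mul_add, mul_one]
    rw [Finset.disjoint_filter]
    intros
    omega

theorem le_sortPos {val : Fin n → ℕ} {J : ℕ}
    (h : ∀ j < J, (Finset.univ.filter fun x => val x = j).card = k) {j : ℕ} (hj : j ≤ J)
    {w : Fin n} (hw : j ≤ val w) : k * j ≤ sortPos val w := by
  rw [← card_filter_val_lt h j hj]
  refine Finset.card_le_card fun x hx => ?_
  rw [Finset.mem_filter] at hx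
  rw [mem_before]
  omega

theorem sortPos_lt_mul {val : Fin n → ℕ} {J : ℕ}
    (h : ∀ j < J, (Finset.univ.filter fun x => val x = j).card = k) {j : ℕ} (hj : j ≤ J)
    {w : Fin n} (hw : val w < j) : sortPos val w < k * j := by
  rw [← card_filter_val_lt h j hj]
  refine Finset.card_lt_card ?_
  rw [Finset.ssubset_iff_of_subset]
  · exact ⟨w, by simpa using hw, by rw [mem_before]; omega⟩
  · intro x hx
    rw [mem_before] at hx
    simp
    omega

/-- The best firms employ the classes of workers with the smallest values. -/
theorem sortPos_div_eq (hk : 0 < k) {val : Fin n → ℕ} {J : ℕ}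
    (h : ∀ j < J, (Finset.univ.filter fun x => val x = j).card = k) {j : ℕ} (hj : j < J)
    {w : Fin n} : sortPos val w / k = j ↔ val w = j := by
  have key : ∀ i < J, val w = i → sortPos val w / k = i := by
    intro i hi hw
    have h1 := le_sortPos h hi.le hw.ge
    have h2 := sortPos_lt_mul h (j := i + 1) hi (w := w) (by omega)
    rw [mul_comm] at h1 h2
    exact Nat.div_eq_of_lt_le h1 h2
  refine ⟨fun hw => ?_, key j hj⟩
  by_contra hne
  rcases Nat.lt_or_ge (val w) J with h' | h'
  · exact hne ((key _ h' rfl).symm.trans hw)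
  · have h1 := le_sortPos h le_rfl h'
    have h2 : J ≤ sortPos val w / k := (Nat.le_div_iff_mul_le hk).mpr (by rwa [mul_comm] at h1)
    omega

theorem le_sortPos_div (hk : 0 < k) {val : Fin n → ℕ} {J : ℕ}
    (h : ∀ j < J, (Finset.univ.filter fun x => val x = j).card = k) {w : Fin n} (hw : J ≤ val w) :
    J ≤ sortPos val w / k := by
  have h1 := le_sortPos h le_rfl hw
  exact (Nat.le_div_iff_mul_le hk).mpr (by rwa [mul_comm] at h1)

theorem sortPos_bottom {val : Fin n → ℕ} {c : ℕ} {w : Fin n} (hw : c ≤ val w) :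
    sortPos val w + (Finset.univ.filter fun x => c ≤ val x).card =
      n + ((Finset.univ.filter fun x => c ≤ val x).filter fun x => x ∈ before val w).card := by
  have h1 : before val w = (Finset.univ.filter fun x => val x < c) ∪
      ((Finset.univ.filter fun x => c ≤ val x).filter fun x => x ∈ before val w) := by
    ext x
    simp only [Finset.mem_union, Finset.mem_filter, Finset.mem_univ, true_and, mem_before]
    omega
  have h2 : (Finset.univ.filter fun x => val x < c).card +
      (Finset.univ.filter fun x => c ≤ val x).card = n := by
    have := Finset.card_filter_add_card_filter_not (s := (Finset.univ : Finset (Fin n)))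
      (fun x => val x < c)
    simpa using this
  rw [sortPos, h1, Finset.card_union_of_disjoint]
  · simp only [← h1]
    omega
  · rw [Finset.disjoint_left]
    intro x hx hx'
    simp only [Finset.mem_filter] at hx hx'
    omega

theorem sortPos_add_lt {val : Fin n → ℕ} {c : ℕ} {w : Fin n} (hw : val w < c) :
    sortPos val w + (Finset.univ.filter fun x => c ≤ val x).card < n := by
  have h2 : (Finset.univ.filter fun x => val x < c).card +
      (Finset.univ.filter fun x => c ≤ val x).card = n := by
    have := Finset.card_filter_add_card_filter_not (s := (Finset.univ : Finset (Fin n)))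
      (fun x => val x < c)
    simpa using this
  have h3 : sortPos val w < (Finset.univ.filter fun x => val x < c).card := by
    refine Finset.card_lt_card ?_
    rw [Finset.ssubset_iff_of_subset]
    · exact ⟨w, by simpa using hw, by rw [mem_before]; omega⟩
    · intro x hx
      rw [mem_before] at hx
      simp
      omega
  omega

end Sorting

/-! ### Disjoint edges and their layout. -/

/-- `m` disjoint edges of `G`; the ends of the edge `i` are `e i true` and `e i false`. -/
structure Pairs {n : ℕ} (G : SimpleGraph (Fin n)) (m : ℕ) where
  e : ℕ → Bool → Fin n
  inj : ∀ i < m, ∀ j < m, ∀ x y, e i x = e j y → i = j ∧ x = y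
  adj : ∀ i < m, G.Adj (e i true) (e i false)

namespace Pairs

variable {n m : ℕ} {G : SimpleGraph (Fin n)} (P : Pairs G m)

theorem adj_not (P : Pairs G m) {i : ℕ} (hi : i < m) (x : Bool) : G.Adj (P.e i x) (P.e i (!x)) := by
  cases x
  · exact (P.adj i hi).symm
  · exact P.adj i hi

open scoped Classical in
/-- The other end of the edge of a worker. -/
noncomputable def mate (w : Fin n) : Fin n :=
  if h : ∃ i x, i < m ∧ P.e i x = w then P.e h.choose (!h.choose_spec.choose) else w

theorem mate_e {i : ℕ} (hi : i < m) (x : Bool) : P.mate (P.e i x) = P.e i (!x) := by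
  have h : ∃ j y, j < m ∧ P.e j y = P.e i x := ⟨i, x, hi, rfl⟩
  rw [mate, dif_pos h]
  obtain ⟨h1, h2⟩ := h.choose_spec.choose_spec
  obtain ⟨h3, h4⟩ := P.inj _ h1 _ hi _ _ h2
  rw [h4]
  congr 1

theorem injOn {S : Finset ℕ} (hS : ∀ i ∈ S, i < m) (x : ℕ → Bool) :
    Set.InjOn (fun i => P.e i (x i)) S := fun _ hi _ hj h =>
  (P.inj _ (hS _ hi) _ (hS _ hj) _ _ h).1

theorem card_image {S : Finset ℕ} (hS : ∀ i ∈ S, i < m) (x : ℕ → Bool) :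
    (S.image fun i => P.e i (x i)).card = S.card :=
  Finset.card_image_of_injOn (P.injOn hS x)

theorem card_union {S T : Finset ℕ} (hS : ∀ i ∈ S, i < m) (hT : ∀ i ∈ T, i < m) (o : ℕ → Bool) :
    ((S.image fun i => P.e i (!o i)) ∪ (T.image fun i => P.e i (o i))).card =
      S.card + T.card := by
  rw [Finset.card_union_of_disjoint, P.card_image hS, P.card_image hT]
  rw [Finset.disjoint_left]
  intro w h1 h2
  obtain ⟨i, hi, rfl⟩ := Finset.mem_image.mp h1
  obtain ⟨j, hj, h⟩ := Finset.mem_image.mp h2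
  obtain ⟨rfl, h'⟩ := P.inj _ (hT _ hj) _ (hS _ hi) _ _ h
  cases h'' : o j <;> simp [h''] at h'

theorem two_mul_le {n m : ℕ} {G : SimpleGraph (Fin n)} (P : Pairs G m) : 2 * m ≤ n := by
  have h := Finset.card_le_univ (((Finset.range m).image fun i => P.e i (!(fun _ => true) i)) ∪
    ((Finset.range m).image fun i => P.e i ((fun _ => true) i)))
  rw [P.card_union (by simp) (by simp), Fintype.card_fin, Finset.card_range] at h
  omega

end Pairs

/-- The shape of a layout: `B` groups of `s` chunks of `c` edges, `r` of which belong to leaders. -/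
structure IsShape (k m r c s B : ℕ) : Prop where
  pos : 0 < r
  le : r ≤ c
  mul : s * r = k
  add : k + r = 2 * c
  le_m : B * s * c ≤ m

/-- The value by which the end of the edge `t` is sorted, where `isU` says if it is the end that may
go to the worst firms. -/
def layoutVal (n r c s B : ℕ) (key : ℕ → ℕ) (t : ℕ) (isU : Bool) : ℕ :=
  -- The values of the chunks are below `B * s` and decrease, so a later chunk gets a better firm.
  -- Unused workers have the value `n` in the middle, and the chosen ends of the leading edges come
  -- after them.
  if t < B * s * c then
    if isU = true ∧ t % c < r then n + 1 + key (t / c * r + t % c) else B * s - 1 - t / c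
  else n

/-- The workers are sorted by `val` so that the leaders' ends chosen by `o` come last. -/
structure IsLayout {n m : ℕ} {G : SimpleGraph (Fin n)} (P : Pairs G m) (r c s B : ℕ)
    (key : ℕ → ℕ) (o : ℕ → Bool) (val : Fin n → ℕ) : Prop where
  pair : ∀ i < m, ∀ x, val (P.e i x) = layoutVal n r c s B key i (x == o i)
  rest : ∀ w, (∀ i < m, ∀ x, P.e i x ≠ w) → val w = n

section Layout

variable {n m k r c s B : ℕ} {G : SimpleGraph (Fin n)} {P : Pairs G m} {key : ℕ → ℕ}
  {o : ℕ → Bool} {val : Fin n → ℕ}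

theorem IsShape.c_pos (h : IsShape k m r c s B) : 0 < c := h.pos.trans_le h.le

theorem IsShape.chunk_lt (_h : IsShape k m r c s B) {κ b : ℕ} (hκ : κ < B * s) (hb : b < c) :
    κ * c + b < B * s * c := by
  calc κ * c + b < (κ + 1) * c := by rw [add_mul]; omega
    _ ≤ B * s * c := Nat.mul_le_mul_right c hκ

theorem chunk_div {κ b : ℕ} (hb : b < c) : (κ * c + b) / c = κ := by
  rw [mul_comm, Nat.mul_add_div (by omega), Nat.div_eq_of_lt hb, add_zero]

theorem chunk_mod {κ b : ℕ} (hb : b < c) : (κ * c + b) % c = b := by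
  rw [mul_comm, Nat.mul_add_mod, Nat.mod_eq_of_lt hb]

theorem IsShape.bs_le (h : IsShape k m r c s B) (P : Pairs G m) : B * s ≤ n := by
  have h1 := P.two_mul_le
  have h2 := h.le_m
  have h3 : B * s * 1 ≤ B * s * c := Nat.mul_le_mul_left _ h.c_pos
  omega

theorem IsLayout.leader (L : IsLayout P r c s B key o val) (h : IsShape k m r c s B) {κ b : ℕ}
    (hκ : κ < B * s) (hb : b < r) : val (P.e (κ * c + b) (o (κ * c + b))) =
      n + 1 + key (κ * r + b) := by
  have hbc := hb.trans_le h.le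
  have hlt := h.chunk_lt hκ hbc
  rw [L.pair _ (hlt.trans_le h.le_m)]
  simp [layoutVal, hlt, chunk_div hbc, chunk_mod hbc, hb]

theorem IsLayout.worse (L : IsLayout P r c s B key o val) (h : IsShape k m r c s B) {κ b : ℕ}
    (hκ : κ < B * s) (hb : b < c) : val (P.e (κ * c + b) (!o (κ * c + b))) = B * s - 1 - κ := by
  have hlt := h.chunk_lt hκ hb
  rw [L.pair _ (hlt.trans_le h.le_m)]
  simp [layoutVal, hlt, chunk_div hb]

theorem IsLayout.filler (L : IsLayout P r c s B key o val) (h : IsShape k m r c s B) {κ b : ℕ}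
    (hκ : κ < B * s) (hb : b < c) (hr : r ≤ b) (x : Bool) :
    val (P.e (κ * c + b) x) = B * s - 1 - κ := by
  have hlt := h.chunk_lt hκ hb
  rw [L.pair _ (hlt.trans_le h.le_m)]
  simp [layoutVal, hlt, chunk_div hb, chunk_mod hb, hr]

/-- Every worker is in a chunk, or sorted into the middle. -/
theorem IsLayout.cases (L : IsLayout P r c s B key o val) (h : IsShape k m r c s B) (w : Fin n) :
    (∃ κ < B * s, ∃ b < c, ∃ x, w = P.e (κ * c + b) x) ∨ val w = n := by
  by_cases hw : ∀ i < m, ∀ x, P.e i x ≠ w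
  · exact Or.inr (L.rest w hw)
  push Not at hw
  obtain ⟨i, hi, x, rfl⟩ := hw
  by_cases hlt : i < B * s * c
  · refine Or.inl ⟨i / c, (Nat.div_lt_iff_lt_mul h.c_pos).mpr hlt, i % c,
      Nat.mod_lt _ h.c_pos, x, ?_⟩
    rw [Nat.div_add_mod']
  · right
    rw [L.pair _ hi]
    simp [layoutVal, hlt]

theorem bool_eq_not_of_ne {x y : Bool} (h : x ≠ y) : x = !y := by cases x <;> cases y <;> simp_all

theorem IsLayout.val_eq_iff (L : IsLayout P r c s B key o val) (h : IsShape k m r c s B) {κ : ℕ}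
    (hκ : κ < B * s) (w : Fin n) : val w = B * s - 1 - κ ↔
      w ∈ ((Finset.Ico (κ * c) (κ * c + c)).image fun i => P.e i (!o i)) ∪
        ((Finset.Ico (κ * c + r) (κ * c + c)).image fun i => P.e i (o i)) := by
  have hn := h.bs_le P
  simp only [Finset.mem_union, Finset.mem_image, Finset.mem_Ico]
  constructor
  · intro hw
    rcases L.cases h w with ⟨κ', hκ', b, hb, x, rfl⟩ | h'
    · by_cases hx : x = o (κ' * c + b)
      · subst hx
        rcases Nat.lt_or_ge b r with hbr | hbr
        · rw [L.leader h hκ' hbr] at hw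
          omega
        · rw [L.filler h hκ' hb hbr] at hw
          obtain rfl : κ = κ' := by omega
          exact Or.inr ⟨κ * c + b, by omega, rfl⟩
      · obtain rfl := bool_eq_not_of_ne hx
        rw [L.worse h hκ' hb] at hw
        obtain rfl : κ = κ' := by omega
        exact Or.inl ⟨κ * c + b, by omega, rfl⟩
    · omega
  · rintro (⟨i, hi, rfl⟩ | ⟨i, hi, rfl⟩)
    · obtain ⟨b, rfl⟩ := Nat.exists_eq_add_of_le hi.1
      exact L.worse h hκ (by omega)
    · obtain ⟨b, rfl⟩ := Nat.exists_eq_add_of_le hi.1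
      rw [add_assoc]
      exact L.filler h hκ (by omega) (by omega) _

/-- A chunk keeps one end of each of its `c` edges and the other end of the `c - r` edges that are
not leading, which makes `2 * c - r = k` workers: the staff of exactly one firm. -/
theorem IsLayout.card_val_eq (L : IsLayout P r c s B key o val) (h : IsShape k m r c s B) (j : ℕ)
    (hj : j < B * s) : (Finset.univ.filter fun x => val x = j).card = k := by
  have hκ : B * s - 1 - j < B * s := by omega
  have e : B * s - 1 - (B * s - 1 - j) = j := by omega
  have := L.val_eq_iff h hκ
  rw [e] at this
  have hlt : ∀ i ∈ Finset.Ico ((B * s - 1 - j) * c) ((B * s - 1 - j) * c + c), i < m := by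
    intro i hi
    rw [Finset.mem_Ico] at hi
    obtain ⟨b, rfl⟩ := Nat.exists_eq_add_of_le hi.1
    exact (h.chunk_lt hκ (by omega)).trans_le h.le_m
  calc _ = (((Finset.Ico ((B * s - 1 - j) * c) ((B * s - 1 - j) * c + c)).image
        fun i => P.e i (!o i)) ∪ ((Finset.Ico ((B * s - 1 - j) * c + r)
          ((B * s - 1 - j) * c + c)).image fun i => P.e i (o i))).card := by
        congr 1
        ext w
        rw [Finset.mem_filter, this]
        simp
    _ = c + (c - r) := by
        rw [P.card_union hlt, Nat.card_Ico, Nat.card_Ico]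
        · omega
        · intro i hi
          refine hlt i ?_
          rw [Finset.mem_Ico] at *
          omega
    _ = k := by
        have := h.add
        have := h.le
        omega

/-- The worker that is the end of the leading edge `l` which may go to the worst firms. -/
def lead (P : Pairs G m) (r c : ℕ) (o : ℕ → Bool) (l : ℕ) : Fin n :=
  P.e (l / r * c + l % r) (o (l / r * c + l % r))

theorem IsShape.lead_lt (h : IsShape k m r c s B) {l : ℕ} (hl : l < B * k) :
    l / r * c + l % r < B * s * c := by
  refine h.chunk_lt ?_ ((Nat.mod_lt _ h.pos).trans_le h.le)
  rw [Nat.div_lt_iff_lt_mul h.pos, mul_assoc, h.mul]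
  exact hl

theorem IsShape.lead_inj (h : IsShape k m r c s B) {l l' : ℕ}
    (he : l / r * c + l % r = l' / r * c + l' % r) : l = l' := by
  have h1 := (Nat.mod_lt l h.pos).trans_le h.le
  have h2 := (Nat.mod_lt l' h.pos).trans_le h.le
  have h3 := chunk_div (κ := l / r) h1
  have h4 := chunk_div (κ := l' / r) h2
  have h5 := chunk_mod (κ := l / r) h1
  have h6 := chunk_mod (κ := l' / r) h2
  rw [he] at h3 h5
  rw [← Nat.div_add_mod' l r, ← Nat.div_add_mod' l' r, h3.symm.trans h4, h5.symm.trans h6]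

theorem IsLayout.val_lead (L : IsLayout P r c s B key o val) (h : IsShape k m r c s B) {l : ℕ}
    (hl : l < B * k) : val (lead P r c o l) = n + 1 + key l := by
  rw [lead, L.leader h _ (Nat.mod_lt _ h.pos), Nat.div_add_mod']
  rw [Nat.div_lt_iff_lt_mul h.pos, mul_assoc, h.mul]
  exact hl

theorem IsLayout.lt_val_iff (L : IsLayout P r c s B key o val) (h : IsShape k m r c s B)
    (w : Fin n) : n + 1 ≤ val w ↔ w ∈ (Finset.range (B * k)).image (lead P r c o) := by
  simp only [Finset.mem_image, Finset.mem_range]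
  have hn := h.bs_le P
  constructor
  · intro hw
    rcases L.cases h w with ⟨κ, hκ, b, hb, x, rfl⟩ | h'
    · by_cases hx : x = o (κ * c + b)
      · subst hx
        rcases Nat.lt_or_ge b r with hbr | hbr
        · refine ⟨κ * r + b, ?_, ?_⟩
          · calc κ * r + b < (κ + 1) * r := by rw [add_mul]; omega
              _ ≤ B * s * r := Nat.mul_le_mul_right r hκ
              _ = B * k := by rw [mul_assoc, h.mul]
          · rw [lead, chunk_div hbr, chunk_mod hbr]
        · rw [L.filler h hκ hb hbr] at hw
          omega
      · obtain rfl := bool_eq_not_of_ne hx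
        rw [L.worse h hκ hb] at hw
        omega
    · omega
  · rintro ⟨l, hl, rfl⟩
    rw [L.val_lead h hl]
    omega

theorem IsShape.lead_injOn (h : IsShape k m r c s B) (P : Pairs G m) (o : ℕ → Bool) :
    Set.InjOn (lead P r c o) (Finset.range (B * k) : Finset ℕ) := by
  intro l hl l' hl' he
  simp only [Finset.coe_range, Set.mem_Iio] at hl hl'
  exact h.lead_inj (P.inj _ ((h.lead_lt hl).trans_le h.le_m) _ ((h.lead_lt hl').trans_le h.le_m)
    _ _ he).1

theorem IsLayout.card_lt_val (L : IsLayout P r c s B key o val) (h : IsShape k m r c s B) :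
    (Finset.univ.filter fun x => n + 1 ≤ val x).card = B * k := by
  rw [show (Finset.univ.filter fun x => n + 1 ≤ val x) =
    (Finset.range (B * k)).image (lead P r c o) from by
      ext w; rw [Finset.mem_filter, L.lt_val_iff h]; simp,
    Finset.card_image_of_injOn (h.lead_injOn P o), Finset.card_range]

/-- The number of leaders that come before the leader `l`. -/
def leadPos (P : Pairs G m) (r c N : ℕ) (o : ℕ → Bool) (key : ℕ → ℕ) (l : ℕ) : ℕ :=
  ((Finset.range N).filter fun l' =>
    key l' < key l ∨ (key l' = key l ∧ lead P r c o l' < lead P r c o l)).card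

theorem IsLayout.sortPos_lead (L : IsLayout P r c s B key o val) (h : IsShape k m r c s B) {l : ℕ}
    (hl : l < B * k) :
    sortPos val (lead P r c o l) + B * k = n + leadPos P r c (B * k) o key l := by
  have h1 := sortPos_bottom (val := val) (c := n + 1) (w := lead P r c o l)
    (by rw [L.val_lead h hl]; omega)
  rw [L.card_lt_val h] at h1
  rw [h1, leadPos]
  congr 1
  rw [show (Finset.univ.filter fun x => n + 1 ≤ val x) =
    (Finset.range (B * k)).image (lead P r c o) from by
      ext w; rw [Finset.mem_filter, L.lt_val_iff h]; simp,
    Finset.filter_image, Finset.card_image_of_injOn]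
  · congr 1
    ext l'
    simp only [Finset.mem_filter, Finset.mem_range, mem_before]
    refine and_congr_right fun hl' => ?_
    rw [L.val_lead h hl, L.val_lead h hl']
    omega
  · refine (h.lead_injOn P o).mono ?_
    exact Finset.coe_subset.mpr (Finset.filter_subset _ _)

/-- The leaders are in the worst `B` firms, the others elsewhere. -/
theorem IsLayout.sortPos_div_iff (L : IsLayout P r c s B key o val) (h : IsShape k m r c s B)
    {nf : ℕ} (hk : 0 < k) (hn : n = k * nf) (hB : B ≤ nf) {β : ℕ} (w : Fin n) :
    sortPos val w / k = nf - B + β ↔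
      ∃ l < B * k, w = lead P r c o l ∧ leadPos P r c (B * k) o key l / k = β := by
  have hsub : n - B * k = (nf - B) * k := by rw [hn, Nat.sub_mul, mul_comm]
  have hBn : B * k ≤ n := by rw [hn, mul_comm]; exact Nat.mul_le_mul_left k hB
  have key' : ∀ l < B * k, sortPos val (lead P r c o l) / k =
      nf - B + leadPos P r c (B * k) o key l / k := by
    intro l hl
    have h1 := L.sortPos_lead h hl
    rw [show sortPos val (lead P r c o l) =
      leadPos P r c (B * k) o key l + (nf - B) * k by omega, Nat.add_mul_div_right _ _ hk, add_comm]
  constructor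
  · intro hw
    by_cases hmem : n + 1 ≤ val w
    · rw [L.lt_val_iff h] at hmem
      obtain ⟨l, hl, rfl⟩ := Finset.mem_image.mp hmem
      rw [Finset.mem_range] at hl
      rw [key' l hl] at hw
      exact ⟨l, hl, rfl, by omega⟩
    · have h1 := sortPos_add_lt (val := val) (c := n + 1) (w := w) (by omega)
      rw [L.card_lt_val h] at h1
      have h2 : sortPos val w / k < nf - B := (Nat.div_lt_iff_lt_mul hk).mpr (by omega)
      omega
  · rintro ⟨l, hl, rfl, rfl⟩
    exact key' l hl

theorem leadPos_id {N l : ℕ} (hl : l < N) : leadPos P r c N o id l = l := by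
  rw [leadPos]
  calc _ = (Finset.range l).card := by
        congr 1
        ext x
        simp only [Finset.mem_filter, Finset.mem_range, id]
        constructor
        · rintro ⟨-, h | ⟨rfl, h⟩⟩
          · exact h
          · exact absurd h (lt_irrefl _)
        · intro h
          exact ⟨h.trans hl, Or.inl h⟩
    _ = l := Finset.card_range l

end Layout

/-! ### Groups of leaders form group systems. -/

section Groups

variable {n m k r c s B nf : ℕ} {G : SimpleGraph (Fin n)} {P : Pairs G m}
  {o : ℕ → Bool} {val : Fin n → ℕ}

/-- The workers of the edges of a chunk. -/
def chunkSet (P : Pairs G m) (c κ : ℕ) : Finset (Fin n) :=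
  ((Finset.Ico (κ * c) (κ * c + c)).image fun i => P.e i (!true)) ∪
    ((Finset.Ico (κ * c) (κ * c + c)).image fun i => P.e i true)

theorem mem_chunkSet {κ : ℕ} {w : Fin n} :
    w ∈ chunkSet P c κ ↔ ∃ b < c, ∃ x, w = P.e (κ * c + b) x := by
  simp only [chunkSet, Finset.mem_union, Finset.mem_image, Finset.mem_Ico]
  constructor
  · rintro (⟨i, hi, rfl⟩ | ⟨i, hi, rfl⟩) <;>
    · obtain ⟨b, rfl⟩ := Nat.exists_eq_add_of_le hi.1
      exact ⟨b, by omega, _, rfl⟩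
  · rintro ⟨b, hb, x, rfl⟩
    cases x
    · exact Or.inl ⟨κ * c + b, by omega, rfl⟩
    · exact Or.inr ⟨κ * c + b, by omega, rfl⟩

theorem IsShape.card_chunkSet (h : IsShape k m r c s B) {κ : ℕ} (hκ : κ < B * s) :
    (chunkSet P c κ).card = k + r := by
  have hlt : ∀ i ∈ Finset.Ico (κ * c) (κ * c + c), i < m := by
    intro i hi
    rw [Finset.mem_Ico] at hi
    obtain ⟨b, rfl⟩ := Nat.exists_eq_add_of_le hi.1
    exact (h.chunk_lt hκ (by omega)).trans_le h.le_m
  rw [chunkSet, P.card_union hlt hlt (fun _ => true), Nat.card_Ico, h.add]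
  omega

/-- The edges of the chunks have `B * s * (k + r) = k * (B * s + B)` ends among the `n = k * nf`
workers. Hence the firms of the chunks and those of the leaders do not overlap. -/
theorem IsShape.firms (h : IsShape k m r c s B) (P : Pairs G m) (hk : 0 < k) (hn : n = k * nf) :
    B * s + B ≤ nf := by
  have h1 := P.two_mul_le
  have h2 := h.le_m
  refine Nat.le_of_mul_le_mul_left ?_ hk
  calc k * (B * s + B) = B * s * (k + r) := by rw [← h.mul]; ring
    _ = 2 * (B * s * c) := by rw [h.add]; ring
    _ ≤ k * nf := by omega

/-- The edges of leaders have no neighbours in later chunks of the same group. -/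
def NoCross (P : Pairs G m) (r c s B : ℕ) : Prop :=
  ∀ β < B, ∀ κ κ', β * s ≤ κ → κ < κ' → κ' < β * s + s → ∀ b < r, ∀ b' < c, ∀ x y,
    ¬ G.Adj (P.e (κ * c + b) x) (P.e (κ' * c + b') y)

/-- The leaders of the group `β` are preferred to their partners. -/
def Proper (P : Pairs G m) (k r c : ℕ) (rank : Fin n ≃ Fin n) (o : ℕ → Bool) (β : ℕ) : Prop :=
  ∀ l, β * k ≤ l → l < β * k + k → rank (P.e (l / r * c + l % r) (o (l / r * c + l % r))) <
    rank (P.e (l / r * c + l % r) (!o (l / r * c + l % r)))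

theorem chunk_bound {β a : ℕ} (hβ : β < B) (ha : a < s) : β * s + a < B * s := by
  calc β * s + a < (β + 1) * s := by rw [add_mul]; omega
    _ ≤ B * s := Nat.mul_le_mul_right s hβ

theorem IsShape.lead_range (h : IsShape k m r c s B) {β a b : ℕ} (ha : a < s) (hb : b < r) :
    β * k ≤ (β * s + a) * r + b ∧ (β * s + a) * r + b < β * k + k := by
  have e : (β * s + a) * r = β * k + a * r := by rw [← h.mul]; ring
  have : a * r + r ≤ k := by
    rw [← h.mul, ← Nat.succ_mul]
    exact Nat.mul_le_mul_right r ha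
  omega

variable {rank : Fin n ≃ Fin n}

theorem add_inj_of_lt {κ κ' b b' : ℕ} (hb : b < c) (hb' : b' < c)
    (he : κ * c + b = κ' * c + b') : κ = κ' ∧ b = b' := by
  have h1 := chunk_div (κ := κ) hb
  have h2 := chunk_mod (κ := κ) hb
  rw [he, chunk_div hb'] at h1
  rw [he, chunk_mod hb'] at h2
  exact ⟨h1.symm, h2.symm⟩

/-- The leaders of a group form a group system for one of the worst firms. -/
noncomputable def groupSystem (h : IsShape k m r c s B) (P : Pairs G m) (hk : 0 < k)
    (hn : n = k * nf) {β : ℕ} (hβ : β < B) (hprop : Proper P k r c rank o β)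
    (hcross : NoCross P r c s B) : GroupSystem G k nf rank (Fin s × Fin r) where
  f := ⟨nf - B + β, by have := h.firms P hk hn; omega⟩
  u i := P.e ((β * s + i.1) * c + i.2) (o ((β * s + i.1) * c + i.2))
  v i := P.e ((β * s + i.1) * c + i.2) (!o ((β * s + i.1) * c + i.2))
  -- The order of the firms is opposite to that of the chunks, as prescribed by `layoutVal`.
  h i := ⟨B * s - 1 - (β * s + i.1), by
    have := h.firms P hk hn
    have := chunk_bound hβ i.1.isLt
    omega⟩
  C g := chunkSet P c (B * s - 1 - g)
  p := P.mate
  u_inj := by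
    rintro ⟨a, b⟩ ⟨a', b'⟩ he
    have hb := b.isLt.trans_le h.le
    have hb' := b'.isLt.trans_le h.le
    have h1 := (P.inj _ ((h.chunk_lt (chunk_bound hβ a.isLt) hb).trans_le h.le_m) _
      ((h.chunk_lt (chunk_bound hβ a'.isLt) hb').trans_le h.le_m) _ _ he).1
    obtain ⟨h2, h3⟩ := add_inj_of_lt hb hb' h1
    simp only [Prod.mk.injEq, Fin.ext_iff]
    omega
  v_inj := by
    rintro ⟨a, b⟩ ⟨a', b'⟩ he
    have hb := b.isLt.trans_le h.le
    have hb' := b'.isLt.trans_le h.le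
    have h1 := (P.inj _ ((h.chunk_lt (chunk_bound hβ a.isLt) hb).trans_le h.le_m) _
      ((h.chunk_lt (chunk_bound hβ a'.isLt) hb').trans_le h.le_m) _ _ he).1
    obtain ⟨h2, h3⟩ := add_inj_of_lt hb hb' h1
    simp only [Prod.mk.injEq, Fin.ext_iff]
    omega
  adj i := P.adj_not ((h.chunk_lt (chunk_bound hβ i.1.isLt) (i.2.isLt.trans_le h.le)).trans_le
    h.le_m) _
  better i := by
    obtain ⟨h1, h2⟩ := h.lead_range (β := β) i.1.isLt i.2.isLt
    have := hprop _ h1 h2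
    rwa [chunk_div i.2.isLt, chunk_mod i.2.isLt] at this
  lt i := by
    have := h.firms P hk hn
    rw [Fin.lt_def]
    have := chunk_bound hβ i.1.isLt
    simp only
    omega
  u_ne_v i j he := by
    have h1 := P.inj _ ((h.chunk_lt (chunk_bound hβ i.1.isLt) (i.2.isLt.trans_le h.le)).trans_le
      h.le_m) _ ((h.chunk_lt (chunk_bound hβ j.1.isLt) (j.2.isLt.trans_le h.le)).trans_le
      h.le_m) _ _ he
    rw [h1.1] at h1
    simpa using h1.2
  u_mem i := by
    have := chunk_bound hβ i.1.isLt
    simp only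
    rw [show B * s - 1 - (B * s - 1 - (β * s + i.1)) = β * s + i.1 by omega]
    exact mem_chunkSet.mpr ⟨_, i.2.isLt.trans_le h.le, _, rfl⟩
  v_mem i := by
    have := chunk_bound hβ i.1.isLt
    simp only
    rw [show B * s - 1 - (B * s - 1 - (β * s + i.1)) = β * s + i.1 by omega]
    exact mem_chunkSet.mpr ⟨_, i.2.isLt.trans_le h.le, _, rfl⟩
  p_mem i y hy := by
    have := chunk_bound hβ i.1.isLt
    obtain ⟨b, hb, x, rfl⟩ := mem_chunkSet.mp hy
    rw [P.mate_e ((h.chunk_lt (by omega) hb).trans_le h.le_m)]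
    exact mem_chunkSet.mpr ⟨b, hb, _, rfl⟩
  p_adj i y hy := by
    have := chunk_bound hβ i.1.isLt
    obtain ⟨b, hb, x, rfl⟩ := mem_chunkSet.mp hy
    have hlt := (h.chunk_lt (κ := B * s - 1 - (B * s - 1 - (β * s + i.1))) (by omega) hb).trans_le
      h.le_m
    rw [P.mate_e hlt]
    exact P.adj_not hlt x
  -- A better firm belongs to a later chunk of the group, where `NoCross` excludes edges.
  cross i j hij y hy := by
    have h1 := chunk_bound hβ i.1.isLt
    have h2 := chunk_bound hβ j.1.isLt
    rw [Fin.lt_def] at hij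
    simp only at hij hy
    rw [show B * s - 1 - (B * s - 1 - (β * s + j.1)) = β * s + j.1 by omega] at hy
    obtain ⟨b, hb, x, rfl⟩ := mem_chunkSet.mp hy
    exact hcross β hβ _ _ (by omega) (by omega) (by omega) _ i.2.isLt _ hb _ _
  card i := by
    have h1 := chunk_bound hβ i.1.isLt
    simp only
    rw [show B * s - 1 - (B * s - 1 - (β * s + i.1)) = β * s + i.1 by omega,
      h.card_chunkSet h1]
    congr 1
    rw [show (Finset.univ.filter fun j : Fin s × Fin r =>
      (⟨B * s - 1 - (β * s + j.1), by
        have := h.firms P hk hn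
        have := chunk_bound hβ j.1.isLt
        omega⟩ : Fin nf) = ⟨B * s - 1 - (β * s + i.1), by
        have := h.firms P hk hn
        omega⟩) = ({i.1} : Finset (Fin s)) ×ˢ (Finset.univ : Finset (Fin r)) from ?_]
    · simp
    · ext j
      have h2 := chunk_bound hβ j.1.isLt
      simp only [Finset.mem_filter, Finset.mem_univ, true_and, Finset.mem_product,
        Finset.mem_singleton, and_true, Fin.ext_iff]
      omega

theorem cnt_groupSystem (h : IsShape k m r c s B) (hk : 0 < k)
    (hn : n = k * nf) {β : ℕ} (hβ : β < B) (hprop : Proper P k r c rank o β)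
    (hcross : NoCross P r c s B) (i : Fin s × Fin r) :
    (groupSystem h P hk hn hβ hprop hcross).cnt Finset.univ
      ((groupSystem h P hk hn hβ hprop hcross).h i) = r := by
  have h1 := (groupSystem h P hk hn hβ hprop hcross).card i
  have h2 := h.card_chunkSet (P := P) (chunk_bound hβ i.1.isLt)
  have h3 : (groupSystem h P hk hn hβ hprop hcross).C
      ((groupSystem h P hk hn hβ hprop hcross).h i) = chunkSet P c (β * s + i.1) := by
    have h1 := chunk_bound hβ i.1.isLt
    change chunkSet P c (B * s - 1 - (B * s - 1 - (β * s + i.1))) = _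
    rw [show B * s - 1 - (B * s - 1 - (β * s + i.1)) = β * s + i.1 by omega]
  rw [h3, h2] at h1
  exact (Nat.add_left_cancel h1).symm

theorem value_groupSystem (h : IsShape k m r c s B) (hk : 0 < k)
    (hn : n = k * nf) {β : ℕ} (hβ : β < B) (hprop : Proper P k r c rank o β)
    (hcross : NoCross P r c s B) (E : ℕ) :
    (groupSystem h P hk hn hβ hprop hcross).value E Finset.univ =
      (∏ t ∈ Finset.Icc 1 r, (1 : ℝ) / GroupSystem.harmBound k E t) ^ s := by
  set Γ := groupSystem h P hk hn hβ hprop hcross with hΓ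
  have hcnt : ∀ g ∈ Finset.univ.image Γ.h, Γ.cnt Finset.univ g = r := by
    intro g hg
    obtain ⟨i, -, rfl⟩ := Finset.mem_image.mp hg
    exact cnt_groupSystem h hk hn hβ hprop hcross i
  have hcard : (Finset.univ.image Γ.h).card = s := by
    have h1 := Finset.card_eq_sum_card_image Γ.h Finset.univ
    have h2 : ∑ g ∈ Finset.univ.image Γ.h, (Finset.univ.filter fun i => Γ.h i = g).card =
        ∑ _g ∈ Finset.univ.image Γ.h, r := Finset.sum_congr rfl hcnt
    rw [h2] at h1
    simp only [Finset.card_univ, Fintype.card_prod, Fintype.card_fin, Finset.sum_const,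
      smul_eq_mul] at h1
    exact (Nat.eq_of_mul_eq_mul_right h.pos h1).symm
  rw [GroupSystem.value, ← Finset.prod_subset (Finset.subset_univ (Finset.univ.image Γ.h)),
    Finset.prod_congr rfl (g := fun _ => ∏ t ∈ Finset.Icc 1 r,
      (1 : ℝ) / GroupSystem.harmBound k E t), Finset.prod_const, hcard]
  · intro g hg
    rw [hcnt g hg]
  · intro g _ hg
    have : Γ.cnt Finset.univ g = 0 := by
      rw [GroupSystem.cnt, Finset.card_eq_zero, Finset.filter_eq_empty_iff]
      intro i _ hi
      exact hg (Finset.mem_image.mpr ⟨i, Finset.mem_univ i, hi⟩)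
    rw [this]
    simp

theorem inv_groupSystem (h : IsShape k m r c s B) (hk : 0 < k)
    (hn : n = k * nf) {β : ℕ} (hβ : β < B) (hprop : Proper P k r c rank o β)
    (hcross : NoCross P r c s B) (L : IsLayout P r c s B id o val) :
    (groupSystem h P hk hn hβ hprop hcross).Inv Finset.univ (sortAssign k nf val) where
  matching := isMatching_sortAssign hk hn val
  f_eq x := by
    have hB : B ≤ nf := by have := h.firms P hk hn; omega
    rw [sortAssign_eq_some hn]
    change sortPos val x / k = nf - B + β ↔ _
    rw [L.sortPos_div_iff h hk hn hB]
    constructor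
    · rintro ⟨l, hl, rfl, hlβ⟩
      rw [leadPos_id hl] at hlβ
      have e := Nat.div_add_mod' l k
      have e1 := Nat.mod_lt l hk
      rw [hlβ] at e
      have hs : l / r - β * s < s := by
        have h1 : l / r < β * s + s := by
          rw [Nat.div_lt_iff_lt_mul h.pos, add_mul, mul_assoc, h.mul]
          omega
        have h2 : β * s ≤ l / r := by
          rw [Nat.le_div_iff_mul_le h.pos, mul_assoc, h.mul]
          omega
        omega
      have h2 : β * s ≤ l / r := by
        rw [Nat.le_div_iff_mul_le h.pos, mul_assoc, h.mul]
        omega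
      refine ⟨(⟨l / r - β * s, hs⟩, ⟨l % r, Nat.mod_lt _ h.pos⟩), Finset.mem_univ _, ?_⟩
      change P.e ((β * s + (l / r - β * s)) * c + l % r)
        (o ((β * s + (l / r - β * s)) * c + l % r)) = _
      rw [Nat.add_sub_cancel' h2]
      rfl
    · rintro ⟨i, -, rfl⟩
      obtain ⟨h1, h2⟩ := h.lead_range (β := β) i.1.isLt i.2.isLt
      have h3 : (β * s + i.1) * r + i.2 < B * k := by
        refine h2.trans_le ?_
        rw [← Nat.succ_mul]
        exact Nat.mul_le_mul_right k hβ
      refine ⟨(β * s + i.1) * r + i.2, h3, ?_, ?_⟩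
      · rw [lead, chunk_div i.2.isLt, chunk_mod i.2.isLt]
        rfl
      · rw [leadPos_id h3]
        exact Nat.div_eq_of_lt_le h1 (by rw [Nat.succ_mul]; exact h2)
  v_eq i _ := by
    rw [sortAssign_eq_some hn]
    have h1 := chunk_bound hβ i.1.isLt
    change _ = B * s - 1 - (β * s + i.1)
    rw [sortPos_div_eq hk (L.card_val_eq h) (by omega)]
    exact L.worse h h1 (i.2.isLt.trans_le h.le)
  sub i _ y hy := by
    rw [sortAssign_eq_some hn] at hy
    have h1 := chunk_bound hβ i.1.isLt
    change _ = B * s - 1 - (β * s + i.1) at hy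
    rw [sortPos_div_eq hk (L.card_val_eq h) (by omega), L.val_eq_iff h h1] at hy
    change y ∈ chunkSet P c (B * s - 1 - (B * s - 1 - (β * s + i.1)))
    rw [show B * s - 1 - (B * s - 1 - (β * s + i.1)) = β * s + i.1 by omega, mem_chunkSet]
    simp only [Finset.mem_union, Finset.mem_image, Finset.mem_Ico] at hy
    rcases hy with ⟨j, hj, rfl⟩ | ⟨j, hj, rfl⟩
    · exact ⟨j - (β * s + i.1) * c, by omega, _, by rw [Nat.add_sub_cancel' hj.1]⟩
    · exact ⟨j - (β * s + i.1) * c, by omega, _, by rw [Nat.add_sub_cancel' (by omega)]⟩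
  order _ _ j hj := absurd (Finset.mem_univ j) hj

/-- The groups whose leaders are all preferred to their partners contribute to the expected number
of firms without employees. -/
theorem le_integral_of_proper [DecidableRel G.Adj] [NeZero n] (h : IsShape k m r c s B) (hk : 0 < k)
    (hn : n = k * nf) (hcross : NoCross P r c s B) (L : IsLayout P r c s B id o val) {E : ℕ}
    (hE : ∀ x, G.degree x ≤ E + 1) (I : Finset ℕ)
    (hI : ∀ β ∈ I, β < B ∧ Proper P k r c rank o β) :
    (I.card : ℝ) * (∏ t ∈ Finset.Icc 1 r, (1 : ℝ) / GroupSystem.harmBound k E t) ^ s ≤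
      ∫ ω, (numOutOfBusiness G k rank (sortAssign k nf val) ω : ℝ) ∂(activation n) := by
  set μ := sortAssign k nf val
  set z := (∏ t ∈ Finset.Icc 1 r, (1 : ℝ) / GroupSystem.harmBound k E t) ^ s with hz
  have hfirm : ∀ β < B, nf - B + β < nf := fun β hβ => by have := h.firms P hk hn; omega
  have hlim : ∀ β : I, ∃ p ≥ z, Tendsto (fun T => avg T fun l =>
      GroupSystem.emptyInd ⟨nf - B + β, hfirm β (hI β β.2).1⟩ (run G k rank μ l)) atTop (nhds p) := by
    intro β
    obtain ⟨h1, h2⟩ := hI β β.2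
    have := (groupSystem h P hk hn h1 h2 hcross).exists_limit_ge hk
      (inv_groupSystem h hk hn h1 h2 hcross L) hE
    rw [value_groupSystem] at this
    exact this
  choose p hp1 hp2 using hlim
  have ht : Tendsto (fun T => ∑ β : I, avg T fun l =>
      GroupSystem.emptyInd ⟨nf - B + β, hfirm β (hI β β.2).1⟩ (run G k rank μ l)) atTop
        (nhds (∑ β : I, p β)) := tendsto_finsetSum _ fun β _ => hp2 β
  have hle : ∑ β : I, p β ≤
      ∫ ω, (numOutOfBusiness G k rank μ ω : ℝ) ∂(activation n) := by
    -- After `T` rounds, the indicators for distinct bad firms add up to at most the number of empty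
    -- firms.
    refine le_of_tendsto' ht fun T => ?_
    rw [← avg_sum]
    refine le_trans (avg_mono T fun l => ?_) (avg_numEmpty_le G k rank μ T)
    have hinj : Function.Injective fun β : I =>
        (⟨nf - B + β, hfirm β (hI β β.2).1⟩ : Fin nf) := by
      intro β β' he
      simp only [Fin.mk.injEq] at he
      ext
      omega
    simp only [GroupSystem.emptyInd]
    rw [← Finset.sum_image (f := fun f => if employees (run G k rank μ l) f = ∅ then (1 : ℝ) else 0)
      (g := fun β : I => (⟨nf - B + β, hfirm β (hI β β.2).1⟩ : Fin nf)) hinj.injOn,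
      Finset.sum_boole, numEmpty]
    norm_cast
    refine Finset.card_le_card fun f hf => ?_
    simp only [Finset.mem_filter, Finset.mem_univ, true_and] at hf ⊢
    exact hf.2
  refine le_trans ?_ hle
  calc (I.card : ℝ) * z = ∑ _β : I, z := by simp
    _ ≤ ∑ β : I, p β := Finset.sum_le_sum fun β _ => hp1 β

end Groups

open scoped BigOperators

/-! ### Random orientations of the leading edges. -/

section Bits

/-- The bits read through an injection are independent and fair. -/
theorem expect_comp_injective {α β : Type*} [Fintype α] [Fintype β] [DecidableEq α] [DecidableEq β]
    {φ : α → β} (hφ : Function.Injective φ) (f : (α → Bool) → ℝ) :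
    𝔼 r : β → Bool, f (r ∘ φ) = 𝔼 a : α → Bool, f a := by
  classical
  let e : α ⊕ {b // b ∉ Set.range φ} ≃ β :=
    (Equiv.sumCongr (Equiv.ofInjective φ hφ) (Equiv.refl _)).trans
      (Equiv.sumCompl (· ∈ Set.range φ))
  let e' : (β → Bool) ≃ (α → Bool) × ({b // b ∉ Set.range φ} → Bool) :=
    (Equiv.arrowCongr e.symm (Equiv.refl Bool)).trans (Equiv.sumArrowEquivProdArrow _ _ _)
  rw [Fintype.expect_equiv e' (g := fun x => f x.1)]
  · rw [← Finset.univ_product_univ,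
      Finset.expect_product' Finset.univ Finset.univ fun a (_ : {b // b ∉ Set.range φ} → Bool) => f a]
    simp only [Fintype.expect_const]
  · intro r
    rfl

theorem expect_ite_eq {α : Type*} [Fintype α] [DecidableEq α] (x : α → Bool) (L : Finset α) :
    𝔼 r : α → Bool, (if ∀ i ∈ L, r i = x i then (1 : ℝ) else 0) = (1 / 2) ^ L.card := by
  have h := expect_comp_injective (φ := ((↑) : L → α)) Subtype.val_injective
    fun a => if a = fun i : L => x i then (1 : ℝ) else 0
  have h2 : ∀ r : α → Bool, (∀ i ∈ L, r i = x i) ↔ r ∘ ((↑) : L → α) = fun i : L => x i := by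
    intro r
    rw [funext_iff]
    simp
  simp_rw [h2]
  rw [h, Fintype.expect_eq_sum_div_card]
  simp

/-- The bit `i` of `r`. -/
def bit {M : ℕ} (r : Fin M → Bool) (i : ℕ) : Bool := if h : i < M then r ⟨i, h⟩ else false

variable {n m k r c s B nf M : ℕ} {G : SimpleGraph (Fin n)} [DecidableRel G.Adj] {P : Pairs G m}

omit [DecidableRel G.Adj] in
theorem lt_of_eq_bit (rank : Fin n ≃ Fin n) {i : ℕ} (hi : i < m) (x : Bool) :
    rank (P.e i x) < rank (P.e i (!x)) ↔
      x = decide (rank (P.e i true) < rank (P.e i false)) := by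
  have hne : rank (P.e i true) ≠ rank (P.e i false) := fun h =>
    (P.adj i hi).ne (rank.injective h)
  cases x
  · simp only [Bool.not_false, false_eq_decide_iff, not_lt]
    exact ⟨fun h => h.le, fun h => lt_of_le_of_ne h hne.symm⟩
  · simp

/-- That a group is proper prescribes at most `k` of the fair bits, an event of probability at least
`(1 / 2) ^ k`. By linearity of expectation the groups need not be independent. -/
theorem le_expect_of_groups [NeZero n] (h : IsShape k m r c s B) (hk : 0 < k) (hn : n = k * nf)
    (hcross : NoCross P r c s B) (hM : m ≤ M) (val : (Fin M → Bool) → Fin n → ℕ)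
    (L : ∀ ρ, IsLayout P r c s B id (bit ρ) (val ρ)) {E : ℕ} (hE : ∀ x, G.degree x ≤ E + 1)
    (rank : Fin n ≃ Fin n) :
    (B : ℝ) * ((1 / 2) ^ k *
      (∏ t ∈ Finset.Icc 1 r, (1 : ℝ) / GroupSystem.harmBound k E t) ^ s) ≤
    𝔼 ρ, ∫ ω, (numOutOfBusiness G k rank (sortAssign k nf (val ρ)) ω : ℝ) ∂(activation n) := by
  classical
  set z := (∏ t ∈ Finset.Icc 1 r, (1 : ℝ) / GroupSystem.harmBound k E t) ^ s with hz
  have hz0 : 0 ≤ z := by positivity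
  have hlt : ∀ β < B, ∀ l < β * k + k, l / r * c + l % r < m := by
    intro β hβ l hl
    refine (h.lead_lt (hl.trans_le ?_)).trans_le h.le_m
    rw [← Nat.succ_mul]
    exact Nat.mul_le_mul_right k hβ
  have h1 : ∀ ρ : Fin M → Bool, (∑ β ∈ Finset.range B,
      (if Proper P k r c rank (bit ρ) β then (1 : ℝ) else 0)) * z ≤
      ∫ ω, (numOutOfBusiness G k rank (sortAssign k nf (val ρ)) ω : ℝ) ∂(activation n) := by
    intro ρ
    rw [Finset.sum_boole]
    refine le_integral_of_proper h hk hn hcross (L ρ) hE _ fun β hβ => ?_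
    rw [Finset.mem_filter, Finset.mem_range] at hβ
    exact hβ
  have h2 : ∀ β ∈ Finset.range B, (1 / 2 : ℝ) ^ k ≤
      𝔼 ρ : Fin M → Bool, (if Proper P k r c rank (bit ρ) β then (1 : ℝ) else 0) := by
    intro β hβ
    rw [Finset.mem_range] at hβ
    set x : Fin M → Bool := fun i =>
      decide (rank (P.e i true) < rank (P.e i false)) with hx
    set J : Finset (Fin M) := (Finset.Ico (β * k) (β * k + k)).attach.image fun l : {l // l ∈ Finset.Ico (β * k) (β * k + k)} =>
      ⟨l.1 / r * c + l.1 % r, (hlt β hβ l (Finset.mem_Ico.mp l.2).2).trans_le hM⟩ with hJ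
    have hcard : J.card ≤ k := by
      refine Finset.card_image_le.trans ?_
      rw [Finset.card_attach, Nat.card_Ico]
      omega
    calc (1 / 2 : ℝ) ^ k ≤ (1 / 2) ^ J.card :=
          pow_le_pow_of_le_one (by norm_num) (by norm_num) hcard
      _ = 𝔼 ρ : Fin M → Bool, (if ∀ i ∈ J, ρ i = x i then (1 : ℝ) else 0) :=
          by rw [← expect_ite_eq x J]; congr!
      _ ≤ _ := by
          refine Finset.expect_le_expect fun ρ _ => ?_
          by_cases hρ : ∀ i ∈ J, ρ i = x i
          · rw [if_pos hρ, if_pos]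
            intro l hl1 hl2
            rw [lt_of_eq_bit rank (hlt β hβ l hl2)]
            have := hρ ⟨l / r * c + l % r, (hlt β hβ l hl2).trans_le hM⟩
              (Finset.mem_image.mpr ⟨⟨l, Finset.mem_Ico.mpr ⟨hl1, hl2⟩⟩,
                Finset.mem_attach _ _, rfl⟩)
            rw [bit, dif_pos ((hlt β hβ l hl2).trans_le hM), this]
          · rw [if_neg hρ]
            split_ifs <;> norm_num
  calc (B : ℝ) * ((1 / 2) ^ k * z) = (∑ _β ∈ Finset.range B, (1 / 2 : ℝ) ^ k) * z := by
        rw [Finset.sum_const, Finset.card_range, nsmul_eq_mul]; ring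
    _ ≤ (∑ β ∈ Finset.range B, 𝔼 ρ : Fin M → Bool,
          (if Proper P k r c rank (bit ρ) β then (1 : ℝ) else 0)) * z :=
        mul_le_mul_of_nonneg_right (Finset.sum_le_sum h2) hz0
    _ = 𝔼 ρ : Fin M → Bool, (∑ β ∈ Finset.range B,
          (if Proper P k r c rank (bit ρ) β then (1 : ℝ) else 0)) * z := by
        rw [← Finset.expect_sum_comm, Finset.expect_mul]
    _ ≤ _ := Finset.expect_le_expect fun ρ _ => h1 ρ

end Bits

/-! ### Random keys and the blocks they form. -/

section Keys

variable {N k : ℕ}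

/-- The indices whose key has its rank in the block `f` of length `k`. -/
def block (k : ℕ) (a : Fin N → ℕ) (f : ℕ) : Finset (Fin N) :=
  Finset.univ.filter fun l => (Finset.univ.filter fun l' => a l' < a l).card / k = f

theorem block_comp (a : Fin N → ℕ) (f : ℕ) (π : Equiv.Perm (Fin N)) :
    (block k (a ∘ π) f).map π.toEmbedding = block k a f := by
  ext l
  simp only [Finset.mem_map_equiv, block, Finset.mem_filter, Finset.mem_univ, true_and,
    Function.comp, Equiv.apply_symm_apply]
  have : (Finset.univ.filter fun l' => a (π l') < a l).card =
      (Finset.univ.filter fun l' => a l' < a l).card := by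
    refine Finset.card_equiv π fun i => ?_
    simp
  rw [this]

theorem rank_injective {a : Fin N → ℕ} (ha : Function.Injective a) :
    Function.Injective fun l => (Finset.univ.filter fun l' => a l' < a l).card := by
  have key : ∀ l₁ l₂, a l₁ < a l₂ → (Finset.univ.filter fun l' => a l' < a l₁).card <
      (Finset.univ.filter fun l' => a l' < a l₂).card := by
    intro l₁ l₂ h
    refine Finset.card_lt_card ?_
    rw [Finset.ssubset_iff_of_subset]
    · exact ⟨l₁, by simpa using h, by simp⟩
    · intro x hx
      simp only [Finset.mem_filter, Finset.mem_univ, true_and] at *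
      exact hx.trans h
  intro l₁ l₂ h
  rcases lt_trichotomy (a l₁) (a l₂) with h' | h' | h'
  · exact absurd h (key _ _ h').ne
  · exact ha h'
  · exact absurd h.symm (key _ _ h').ne

theorem card_block (hk : 0 < k) {F : ℕ} (hN : N = k * F) {a : Fin N → ℕ}
    (ha : Function.Injective a) {f : ℕ} (hf : f < F) : (block k a f).card = k := by
  set R : Fin N → ℕ := fun l => (Finset.univ.filter fun l' => a l' < a l).card with hR
  have hinj : Function.Injective R := rank_injective ha
  have hlt : ∀ l, R l < N := by
    intro l
    have : (Finset.univ.filter fun l' => a l' < a l) ⊂ Finset.univ := by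
      rw [Finset.ssubset_univ_iff]
      intro h
      have := h ▸ Finset.mem_univ l
      simp at this
    have := Finset.card_lt_card this
    rwa [Finset.card_univ, Fintype.card_fin] at this
  have himg : Finset.univ.image R = Finset.range N := by
    refine Finset.eq_of_subset_of_card_le ?_ ?_
    · intro y hy
      obtain ⟨l, -, rfl⟩ := Finset.mem_image.mp hy
      exact Finset.mem_range.mpr (hlt l)
    · rw [Finset.card_image_of_injective _ hinj]
      simp
  have hb : (block k a f).image R = Finset.Ico (f * k) (f * k + k) := by
    ext y
    simp only [Finset.mem_image, block, Finset.mem_filter, Finset.mem_univ, true_and,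
      Finset.mem_Ico]
    constructor
    · rintro ⟨l, hl, rfl⟩
      change R l / k = f at hl
      have h1 := Nat.div_add_mod' (R l) k
      have h2 := Nat.mod_lt (R l) hk
      rw [hl] at h1
      omega
    · rintro ⟨h1, h2⟩
      have hy : y ∈ Finset.univ.image R := by
        rw [himg, Finset.mem_range, hN]
        calc y < (f + 1) * k := by rw [Nat.succ_mul]; exact h2
          _ ≤ k * F := by rw [mul_comm k]; exact Nat.mul_le_mul_right k hf
      obtain ⟨l, -, rfl⟩ := Finset.mem_image.mp hy
      exact ⟨l, Nat.div_eq_of_lt_le h1 (by rw [Nat.succ_mul]; exact h2), rfl⟩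
  have := congrArg Finset.card hb
  rw [Finset.card_image_of_injective _ hinj, Nat.card_Ico] at this
  omega

/-- Some permutation maps a set onto another one of the same size. -/
theorem exists_perm_map_eq {α : Type*} [Fintype α] [DecidableEq α] {A A' : Finset α}
    (h : A.card = A'.card) : ∃ π : Equiv.Perm α, A.map π.toEmbedding = A' := by
  let e : {x // x ∈ A} ≃ {x // x ∈ A'} := Fintype.equivOfCardEq (by simpa using h)
  refine ⟨e.extendSubtype, Finset.eq_of_subset_of_card_le ?_ (by simp [h])⟩
  intro x hx
  obtain ⟨y, hy, rfl⟩ := Finset.mem_map.mp hx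
  exact e.extendSubtype_mem y hy

variable {K : Type*} [Fintype K] [DecidableEq K] {g : K → ℕ}

/-- Permuting the indices shows that the number of injective key assignments with a given block
depends only on the size of that block. So, for distinct keys, the block is a uniformly distributed
`k`-subset. -/
theorem card_block_subset (hg : Function.Injective g) (hk : 0 < k) {F : ℕ} (hN : N = k * F) {f : ℕ}
    (hf : f < F) (S : Finset (Fin N)) :
    (Finset.univ.filter fun κ : Fin N → K =>
      Function.Injective κ ∧ block k (g ∘ κ) f ⊆ S).card * N.choose k =
    S.card.choose k * (Finset.univ.filter fun κ : Fin N → K => Function.Injective κ).card := by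
  classical
  set cnt : Finset (Fin N) → ℕ := fun A =>
    (Finset.univ.filter fun κ : Fin N → K => Function.Injective κ ∧ block k (g ∘ κ) f = A).card
    with hcnt
  have hcnt_eq : ∀ A A' : Finset (Fin N), A.card = A'.card → cnt A = cnt A' := by
    intro A A' h
    obtain ⟨π, rfl⟩ := exists_perm_map_eq h
    refine Finset.card_equiv (Equiv.arrowCongr π (Equiv.refl K)) fun κ => ?_
    simp only [Finset.mem_filter, Finset.mem_univ, true_and]
    have e : (Equiv.arrowCongr π (Equiv.refl K)) κ = κ ∘ π.symm := rfl
    rw [e]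
    refine and_congr ?_ ?_
    · exact (Equiv.injective_comp π.symm κ).symm
    · rw [← Function.comp_assoc]
      have := block_comp (k := k) ((g ∘ κ) ∘ π.symm) f π
      rw [← this]
      rw [show ((g ∘ κ) ∘ π.symm) ∘ π = g ∘ κ from by ext; simp]
      exact (Finset.map_inj).symm
  have hsum : ∀ T : Finset (Fin N), (Finset.univ.filter fun κ : Fin N → K =>
      Function.Injective κ ∧ block k (g ∘ κ) f ⊆ T).card = ∑ A ∈ T.powersetCard k, cnt A := by
    intro T
    rw [Finset.card_eq_sum_card_fiberwise (f := fun κ => block k (g ∘ κ) f)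
      (t := T.powersetCard k)]
    · refine Finset.sum_congr rfl fun A hA => ?_
      rw [hcnt, Finset.filter_filter]
      congr 1
      ext κ
      simp only [Finset.mem_filter, Finset.mem_univ, true_and]
      constructor
      · rintro ⟨⟨h1, -⟩, h2⟩
        exact ⟨h1, h2⟩
      · rintro ⟨h1, rfl⟩
        exact ⟨⟨h1, (Finset.mem_powersetCard.mp hA).1⟩, rfl⟩
    · intro κ hκ
      simp only [Finset.coe_filter, Finset.mem_univ, true_and, Set.mem_ofPred_eq] at hκ
      rw [Finset.mem_coe, Finset.mem_powersetCard]
      exact ⟨hκ.2, card_block hk hN (hg.comp hκ.1) hf⟩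
  have huniv := hsum Finset.univ
  simp only [Finset.subset_univ, and_true] at huniv
  have hkN : k ≤ N := by
    rw [hN]
    exact Nat.le_mul_of_pos_right k (by omega)
  obtain ⟨A₀, hA₀⟩ : ∃ A₀ : Finset (Fin N), A₀.card = k := by
    obtain ⟨A₀, -, h⟩ := Finset.exists_subset_card_eq (s := (Finset.univ : Finset (Fin N)))
      (n := k) (by simpa using hkN)
    exact ⟨A₀, h⟩
  have hconst : ∀ T : Finset (Fin N), ∑ A ∈ T.powersetCard k, cnt A = T.card.choose k * cnt A₀ := by
    intro T
    rw [Finset.sum_congr rfl fun A hA => hcnt_eq A A₀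
      ((Finset.mem_powersetCard.mp hA).2.trans hA₀.symm), Finset.sum_const,
      Finset.card_powersetCard, smul_eq_mul]
  rw [hsum, huniv, hconst, hconst, Finset.card_univ, Fintype.card_fin]
  ring

/-- The birthday bound: the descending factorial is at least `(q + 1 - N) ^ N`, and Bernoulli's
inequality applies to `(1 - N / q) ^ N`. -/
theorem card_injective_ge [Nonempty K] (hN : 0 < N) :
    (1 - (N : ℝ) ^ 2 / Fintype.card K) * (Fintype.card K : ℝ) ^ N ≤
      (Finset.univ.filter fun κ : Fin N → K => Function.Injective κ).card := by
  have e : (Finset.univ.filter fun κ : Fin N → K => Function.Injective κ).card =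
      (Fintype.card K).descFactorial N := by
    rw [← Fintype.card_subtype, ← Fintype.card_congr (Equiv.subtypeInjectiveEquivEmbedding _ _).symm,
      Fintype.card_embedding_eq, Fintype.card_fin]
  rw [e]
  set q := Fintype.card K with hq
  have hq0 : (0 : ℝ) < q := by exact_mod_cast Fintype.card_pos
  by_cases hqN : q < N
  · refine le_trans ?_ (Nat.cast_nonneg _)
    refine mul_nonpos_of_nonpos_of_nonneg ?_ (by positivity)
    rw [sub_nonpos, le_div_iff₀ hq0]
    have : (q : ℝ) ≤ N := by exact_mod_cast hqN.le
    have : (1 : ℝ) ≤ N := by exact_mod_cast hN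
    nlinarith
  push Not at hqN
  have h1 : ((q + 1 - N : ℕ) : ℝ) ^ N ≤ q.descFactorial N := by
    exact_mod_cast Nat.pow_sub_le_descFactorial q N
  refine le_trans ?_ h1
  have hNq : (N : ℝ) ≤ q := by exact_mod_cast hqN
  have h2 : (1 - (N : ℝ) / q) * q ≤ ((q + 1 - N : ℕ) : ℝ) := by
    rw [Nat.cast_sub (by omega), sub_mul, div_mul_cancel₀ _ hq0.ne']
    push_cast
    linarith
  have h3 : 1 + (N : ℝ) * (-(N / q)) ≤ (1 + -((N : ℝ) / q)) ^ N := by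
    refine one_add_mul_le_pow ?_ N
    have : (N : ℝ) / q ≤ 1 := (div_le_one hq0).mpr hNq
    linarith
  have h0 : (0 : ℝ) ≤ 1 - N / q := by
    have : (N : ℝ) / q ≤ 1 := (div_le_one hq0).mpr hNq
    linarith
  calc (1 - (N : ℝ) ^ 2 / q) * (q : ℝ) ^ N = (1 + (N : ℝ) * (-(N / q))) * (q : ℝ) ^ N := by ring
    _ ≤ (1 - (N : ℝ) / q) ^ N * (q : ℝ) ^ N := by
        refine mul_le_mul_of_nonneg_right ?_ (by positivity)
        rw [sub_eq_add_neg]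
        exact h3
    _ = ((1 - (N : ℝ) / q) * q) ^ N := (mul_pow _ _ _).symm
    _ ≤ _ := by gcongr

/-- Independent uniform keys put the indices of a set together. -/
theorem expect_block_ge [Nonempty K] (hg : Function.Injective g) (hk : 0 < k) {F : ℕ} (hF : 0 < F)
    (hN : N = k * F)
    (hK : 100 * (N : ℝ) ^ 2 ≤ Fintype.card K) (S : Finset (Fin N)) :
    99 / 100 * F * (S.card.choose k : ℝ) / N.choose k ≤
      𝔼 κ : Fin N → K, ∑ f ∈ Finset.range F,
        if Function.Injective κ ∧ block k (g ∘ κ) f ⊆ S then (1 : ℝ) else 0 := by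
  have hN0 : 0 < N := by rw [hN]; positivity
  have hkN : k ≤ N := by
    rw [hN]
    exact Nat.le_mul_of_pos_right k hF
  have hch : (0 : ℝ) < N.choose k := by exact_mod_cast Nat.choose_pos hkN
  have hq0 : (0 : ℝ) < Fintype.card K := by exact_mod_cast Fintype.card_pos
  have hinj : 99 / 100 * (Fintype.card K : ℝ) ^ N ≤
      (Finset.univ.filter fun κ : Fin N → K => Function.Injective κ).card := by
    refine le_trans ?_ (card_injective_ge (K := K) hN0)
    refine mul_le_mul_of_nonneg_right ?_ (by positivity)
    have : (N : ℝ) ^ 2 / Fintype.card K ≤ 1 / 100 := by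
      rw [div_le_div_iff₀ hq0 (by norm_num)]
      linarith
    linarith
  have hf : ∀ f ∈ Finset.range F, 99 / 100 * (S.card.choose k : ℝ) / N.choose k ≤
      𝔼 κ : Fin N → K, if Function.Injective κ ∧ block k (g ∘ κ) f ⊆ S then (1 : ℝ) else 0 := by
    intro f hf
    rw [Fintype.expect_eq_sum_div_card, Finset.sum_boole, div_le_div_iff₀ hch (by positivity)]
    have h := card_block_subset hg hk hN (Finset.mem_range.mp hf) S
    have h' : ((Finset.univ.filter fun κ : Fin N → K =>
      Function.Injective κ ∧ block k (g ∘ κ) f ⊆ S).card : ℝ) * N.choose k =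
        S.card.choose k * (Finset.univ.filter fun κ : Fin N → K => Function.Injective κ).card := by
      exact_mod_cast h
    rw [h', Fintype.card_fun, Fintype.card_fin]
    push_cast
    calc 99 / 100 * (S.card.choose k : ℝ) * (Fintype.card K : ℝ) ^ N
        = S.card.choose k * (99 / 100 * (Fintype.card K : ℝ) ^ N) := by ring
      _ ≤ _ := by gcongr
  rw [Finset.expect_sum_comm]
  calc 99 / 100 * F * (S.card.choose k : ℝ) / N.choose k
      = ∑ _f ∈ Finset.range F, 99 / 100 * (S.card.choose k : ℝ) / N.choose k := by
        rw [Finset.sum_const, Finset.card_range, nsmul_eq_mul]; ring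
    _ ≤ _ := Finset.sum_le_sum hf

end Keys

/-! ### Scattering the leaders over the worst firms. -/

section Scatter

theorem avg_expect {n : ℕ} {Ω : Type*} [Fintype Ω] (T : ℕ) (F : Ω → List (Fin n) → ℝ) :
    avg T (fun l => 𝔼 x, F x l) = 𝔼 x, avg T (F x) := by
  simp only [Fintype.expect_eq_sum_div_card, div_eq_inv_mul]
  rw [avg_mul_left, avg_sum]

/-- The number of fair bits that agree with a fixed pattern is binomial, since `o` corresponds to
the set where it agrees with `x`. -/
theorem expect_card_agree {N : ℕ} (x : Fin N → Bool) (f : ℕ → ℝ) :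
    𝔼 o : Fin N → Bool, f (Finset.univ.filter fun e => o e = x e).card =
      (∑ j ∈ Finset.range (N + 1), (N.choose j : ℝ) * f j) / 2 ^ N := by
  rw [Fintype.expect_eq_sum_div_card]
  congr 1
  · have h := Finset.sum_powerset_apply_card f (x := (Finset.univ : Finset (Fin N)))
    simp only [Finset.card_univ, Fintype.card_fin, nsmul_eq_mul] at h
    rw [← h]
    refine Finset.sum_nbij' (fun o => Finset.univ.filter fun e => o e = x e)
      (fun A e => if e ∈ A then x e else !x e) ?_ ?_ ?_ ?_ ?_
    · simp
    · simp
    · intro o _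
      funext e
      by_cases h : o e = x e
      · simp [h]
      · simp only [Finset.mem_filter, Finset.mem_univ, true_and, h, if_false]
        exact (bool_eq_not_of_ne h).symm
    · intro A _
      ext e
      by_cases h : e ∈ A <;> simp [h]
    · simp
  · simp

variable {n m k F nf M : ℕ} {G : SimpleGraph (Fin n)} {P : Pairs G m}

theorem isShape_scatter (hk : 0 < k) (hm : F * k ≤ m) : IsShape k m k k 1 F where
  pos := hk
  le := le_rfl
  mul := one_mul k
  add := by ring
  le_m := by rwa [mul_one]

theorem lead_self (o : ℕ → Bool) (l : ℕ) : lead P k k o l = P.e l (o l) := by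
  rw [lead, Nat.div_add_mod']

/-- Every edge of a chunk is leading here, so the best `F` firms employ exactly the ends not chosen
by the orientation. The keys have no influence on them, and the successes are therefore independent
of the keys. -/
theorem trunc_eq_of_agree (hk : 0 < k) (hn : n = k * nf) (hm : F * k ≤ m)
    {key key' : ℕ → ℕ} {o o' : ℕ → Bool} {val val' : Fin n → ℕ}
    (L : IsLayout P k k 1 F key o val) (L' : IsLayout P k k 1 F key' o' val')
    (ho : ∀ i < F * k, o i = o' i) :
    trunc F (sortAssign k nf val) = trunc F (sortAssign k nf val') := by
  have h := isShape_scatter hk hm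
  have hval : ∀ w, ∀ j < F, val w = j ↔ val' w = j := by
    intro w j hj
    have h1 := L.val_eq_iff h (κ := F - 1 - j) (by omega) w
    have h2 := L'.val_eq_iff h (κ := F - 1 - j) (by omega) w
    rw [mul_one, show F - 1 - (F - 1 - j) = j by omega] at h1 h2
    rw [h1, h2]
    simp only [Finset.Ico_self, Finset.image_empty, Finset.union_empty, Finset.mem_image,
      Finset.mem_Ico]
    refine exists_congr fun i => and_congr_right fun hi => ?_
    rw [ho i]
    calc i < (F - 1 - j + 1) * k := by rw [add_mul]; omega
      _ ≤ F * k := Nat.mul_le_mul_right k (by omega)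
  funext w
  ext g
  rw [trunc_eq_some, trunc_eq_some]
  refine and_congr_left fun hg => ?_
  have hg' : g.val < F * 1 := by omega
  rw [sortAssign_eq_some hn, sortAssign_eq_some hn, sortPos_div_eq hk (L.card_val_eq h) hg',
    sortPos_div_eq hk (L'.card_val_eq h) hg', hval w _ hg]

theorem leadPos_eq_card {N r c : ℕ} {o : ℕ → Bool} {key : ℕ → ℕ} {a : Fin N → ℕ}
    (ha : Function.Injective a) (hkey : ∀ l : Fin N, key l = a l) (l : Fin N) :
    leadPos P r c N o key l = (Finset.univ.filter fun l' => a l' < a l).card := by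
  rw [leadPos, ← Finset.card_map Fin.valEmbedding]
  congr 1
  ext x
  simp only [Finset.mem_filter, Finset.mem_range, Finset.mem_map, Finset.mem_univ, true_and,
    Fin.valEmbedding_apply]
  constructor
  · rintro ⟨hx, h⟩
    refine ⟨⟨x, hx⟩, ?_, rfl⟩
    have h1 := hkey ⟨x, hx⟩
    simp only at h1
    rw [h1, hkey l] at h
    rcases h with h | ⟨h, h'⟩
    · exact h
    · have := congrArg Fin.val (ha h)
      simp only at this
      rw [this] at h'
      exact absurd h' (lt_irrefl _)
  · rintro ⟨x, hx, rfl⟩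
    exact ⟨x.isLt, Or.inl (by rw [hkey, hkey]; exact hx)⟩

/-- The ends of the edges that may go to the worst firms. -/
def uEnd (P : Pairs G m) {N : ℕ} (o : Fin N → Bool) (e : Fin N) : Fin n := P.e e (o e)

/-- The other ends. -/
def vEnd (P : Pairs G m) {N : ℕ} (o : Fin N → Bool) (e : Fin N) : Fin n := P.e e (!o e)

theorem uEnd_injective {N : ℕ} (hN : N ≤ m) (o : Fin N → Bool) :
    Function.Injective (uEnd P o) := fun e e' h =>
  Fin.ext (P.inj _ (e.isLt.trans_le hN) _ (e'.isLt.trans_le hN) _ _ h).1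

theorem vEnd_injective {N : ℕ} (hN : N ≤ m) (o : Fin N → Bool) :
    Function.Injective (vEnd P o) := fun e e' h =>
  Fin.ext (P.inj _ (e.isLt.trans_le hN) _ (e'.isLt.trans_le hN) _ _ h).1

variable [DecidableRel G.Adj]

theorem numEmpty_ge_of_layout (hk : 0 < k) (hn : n = k * nf) (hm : F * k ≤ m) (hF : 0 < F)
    {key : ℕ → ℕ} {o : ℕ → Bool} {val : Fin n → ℕ} (L : IsLayout P k k 1 F key o val) {a : Fin (F * k) → ℕ}
    (hkey : ∀ l : Fin (F * k), key l = a l) (rank : Fin n ≃ Fin n) (l : List (Fin n)) :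
    (∑ β ∈ Finset.range F, if Function.Injective a ∧ block k a β ⊆
      succs G k rank (uEnd P fun e : Fin (F * k) => o e) (vEnd P fun e : Fin (F * k) => o e)
        (trunc F (sortAssign k nf val), ∅) l then (1 : ℝ) else 0) ≤
      numEmpty (run G k rank (sortAssign k nf val) l) := by
  have h := isShape_scatter hk hm
  have hfirm := h.firms P hk hn
  rw [Finset.sum_boole]
  norm_cast
  refine Finset.card_le_card_of_injOn
    (fun β => if hβ : β < F then (⟨nf - F + β, by omega⟩ : Fin nf) else ⟨nf - 1, by omega⟩) ?_ ?_
  · intro β hβ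
    simp only [Finset.coe_filter, Finset.mem_range, Set.mem_ofPred_eq] at hβ
    obtain ⟨hβF, ha, hsub⟩ := hβ
    simp only [Finset.coe_filter, Finset.mem_univ, true_and, Set.mem_ofPred_eq, dif_pos hβF]
    refine employees_run_eq_empty G k rank (fun e => P.adj_not (e.isLt.trans_le hm) _) (F := F)
      (by simp only; omega) (fun x hx => ?_) hsub
    rw [sortAssign_eq_some hn] at hx
    simp only at hx
    rw [L.sortPos_div_iff h hk hn (by omega)] at hx
    obtain ⟨i, hi, rfl, hβ⟩ := hx
    refine ⟨⟨i, hi⟩, ?_, (lead_self _ _).symm⟩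
    rw [block, Finset.mem_filter]
    exact ⟨Finset.mem_univ _, by rw [← hβ, ← leadPos_eq_card (P := P) ha hkey ⟨i, hi⟩]⟩
  · intro β hβ β' hβ' he
    simp only [Finset.coe_filter, Finset.mem_range, Set.mem_ofPred_eq] at hβ hβ'
    simp only [dif_pos hβ.1, dif_pos hβ'.1, Fin.mk.injEq] at he
    omega

theorem wbound_le_of_layout [NeZero n] (hk : 0 < k) (hn : n = k * nf) (hm : F * k ≤ m)
    {key : ℕ → ℕ} {o : ℕ → Bool} {val : Fin n → ℕ} (L : IsLayout P k k 1 F key o val)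
    (rank : Fin n ≃ Fin n) {D : ℕ} (hD0 : 0 < D) (hD : ∀ x, G.degree x ≤ D) (j : ℕ) :
    ∃ p ≥ wbound D (k * F) j (Finset.univ.filter fun e : Fin (F * k) =>
        o e = decide (rank (P.e e true) < rank (P.e e false))).card,
      Tendsto (fun T => avg T fun l => ((succs G k rank (uEnd P fun e : Fin (F * k) => o e)
        (vEnd P fun e : Fin (F * k) => o e) (trunc F (sortAssign k nf val), ∅) l).card.choose j : ℝ))
        atTop (nhds p) := by
  have h := isShape_scatter hk hm
  have hfirm := h.firms P hk hn
  obtain ⟨p, hp, hp0, hpos, harm⟩ := exists_moments G k rank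
    (v := vEnd P fun e : Fin (F * k) => o e) (nf := nf)
    (uEnd_injective (P := P) hm fun e : Fin (F * k) => o e)
  refine ⟨_, ?_, hp j _⟩
  refine wbound_le_moments G k rank hk (fun e => P.adj_not (e.isLt.trans_le hm) _)
    (uEnd_injective (P := P) hm _) (vEnd_injective (P := P) hm _) hD0 hD hp0 hpos harm j _ _ _
    ?_ ?_ ?_
  · intro f
    refine le_trans (Finset.card_le_card fun x hx => ?_) (isMatching_sortAssign hk hn val f)
    rw [mem_employees] at *
    exact (trunc_eq_some.mp hx).1
  · intro w g hg
    exact (trunc_eq_some.mp hg).2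
  · intro e he
    rw [Finset.mem_filter] at he
    have hem : (e : ℕ) < m := e.isLt.trans_le hm
    have heF : (e : ℕ) / k < F * 1 := by
      rw [mul_one]; exact (Nat.div_lt_iff_lt_mul hk).mpr e.isLt
    have hmod := Nat.mod_lt (e : ℕ) hk
    have hF1 : 0 < F * 1 := (Nat.zero_le _).trans_lt heF
    rw [alive, Finset.mem_filter]
    refine ⟨Finset.mem_univ _, Finset.notMem_empty _, ?_, ?_, ?_⟩
    · exact (lt_of_eq_bit rank hem _).mpr he.2
    · have h1 := L.worse h heF hmod
      rw [Nat.div_add_mod'] at h1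
      have h2 : trunc F (sortAssign k nf val) (vEnd P (fun e : Fin (F * k) => o e) e) =
          some ⟨F * 1 - 1 - e / k, (Nat.sub_le _ _).trans_lt (by omega)⟩ := by
        rw [trunc_eq_some, sortAssign_eq_some hn]
        refine ⟨?_, (Nat.sub_le _ _).trans_lt (by omega)⟩
        rw [sortPos_div_eq hk (L.card_val_eq h) ((Nat.sub_le _ _).trans_lt (by omega))]
        exact h1
      intro h0
      exact absurd (h2.symm.trans h0) (by simp)
    · have h1 := L.leader h heF hmod
      rw [Nat.div_add_mod'] at h1
      rcases hx : sortAssign k nf val (uEnd P (fun e : Fin (F * k) => o e) e) with _ | g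
      · exact trunc_of_none hx
      · refine trunc_eq_none hx ?_
        rw [sortAssign_eq_some hn] at hx
        rw [← hx]
        have h2 := le_sortPos_div hk (L.card_val_eq h) (w := P.e e (o e)) (by
          rw [h1]
          have := h.bs_le P
          omega)
        rwa [mul_one] at h2

/-- Scattering the leaders at random over the worst firms. -/
theorem le_expect_of_scatter [NeZero n] (hk : 0 < k) (hn : n = k * nf) (hm : F * k ≤ m) (hF : 0 < F)
    (hM : n + n * n ≤ M) (hsize : 6 ≤ F * k) {g : (Fin n → Bool) → ℕ} (hg : Function.Injective g)
    (key : (Fin M → Bool) → ℕ → ℕ)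
    (hkey : ∀ ρ, ∀ l < F * k, key ρ l = g fun i => bit ρ (n + l * n + i))
    (val : (Fin M → Bool) → Fin n → ℕ)
    (L : ∀ ρ, IsLayout P k k 1 F (key ρ) (bit ρ) (val ρ)) (rank : Fin n ≃ Fin n)
    {D : ℕ} (hD0 : 0 < D) (hD : ∀ x, G.degree x ≤ D) :
    99 / 100 * F * ((∑ x ∈ Finset.range (k * F + 1), ((k * F).choose x : ℝ) *
        wbound D (k * F) k x) / 2 ^ (k * F)) / (k * F).choose k ≤
    𝔼 ρ, ∫ ω, (numOutOfBusiness G k rank (sortAssign k nf (val ρ)) ω : ℝ) ∂(activation n) := by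
  classical
  have hmn := P.two_mul_le
  set N := F * k with hN
  have hkF : k * F = N := mul_comm k F
  rw [hkF]
  have hNM : ∀ e : Fin N, (e : ℕ) < M := fun e => by have := e.isLt; omega
  have hkeyM : ∀ x : Fin N × Fin n, n + x.1 * n + x.2 < M := fun x => by
    have h1 : (x.1 : ℕ) * n + n ≤ n * n := by
      rw [← Nat.succ_mul]
      exact Nat.mul_le_mul_right n (by have := x.1.isLt; omega)
    have := x.2.isLt
    omega
  -- The positions of the bits in use: `N ≤ n` orientations at the beginning, and from position `n`
  -- on `n` bits for each key. They are distinct, so these bits are independent and fair.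
  set φ : Fin N ⊕ Fin N × Fin n → Fin M :=
    Sum.elim (fun e => ⟨e, hNM e⟩) (fun x => ⟨n + x.1 * n + x.2, hkeyM x⟩) with hφ
  have hφi : Function.Injective φ := by
    have hlt : ∀ e : Fin N, (e : ℕ) < n := fun e => by have := e.isLt; omega
    rintro (e | ⟨a, b⟩) (e' | ⟨a', b'⟩) he <;>
      simp only [hφ, Sum.elim_inl, Sum.elim_inr, Fin.mk.injEq] at he
    · rw [Fin.ext he]
    · have := hlt e; omega
    · have := hlt e'; omega
    · obtain ⟨h1, h2⟩ := add_inj_of_lt (c := n) b.isLt b'.isLt (by omega : (a : ℕ) * n + b = a' * n + b')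
      rw [Fin.ext h1, Fin.ext h2]
  -- The bits beyond the orientations are set to `false`; by `trunc_eq_of_agree` any other choice
  -- gives the same successes.
  set ex : (Fin N → Bool) → Fin M → Bool := fun o i => if h : (i : ℕ) < N then o ⟨i, h⟩ else false
    with hex
  have hexb : ∀ (o : Fin N → Bool) (e : Fin N), bit (ex o) e = o e := by
    intro o e
    rw [bit, dif_pos (hNM e)]
    simp [hex]
  set S : (Fin N → Bool) → List (Fin n) → Finset (Fin N) := fun o l =>
    succs G k rank (uEnd P o) (vEnd P o) (trunc F (sortAssign k nf (val (ex o))), ∅) l with hS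
  set Φ : (Fin N ⊕ Fin N × Fin n → Bool) → List (Fin n) → ℝ := fun a l =>
    ∑ β ∈ Finset.range F, if Function.Injective (fun (e : Fin N) i => a (Sum.inr (e, i))) ∧
      block k (g ∘ fun e i => a (Sum.inr (e, i))) β ⊆ S (fun e => a (Sum.inl e)) l
        then (1 : ℝ) else 0 with hΦ
  have hbit1 : ∀ (ρ : Fin M → Bool) (e : Fin N), (ρ ∘ φ) (Sum.inl e) = bit ρ e := by
    intro ρ e
    rw [bit, dif_pos (hNM e)]
    rfl
  have hbit2 : ∀ (ρ : Fin M → Bool) (e : Fin N) (i : Fin n),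
      (ρ ∘ φ) (Sum.inr (e, i)) = bit ρ (n + e * n + i) := by
    intro ρ e i
    rw [bit, dif_pos (hkeyM (e, i))]
    rfl
  have h1 : ∀ (ρ : Fin M → Bool) (T : ℕ), avg T (Φ (ρ ∘ φ)) ≤
      ∫ ω, (numOutOfBusiness G k rank (sortAssign k nf (val ρ)) ω : ℝ) ∂(activation n) := by
    intro ρ T
    refine le_trans (avg_mono T fun l => ?_) (avg_numEmpty_le G k rank _ T)
    refine le_trans (le_of_eq ?_) (numEmpty_ge_of_layout hk hn hm hF (L ρ)
      (a := g ∘ fun (e : Fin N) i => (ρ ∘ φ) (Sum.inr (e, i))) ?_ rank l)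
    · rw [hΦ]
      have e1 : S (fun e => (ρ ∘ φ) (Sum.inl e)) l =
          succs G k rank (uEnd P fun e : Fin N => bit ρ e) (vEnd P fun e : Fin N => bit ρ e)
            (trunc F (sortAssign k nf (val ρ)), ∅) l := by
        rw [hS]
        simp only [hbit1]
        rw [trunc_eq_of_agree hk hn hm (L _) (L ρ)]
        intro i hi
        exact hexb (fun e : Fin N => bit ρ e) ⟨i, hi⟩
      simp only [e1, hg.of_comp_iff]
      congr!
    · intro l
      rw [hkey ρ l l.isLt]
      simp only [hbit2]
      rfl
  -- Since `10 * N ≤ 2 ^ N` from `N = 6` on and `2 * N ≤ n`, keys of `n` bits are distinct with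
  -- probability at least 0.99.
  have hcard : 100 * (N : ℝ) ^ 2 ≤ Fintype.card (Fin n → Bool) := by
    have h3 : ∀ j, 6 ≤ j → 10 * j ≤ 2 ^ j := by
      intro j hj
      induction j, hj using Nat.le_induction with
      | base => norm_num
      | succ j hj ih => rw [pow_succ]; omega
    have h4 : (10 * N) ^ 2 ≤ 2 ^ n := by
      calc (10 * N) ^ 2 ≤ (2 ^ N) ^ 2 := Nat.pow_le_pow_left (h3 N hsize) 2
        _ = 2 ^ (N * 2) := (pow_mul _ _ _).symm
        _ ≤ 2 ^ n := Nat.pow_le_pow_right (by norm_num) (by omega)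
    have h5 : ((10 * N : ℕ) : ℝ) ^ 2 ≤ 2 ^ n := by exact_mod_cast h4
    simp only [Fintype.card_fun, Fintype.card_bool, Fintype.card_fin]
    push_cast at h5 ⊢
    nlinarith
  set c : ℝ := 99 / 100 * F / N.choose k with hc
  have hc0 : 0 ≤ c := by positivity
  -- For a fixed orientation and word the set of successes is fixed, while the keys are still
  -- uniform.
  have h2 : ∀ l, 𝔼 o : Fin N → Bool, c * ((S o l).card.choose k : ℝ) ≤
      𝔼 ρ : Fin M → Bool, Φ (ρ ∘ φ) l := by
    intro l
    rw [expect_comp_injective hφi fun a => Φ a l]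
    let e : (Fin N ⊕ Fin N × Fin n → Bool) ≃ (Fin N → Bool) × (Fin N → Fin n → Bool) :=
      (Equiv.sumArrowEquivProdArrow _ _ _).trans
        (Equiv.prodCongr (Equiv.refl _) (Equiv.curry _ _ _))
    have e2 : 𝔼 a, Φ a l = 𝔼 o : Fin N → Bool, 𝔼 κ : Fin N → Fin n → Bool,
        ∑ β ∈ Finset.range F, if Function.Injective κ ∧ block k (g ∘ κ) β ⊆ S o l
          then (1 : ℝ) else 0 := by
      refine (Fintype.expect_equiv e (fun a => Φ a l) (fun x : (Fin N → Bool) ×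
        (Fin N → Fin n → Bool) => ∑ β ∈ Finset.range F, if Function.Injective x.2 ∧
          block k (g ∘ x.2) β ⊆ S x.1 l then (1 : ℝ) else 0) (fun a => rfl)).trans ?_
      rw [← Finset.univ_product_univ, Finset.expect_product]
    rw [e2]
    refine Finset.expect_le_expect fun o _ => ?_
    refine le_trans (le_of_eq ?_) (expect_block_ge (N := N) hg hk hF hkF.symm hcard (S o l))
    rw [hc]
    ring
  have hlim : ∀ o : Fin N → Bool, ∃ p ≥ wbound D N k (Finset.univ.filter fun e : Fin N =>
      o e = decide (rank (P.e e true) < rank (P.e e false))).card,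
      Tendsto (fun T => avg T fun l => ((S o l).card.choose k : ℝ)) atTop (nhds p) := by
    intro o
    have := wbound_le_of_layout hk hn hm (L (ex o)) rank hD0 hD k
    simp only [hexb, hkF] at this
    exact this
  choose p hp1 hp2 using hlim
  have h3 : Tendsto (fun T => avg T fun l => 𝔼 o : Fin N → Bool, c * ((S o l).card.choose k : ℝ))
      atTop (nhds (𝔼 o : Fin N → Bool, c * p o)) := by
    simp only [avg_expect, avg_mul_left]
    simp only [Fintype.expect_eq_sum_div_card]
    exact (tendsto_finsetSum _ fun o _ => (hp2 o).const_mul c).div_const _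
  have h4 : 𝔼 o : Fin N → Bool, c * p o ≤
      𝔼 ρ, ∫ ω, (numOutOfBusiness G k rank (sortAssign k nf (val ρ)) ω : ℝ) ∂(activation n) := by
    refine le_of_tendsto' h3 fun T => ?_
    calc _ ≤ avg T (fun l => 𝔼 ρ : Fin M → Bool, Φ (ρ ∘ φ) l) := avg_mono T h2
      _ = 𝔼 ρ : Fin M → Bool, avg T (Φ (ρ ∘ φ)) := avg_expect T _
      _ ≤ _ := Finset.expect_le_expect fun ρ _ => h1 ρ T
  refine le_trans ?_ h4
  calc _ = c * 𝔼 o : Fin N → Bool, wbound D N k (Finset.univ.filter fun e : Fin N =>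
        o e = decide (rank (P.e e true) < rank (P.e e false))).card := by
        rw [expect_card_agree (fun e : Fin N => decide (rank (P.e e true) < rank (P.e e false)))
          (wbound D N k), hc]
        ring
    _ ≤ c * 𝔼 o : Fin N → Bool, p o := by
        refine mul_le_mul_of_nonneg_left (Finset.expect_le_expect fun o _ => hp1 o) hc0
    _ = _ := Finset.mul_expect _ _ _

end Scatter

/-! ### Almost maximum matchings by local search. -/

section LocalSearch

variable {n : ℕ}

/-- `f` exchanges the ends of the edges of a matching and fixes the other workers. -/
structure IsMate (G : SimpleGraph (Fin n)) (f : Fin n → Fin n) : Prop where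
  invol : ∀ x, f (f x) = x
  adj : ∀ x, f x ≠ x → G.Adj x (f x)

/-- The number of matched workers. -/
def matched (f : Fin n → Fin n) : ℕ := (Finset.univ.filter fun x => f x ≠ x).card

theorem matched_le (f : Fin n → Fin n) : matched f ≤ n := by
  have := Finset.card_le_univ (Finset.univ.filter fun x => f x ≠ x)
  rwa [Fintype.card_fin] at this

theorem IsMate.injective {G : SimpleGraph (Fin n)} {f : Fin n → Fin n} (hf : IsMate G f) :
    Function.Injective f := fun x y h => by rw [← hf.invol x, h, hf.invol]

/-- Add the edge `x y` and remove the edges that meet it. -/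
def insEdge (G : SimpleGraph (Fin n)) [DecidableRel G.Adj] (x y : Fin n) (f : Fin n → Fin n) :
    Fin n → Fin n := fun i =>
  if G.Adj x y then
    if i = x then y else if i = y then x else if f i = x ∨ f i = y then i else f i
  else f i

variable {G : SimpleGraph (Fin n)} [DecidableRel G.Adj]

theorem IsMate.insEdge {f : Fin n → Fin n} (hf : IsMate G f) (x y : Fin n) :
    IsMate G (insEdge G x y f) := by
  by_cases hxy : G.Adj x y
  · have hne := hxy.ne
    constructor
    · intro i
      have h1 := hf.invol i
      unfold JobMarket.insEdge
      grind
    · intro i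
      have h1 := hf.adj i
      have h2 := hxy.symm
      unfold JobMarket.insEdge
      grind
  · have : JobMarket.insEdge G x y f = f := by
      funext i; simp [JobMarket.insEdge, hxy]
    rwa [this]

/-- Add a list of edges. -/
def insEdges (G : SimpleGraph (Fin n)) [DecidableRel G.Adj] (T : List (Fin n × Fin n))
    (f : Fin n → Fin n) : Fin n → Fin n := T.foldl (fun f p => insEdge G p.1 p.2 f) f

theorem IsMate.insEdges {f : Fin n → Fin n} (hf : IsMate G f) (T : List (Fin n × Fin n)) :
    IsMate G (insEdges G T f) := by
  induction T generalizing f with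
  | nil => exact hf
  | cons p T ih => exact ih (hf.insEdge p.1 p.2)

variable {f g : Fin n → Fin n}

/-- An inserted edge of `g` never removes an edge of `g` inserted before. As `K` is closed under `f`
and `g`, the insertions inside `K` leave the matching outside unchanged. -/
theorem insEdges_spec (hg : IsMate G g) {K : Finset (Fin n)} (hfK : ∀ x ∈ K, f x ∈ K)
    (hgK : ∀ x ∈ K, g x ∈ K) (hf : IsMate G f) (D : Finset (Fin n)) (L : List (Fin n))
    (hL : ∀ x ∈ L, x ∈ K ∧ g x ≠ x) (f' : Fin n → Fin n) (hD : ∀ x ∈ D, f' x = g x)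
    (hout : ∀ x ∉ K, f' x = f x) :
    (∀ x, (x ∈ D ∨ x ∈ L) → insEdges G (L.map fun x => (x, g x)) f' x = g x) ∧
      ∀ x ∉ K, insEdges G (L.map fun x => (x, g x)) f' x = f x := by
  induction L generalizing D f' with
  | nil => exact ⟨fun x hx => hD x (by simpa using hx), hout⟩
  | cons y L ih =>
    obtain ⟨hyK, hy⟩ := hL y (by simp)
    have hadj := hg.adj y hy
    have hD' : ∀ x ∈ insert y D, insEdge G y (g y) f' x = g x := by
      intro x hx
      have e1 := hg.invol x
      have e2 := hg.invol y
      rcases Finset.mem_insert.mp hx with rfl | hx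
      · simp [insEdge, hadj]
      · have e3 := hD x hx
        simp only [insEdge, if_pos hadj]
        grind
    have hout' : ∀ x ∉ K, insEdge G y (g y) f' x = f x := by
      intro x hx
      have e1 := hout x hx
      have e2 := hgK y hyK
      have e3 : f x ∉ K := fun h => hx (hf.invol x ▸ hfK _ h)
      simp only [insEdge, if_pos hadj]
      grind
    obtain ⟨h1, h2⟩ := ih (insert y D) (fun x hx => hL x (by simp [hx])) (insEdge G y (g y) f')
      hD' hout'
    refine ⟨fun x hx => h1 x ?_, h2⟩
    rw [Finset.mem_insert]
    rw [List.mem_cons] at hx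
    tauto

theorem card_filter_split (K : Finset (Fin n)) (p : Fin n → Prop) [DecidablePred p] :
    (Finset.univ.filter p).card = (K.filter p).card + (Kᶜ.filter p).card := by
  rw [← Finset.card_union_of_disjoint]
  · congr 1
    ext x
    simp only [Finset.mem_filter, Finset.mem_univ, true_and, Finset.mem_union, Finset.mem_compl]
    tauto
  · rw [Finset.disjoint_left]
    intro x hx hx'
    simp only [Finset.mem_filter, Finset.mem_compl] at hx hx'
    exact hx'.1 hx.1

/-- No insertion of at most `c` edges enlarges the matching. -/
def LocallyOptimal (G : SimpleGraph (Fin n)) [DecidableRel G.Adj] (c : ℕ) (f : Fin n → Fin n) :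
    Prop := ∀ T : List (Fin n × Fin n), T.length ≤ c → matched (insEdges G T f) ≤ matched f

/-- If `g` matched at most `c` workers of `K`, inserting the edges of `g` at these workers would
replace `f` by `g` on `K` as far as they are concerned, and so enlarge the matching. Each edge is
inserted from both ends, which does no harm. -/
theorem LocallyOptimal.lt_card {c : ℕ} (ho : LocallyOptimal G c f) (hf : IsMate G f)
    (hg : IsMate G g) {K : Finset (Fin n)} (hfK : ∀ x ∈ K, f x ∈ K) (hgK : ∀ x ∈ K, g x ∈ K)
    (hlt : (K.filter fun x => f x ≠ x).card < (K.filter fun x => g x ≠ x).card) :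
    c < (K.filter fun x => g x ≠ x).card := by
  by_contra! hc
  set S := K.filter fun x => g x ≠ x with hS
  obtain ⟨h1, h2⟩ := insEdges_spec hg hfK hgK hf ∅ S.toList
    (fun x hx => by rw [Finset.mem_toList, hS, Finset.mem_filter] at hx; exact hx) f (by simp)
    (fun _ _ => rfl)
  have h3 := ho (S.toList.map fun x => (x, g x)) (by simpa using hc)
  set f' := insEdges G (S.toList.map fun x => (x, g x)) f with hf'
  rw [matched, matched, card_filter_split K, card_filter_split K (fun x => f x ≠ x)] at h3
  have h4 : S ⊆ K.filter fun x => f' x ≠ x := by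
    intro x hx
    have hx' := Finset.mem_filter.mp hx
    rw [Finset.mem_filter, h1 x (Or.inr (Finset.mem_toList.mpr hx))]
    exact hx'
  have h5 : (Kᶜ.filter fun x => f' x ≠ x) = Kᶜ.filter fun x => f x ≠ x := by
    refine Finset.filter_congr fun x hx => ?_
    rw [h2 x (Finset.mem_compl.mp hx)]
  have h6 := Finset.card_le_card h4
  rw [h5] at h3
  omega

/-- The edges of both matchings. -/
def unionGraph (f g : Fin n → Fin n) : SimpleGraph (Fin n) :=
  SimpleGraph.fromRel fun x y => f x = y ∨ g x = y

theorem unionGraph_adj {x y : Fin n} : (unionGraph f g).Adj x y ↔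
    x ≠ y ∧ ((f x = y ∨ g x = y) ∨ f y = x ∨ g y = x) := SimpleGraph.fromRel_adj _ _ _

omit [DecidableRel G.Adj] in
-- A connected graph on `K` has at least `|K| - 1` edges. Twice their number is at most the number
-- of workers of `K` matched by `f` plus the number matched by `g`, and the latter is at most `|K|`.
theorem card_component_le (hf : IsMate G f) (hg : IsMate G g)
    (C : (unionGraph f g).ConnectedComponent) {K : Finset (Fin n)} (hK : ∀ x, x ∈ K ↔ x ∈ C.supp) :
    (K.filter fun x => g x ≠ x).card ≤ (K.filter fun x => f x ≠ x).card + 2 := by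
  classical
  have hconn := C.connected_toSimpleGraph
  have h1 := hconn.card_vert_le_card_edgeSet_add_one
  have h2 := C.toSimpleGraph.sum_degrees_eq_twice_card_edges
  rw [Nat.card_eq_fintype_card, Nat.card_eq_fintype_card, ← SimpleGraph.edgeFinset_card] at h1
  have hKcard : Fintype.card C = K.card := by
    rw [← Fintype.card_coe]
    exact Fintype.card_congr (Equiv.subtypeEquivRight fun x => (hK x).symm)
  have hdeg : ∀ x : C, C.toSimpleGraph.degree x ≤
      (if f x.1 ≠ x.1 then 1 else 0) + (if g x.1 ≠ x.1 then 1 else 0) := by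
    intro x
    rw [← SimpleGraph.card_neighborFinset_eq_degree, ← Finset.card_map (Function.Embedding.subtype _)]
    calc _ ≤ ((if f x.1 ≠ x.1 then {f x.1} else ∅ : Finset (Fin n)) ∪
          (if g x.1 ≠ x.1 then {g x.1} else ∅)).card := by
          refine Finset.card_le_card fun y hy => ?_
          obtain ⟨z, hz, rfl⟩ := Finset.mem_map.mp hy
          rw [SimpleGraph.mem_neighborFinset] at hz
          have hz' : (unionGraph f g).Adj x.1 z.1 := hz
          rw [unionGraph_adj] at hz'
          have e1 := hf.invol z.1
          have e2 := hg.invol z.1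
          simp only [Function.Embedding.subtype_apply, Finset.mem_union]
          grind
      _ ≤ _ := by
          refine (Finset.card_union_le _ _).trans (Nat.add_le_add ?_ ?_) <;> split_ifs <;> simp
  have h3 : ∑ x : C, C.toSimpleGraph.degree x ≤
      (K.filter fun x => f x ≠ x).card + (K.filter fun x => g x ≠ x).card := by
    refine (Finset.sum_le_sum fun x _ => hdeg x).trans ?_
    rw [Finset.card_filter, Finset.card_filter, ← Finset.sum_add_distrib]
    refine le_of_eq ?_
    rw [← Finset.sum_coe_sort K]
    exact Fintype.sum_equiv (Equiv.subtypeEquivRight (p := (· ∈ C)) fun x => (hK x).symm) _ _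
      fun x => rfl
  have h4 : (K.filter fun x => g x ≠ x).card ≤ K.card := Finset.card_filter_le _ _
  omega

/-- A locally optimal matching is almost as large as any other. -/
theorem LocallyOptimal.matched_ge {c : ℕ} (hc : 0 < c) (ho : LocallyOptimal G c f)
    (hf : IsMate G f) (hg : IsMate G g) :
    (matched g ≤ matched f ∨ c - 1 ≤ matched f) ∧
      (c - 1) * matched g ≤ (c + 1) * matched f := by
  classical
  -- Both matchings respect the components of their union, so they are compared component by
  -- component.
  set comp := fun x => (unionGraph f g).connectedComponentMk x with hcomp
  set K : (unionGraph f g).ConnectedComponent → Finset (Fin n) :=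
    fun C => Finset.univ.filter fun x => comp x = C with hK
  have hKmem : ∀ C x, x ∈ K C ↔ x ∈ C.supp := by
    intro C x
    rw [hK, Finset.mem_filter, SimpleGraph.ConnectedComponent.mem_supp_iff]
    simp [hcomp]
  have hfK : ∀ C, ∀ x ∈ K C, f x ∈ K C := by
    intro C x hx
    by_cases h : f x = x
    · rwa [h]
    · rw [hK, Finset.mem_filter] at *
      refine ⟨Finset.mem_univ _, ?_⟩
      rw [← hx.2]
      refine SimpleGraph.ConnectedComponent.sound (SimpleGraph.Adj.reachable ?_)
      rw [unionGraph_adj]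
      exact ⟨h, Or.inl (Or.inl (hf.invol x))⟩
  have hgK : ∀ C, ∀ x ∈ K C, g x ∈ K C := by
    intro C x hx
    by_cases h : g x = x
    · rwa [h]
    · rw [hK, Finset.mem_filter] at *
      refine ⟨Finset.mem_univ _, ?_⟩
      rw [← hx.2]
      refine SimpleGraph.ConnectedComponent.sound (SimpleGraph.Adj.reachable ?_)
      rw [unionGraph_adj]
      exact ⟨h, Or.inl (Or.inr (hg.invol x))⟩
  have hsum : ∀ q : Fin n → Fin n, matched q =
      ∑ C ∈ Finset.univ.image comp, ((K C).filter fun x => q x ≠ x).card := by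
    intro q
    rw [matched, Finset.card_eq_sum_card_fiberwise (f := comp) (t := Finset.univ.image comp)]
    · refine Finset.sum_congr rfl fun C _ => ?_
      congr 1
      ext x
      simp only [hK, Finset.mem_filter, Finset.mem_univ, true_and]
      tauto
    · intro x _
      exact Finset.mem_coe.mpr (Finset.mem_image_of_mem _ (Finset.mem_univ x))
  have h2 : ∀ C, ((K C).filter fun x => g x ≠ x).card ≤
      ((K C).filter fun x => f x ≠ x).card + 2 := fun C => card_component_le hf hg C (hKmem C)
  have h3 : ∀ C, ((K C).filter fun x => f x ≠ x).card < ((K C).filter fun x => g x ≠ x).card →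
      c < ((K C).filter fun x => g x ≠ x).card := fun C => ho.lt_card hf hg (hfK C) (hgK C)
  constructor
  · by_cases h : ∀ C, ((K C).filter fun x => g x ≠ x).card ≤ ((K C).filter fun x => f x ≠ x).card
    · left
      rw [hsum, hsum]
      exact Finset.sum_le_sum fun C _ => h C
    · right
      push Not at h
      obtain ⟨C, hC⟩ := h
      have h4 := h3 C hC
      have h5 := h2 C
      have h6 : ((K C).filter fun x => f x ≠ x).card ≤ matched f :=
        Finset.card_le_card fun x hx => by
          simp only [Finset.mem_filter, Finset.mem_univ, true_and] at *
          exact hx.2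
      omega
  · rw [hsum, hsum, Finset.mul_sum, Finset.mul_sum]
    -- Where `g` wins, it matches more than `c` workers and at most 2 more than `f`, and `(c + 1) *
    -- (x - 2) ≥ (c - 1) * x` for `x ≥ c + 1`.
    refine Finset.sum_le_sum fun C _ => ?_
    have h4 := h2 C
    have h5 := h3 C
    obtain ⟨d, rfl⟩ : ∃ d, c = d + 1 := ⟨c - 1, by omega⟩
    by_cases h : ((K C).filter fun x => f x ≠ x).card < ((K C).filter fun x => g x ≠ x).card
    · have h6 := h5 h
      rw [Nat.add_sub_cancel]
      nlinarith
    · push Not at h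
      rw [Nat.add_sub_cancel]
      nlinarith

omit [DecidableRel G.Adj] in
theorem exists_mate_of_isMatching {M : G.Subgraph} (hM : M.IsMatching) :
    ∃ g : Fin n → Fin n, IsMate G g ∧ 2 * M.edgeSet.ncard ≤ matched g := by
  classical
  have hM' : ∀ v, v ∈ M.verts → ∃ w, M.Adj v w ∧ ∀ y, M.Adj v y → y = w := fun v hv => hM hv
  choose! g hg1 hg2 using hM'
  have hmem : ∀ {v}, v ∈ M.verts → g v ∈ M.verts := fun hv => M.edge_vert (hg1 _ hv).symm
  have hgg : ∀ {v}, v ∈ M.verts → g (g v) = v := fun hv =>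
    (hg2 _ (hmem hv) _ (hg1 _ hv).symm).symm
  refine ⟨fun v => if v ∈ M.verts then g v else v, ⟨fun v => ?_, fun v => ?_⟩, ?_⟩
  · by_cases hv : v ∈ M.verts
    · simp [hv, hmem hv, hgg hv]
    · simp [hv]
  · by_cases hv : v ∈ M.verts
    · intro _
      simpa [hv] using M.adj_sub (hg1 v hv)
    · simp [hv]
  · have h1 := M.spanningCoe.sum_degrees_eq_twice_card_edges
    have h2 : M.edgeSet.ncard = M.spanningCoe.edgeFinset.card := by
      rw [← Set.ncard_coe_finset, SimpleGraph.coe_edgeFinset]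
      congr 1
    rw [h2, ← h1, matched, Finset.card_filter]
    refine Finset.sum_le_sum fun v _ => ?_
    by_cases hv : v ∈ M.verts
    · have hne : g v ≠ v := fun h => M.loopless.irrefl v (by have := hg1 v hv; rwa [h] at this)
      simp only [hv, if_true, hne, ne_eq, not_false_eq_true]
      rw [← SimpleGraph.card_neighborFinset_eq_degree, Finset.card_le_one]
      intro a ha b hb
      rw [SimpleGraph.mem_neighborFinset] at ha hb
      rw [hg2 v hv a ha, hg2 v hv b hb]
    · simp only [hv, if_false, ne_eq, not_true_eq_false]
      rw [Nat.le_zero, ← SimpleGraph.card_neighborFinset_eq_degree, Finset.card_eq_zero,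
        Finset.eq_empty_iff_forall_notMem]
      intro a ha
      rw [SimpleGraph.mem_neighborFinset] at ha
      exact hv (M.edge_vert ha)

end LocalSearch

/-! ### A small imperative language and its compilation to programs -/

/-- Expressions over variables and arrays; `sum x e` is the sum of `e` over the values of the
variable `x + 2` below the value of the variable `0`. -/
inductive Expr : Type
  | var (x : ℕ)
  | const (c : ℕ)
  | add (e f : Expr)
  | sub (e f : Expr)
  | read (a : ℕ) (e : Expr)
  | ite (c e f : Expr)
  | sum (x : ℕ) (e : Expr)

namespace Expr

/-- The value of an expression. -/
def eval : Expr → (ℕ → ℕ) → (ℕ → ℕ → ℕ) → ℕ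
  | var x, v, _ => v x
  | const c, _, _ => c
  | add e f, v, A => e.eval v A + f.eval v A
  | sub e f, v, A => e.eval v A - f.eval v A
  | read a e, v, A => A a (e.eval v A)
  | ite c e f, v, A => if c.eval v A ≠ 0 then e.eval v A else f.eval v A
  | sum x e, v, A => ∑ j ∈ Finset.range (v 0), e.eval (Function.update v (x + 2) j) A

/-- The program that puts the value of an expression into the register `2 * i + 1`, where the
variable `x` is kept in the register `2 * x`. -/
def compile : Expr → ℕ → Prog
  -- Machines have no copy instruction; a register that has just been set to 0 is added instead.
  | var x, i => .seq (.const (2 * (i + 1) + 1) 0) (.add (2 * i + 1) (2 * x) (2 * (i + 1) + 1))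
  | const c, i => .const (2 * i + 1) c
  | add e f, i => .seq (e.compile i) (.seq (f.compile (i + 1))
      (.add (2 * i + 1) (2 * i + 1) (2 * (i + 1) + 1)))
  | sub e f, i => .seq (e.compile i) (.seq (f.compile (i + 1))
      (.sub (2 * i + 1) (2 * i + 1) (2 * (i + 1) + 1)))
  | read a e, i => .seq (e.compile i) (.load (2 * i + 1) a (2 * i + 1))
  | ite c e f, i => .seq (c.compile i) (.ite (2 * i + 1) (e.compile i) (f.compile i))
  | sum x e, i =>
    -- The temporaries from `i` on hold, in this order, the partial sum, the saved value of the
    -- summation variable, the number of remaining terms, and the constant 1.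
    .seq (.const (2 * i + 1) 0) <| .seq (.add (2 * (i + 1) + 1) (2 * (x + 2)) (2 * i + 1)) <|
    .seq (.add (2 * (i + 2) + 1) 0 (2 * i + 1)) <| .seq (.const (2 * (i + 3) + 1) 1) <|
    .seq (.const (2 * (x + 2)) 0) <|
    .seq (.loop (2 * (i + 2) + 1) <|
      .seq (e.compile (i + 4)) <| .seq (.add (2 * i + 1) (2 * i + 1) (2 * (i + 4) + 1)) <|
      .seq (.add (2 * (x + 2)) (2 * (x + 2)) (2 * (i + 3) + 1))
        (.sub (2 * (i + 2) + 1) (2 * (i + 2) + 1) (2 * (i + 3) + 1))) <|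
    .seq (.const (2 * (i + 3) + 1) 0) (.add (2 * (x + 2)) (2 * (i + 1) + 1) (2 * (i + 3) + 1))

/-- A bound on the running time. -/
noncomputable def cost : Expr → Polynomial ℕ
  | var _ => 2
  | const _ => 1
  | add e f => e.cost + f.cost + 1
  | sub e f => e.cost + f.cost + 1
  | read _ e => e.cost + 1
  | ite c e f => c.cost + e.cost + f.cost + 1
  | sum _ e => Polynomial.X * (e.cost + 4) + 8

end Expr

/-- The registers hold the variables, and the arrays are as given. -/
structure Agree (v : ℕ → ℕ) (A : ℕ → ℕ → ℕ) (s : Store) : Prop where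
  var : ∀ x, s.var (2 * x) = v x
  arr : s.arr = A

theorem Agree.setVar_odd {v : ℕ → ℕ} {A : ℕ → ℕ → ℕ} {s : Store} (h : Agree v A s) (i c : ℕ) :
    Agree v A (s.setVar (2 * i + 1) c) where
  var x := by
    rw [← h.var x]
    exact Function.update_of_ne (by omega) _ _
  arr := h.arr

theorem Agree.setVar_even {v : ℕ → ℕ} {A : ℕ → ℕ → ℕ} {s : Store} (h : Agree v A s) (x c : ℕ) :
    Agree (Function.update v x c) A (s.setVar (2 * x) c) where
  var y := by
    by_cases hy : y = x
    · subst hy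
      simp [Store.setVar]
    · rw [Function.update_of_ne hy, ← h.var y]
      exact Function.update_of_ne (by omega) _ _
  arr := h.arr

@[simp]
theorem setVar_var_self (s : Store) (x c : ℕ) : (s.setVar x c).var x = c := by simp [Store.setVar]

theorem setVar_var_ne (s : Store) {x y : ℕ} (c : ℕ) (h : y ≠ x) : (s.setVar x c).var y = s.var y :=
  Function.update_of_ne h _ _

/-- A loop that counts a register down from `m`, for an invariant `I` with a body of cost `t₀`. -/
theorem exec_loop {x : ℕ} {p : Prog} {t₀ : ℕ} (I : ℕ → Store → Prop) {m : ℕ}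
    (hx : ∀ j s, I j s → s.var x = m - j)
    (hp : ∀ j < m, ∀ s, I j s → ∃ t ≤ t₀, ∃ s', Exec p s t s' ∧ I (j + 1) s') {s : Store}
    (hs : I 0 s) : ∃ t ≤ m * (t₀ + 1) + 1, ∃ s', Exec (.loop x p) s t s' ∧ I m s' := by
  have key : ∀ d ≤ m, ∀ s, I (m - d) s →
      ∃ t ≤ d * (t₀ + 1) + 1, ∃ s', Exec (.loop x p) s t s' ∧ I m s' := by
    intro d
    induction d with
    | zero =>
      intro _ s hs
      refine ⟨1, by omega, s, Exec.loop_stop ?_, by simpa using hs⟩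
      rw [hx _ _ hs]
      omega
    | succ d ih =>
      intro hd s hs
      obtain ⟨t, ht, s', he, hs'⟩ := hp (m - (d + 1)) (by omega) s hs
      rw [show m - (d + 1) + 1 = m - d by omega] at hs'
      obtain ⟨t', ht', s'', he', hs''⟩ := ih (by omega) s' hs'
      refine ⟨t + t' + 1, ?_, s'', Exec.loop_next ?_ he he', hs''⟩
      · rw [add_mul]
        omega
      · rw [hx _ _ hs]
        omega
  exact key m le_rfl s (by simpa using hs)

/-- The last clause protects the temporaries below `i`; it lets a compound expression keep its first
operand while the second is computed. The variable `0` never changes, so the cost is a polynomial in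
its value. -/
theorem Expr.exec_compile (e : Expr) : ∀ (i : ℕ) (v : ℕ → ℕ) (A : ℕ → ℕ → ℕ) (s : Store),
    Agree v A s → ∃ t ≤ e.cost.eval (v 0), ∃ s', Exec (e.compile i) s t s' ∧ Agree v A s' ∧
      s'.var (2 * i + 1) = e.eval v A ∧ ∀ j < i, s'.var (2 * j + 1) = s.var (2 * j + 1) := by
  induction e with
  | var x =>
    intro i v A s h
    refine ⟨2, by simp [cost], _, .seq (.const _ _ _) (.add _ _ _ _),
      (h.setVar_odd _ _).setVar_odd _ _, ?_, ?_⟩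
    · rw [setVar_var_self, setVar_var_self, setVar_var_ne _ _ (by omega), h.var]
      rfl
    · intro j hj
      rw [setVar_var_ne _ _ (by omega), setVar_var_ne _ _ (by omega)]
  | const c =>
    intro i v A s h
    refine ⟨1, by simp [cost], _, .const _ _ _, h.setVar_odd _ _, setVar_var_self _ _ _, ?_⟩
    intro j hj
    rw [setVar_var_ne _ _ (by omega)]
  | add e f ihe ihf =>
    intro i v A s h
    obtain ⟨t, ht, s', he, h', hv, hu⟩ := ihe i v A s h
    obtain ⟨t', ht', s'', he', h'', hv', hu'⟩ := ihf (i + 1) v A s' h'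
    refine ⟨t + (t' + 1), by simp [cost]; omega, _, .seq he (.seq he' (.add _ _ _ _)),
      h''.setVar_odd _ _, ?_, ?_⟩
    · rw [setVar_var_self, hv', hu' i (by omega), hv]
      rfl
    · intro j hj
      rw [setVar_var_ne _ _ (by omega), hu' j (by omega), hu j hj]
  | sub e f ihe ihf =>
    intro i v A s h
    obtain ⟨t, ht, s', he, h', hv, hu⟩ := ihe i v A s h
    obtain ⟨t', ht', s'', he', h'', hv', hu'⟩ := ihf (i + 1) v A s' h'
    refine ⟨t + (t' + 1), by simp [cost]; omega, _, .seq he (.seq he' (.sub _ _ _ _)),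
      h''.setVar_odd _ _, ?_, ?_⟩
    · rw [setVar_var_self, hv', hu' i (by omega), hv]
      rfl
    · intro j hj
      rw [setVar_var_ne _ _ (by omega), hu' j (by omega), hu j hj]
  | read a e ihe =>
    intro i v A s h
    obtain ⟨t, ht, s', he, h', hv, hu⟩ := ihe i v A s h
    refine ⟨t + 1, by simp [cost]; omega, _, .seq he (.load _ _ _ _), h'.setVar_odd _ _, ?_, ?_⟩
    · rw [setVar_var_self, hv, h'.arr]
      rfl
    · intro j hj
      rw [setVar_var_ne _ _ (by omega), hu j hj]
  | ite c e f ihc ihe ihf =>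
    intro i v A s h
    obtain ⟨t, ht, s', he, h', hv, hu⟩ := ihc i v A s h
    by_cases hc : c.eval v A = 0
    · obtain ⟨t', ht', s'', he', h'', hv', hu'⟩ := ihf i v A s' h'
      refine ⟨t + (t' + 1), by simp [cost]; omega, s'', .seq he (.ite_false (hv.trans hc) he'), h'',
        ?_, fun j hj => (hu' j hj).trans (hu j hj)⟩
      rw [hv', eval, if_neg (by simpa using hc)]
    · obtain ⟨t', ht', s'', he', h'', hv', hu'⟩ := ihe i v A s' h'
      refine ⟨t + (t' + 1), by simp [cost]; omega, s'', .seq he (.ite_true (by rwa [hv]) he'), h'',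
        ?_, fun j hj => (hu' j hj).trans (hu j hj)⟩
      rw [hv', eval, if_pos hc]
  | sum x e ihe =>
    intro i v A s h
    set I : ℕ → Store → Prop := fun j s' => Agree (Function.update v (x + 2) j) A s' ∧
      s'.var (2 * i + 1) = ∑ l ∈ Finset.range j, e.eval (Function.update v (x + 2) l) A ∧
      s'.var (2 * (i + 1) + 1) = v (x + 2) ∧ s'.var (2 * (i + 2) + 1) = v 0 - j ∧
      s'.var (2 * (i + 3) + 1) = 1 ∧ ∀ j < i, s'.var (2 * j + 1) = s.var (2 * j + 1) with hI
    have h0 := (((h.setVar_odd i 0).setVar_odd (i + 1) ((s.setVar (2 * i + 1) 0).var (2 * (x + 2)) +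
      (s.setVar (2 * i + 1) 0).var (2 * i + 1))))
    refine Exists.elim (exec_loop (x := 2 * (i + 2) + 1)
      (p := .seq (e.compile (i + 4)) <| .seq (.add (2 * i + 1) (2 * i + 1) (2 * (i + 4) + 1)) <|
      .seq (.add (2 * (x + 2)) (2 * (x + 2)) (2 * (i + 3) + 1))
        (.sub (2 * (i + 2) + 1) (2 * (i + 2) + 1) (2 * (i + 3) + 1)))
      (t₀ := e.cost.eval (v 0) + 3) I (m := v 0) (fun j s' h => h.2.2.2.1) ?_
      (s := (((((s.setVar (2 * i + 1) 0).setVar (2 * (i + 1) + 1) (v (x + 2))).setVar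
        (2 * (i + 2) + 1) (v 0)).setVar (2 * (i + 3) + 1) 1).setVar (2 * (x + 2)) 0)) ?_) ?_
    rotate_left 2
    · rintro t ⟨ht, s', he, h1, h2, h3, -, -, h6⟩
      refine ⟨1 + (1 + (1 + (1 + (1 + (t + (1 + 1)))))), ?_, _,
        .seq (.const _ _ _) (.seq (.add _ _ _ _) (.seq (.add _ _ _ _) (.seq (.const _ _ _)
          (.seq (.const _ _ _) (.seq (s' := s') ?_ (.seq (.const _ _ _) (.add _ _ _ _))))))),
        ?_, ?_, ?_⟩
      · simp only [cost, Polynomial.eval_add, Polynomial.eval_mul, Polynomial.eval_X,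
          Polynomial.eval_ofNat]
        have : v 0 * (Polynomial.eval (v 0) e.cost + 3 + 1) =
          v 0 * (Polynomial.eval (v 0) e.cost + 4) := by ring
        omega
      · convert he using 6
        · rw [setVar_var_self, setVar_var_ne _ _ (by omega), h.var, add_zero]
        · rw [setVar_var_ne _ _ (by omega), setVar_var_ne _ _ (by omega),
            setVar_var_ne _ _ (by omega), setVar_var_self, ← h.var 0, add_zero]
      · have h7 := (h1.setVar_odd (i + 3) 0).setVar_even (x + 2) (v (x + 2))
        rw [Function.update_idem, Function.update_eq_self] at h7
        convert h7 using 2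
        rw [setVar_var_self, setVar_var_ne _ _ (by omega), h3, add_zero]
      · rw [setVar_var_ne _ _ (by omega), setVar_var_ne _ _ (by omega), h2]
        rfl
      · intro j hj
        rw [setVar_var_ne _ _ (by omega), setVar_var_ne _ _ (by omega), h6 j hj]
    · rintro j hj s' ⟨h1, h2, h3, h4, h5, h6⟩
      obtain ⟨t', ht', s'', he', h', hv', hu'⟩ := ihe (i + 4) _ A s' h1
      rw [Function.update_of_ne (by omega)] at ht'
      refine ⟨t' + (1 + (1 + 1)), by omega, _,
        .seq he' (.seq (.add _ _ _ _) (.seq (.add _ _ _ _) (.sub _ _ _ _))), ?_, ?_, ?_, ?_, ?_, ?_⟩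
      · refine Agree.setVar_odd ?_ _ _
        have h7 := (h'.setVar_odd i (s''.var (2 * i + 1) + s''.var (2 * (i + 4) + 1))).setVar_even
          (x + 2) (j + 1)
        rw [Function.update_idem] at h7
        convert h7 using 2
        rw [setVar_var_ne _ _ (by omega), setVar_var_ne _ _ (by omega), h'.var,
          hu' (i + 3) (by omega), h5, Function.update_self]
      · rw [setVar_var_ne _ _ (by omega), setVar_var_ne _ _ (by omega), setVar_var_self,
          hu' i (by omega), h2, hv', Finset.sum_range_succ]
      · rw [setVar_var_ne _ _ (by omega), setVar_var_ne _ _ (by omega),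
          setVar_var_ne _ _ (by omega), hu' (i + 1) (by omega), h3]
      · rw [setVar_var_self, setVar_var_ne _ _ (by omega), setVar_var_ne _ _ (by omega),
          setVar_var_ne _ _ (by omega), setVar_var_ne _ _ (by omega), hu' (i + 2) (by omega), h4,
          hu' (i + 3) (by omega), h5]
        omega
      · rw [setVar_var_ne _ _ (by omega), setVar_var_ne _ _ (by omega),
          setVar_var_ne _ _ (by omega), hu' (i + 3) (by omega), h5]
      · intro l hl
        rw [setVar_var_ne _ _ (by omega), setVar_var_ne _ _ (by omega),
          setVar_var_ne _ _ (by omega), hu' l (by omega), h6 l hl]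
    · refine ⟨?_, ?_, ?_, ?_, ?_, ?_⟩
      · exact ((((h.setVar_odd _ _).setVar_odd _ _).setVar_odd _ _).setVar_odd _ _).setVar_even _ _
      · rw [setVar_var_ne _ _ (by omega), setVar_var_ne _ _ (by omega),
          setVar_var_ne _ _ (by omega), setVar_var_ne _ _ (by omega), setVar_var_self]
        rfl
      · rw [setVar_var_ne _ _ (by omega), setVar_var_ne _ _ (by omega),
          setVar_var_ne _ _ (by omega), setVar_var_self]
      · rw [setVar_var_ne _ _ (by omega), setVar_var_ne _ _ (by omega), setVar_var_self]
        rfl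
      · rw [setVar_var_ne _ _ (by omega), setVar_var_self]
      · intro j hj
        rw [setVar_var_ne _ _ (by omega), setVar_var_ne _ _ (by omega),
          setVar_var_ne _ _ (by omega), setVar_var_ne _ _ (by omega), setVar_var_ne _ _ (by omega)]

/-- Statements; `forN x p` executes `p` for the values of the variable `x + 2` below the value of
the variable `0`. -/
inductive Stmt : Type
  | write (a : ℕ) (e f : Expr)
  | seq (p q : Stmt)
  | ite (c : Expr) (p q : Stmt)
  | forN (x : ℕ) (p : Stmt)

namespace Stmt

/-- The arrays after the execution of a statement. -/
def run : Stmt → (ℕ → ℕ) → (ℕ → ℕ → ℕ) → (ℕ → ℕ → ℕ)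
  | write a e f, v, A => Function.update A a (Function.update (A a) (e.eval v A) (f.eval v A))
  | seq p q, v, A => q.run v (p.run v A)
  | ite c p q, v, A => if c.eval v A ≠ 0 then p.run v A else q.run v A
  | forN x p, v, A =>
    (List.range (v 0)).foldl (fun A j => p.run (Function.update v (x + 2) j) A) A

/-- The program of a statement, with temporary registers from `2 * i + 1` on. -/
def compile : Stmt → ℕ → Prog
  | write a e f, i => .seq (e.compile i) (.seq (f.compile (i + 1))
      (.store a (2 * i + 1) (2 * (i + 1) + 1)))
  | seq p q, i => .seq (p.compile i) (q.compile i)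
  | ite c p q, i => .seq (c.compile i) (.ite (2 * i + 1) (p.compile i) (q.compile i))
  | forN x p, i =>
    .seq (.const (2 * i + 1) 0) <| .seq (.add (2 * (i + 1) + 1) (2 * (x + 2)) (2 * i + 1)) <|
    .seq (.add (2 * (i + 2) + 1) 0 (2 * i + 1)) <| .seq (.const (2 * i + 1) 1) <|
    .seq (.const (2 * (x + 2)) 0) <|
    .seq (.loop (2 * (i + 2) + 1) <|
      .seq (p.compile (i + 3)) <|
      .seq (.add (2 * (x + 2)) (2 * (x + 2)) (2 * i + 1))
        (.sub (2 * (i + 2) + 1) (2 * (i + 2) + 1) (2 * i + 1))) <|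
    .seq (.const (2 * i + 1) 0) (.add (2 * (x + 2)) (2 * (i + 1) + 1) (2 * i + 1))

/-- A bound on the running time. -/
noncomputable def cost : Stmt → Polynomial ℕ
  | write _ e f => e.cost + f.cost + 1
  | seq p q => p.cost + q.cost
  | ite c p q => c.cost + p.cost + q.cost + 1
  | forN _ p => Polynomial.X * (p.cost + 3) + 8

theorem exec_compile (p : Stmt) : ∀ (i : ℕ) (v : ℕ → ℕ) (A : ℕ → ℕ → ℕ) (s : Store),
    Agree v A s → ∃ t ≤ p.cost.eval (v 0), ∃ s', Exec (p.compile i) s t s' ∧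
      Agree v (p.run v A) s' ∧ ∀ j < i, s'.var (2 * j + 1) = s.var (2 * j + 1) := by
  induction p with
  | write a e f =>
    intro i v A s h
    obtain ⟨t, ht, s', he, h', hv, hu⟩ := e.exec_compile i v A s h
    obtain ⟨t', ht', s'', he', h'', hv', hu'⟩ := f.exec_compile (i + 1) v A s' h'
    refine ⟨t + (t' + 1), by simp [cost]; omega, _, .seq he (.seq he' (.store _ _ _ _)), ?_, ?_⟩
    · refine ⟨h''.var, ?_⟩
      simp only [Store.setArr, run]
      rw [hv', hu' i (by omega), hv, h''.arr]
    · intro j hj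
      exact (hu' j (by omega)).trans (hu j hj)
  | seq p q ihp ihq =>
    intro i v A s h
    obtain ⟨t, ht, s', he, h', hu⟩ := ihp i v A s h
    obtain ⟨t', ht', s'', he', h'', hu'⟩ := ihq i v _ s' h'
    exact ⟨t + t', by simp [cost]; omega, s'', .seq he he', h'',
      fun j hj => (hu' j hj).trans (hu j hj)⟩
  | ite c p q ihp ihq =>
    intro i v A s h
    obtain ⟨t, ht, s', he, h', hv, hu⟩ := c.exec_compile i v A s h
    by_cases hc : c.eval v A = 0
    · obtain ⟨t', ht', s'', he', h'', hu'⟩ := ihq i v A s' h'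
      refine ⟨t + (t' + 1), by simp [cost]; omega, s'', .seq he (.ite_false (hv.trans hc) he'),
        ?_, fun j hj => (hu' j hj).trans (hu j hj)⟩
      rwa [run, if_neg (by simpa using hc)]
    · obtain ⟨t', ht', s'', he', h'', hu'⟩ := ihp i v A s' h'
      refine ⟨t + (t' + 1), by simp [cost]; omega, s'', .seq he (.ite_true (by rwa [hv]) he'),
        ?_, fun j hj => (hu' j hj).trans (hu j hj)⟩
      rwa [run, if_pos hc]
  | forN x p ih =>
    intro i v A s h
    set I : ℕ → Store → Prop := fun j s' => Agree (Function.update v (x + 2) j)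
      ((List.range j).foldl (fun A j => p.run (Function.update v (x + 2) j) A) A) s' ∧
      s'.var (2 * i + 1) = 1 ∧ s'.var (2 * (i + 1) + 1) = v (x + 2) ∧
      s'.var (2 * (i + 2) + 1) = v 0 - j ∧ ∀ j < i, s'.var (2 * j + 1) = s.var (2 * j + 1) with hI
    refine Exists.elim (exec_loop (x := 2 * (i + 2) + 1)
      (p := .seq (p.compile (i + 3)) <|
      .seq (.add (2 * (x + 2)) (2 * (x + 2)) (2 * i + 1))
        (.sub (2 * (i + 2) + 1) (2 * (i + 2) + 1) (2 * i + 1)))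
      (t₀ := p.cost.eval (v 0) + 2) I (m := v 0) (fun j s' h => h.2.2.2.1) ?_
      (s := (((((s.setVar (2 * i + 1) 0).setVar (2 * (i + 1) + 1) (v (x + 2))).setVar
        (2 * (i + 2) + 1) (v 0)).setVar (2 * i + 1) 1).setVar (2 * (x + 2)) 0)) ?_) ?_
    rotate_left 2
    · rintro t ⟨ht, s', he, h1, h2, h3, -, h6⟩
      refine ⟨1 + (1 + (1 + (1 + (1 + (t + (1 + 1)))))), ?_, _,
        .seq (.const _ _ _) (.seq (.add _ _ _ _) (.seq (.add _ _ _ _) (.seq (.const _ _ _)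
          (.seq (.const _ _ _) (.seq (s' := s') ?_ (.seq (.const _ _ _) (.add _ _ _ _))))))),
        ?_, ?_⟩
      · simp only [cost, Polynomial.eval_add, Polynomial.eval_mul, Polynomial.eval_X,
          Polynomial.eval_ofNat]
        have : v 0 * (Polynomial.eval (v 0) p.cost + 2 + 1) =
          v 0 * (Polynomial.eval (v 0) p.cost + 3) := by ring
        omega
      · convert he using 6
        · rw [setVar_var_self, setVar_var_ne _ _ (by omega), h.var, add_zero]
        · rw [setVar_var_ne _ _ (by omega), setVar_var_ne _ _ (by omega),
            setVar_var_ne _ _ (by omega), setVar_var_self, ← h.var 0, add_zero]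
      · have h7 := (h1.setVar_odd i 0).setVar_even (x + 2) (v (x + 2))
        rw [Function.update_idem, Function.update_eq_self] at h7
        convert h7 using 2
        · rfl
        rw [setVar_var_self, setVar_var_ne _ _ (by omega), h3, add_zero]
      · intro j hj
        rw [setVar_var_ne _ _ (by omega), setVar_var_ne _ _ (by omega), h6 j hj]
    · rintro j hj s' ⟨h1, h2, h3, h4, h5⟩
      obtain ⟨t', ht', s'', he', h', hu'⟩ := ih (i + 3) _ _ s' h1
      rw [Function.update_of_ne (by omega)] at ht'
      refine ⟨t' + (1 + 1), by omega, _,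
        .seq he' (.seq (.add _ _ _ _) (.sub _ _ _ _)), ?_, ?_, ?_, ?_, ?_⟩
      · refine Agree.setVar_odd ?_ _ _
        have h7 := h'.setVar_even (x + 2) (j + 1)
        rw [Function.update_idem] at h7
        rw [List.range_succ, List.foldl_append]
        convert h7 using 2
        · rfl
        rw [h'.var, hu' i (by omega), h2, Function.update_self]
      · rw [setVar_var_ne _ _ (by omega), setVar_var_ne _ _ (by omega), hu' i (by omega), h2]
      · rw [setVar_var_ne _ _ (by omega), setVar_var_ne _ _ (by omega), hu' (i + 1) (by omega), h3]
      · rw [setVar_var_self, setVar_var_ne _ _ (by omega), setVar_var_ne _ _ (by omega),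
          hu' (i + 2) (by omega), h4, hu' i (by omega), h2]
        omega
      · intro l hl
        rw [setVar_var_ne _ _ (by omega), setVar_var_ne _ _ (by omega), hu' l (by omega), h5 l hl]
    · refine ⟨?_, ?_, ?_, ?_, ?_⟩
      · exact ((((h.setVar_odd _ _).setVar_odd _ _).setVar_odd _ _).setVar_odd _ _).setVar_even _ _
      · rw [setVar_var_ne _ _ (by omega), setVar_var_self]
      · rw [setVar_var_ne _ _ (by omega), setVar_var_ne _ _ (by omega),
          setVar_var_ne _ _ (by omega), setVar_var_self]
      · rw [setVar_var_ne _ _ (by omega), setVar_var_ne _ _ (by omega), setVar_var_self]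
        rfl
      · intro j hj
        rw [setVar_var_ne _ _ (by omega), setVar_var_ne _ _ (by omega),
          setVar_var_ne _ _ (by omega), setVar_var_ne _ _ (by omega), setVar_var_ne _ _ (by omega)]

/-- The variables at the beginning. -/
def input (n k : ℕ) : ℕ → ℕ := fun x => if x = 0 then n else if x = 1 then k else 0

/-- Statements can be executed in polynomial time. -/
theorem exists_prog (p : Stmt) : ∃ (q : Prog) (T : Polynomial ℕ),
    ∀ (n k : ℕ) (G : SimpleGraph (Fin n)) [DecidableRel G.Adj] (m : ℕ) (r : Fin m → Bool),
      ∃ t ≤ T.eval n, ∃ s', Exec q (inputStore G k r) t s' ∧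
        s'.arr = p.run (input n k) (inputStore G k r).arr := by
  -- The input `k` arrives in register 1, which compiled code uses as a temporary. It is copied to
  -- register 2, the place of the variable `1`; register 3 still contains 0.
  refine ⟨.seq (.add 2 1 3) (p.compile 0), p.cost + 1, ?_⟩
  intro n k G _ m r
  have h : Agree (input n k) (inputStore G k r).arr ((inputStore G k r).setVar 2 k) := by
    refine ⟨fun x => ?_, rfl⟩
    rcases x with _ | _ | x
    · rfl
    · rfl
    · rw [setVar_var_ne _ _ (by omega)]
      simp only [inputStore, input]
      rw [if_neg (by omega), if_neg (by omega), if_neg (by omega), if_neg (by omega)]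
  obtain ⟨t, ht, s', he, h', -⟩ := p.exec_compile 0 _ _ _ h
  refine ⟨1 + t, ?_, s', .seq (.add _ _ _ _) he, h'.arr⟩
  have : input n k 0 = n := rfl
  rw [this] at ht
  simp
  omega

end Stmt

/-! ### The choice of the layout and the resulting bounds. -/

section Branches

/-- The number of leaders of a chunk. -/
def leadersPer (D k : ℕ) : ℕ :=
  if D = 2 then
    -- For these `k` a firm with all `k` partners would give too small a bound. The chosen `r`
    -- divides `k`, has the parity of `k`, and leaves at least two edges of a chunk without a
    -- leader.
    if k = 5 then 1 else if k = 6 then 2 else if k = 7 then 1 else if k = 8 then 2 else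
    if k = 9 then 3 else if k = 10 then 2 else k
  else k

/-- Whether the leaders are scattered at random. -/
def Scattered (D k : ℕ) : Prop := (3 ≤ D ∧ 6 ≤ k) ∨ (D = 2 ∧ 11 ≤ k)

/-- The number of edges of a chunk. -/
def chunkSize (D k : ℕ) : ℕ := (k + leadersPer D k) / 2

/-- The number of chunks of a group. -/
def chunksPer (D k : ℕ) : ℕ := k / leadersPer D k

/-- The number of groups that can be made of `m` edges. -/
def groups (D k m : ℕ) : ℕ := m / (chunksPer D k * chunkSize D k)

theorem isShape_groups {k : ℕ} (hk : 0 < k) (D m : ℕ) :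
    IsShape k m (leadersPer D k) (chunkSize D k) (chunksPer D k) (groups D k m) := by
  have h0 : 0 < leadersPer D k ∧ leadersPer D k ≤ k ∧ k / leadersPer D k * leadersPer D k = k ∧
      2 ∣ k + leadersPer D k := by
    unfold leadersPer
    have h1 : 0 < k ∧ k ≤ k ∧ k / k * k = k ∧ 2 ∣ k + k :=
      ⟨hk, le_rfl, by rw [Nat.div_self hk, one_mul], ⟨k, by ring⟩⟩
    split_ifs <;> first
      | exact h1
      | (subst_vars; decide)
  obtain ⟨h1, h2, h3, h4⟩ := h0
  refine ⟨h1, ?_, h3, ?_, ?_⟩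
  · unfold chunkSize
    omega
  · unfold chunkSize
    omega
  · rw [groups, mul_assoc]
    exact Nat.div_mul_le_self _ _

theorem prod_one_div (S : Finset ℕ) (a : ℕ → ℕ) :
    ∏ t ∈ S, (1 : ℝ) / a t = 1 / ((∏ t ∈ S, a t : ℕ) : ℝ) := by
  rw [Finset.prod_div_distrib, Finset.prod_const_one]
  push_cast
  rfl

/-- The bound for groups, without fractions. -/
theorem group_bound {k r s q B E : ℕ}
    (h : q * (∏ t ∈ Finset.Icc 1 r, GroupSystem.harmBound k E t) ^ s ≤
      B * (k.factorial * (2 * E + 1) ^ k)) :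
    (q : ℝ) * (1 / (2 ^ k * k.factorial * (2 * ((E + 1 : ℕ) : ℝ) - 1) ^ k)) ≤
      B * ((1 / 2) ^ k * (∏ t ∈ Finset.Icc 1 r, (1 : ℝ) / GroupSystem.harmBound k E t) ^ s) := by
  have hprod : 0 < ∏ t ∈ Finset.Icc 1 r, GroupSystem.harmBound k E t :=
    Finset.prod_pos fun t ht => GroupSystem.harmBound_pos k E
      (by rw [Finset.mem_Icc] at ht; omega)
  rw [prod_one_div]
  set z := ∏ t ∈ Finset.Icc 1 r, GroupSystem.harmBound k E t
  have hz : (0 : ℝ) < z := by exact_mod_cast hprod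
  have h' : (q : ℝ) * (z : ℝ) ^ s ≤ B * (k.factorial * (2 * E + 1) ^ k) := by exact_mod_cast h
  have hd : (2 * ((E + 1 : ℕ) : ℝ) - 1) = 2 * E + 1 := by push_cast; ring
  rw [hd, one_div_pow, one_div_pow, mul_one_div, one_div_mul_one_div, mul_one_div,
    div_le_div_iff₀ (by positivity) (by positivity)]
  calc (q : ℝ) * (2 ^ k * (z : ℝ) ^ s) = 2 ^ k * (q * (z : ℝ) ^ s) := by ring
    _ ≤ 2 ^ k * (B * (k.factorial * (2 * E + 1) ^ k)) := by gcongr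
    _ = _ := by ring

/-- The matching is almost as large as `k * (2 * D * q)`. -/
structure LargeMatching (k D q m : ℕ) : Prop where
  small : k * (2 * D * q) ≤ m ∨ 2001 ≤ m
  large : 2001 * (k * (2 * D * q)) ≤ 2002 * m

/-- Either the matching has the full size, or `m ≥ 2001` and the relative loss is tiny. In the
second case, rounding `m / k` costs at most one firm, which is a small part of `2 * D * q` if this
is at least 50. Otherwise `k * (2 * D * q) > m ≥ 2001` forces `k` to be large. -/
theorem LargeMatching.firms {k D q m : ℕ} (h : LargeMatching k D q m) (hk : 0 < k) :
    2 * D * q ≤ m / k ∨ (50 ≤ 2 * D * q ∧ 979 * (2 * D * q) ≤ 1000 * (m / k)) ∨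
      (41 ≤ k ∧ 2 * D * q ≤ m / k + 1) := by
  obtain ⟨h1, h2⟩ := h
  set A := 2 * D * q
  by_cases h3 : k * A ≤ m
  · left
    exact (Nat.le_div_iff_mul_le hk).mpr (by rwa [mul_comm])
  right
  have h4 : 2001 ≤ m := by omega
  have h5 : m < k * (m / k + 1) := Nat.lt_mul_div_succ m hk
  have h6 : 2001 * A < 2002 * (m / k + 1) := by
    refine Nat.lt_of_mul_lt_mul_left (a := k) ?_
    calc k * (2001 * A) = 2001 * (k * A) := by ring
      _ ≤ 2002 * m := h2
      _ < 2002 * (k * (m / k + 1)) := by omega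
      _ = k * (2002 * (m / k + 1)) := by ring
  rcases Nat.lt_or_ge A 50 with h7 | h7
  · right
    refine ⟨?_, by omega⟩
    by_contra! h8
    have : k * A ≤ 40 * 49 := Nat.mul_le_mul (by omega) (by omega)
    omega
  · left
    exact ⟨h7, by omega⟩

/-- The constants have room for the loss: `0.979 * 6 > 5.8`, `0.979 * 4 > 3.8`, and `4 * q - 1 ≥ 3 *
q` when one firm is missing. -/
theorem LargeMatching.scatterRange {k D q m : ℕ} (h : LargeMatching k D q m) (hq : 0 < q)
    (hs : Scattered D k) : ScatterRange D (m / k) k q := by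
  have hk : 0 < k := by rcases hs with h | h <;> omega
  have h1 := h.firms hk
  rcases hs with ⟨hD, hk6⟩ | ⟨rfl, hk11⟩
  · have h2 : 2 * 3 * q ≤ 2 * D * q := Nat.mul_le_mul_right q (by omega)
    rcases h1 with h1 | h1 | h1
    · exact Or.inl ⟨hD, hk6, by omega, by omega⟩
    · exact Or.inl ⟨hD, hk6, by omega, by omega⟩
    · exact Or.inr (Or.inr ⟨by omega, by omega, by omega, by omega⟩)
  · rcases h1 with h1 | h1 | h1
    · exact Or.inr (Or.inl ⟨le_rfl, hk11, by omega, by omega⟩)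
    · exact Or.inr (Or.inl ⟨le_rfl, hk11, by omega, by omega⟩)
    · exact Or.inr (Or.inr ⟨le_rfl, by omega, by omega, by omega⟩)

/-- Factor by factor, `2 * (t * (2E + 1) + (k - t) * E) ≤ (2E + 1) * (k + t)`. Relative to `k! * (2E
+ 1) ^ k` the loss is thus at most `(2k).choose k / 2 ^ k`, whatever `E` is. -/
theorem two_pow_mul_prod_harmBound_le (k E : ℕ) :
    2 ^ k * ∏ t ∈ Finset.Icc 1 k, GroupSystem.harmBound k E t ≤
      (2 * E + 1) ^ k * ∏ t ∈ Finset.Icc 1 k, (k + t) := by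
  have h : ∀ a : ℕ, a ^ k = ∏ _t ∈ Finset.Icc 1 k, a := fun a => by
    rw [Finset.prod_const, Nat.card_Icc, Nat.add_sub_cancel]
  rw [h, h, ← Finset.prod_mul_distrib, ← Finset.prod_mul_distrib]
  refine Finset.prod_le_prod' fun t ht => ?_
  rw [Finset.mem_Icc] at ht
  obtain ⟨d, rfl⟩ := Nat.exists_eq_add_of_le ht.2
  unfold GroupSystem.harmBound
  rw [Nat.add_sub_cancel_left]
  nlinarith

/-- For `E = 0` nothing is lost. Otherwise the loss is at most 3 for `E = 1`, at most 5.8 for `E =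
2`, and at most `10.choose 5 / 2 ^ 5 = 7.875` for `3 ≤ E`, always below the surplus `2 * (E + 1)`
with room for the local search. -/
theorem LargeMatching.block_bound {k E q m : ℕ} (h : LargeMatching k (E + 1) q m) (hk : 0 < k)
    (hE : E = 0 ∨ (E = 1 ∧ k ≤ 4) ∨ (2 ≤ E ∧ k ≤ 5)) :
    q * (∏ t ∈ Finset.Icc 1 k, GroupSystem.harmBound k E t) ^ 1 ≤
      m / k * (k.factorial * (2 * E + 1) ^ k) := by
  have h1 := h.firms hk
  rw [pow_one]
  rcases hE with rfl | ⟨rfl, hk4⟩ | ⟨hE, hk5⟩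
  · have e : ∏ t ∈ Finset.Icc 1 k, GroupSystem.harmBound k 0 t = k.factorial := by
      rw [← Finset.prod_Ico_id_eq_factorial, Finset.Ico_add_one_right_eq_Icc]
      refine Finset.prod_congr rfl fun t _ => ?_
      simp [GroupSystem.harmBound]
    rw [e]
    simp only [mul_zero, zero_add, one_pow, mul_one]
    refine Nat.mul_le_mul_right _ ?_
    generalize m / k = F at h1 ⊢
    rcases h1 with h1 | h1 | h1 <;> omega
  · have h2 : 3 * q ≤ m / k := by
      rcases h1 with h1 | h1 | h1 <;> omega
    have h3 : ∏ t ∈ Finset.Icc 1 k, GroupSystem.harmBound k 1 t ≤ 3 * (k.factorial * 3 ^ k) := by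
      interval_cases k <;> decide
    calc q * ∏ t ∈ Finset.Icc 1 k, GroupSystem.harmBound k 1 t
        ≤ q * (3 * (k.factorial * 3 ^ k)) := Nat.mul_le_mul_left q h3
      _ = 3 * q * (k.factorial * 3 ^ k) := by ring
      _ ≤ _ := Nat.mul_le_mul_right _ h2
  · rcases hE.eq_or_lt with rfl | hE
    · have h2 : 58 * q ≤ 10 * (m / k) := by
        rcases h1 with h1 | h1 | h1 <;> omega
      have h3 : 10 * ∏ t ∈ Finset.Icc 1 k, GroupSystem.harmBound k 2 t ≤
          58 * (k.factorial * 5 ^ k) := by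
        interval_cases k <;> decide
      refine Nat.le_of_mul_le_mul_left ?_ (by norm_num : 0 < 10)
      calc 10 * (q * ∏ t ∈ Finset.Icc 1 k, GroupSystem.harmBound k 2 t)
          = q * (10 * ∏ t ∈ Finset.Icc 1 k, GroupSystem.harmBound k 2 t) := by ring
        _ ≤ q * (58 * (k.factorial * 5 ^ k)) := Nat.mul_le_mul_left q h3
        _ = 58 * q * (k.factorial * 5 ^ k) := by ring
        _ ≤ 10 * (m / k) * (k.factorial * 5 ^ k) := Nat.mul_le_mul_right _ h2
        _ = _ := by ring
    · have h0 : 2 * 4 * q ≤ 2 * (E + 1) * q := Nat.mul_le_mul_right q (by omega)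
      have h5 := h.small
      have h6 := h.large
      set A := 2 * (E + 1) * q
      have h2 : 7875 * q ≤ 1000 * (m / k) := by
        interval_cases k <;> omega
      have h3 : 1000 * ∏ t ∈ Finset.Icc 1 k, (k + t) ≤ 7875 * (k.factorial * 2 ^ k) := by
        interval_cases k <;> decide
      have h4 := two_pow_mul_prod_harmBound_le k E
      refine Nat.le_of_mul_le_mul_left ?_ (by positivity : 0 < 1000 * 2 ^ k)
      calc 1000 * 2 ^ k * (q * ∏ t ∈ Finset.Icc 1 k, GroupSystem.harmBound k E t)
          = 1000 * q * (2 ^ k * ∏ t ∈ Finset.Icc 1 k, GroupSystem.harmBound k E t) := by ring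
        _ ≤ 1000 * q * ((2 * E + 1) ^ k * ∏ t ∈ Finset.Icc 1 k, (k + t)) :=
          Nat.mul_le_mul_left _ h4
        _ = q * (2 * E + 1) ^ k * (1000 * ∏ t ∈ Finset.Icc 1 k, (k + t)) := by ring
        _ ≤ q * (2 * E + 1) ^ k * (7875 * (k.factorial * 2 ^ k)) := Nat.mul_le_mul_left _ h3
        _ = 7875 * q * (k.factorial * 2 ^ k * (2 * E + 1) ^ k) := by ring
        _ ≤ 1000 * (m / k) * (k.factorial * 2 ^ k * (2 * E + 1) ^ k) :=
          Nat.mul_le_mul_right _ h2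
        _ = _ := by ring

/-- With few leaders per chunk a group consumes more edges, but its factors `harmBound` involve only
small `t`. The finitely many `k` are checked numerically. -/
theorem LargeMatching.window_bound {k q m : ℕ} (h : LargeMatching k 2 q m) (hk : 5 ≤ k)
    (hk' : k ≤ 10) :
    q * (∏ t ∈ Finset.Icc 1 (leadersPer 2 k), GroupSystem.harmBound k 1 t) ^ chunksPer 2 k ≤
      groups 2 k m * (k.factorial * (2 * 1 + 1) ^ k) := by
  obtain ⟨h1, h2⟩ := h
  interval_cases k <;>
  · simp only [groups, leadersPer, chunksPer, chunkSize, GroupSystem.harmBound]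
    norm_num [Finset.prod_Icc_succ_top, Nat.factorial] at *
    omega

variable {n m k nf M : ℕ} {G : SimpleGraph (Fin n)} [DecidableRel G.Adj] {P : Pairs G m}

/-- Every layout of a large matching gives the lower bound. -/
theorem le_expect_of_layout [NeZero n] (hk : 0 < k) (hn : n = k * nf) {D q : ℕ} (hD : 0 < D)
    (hdeg : ∀ x, G.degree x ≤ D) (hm : LargeMatching k D q m) (hq : 0 < q)
    (hM : n + n * n ≤ M) {g : (Fin n → Bool) → ℕ} (hg : Function.Injective g)
    (key : (Fin M → Bool) → ℕ → ℕ)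
    (hkey : ∀ ρ, ∀ l < n, key ρ l = g fun i => bit ρ (n + l * n + i))
    (val : (Fin M → Bool) → Fin n → ℕ)
    (hL : Scattered D k → ∀ ρ, IsLayout P (leadersPer D k) (chunkSize D k) (chunksPer D k)
      (groups D k m) (key ρ) (bit ρ) (val ρ))
    (hL' : ¬ Scattered D k → ∀ ρ, IsLayout P (leadersPer D k) (chunkSize D k) (chunksPer D k)
      (groups D k m) id (bit ρ) (val ρ))
    (hcross : D = 2 → 5 ≤ k → k ≤ 10 → NoCross P (leadersPer D k) (chunkSize D k) (chunksPer D k)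
      (groups D k m)) (rank : Fin n ≃ Fin n) :
    (q : ℝ) * (1 / (2 ^ k * k.factorial * (2 * (D : ℝ) - 1) ^ k)) ≤
    𝔼 ρ, ∫ ω, (numOutOfBusiness G k rank (sortAssign k nf (val ρ)) ω : ℝ) ∂(activation n) := by
  have hmn := P.two_mul_le
  have hself : ¬ (D = 2 ∧ 5 ≤ k ∧ k ≤ 10) → leadersPer D k = k ∧ chunkSize D k = k ∧
      chunksPer D k = 1 ∧ groups D k m = m / k := by
    intro h
    have h1 : leadersPer D k = k := by
      unfold leadersPer
      split_ifs <;> omega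
    have h2 : chunkSize D k = k := by rw [chunkSize, h1]; omega
    have h3 : chunksPer D k = 1 := by rw [chunksPer, h1, Nat.div_self hk]
    exact ⟨h1, h2, h3, by rw [groups, h2, h3, one_mul]⟩
  by_cases hs : Scattered D k
  · have hr := hm.scatterRange hq hs
    obtain ⟨e1, e2, e3, e4⟩ := hself (by rcases hs with h | h <;> omega)
    have hL := hL hs
    simp only [e1, e2, e3, e4] at hL
    have hFk : m / k * k ≤ m := Nat.div_mul_le_self m k
    have hF : 0 < m / k ∧ 6 ≤ m / k * k := by
      have h1 : 3 ≤ m / k ∧ 6 ≤ k := by rcases hr with h | h | h <;> omega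
      exact ⟨by omega, by nlinarith⟩
    have h1 := le_expect_of_scatter hk hn hFk hF.1 hM hF.2 hg key
      (fun ρ l hl => hkey ρ l (by omega)) val hL rank hD hdeg
    refine le_trans ?_ h1
    have hch : (0 : ℝ) < (k * (m / k)).choose k := by
      exact_mod_cast Nat.choose_pos (Nat.le_mul_of_pos_right k hF.1)
    rw [le_div_iff₀ hch, mul_one_div]
    exact hr.le
  · have hL := hL' hs
    obtain ⟨E, rfl⟩ : ∃ E, D = E + 1 := ⟨D - 1, by omega⟩
    by_cases hw : E + 1 = 2 ∧ 5 ≤ k ∧ k ≤ 10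
    · obtain ⟨h1, h2, h3⟩ := hw
      obtain rfl : E = 1 := by omega
      refine le_trans (group_bound (hm.window_bound h2 h3)) ?_
      exact le_expect_of_groups (isShape_groups hk _ _) hk hn (hcross rfl h2 h3)
        (by omega) val hL hdeg rank
    · obtain ⟨e1, e2, e3, e4⟩ := hself hw
      simp only [e1, e2, e3, e4] at hL
      have hE : E = 0 ∨ (E = 1 ∧ k ≤ 4) ∨ (2 ≤ E ∧ k ≤ 5) := by
        unfold Scattered at hs
        omega
      refine le_trans (group_bound (hm.block_bound hk hE)) ?_
      refine le_expect_of_groups (isShape_scatter hk (Nat.div_mul_le_self m k)) hk hn ?_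
        (by omega) val hL hdeg rank
      intro β _ κ κ' h1 h2 h3
      omega

theorem expectedOutOfBusiness_map [NeZero n] {Ω : Type*} [Fintype Ω] [Nonempty Ω]
    (out : Ω → Assignment n nf) (rank : Fin n ≃ Fin n) :
    expectedOutOfBusiness G k rank ((PMF.uniformOfFintype Ω).map out) =
      𝔼 ρ, ∫ ω, (numOutOfBusiness G k rank (out ρ) ω : ℝ) ∂(activation n) := by
  classical
  rw [expectedOutOfBusiness, Fintype.expect_eq_sum_div_card]
  have h : ∀ μ, (((PMF.uniformOfFintype Ω).map out) μ).toReal =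
      ∑ ρ, if μ = out ρ then ((Fintype.card Ω : ℝ))⁻¹ else 0 := by
    intro μ
    rw [PMF.map_apply, tsum_fintype, ENNReal.toReal_sum]
    · refine Finset.sum_congr rfl fun ρ _ => ?_
      split_ifs <;> simp
    · intro ρ _
      split_ifs <;> simp
  simp_rw [h, Finset.sum_mul]
  rw [Finset.sum_comm, div_eq_mul_inv, Finset.sum_mul]
  refine Finset.sum_congr rfl fun ρ _ => ?_
  simp only [ite_mul, zero_mul, Finset.sum_ite_eq', Finset.mem_univ, if_true]
  rw [mul_comm]

end Branches

/-! ### Derived expressions and filling of arrays. -/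

namespace Expr

/-- The truth value of an expression. -/
def Holds (e : Expr) (v : ℕ → ℕ) (A : ℕ → ℕ → ℕ) : Prop := e.eval v A ≠ 0

/-- `e < f` -/
def lt (e f : Expr) : Expr := ite (sub f e) (const 1) (const 0)

/-- `e = f` -/
def eq (e f : Expr) : Expr := ite (add (sub e f) (sub f e)) (const 0) (const 1)

/-- Negation. -/
def not (e : Expr) : Expr := ite e (const 0) (const 1)

/-- Conjunction. -/
def and (e f : Expr) : Expr := ite e (ite f (const 1) (const 0)) (const 0)

/-- Disjunction. -/
def or (e f : Expr) : Expr := ite e (const 1) (ite f (const 1) (const 0))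

/-- The number of values of the variable `x + 2` for which `e` holds. -/
def count (x : ℕ) (e : Expr) : Expr := sum x (ite e (const 1) (const 0))

variable {e f c : Expr} {v : ℕ → ℕ} {A : ℕ → ℕ → ℕ}

@[simp] theorem eval_var {x : ℕ} : (var x).eval v A = v x := rfl
@[simp] theorem eval_const {x : ℕ} : (const x).eval v A = x := rfl
@[simp] theorem eval_add : (add e f).eval v A = e.eval v A + f.eval v A := rfl
@[simp] theorem eval_sub : (sub e f).eval v A = e.eval v A - f.eval v A := rfl
@[simp] theorem eval_read {a : ℕ} : (read a e).eval v A = A a (e.eval v A) := rfl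

open scoped Classical in
@[simp] theorem eval_ite : (ite c e f).eval v A =
    if c.Holds v A then e.eval v A else f.eval v A := by
  simp only [eval, Holds]
  congr

@[simp] theorem holds_lt : (lt e f).Holds v A ↔ e.eval v A < f.eval v A := by
  simp only [lt, Holds, eval]
  by_cases h : f.eval v A - e.eval v A = 0
  · simp [h]; omega
  · simp [h]; omega

@[simp] theorem holds_eq : (eq e f).Holds v A ↔ e.eval v A = f.eval v A := by
  simp only [eq, Holds, eval]
  by_cases h : e.eval v A = f.eval v A
  · simp [h]
  · simp [h]
    omega

@[simp] theorem holds_not : (not e).Holds v A ↔ ¬ e.Holds v A := by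
  simp only [not, Holds, eval]
  split_ifs <;> simp_all

@[simp] theorem holds_and : (and e f).Holds v A ↔ e.Holds v A ∧ f.Holds v A := by
  simp [and, Holds, eval]

@[simp] theorem holds_or : (or e f).Holds v A ↔ e.Holds v A ∨ f.Holds v A := by
  simp only [or, Holds, eval]
  split_ifs <;> simp_all

theorem holds_sum {x : ℕ} : (sum x e).Holds v A ↔
    ∃ j < v 0, e.Holds (Function.update v (x + 2) j) A := by
  simp [Holds, eval, Finset.sum_eq_zero_iff]

open scoped Classical in
theorem eval_count {x : ℕ} : (count x e).eval v A =
    ((Finset.range (v 0)).filter fun j => e.Holds (Function.update v (x + 2) j) A).card := by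
  rw [Finset.card_filter]
  simp only [count, eval, Holds]
  refine Finset.sum_congr rfl fun j _ => ?_
  congr

end Expr

namespace Stmt

/-- `a[i] := e` for all `i` below the variable `0`, with `i` in the variable `x + 2`. -/
def fill (x a : ℕ) (e : Expr) : Stmt := forN x (write a (.var (x + 2)) e)

/-- The expression for entry `t` sees the entries already written, so an array can be filled
recursively. -/
theorem run_fill (x a : ℕ) (e : Expr) (v : ℕ → ℕ) (A : ℕ → ℕ → ℕ) :
    ∃ R : ℕ → ℕ, (fill x a e).run v A = Function.update A a R ∧
      (∀ t, v 0 ≤ t → R t = A a t) ∧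
      ∀ t < v 0, R t = e.eval (Function.update v (x + 2) t)
        (Function.update A a fun j => if j < t then R j else A a j) := by
  have key : ∀ m, ∃ R : ℕ → ℕ,
      (List.range m).foldl (fun A j => (write a (.var (x + 2)) e).run
        (Function.update v (x + 2) j) A) A = Function.update A a R ∧
      (∀ t, m ≤ t → R t = A a t) ∧
      ∀ t < m, R t = e.eval (Function.update v (x + 2) t)
        (Function.update A a fun j => if j < t then R j else A a j) := by
    intro m
    induction m with
    | zero => exact ⟨A a, by simp, fun _ _ => rfl, fun t ht => absurd ht (by omega)⟩
    | succ m ih =>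
      obtain ⟨R, h1, h2, h3⟩ := ih
      set z := e.eval (Function.update v (x + 2) m) (Function.update A a R) with hz
      have hR : ∀ t ≤ m, (fun j => if j < t then Function.update R m z j else A a j) =
          fun j => if j < t then R j else A a j := by
        intro t ht
        funext j
        by_cases hj : j < t
        · rw [if_pos hj, if_pos hj, Function.update_of_ne (by omega)]
        · rw [if_neg hj, if_neg hj]
      refine ⟨Function.update R m z, ?_, ?_, ?_⟩
      · rw [List.range_succ, List.foldl_append, h1]
        simp [run, hz]
      · intro t ht
        rw [Function.update_of_ne (by omega), h2 t (by omega)]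
      · intro t ht
        rw [hR t (by omega)]
        by_cases htm : t = m
        · subst htm
          rw [Function.update_self, hz]
          congr 2
          funext j
          by_cases hj : j < t
          · rw [if_pos hj]
          · rw [if_neg hj, h2 j (by omega)]
        · rw [Function.update_of_ne htm, h3 t (by omega)]
  exact key (v 0)

/-- Filling an array from values that do not depend on the entries written before. -/
theorem run_fill_of_forall {x a : ℕ} {e : Expr} {v : ℕ → ℕ} {A : ℕ → ℕ → ℕ} {F : ℕ → ℕ}
    (h : ∀ i < v 0, ∀ B : ℕ → ℕ → ℕ, (∀ b, b ≠ a → B b = A b) → (∀ j, i ≤ j → B a j = A a j) →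
      e.eval (Function.update v (x + 2) i) B = F i) :
    (∀ i < v 0, (fill x a e).run v A a i = F i) ∧
      ∀ b, b ≠ a → (fill x a e).run v A b = A b := by
  obtain ⟨R, h1, -, h3⟩ := run_fill x a e v A
  rw [h1]
  refine ⟨fun i hi => ?_, fun b hb => Function.update_of_ne hb _ _⟩
  rw [Function.update_self, h3 i hi]
  refine h i hi _ (fun b hb => Function.update_of_ne hb _ _) fun j hj => ?_
  rw [Function.update_self, if_neg (by omega)]

/-- The statement that does nothing. -/
def skip : Stmt := write 0 (.const 0) (.read 0 (.const 0))

theorem run_skip (v : ℕ → ℕ) (A : ℕ → ℕ → ℕ) : skip.run v A = A := by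
  simp [skip, run]

open scoped Classical in
theorem run_ite (c : Expr) (p q : Stmt) (v : ℕ → ℕ) (A : ℕ → ℕ → ℕ) :
    (ite c p q).run v A = if c.Holds v A then p.run v A else q.run v A := by
  simp only [run, Expr.Holds]
  congr

end Stmt

/-! ### The local search for a matching -/

section Search

variable {n : ℕ} {G : SimpleGraph (Fin n)}

/-- The array `0` is the adjacency matrix. -/
def HasGraph (G : SimpleGraph (Fin n)) (A : ℕ → ℕ → ℕ) : Prop :=
  ∀ i j : Fin n, A 0 (i * n + j) ≠ 0 ↔ G.Adj i j

/-- The array `a` holds the values of `f`. -/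
def Rep (A : ℕ → ℕ → ℕ) (a : ℕ) (f : Fin n → Fin n) : Prop := ∀ i : Fin n, A a i = f i

/-- The adjacency of the workers `e` and `f`; uses the variable `9`. -/
def adjE (e f : Expr) : Expr := .read 0 (.add (.sum 7 e) f)

theorem holds_adjE {A : ℕ → ℕ → ℕ} (hA : HasGraph G A) {v : ℕ → ℕ} (hv : v 0 = n) {e f : Expr}
    {i j : Fin n} (he : ∀ y, e.eval (Function.update v 9 y) A = i) (hf : f.eval v A = j) :
    (adjE e f).Holds v A ↔ G.Adj i j := by
  rw [← hA i j]
  simp only [adjE, Expr.Holds, Expr.eval, he, hf, Finset.sum_const, Finset.card_range, smul_eq_mul,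
    hv, mul_comm]

variable [DecidableRel G.Adj]

/-- The entry of `insEdge` at the variable `3` for the edge of the variables `x` and `y`. -/
def insE (x y : ℕ) : Expr :=
  .ite (adjE (.var x) (.var y))
    (.ite (.eq (.var 3) (.var x)) (.var y) (.ite (.eq (.var 3) (.var y)) (.var x)
      (.ite (.or (.eq (.read 4 (.var 3)) (.var x)) (.eq (.read 4 (.var 3)) (.var y))) (.var 3)
        (.read 4 (.var 3)))))
    (.read 4 (.var 3))

/-- Updating the array in place is safe because an entry of `insEdge` depends on no other entry of
the old matching. -/
theorem run_ins {A : ℕ → ℕ → ℕ} (hA : HasGraph G A) {f : Fin n → Fin n} (hf : Rep A 4 f)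
    {v : ℕ → ℕ} (hv : v 0 = n) {x y : ℕ} (hx : 10 ≤ x) (hy : 10 ≤ y) {i j : Fin n} (hi : v x = i)
    (hj : v y = j) :
    Rep ((Stmt.fill 1 4 (insE x y)).run v A) 4 (insEdge G i j f) ∧
      ∀ b, b ≠ 4 → (Stmt.fill 1 4 (insE x y)).run v A b = A b := by
  have h := Stmt.run_fill_of_forall (x := 1) (a := 4) (e := insE x y) (v := v) (A := A)
    (F := fun t => if h : t < n then insEdge G i j f ⟨t, h⟩ else 0) ?_
  · refine ⟨fun t => ?_, h.2⟩
    rw [h.1 t (by rw [hv]; exact t.isLt), dif_pos t.isLt]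
  · intro t ht B hB hB4
    rw [hv] at ht
    have hB0 : HasGraph G B := by rw [HasGraph, hB 0 (by norm_num)]; exact hA
    have h4 : B 4 t = f ⟨t, ht⟩ := by rw [hB4 t le_rfl]; exact hf ⟨t, ht⟩
    have ex : ∀ a, Function.update v 3 a x = i := fun a => by
      rw [Function.update_of_ne (by omega), hi]
    have ey : ∀ a, Function.update v 3 a y = j := fun a => by
      rw [Function.update_of_ne (by omega), hj]
    have hadj : (adjE (.var x) (.var y)).Holds (Function.update v 3 t) B ↔ G.Adj i j := by
      refine holds_adjE hB0 ?_ (fun a => ?_) (ey t)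
      · rw [Function.update_of_ne (by omega), hv]
      · rw [Expr.eval_var, Function.update_of_ne (by omega), ex]
    have e3 : Function.update v 3 t 3 = t := Function.update_self _ _ _
    rw [dif_pos ht]
    simp only [insE, Expr.eval_ite, hadj, Expr.holds_eq, Expr.holds_or, Expr.eval_var,
      Expr.eval_read, ex, ey, e3, h4, insEdge, Fin.ext_iff]
    split_ifs <;> simp_all

/-- Copy the array `a` to the array `b`. -/
def copy (a b : ℕ) : Stmt := Stmt.fill 1 b (.read a (.var 3))

theorem run_copy {A : ℕ → ℕ → ℕ} {a b : ℕ} (hab : a ≠ b) {f : Fin n → Fin n} (hf : Rep A a f)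
    {v : ℕ → ℕ} (hv : v 0 = n) : Rep ((copy a b).run v A) b f ∧
      ∀ c, c ≠ b → (copy a b).run v A c = A c := by
  have h := Stmt.run_fill_of_forall (x := 1) (a := b) (e := .read a (.var 3)) (v := v) (A := A)
    (F := A a) ?_
  · refine ⟨fun t => ?_, h.2⟩
    rw [copy, h.1 t (by rw [hv]; exact t.isLt), hf t]
  · intro t ht B hB _
    simp [hB a hab]

/-- The number of matched workers in the array `a`. -/
def matchedE (a : ℕ) : Expr := .count 1 (.not (.eq (.read a (.var 3)) (.var 3)))

theorem eval_matchedE {A : ℕ → ℕ → ℕ} {a : ℕ} {f : Fin n → Fin n} (hf : Rep A a f)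
    {v : ℕ → ℕ} (hv : v 0 = n) : (matchedE a).eval v A = matched f := by
  classical
  rw [matchedE, Expr.eval_count, matched, hv, ← Finset.card_map Fin.valEmbedding]
  congr 1
  ext t
  simp only [Expr.holds_not, Expr.holds_eq, Expr.eval_read, Expr.eval_var, Function.update_self,
    Finset.mem_filter, Finset.mem_range, Finset.mem_map, Finset.mem_univ, true_and,
    Fin.valEmbedding_apply]
  constructor
  · rintro ⟨ht, h⟩
    refine ⟨⟨t, ht⟩, fun h' => h ?_, rfl⟩
    have := hf ⟨t, ht⟩
    rw [h'] at this
    exact this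
  · rintro ⟨i, hi, rfl⟩
    refine ⟨i.isLt, fun h => hi (Fin.ext ?_)⟩
    rw [← hf i]
    exact h

/-- Copy the matching and insert a list of edges, given by variables. -/
def insAll : List (ℕ × ℕ) → Stmt
  | T => T.foldl (fun p xy => .seq p (Stmt.fill 1 4 (insE xy.1 xy.2))) (copy 3 4)

theorem run_insAll {A : ℕ → ℕ → ℕ} (hA : HasGraph G A) {f : Fin n → Fin n} (hf : Rep A 3 f)
    {v : ℕ → ℕ} (hv : v 0 = n) (T : List ((ℕ × ℕ) × (Fin n × Fin n)))
    (hT : ∀ p ∈ T, 10 ≤ p.1.1 ∧ 10 ≤ p.1.2 ∧ v p.1.1 = p.2.1 ∧ v p.1.2 = p.2.2) :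
    Rep ((insAll (T.map Prod.fst)).run v A) 4 (insEdges G (T.map Prod.snd) f) ∧
      ∀ b, b ≠ 4 → (insAll (T.map Prod.fst)).run v A b = A b := by
  induction T using List.reverseRecOn with
  | nil => exact run_copy (by norm_num) hf hv
  | append_singleton T p ih =>
    obtain ⟨h1, h2⟩ := ih fun p hp => hT p (by simp [hp])
    obtain ⟨hp1, hp2, hp3, hp4⟩ := hT p (by simp)
    have hA' : HasGraph G ((insAll (T.map Prod.fst)).run v A) := by
      rw [HasGraph, h2 0 (by norm_num)]; exact hA
    have h := run_ins hA' h1 hv hp1 hp2 hp3 hp4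
    have e : (insAll ((T ++ [p]).map Prod.fst)).run v A =
        (Stmt.fill 1 4 (insE p.1.1 p.1.2)).run v ((insAll (T.map Prod.fst)).run v A) := by
      simp [insAll, List.foldl_append, Stmt.run]
    rw [e]
    refine ⟨?_, fun b hb => (h.2 b hb).trans (h2 b hb)⟩
    have e2 : insEdges G ((T ++ [p]).map Prod.snd) f =
        insEdge G p.2.1 p.2.2 (insEdges G (T.map Prod.snd) f) := by
      simp [insEdges, List.foldl_append]
    rw [e2]
    exact h.1

/-- The statement improves the matching in the array `3` unless it has the property `Opt`. -/
def Improves (G : SimpleGraph (Fin n)) (v : ℕ → ℕ) (p : Stmt) (Opt : (Fin n → Fin n) → Prop) :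
    Prop := ∀ A f, HasGraph G A → Rep A 3 f → IsMate G f → ∃ f', IsMate G f' ∧
      Rep (p.run v A) 3 f' ∧ (∀ b, b ≠ 3 → b ≠ 4 → p.run v A b = A b) ∧
      ((Opt f ∧ f' = f) ∨ (¬ Opt f ∧ matched f < matched f'))

/-- Insert a list of edges if that enlarges the matching. -/
def tryStmt (T : List (ℕ × ℕ)) : Stmt :=
  .seq (insAll T) (.ite (.lt (matchedE 3) (matchedE 4)) (copy 4 3) Stmt.skip)

theorem improves_tryStmt {v : ℕ → ℕ} (hv : v 0 = n) (T : List ((ℕ × ℕ) × (Fin n × Fin n)))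
    (hT : ∀ p ∈ T, 10 ≤ p.1.1 ∧ 10 ≤ p.1.2 ∧ v p.1.1 = p.2.1 ∧ v p.1.2 = p.2.2) :
    Improves G v (tryStmt (T.map Prod.fst))
      fun f => matched (insEdges G (T.map Prod.snd) f) ≤ matched f := by
  intro A f hA hf hm
  obtain ⟨h1, h2⟩ := run_insAll hA hf hv T hT
  set A' := (insAll (T.map Prod.fst)).run v A with hA'
  have hf' : Rep A' 3 f := fun i => by rw [h2 3 (by norm_num)]; exact hf i
  have e : (tryStmt (T.map Prod.fst)).run v A =
    (Stmt.ite (.lt (matchedE 3) (matchedE 4)) (copy 4 3) Stmt.skip).run v A' := rfl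
  rw [e, Stmt.run_ite]
  simp only [Expr.holds_lt, eval_matchedE hf' hv, eval_matchedE h1 hv]
  split_ifs with h
  · obtain ⟨h3, h4⟩ := run_copy (b := 3) (by norm_num) h1 hv
    exact ⟨_, hm.insEdges _, h3, fun b hb hb' => (h4 b hb).trans (h2 b hb'),
      Or.inr ⟨by omega, h⟩⟩
  · rw [Stmt.run_skip]
    exact ⟨f, hm, hf', fun b _ hb' => h2 b hb', Or.inl ⟨by omega, rfl⟩⟩

omit [DecidableRel G.Adj] in
-- As long as no body improves, the matching is still `f`, so the properties `Opt j` are all tested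
-- for `f` itself. After an improvement the size never drops again.
theorem Improves.forN {v : ℕ → ℕ} (hv : v 0 = n) {x : ℕ} {p : Stmt}
    {Opt : Fin n → (Fin n → Fin n) → Prop}
    (h : ∀ j : Fin n, Improves G (Function.update v (x + 2) j) p (Opt j)) :
    Improves G v (Stmt.forN x p) fun f => ∀ j, Opt j f := by
  intro A f hA hf hm
  have key : ∀ m ≤ n, ∃ f', IsMate G f' ∧
      Rep ((List.range m).foldl (fun A j => p.run (Function.update v (x + 2) j) A) A) 3 f' ∧
      (∀ b, b ≠ 3 → b ≠ 4 →
        (List.range m).foldl (fun A j => p.run (Function.update v (x + 2) j) A) A b = A b) ∧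
      (((∀ j : Fin n, j.val < m → Opt j f) ∧ f' = f) ∨
        ((¬ ∀ j : Fin n, j.val < m → Opt j f) ∧ matched f < matched f')) := by
    intro m
    induction m with
    | zero =>
      intro _
      exact ⟨f, hm, hf, fun _ _ _ => rfl, Or.inl ⟨fun j hj => absurd hj (by omega), rfl⟩⟩
    | succ m ih =>
      intro hmn
      obtain ⟨f', h1, h2, h3, h4⟩ := ih (by omega)
      rw [List.range_succ, List.foldl_append]
      set A' := (List.range m).foldl (fun A j => p.run (Function.update v (x + 2) j) A) A
      have hA' : HasGraph G A' := by rw [HasGraph, h3 0 (by norm_num) (by norm_num)]; exact hA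
      obtain ⟨f'', h5, h6, h7, h8⟩ := h ⟨m, by omega⟩ A' f' hA' h2 h1
      refine ⟨f'', h5, h6, fun b hb hb' => (h7 b hb hb').trans (h3 b hb hb'), ?_⟩
      rcases h4 with ⟨h4, rfl⟩ | ⟨h4, h4'⟩
      · rcases h8 with ⟨h8, rfl⟩ | ⟨h8, h8'⟩
        · refine Or.inl ⟨fun j hj => ?_, rfl⟩
          rcases Nat.lt_succ_iff_lt_or_eq.mp hj with hj | hj
          · exact h4 j hj
          · have : j = ⟨m, by omega⟩ := Fin.ext hj
            rw [this]
            exact h8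
        · exact Or.inr ⟨fun h9 => h8 (h9 ⟨m, by omega⟩ (Nat.lt_succ_self m)), h8'⟩
      · refine Or.inr ⟨fun h9 => h4 fun j hj => h9 j (by omega), h4'.trans_le ?_⟩
        rcases h8 with ⟨-, rfl⟩ | ⟨-, h8⟩
        · exact le_rfl
        · exact h8.le
  obtain ⟨f', h1, h2, h3, h4⟩ := key n le_rfl
  have e : (Stmt.forN x p).run v A =
      (List.range n).foldl (fun A j => p.run (Function.update v (x + 2) j) A) A := by
    simp only [Stmt.run, hv]
  rw [e]
  refine ⟨f', h1, h2, h3, ?_⟩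
  rcases h4 with ⟨h4, h4'⟩ | ⟨h4, h4'⟩
  · exact Or.inl ⟨fun j => h4 j j.isLt, h4'⟩
  · exact Or.inr ⟨fun h5 => h4 fun j _ => h5 j, h4'⟩

/-- Try all lists of `d` edges followed by the edges of `T`. -/
def searchStmt : ℕ → List (ℕ × ℕ) → Stmt
  | 0, T => tryStmt T
  | d + 1, T => .forN (2 * d + 8) (.forN (2 * d + 9) (searchStmt d ((2 * d + 10, 2 * d + 11) :: T)))

theorem improves_searchStmt (d : ℕ) : ∀ {v : ℕ → ℕ}, v 0 = n →
    ∀ T : List ((ℕ × ℕ) × (Fin n × Fin n)), (∀ p ∈ T, 2 * d + 10 ≤ p.1.1 ∧ 2 * d + 10 ≤ p.1.2 ∧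
      v p.1.1 = p.2.1 ∧ v p.1.2 = p.2.2) → Improves G v (searchStmt d (T.map Prod.fst)) fun f =>
        ∀ S : List (Fin n × Fin n), S.length = d →
          matched (insEdges G (S ++ T.map Prod.snd) f) ≤ matched f := by
  induction d with
  | zero =>
    intro v hv T hT
    have h := improves_tryStmt (G := G) hv T (by simpa using hT)
    intro A f hA hf hm
    obtain ⟨f', h1, h2, h3, h4⟩ := h A f hA hf hm
    refine ⟨f', h1, h2, h3, ?_⟩
    simpa [List.length_eq_zero_iff] using h4
  | succ d ih =>
    intro v hv T hT
    have h : Improves G v (searchStmt (d + 1) (T.map Prod.fst)) fun f => ∀ i j : Fin n,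
        ∀ S : List (Fin n × Fin n), S.length = d →
          matched (insEdges G (S ++ (i, j) :: T.map Prod.snd) f) ≤ matched f := by
      refine Improves.forN hv fun i => Improves.forN ?_ fun j => ?_
      · rw [Function.update_of_ne (by omega), hv]
      · refine ih ?_ (((2 * d + 10, 2 * d + 11), (i, j)) :: T) ?_
        · rw [Function.update_of_ne (by omega), Function.update_of_ne (by omega), hv]
        · intro p hp
          rcases List.mem_cons.mp hp with rfl | hp
          · refine ⟨by simp, by simp, ?_, ?_⟩
            · simp only
              rw [Function.update_of_ne (by omega), Function.update_self]
            · simp only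
              rw [Function.update_self]
          · obtain ⟨h1, h2, h3, h4⟩ := hT p hp
            refine ⟨by omega, by omega, ?_, ?_⟩
            · rw [Function.update_of_ne (by omega), Function.update_of_ne (by omega), h3]
            · rw [Function.update_of_ne (by omega), Function.update_of_ne (by omega), h4]
    intro A f hA hf hm
    obtain ⟨f', h1, h2, h3, h4⟩ := h A f hA hf hm
    refine ⟨f', h1, h2, h3, ?_⟩
    have e : (∀ S : List (Fin n × Fin n), S.length = d + 1 →
        matched (insEdges G (S ++ T.map Prod.snd) f) ≤ matched f) ↔ ∀ i j : Fin n,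
        ∀ S : List (Fin n × Fin n), S.length = d →
          matched (insEdges G (S ++ (i, j) :: T.map Prod.snd) f) ≤ matched f := by
      constructor
      · intro h i j S hS
        have := h (S ++ [(i, j)]) (by simp [hS])
        simpa using this
      · intro h S hS
        obtain ⟨S', p, rfl⟩ : ∃ S' p, S = S' ++ [p] :=
          ⟨S.dropLast, S.getLast (by rintro rfl; simp at hS), (List.dropLast_append_getLast _).symm⟩
        have := h p.1 p.2 S' (by simpa using hS)
        simpa using this
    beta_reduce at h4 ⊢
    rw [e]
    exact h4

/-- Local search, starting from the empty matching. -/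
def matchStmt (c : ℕ) : Stmt :=
  .seq (Stmt.fill 1 3 (.var 3)) (.forN 0 (searchStmt c []))

/-- Each round enlarges the matching unless it is optimal, and a matching covers at most `n`
workers; hence `n` rounds suffice. -/
theorem run_matchStmt (c : ℕ) {v : ℕ → ℕ} (hv : v 0 = n) {A : ℕ → ℕ → ℕ} (hA : HasGraph G A) :
    ∃ f : Fin n → Fin n, IsMate G f ∧ LocallyOptimal G c f ∧ Rep ((matchStmt c).run v A) 3 f ∧
      ∀ b, b ≠ 3 → b ≠ 4 → (matchStmt c).run v A b = A b := by
  have h0 := Stmt.run_fill_of_forall (x := 1) (a := 3) (e := .var 3) (v := v) (A := A)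
    (F := fun i => i) (fun i _ B _ _ => by simp)
  set A₀ := (Stmt.fill 1 3 (.var 3)).run v A with hA₀
  set Opt : (Fin n → Fin n) → Prop := fun f => ∀ S : List (Fin n × Fin n), S.length = c →
    matched (insEdges G S f) ≤ matched f with hOpt
  have hs : ∀ j : ℕ, Improves G (Function.update v 2 j) (searchStmt c []) Opt := by
    intro j
    have := improves_searchStmt (G := G) c (v := Function.update v 2 j)
      (by rw [Function.update_of_ne (by omega), hv]) [] (by simp)
    simpa using this
  have key : ∀ m, ∃ f : Fin n → Fin n, IsMate G f ∧
      Rep ((List.range m).foldl (fun A j => (searchStmt c []).run (Function.update v 2 j) A) A₀)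
        3 f ∧
      (∀ b, b ≠ 3 → b ≠ 4 →
        (List.range m).foldl (fun A j => (searchStmt c []).run (Function.update v 2 j) A) A₀ b =
          A b) ∧ (Opt f ∨ m ≤ matched f) := by
    intro m
    induction m with
    | zero =>
      refine ⟨id, ⟨fun _ => rfl, fun x hx => absurd rfl hx⟩, fun i => ?_, fun b hb _ => h0.2 b hb,
        Or.inr (Nat.zero_le _)⟩
      exact h0.1 i (by rw [hv]; exact i.isLt)
    | succ m ih =>
      obtain ⟨f, h1, h2, h3, h4⟩ := ih
      rw [List.range_succ, List.foldl_append]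
      set A' := (List.range m).foldl
        (fun A j => (searchStmt c []).run (Function.update v 2 j) A) A₀
      have hA' : HasGraph G A' := by rw [HasGraph, h3 0 (by norm_num) (by norm_num)]; exact hA
      obtain ⟨f', h5, h6, h7, h8⟩ := hs m A' f hA' h2 h1
      refine ⟨f', h5, h6, fun b hb hb' => (h7 b hb hb').trans (h3 b hb hb'), ?_⟩
      rcases h8 with ⟨h8, rfl⟩ | ⟨h8, h8'⟩
      · exact Or.inl h8
      · rcases h4 with h4 | h4
        · exact absurd h4 h8
        · exact Or.inr (by omega)
  obtain ⟨f, h1, h2, h3, h4⟩ := key n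
  have e : (matchStmt c).run v A =
      (List.range n).foldl (fun A j => (searchStmt c []).run (Function.update v 2 j) A) A₀ := by
    simp only [matchStmt, Stmt.run, hv]
    rfl
  refine ⟨f, h1, ?_, by rw [e]; exact h2, by rw [e]; exact h3⟩
  have h5 : Opt f := h4.elim id fun h S _ => (matched_le _).trans h
  intro T hT
  rcases Nat.eq_zero_or_pos n with rfl | hn
  · simp [matched]
  -- Inserting a loop does nothing, so shorter lists can be padded to the length `c` that the search
  -- covers.
  · have h6 := h5 (List.replicate (c - T.length) (⟨0, hn⟩, ⟨0, hn⟩) ++ T) (by simp; omega)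
    have h7 : ∀ d, insEdges G (List.replicate d (⟨0, hn⟩, ⟨0, hn⟩) ++ T) f = insEdges G T f := by
      intro d
      induction d with
      | zero => rfl
      | succ d ih =>
        rw [← ih, List.replicate_succ]
        have : insEdge G ⟨0, hn⟩ ⟨0, hn⟩ f = f := by
          funext i
          simp [insEdge]
        simp only [insEdges, List.cons_append, List.foldl_cons, this]
    rwa [h7] at h6

end Search

/-! ### Expressions that use the variables from `9` on for intermediate results -/

/-- The expression `e` has the value `a`, whatever the values of the variables from `9` on. -/
def Val (v : ℕ → ℕ) (A : ℕ → ℕ → ℕ) (e : Expr) (a : ℕ) : Prop :=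
  ∀ v' : ℕ → ℕ, (∀ x < 9, v' x = v x) → e.eval v' A = a

/-- The expression `e` holds iff `p`, whatever the values of the variables from `9` on. -/
def Tests (v : ℕ → ℕ) (A : ℕ → ℕ → ℕ) (e : Expr) (p : Prop) : Prop :=
  ∀ v' : ℕ → ℕ, (∀ x < 9, v' x = v x) → (e.Holds v' A ↔ p)

section Val

variable {n : ℕ} {v : ℕ → ℕ} {A : ℕ → ℕ → ℕ} {e f c : Expr} {a b : ℕ} {p q : Prop}

theorem Val.eval (h : Val v A e a) : e.eval v A = a := h v fun _ _ => rfl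

theorem Val.var {x : ℕ} (hx : x < 9) (h : v x = a) : Val v A (.var x) a :=
  fun v' hv' => by rw [Expr.eval_var, hv' x hx, h]

theorem Val.const (a : ℕ) : Val v A (.const a) a := fun _ _ => rfl

theorem Val.add (he : Val v A e a) (hf : Val v A f b) : Val v A (.add e f) (a + b) :=
  fun v' hv' => by rw [Expr.eval_add, he v' hv', hf v' hv']

theorem Val.sub (he : Val v A e a) (hf : Val v A f b) : Val v A (.sub e f) (a - b) :=
  fun v' hv' => by rw [Expr.eval_sub, he v' hv', hf v' hv']

theorem Val.read (x : ℕ) (he : Val v A e a) : Val v A (.read x e) (A x a) :=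
  fun v' hv' => by rw [Expr.eval_read, he v' hv']

theorem Val.ite [Decidable p] (hc : Tests v A c p) (he : p → Val v A e a)
    (hf : ¬ p → Val v A f b) : Val v A (.ite c e f) (if p then a else b) := fun v' hv' => by
  rw [Expr.eval_ite]
  have h := hc v' hv'
  split_ifs with h1 h2 h2
  · exact he h2 v' hv'
  · exact absurd (h.mp h1) h2
  · exact absurd (h.mpr h2) h1
  · exact hf h2 v' hv'

theorem Val.lt (he : Val v A e a) (hf : Val v A f b) : Tests v A (.lt e f) (a < b) :=
  fun v' hv' => by rw [Expr.holds_lt, he v' hv', hf v' hv']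

theorem Val.eq (he : Val v A e a) (hf : Val v A f b) : Tests v A (.eq e f) (a = b) :=
  fun v' hv' => by rw [Expr.holds_eq, he v' hv', hf v' hv']

theorem Tests.of_val (he : Val v A e a) : Tests v A e (a ≠ 0) :=
  fun v' hv' => by rw [Expr.Holds, he v' hv']

theorem Tests.not (he : Tests v A e p) : Tests v A (.not e) (¬ p) :=
  fun v' hv' => by rw [Expr.holds_not, he v' hv']

theorem Tests.and (he : Tests v A e p) (hf : p → Tests v A f q) : Tests v A (.and e f) (p ∧ q) :=
  fun v' hv' => by
    rw [Expr.holds_and, he v' hv']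
    exact and_congr_right fun h => hf h v' hv'

theorem Tests.or (he : Tests v A e p) (hf : Tests v A f q) : Tests v A (.or e f) (p ∨ q) :=
  fun v' hv' => by rw [Expr.holds_or, he v' hv', hf v' hv']

theorem Tests.congr (he : Tests v A e p) (h : p ↔ q) : Tests v A e q :=
  fun v' hv' => (he v' hv').trans h

theorem agree_update {v' : ℕ → ℕ} (h : ∀ x < 9, v' x = v x) (y j : ℕ) :
    ∀ x < 9, Function.update v' y j x = Function.update v y j x := fun x hx => by
  by_cases hxy : x = y
  · subst hxy
    rw [Function.update_self, Function.update_self]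
  · rw [Function.update_of_ne hxy, Function.update_of_ne hxy, h x hx]

theorem agree_update_scratch {v' : ℕ → ℕ} (h : ∀ x < 9, v' x = v x) {y : ℕ} (hy : 9 ≤ y) (j : ℕ) :
    ∀ x < 9, Function.update v' y j x = v x := fun x hx => by
  rw [Function.update_of_ne (by omega), h x hx]

theorem Val.sum (hv : v 0 = n) {x : ℕ} {a : Fin n → ℕ}
    (h : ∀ j : Fin n, Val (Function.update v (x + 2) j) A e (a j)) :
    Val v A (.sum x e) (∑ j, a j) := fun v' hv' => by
  rw [Expr.eval, hv' 0 (by norm_num), hv, Finset.sum_range]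
  exact Finset.sum_congr rfl fun j _ => h j _ (agree_update hv' _ _)

theorem Val.count (hv : v 0 = n) {x : ℕ} {p : Fin n → Prop} [DecidablePred p]
    (h : ∀ j : Fin n, Tests (Function.update v (x + 2) j) A e (p j)) :
    Val v A (.count x e) (Finset.univ.filter p).card := by
  rw [Finset.card_filter]
  exact Val.sum hv fun j => Val.ite (h j) (fun _ => Val.const 1) fun _ => Val.const 0

theorem Tests.exists (hv : v 0 = n) {x : ℕ} {p : Fin n → Prop}
    (h : ∀ j : Fin n, Tests (Function.update v (x + 2) j) A e (p j)) :
    Tests v A (.sum x e) (∃ j, p j) := fun v' hv' => by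
  rw [Expr.holds_sum, hv' 0 (by norm_num), hv]
  constructor
  · rintro ⟨j, hj, h'⟩
    exact ⟨⟨j, hj⟩, (h ⟨j, hj⟩ _ (agree_update hv' _ _)).mp h'⟩
  · rintro ⟨j, h'⟩
    exact ⟨j, j.isLt, (h j _ (agree_update hv' _ _)).mpr h'⟩

theorem Tests.adj {G : SimpleGraph (Fin n)} (hA : HasGraph G A) (hv : v 0 = n) {i j : Fin n}
    (he : Val v A e i) (hf : Val v A f j) : Tests v A (adjE e f) (G.Adj i j) := fun v' hv' =>
  holds_adjE hA (by rw [hv' 0 (by norm_num), hv])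
    (fun y => he _ (agree_update_scratch hv' (by norm_num) y)) (hf v' hv')

/-- The product; the first factor is at most the variable `0`. -/
def mulE (e f : Expr) : Expr := .sum 7 (.ite (.lt (.var 9) e) f (.const 0))

theorem sum_range_ite_lt {a : ℕ} (h : a ≤ n) (b : ℕ) :
    ∑ j ∈ Finset.range n, (if j < a then b else 0) = a * b := by
  rw [← Finset.sum_filter, Finset.sum_const, smul_eq_mul]
  congr 1
  rw [show (Finset.range n).filter (fun j => j < a) = Finset.range a by
    ext j; simp only [Finset.mem_filter, Finset.mem_range]; omega, Finset.card_range]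

theorem Val.mul (hv : v 0 = n) (he : Val v A e a) (hf : Val v A f b) (ha : a ≤ n) :
    Val v A (mulE e f) (a * b) := fun v' hv' => by
  rw [mulE, Expr.eval, hv' 0 (by norm_num), hv, ← sum_range_ite_lt ha b]
  refine Finset.sum_congr rfl fun j _ => ?_
  have h := agree_update_scratch hv' (y := 7 + 2) (by norm_num) j
  simp only [Expr.eval_ite, Expr.holds_lt, he _ h, hf _ h, Expr.eval_var, Expr.eval_const,
    Function.update_self]

/-- The quotient. -/
def divE (e f : Expr) : Expr :=
  -- The quotient is the number of `j` with `(j + 1) * f ≤ e`; the inner sum computes this product.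
  .count 7 (.not (.lt e (.sum 8 (.ite (.lt (.var 10) (.add (.var 9) (.const 1))) f (.const 0)))))

theorem Val.div (hv : v 0 = n) (he : Val v A e a) (hf : Val v A f b) (hb : 0 < b)
    (ha : a / b ≤ n) : Val v A (divE e f) (a / b) := fun v' hv' => by
  classical
  rw [divE, Expr.eval_count, hv' 0 (by norm_num), hv]
  rw [Finset.filter_congr (q := fun j => j < a / b), Finset.card_filter, sum_range_ite_lt ha 1,
    mul_one]
  intro j hj
  have h := agree_update_scratch hv' (y := 7 + 2) (by norm_num) j
  rw [Expr.holds_not, Expr.holds_lt, he _ h, Expr.eval, h 0 (by norm_num), hv]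
  have h2 : ∀ i, (Expr.ite (.lt (.var 10) (.add (.var 9) (.const 1))) f (.const 0)).eval
      (Function.update (Function.update v' (7 + 2) j) (8 + 2) i) A = if i < j + 1 then b else 0 := by
    intro i
    have h' := agree_update_scratch h (y := 8 + 2) (by norm_num) i
    simp [Expr.eval_ite, hf _ h']
  simp only [h2]
  rw [sum_range_ite_lt (Finset.mem_range.mp hj), not_lt, ← Nat.le_div_iff_mul_le hb]
  omega

/-- The remainder. -/
def modE (e f : Expr) : Expr := .sub e (mulE (divE e f) f)

theorem Val.mod (hv : v 0 = n) (he : Val v A e a) (hf : Val v A f b) (hb : 0 < b)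
    (ha : a / b ≤ n) : Val v A (modE e f) (a % b) := by
  have h := he.sub ((he.div hv hf hb ha).mul hv hf ha)
  rwa [show a - a / b * b = a % b by have := Nat.div_add_mod' a b; omega] at h

/-- The first value of the variable `y + 2` for which `e` holds; uses the variable `x + 2`. -/
def firstE (x y : ℕ) (e : Expr) : Expr :=
  .count x (.not (.sum y (.and (.lt (.var (y + 2)) (.add (.var (x + 2)) (.const 1))) e)))

open scoped Classical in
/-- The first index with the property `p`, or `n` if there is none. -/
noncomputable def firstIndex (p : Fin n → Prop) : ℕ :=
  (Finset.univ.filter fun i => ¬ ∃ j ≤ i, p j).card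

theorem Val.first (hv : v 0 = n) {x y : ℕ} (hx : x + 2 < 9) (hy : y + 2 < 9) (hxy : x ≠ y)
    {p : Fin n → Prop} (h : ∀ i j : Fin n,
      Tests (Function.update (Function.update v (x + 2) i) (y + 2) j) A e (p j)) :
    Val v A (firstE x y e) (firstIndex p) := by
  classical
  refine Val.count hv fun i => Tests.not ?_
  refine (Tests.exists (p := fun j : Fin n => (j : ℕ) < i + 1 ∧ p j) ?_ fun j => ?_).congr ?_
  · rw [Function.update_of_ne (by omega), hv]
  · refine Tests.and (Val.lt (Val.var hy (Function.update_self _ _ _))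
      (Val.add (Val.var hx ?_) (Val.const 1))) fun _ => h i j
    rw [Function.update_of_ne (by omega), Function.update_self]
  · simp only [Nat.lt_succ_iff, Fin.le_def]

theorem exists_firstIndex_eq {p : Fin n → Prop} (h : ∃ j, p j) :
    ∃ j : Fin n, p j ∧ firstIndex p = j := by
  classical
  obtain ⟨j, hj, hmin⟩ := WellFounded.has_min wellFounded_lt {j | p j} h
  refine ⟨j, hj, ?_⟩
  rw [firstIndex, show (Finset.univ.filter fun i => ¬ ∃ j ≤ i, p j) = Finset.Iio j by
    ext i
    simp only [Finset.mem_filter, Finset.mem_univ, true_and, Finset.mem_Iio, not_exists, not_and]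
    constructor
    · intro h'
      by_contra! h''
      exact h' j h'' hj
    · intro h' j' hj' hp
      exact hmin j' hp (hj'.trans_lt h'), Fin.card_Iio]

theorem firstIndex_of_not {p : Fin n → Prop} (h : ¬ ∃ j, p j) : firstIndex p = n := by
  classical
  rw [firstIndex, Finset.filter_true_of_mem, Finset.card_univ, Fintype.card_fin]
  rintro i - ⟨j, -, hj⟩
  exact h ⟨j, hj⟩

end Val

/-! ### Ordering the edges so that the leaders of a chunk have no edges to later chunks -/

section Order

variable {α : Type*} [DecidableEq α] {U : Finset α} {C : α → α → Prop} {O : ℕ → α} {c r m κ : ℕ}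

open scoped Classical in
/-- The elements that are not used before `t` and are joined to a leader of the chunk `κ` before
`t`. -/
noncomputable def pending (U : Finset α) (C : α → α → Prop) (O : ℕ → α) (c r κ t : ℕ) : Finset α :=
  U.filter fun y => (∀ j < t, O j ≠ y) ∧ ∃ j < t, j / c = κ ∧ j % c < r ∧ C (O j) y

theorem mem_pending {t : ℕ} {y : α} : y ∈ pending U C O c r κ t ↔
    y ∈ U ∧ (∀ j < t, O j ≠ y) ∧ ∃ j < t, j / c = κ ∧ j % c < r ∧ C (O j) y := by
  simp only [pending, Finset.mem_filter]

open scoped Classical in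
-- If a pending element is taken, it leaves the set and adds at most one new element, since one of
-- its at most two neighbours has been used already. If nothing is pending, the next element adds at
-- most two.
theorem card_pending_le_two (hC : ∀ x y, C x y → C y x)
    (hdeg : ∀ x ∈ U, (U.filter (C x)).card ≤ 2) (hU : ∀ t < m, O t ∈ U)
    (hO : ∀ t < m, (pending U C O c r (t / c) t).Nonempty → O t ∈ pending U C O c r (t / c) t)
    (hm : κ * c + c ≤ m) {b : ℕ} (hb : b ≤ r) (hbc : b ≤ c) :
    (pending U C O c r κ (κ * c + b)).card ≤ 2 := by
  induction b with
  | zero =>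
    rw [Finset.card_eq_zero.mpr]
    · norm_num
    · refine Finset.eq_empty_of_forall_notMem fun y hy => ?_
      obtain ⟨-, -, j, hj, rfl, -⟩ := mem_pending.mp hy
      have := Nat.div_mul_le_self j c
      omega
  | succ b ih =>
    have ih := ih (by omega) (by omega)
    set t := κ * c + b with ht
    have htm : t < m := by omega
    have htc : t / c = κ := chunk_div (by omega)
    have hO := hO t htm
    rw [htc] at hO
    set Y := U.filter fun y => (∀ j < t + 1, O j ≠ y) ∧ C (O t) y with hY
    have hsub : pending U C O c r κ (κ * c + (b + 1)) ⊆ (pending U C O c r κ t).erase (O t) ∪ Y := by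
      intro y hy
      obtain ⟨h1, h2, j, h3, h4, h5, h6⟩ := mem_pending.mp hy
      rw [← add_assoc, ← ht] at h2 h3
      rcases Nat.lt_succ_iff_lt_or_eq.mp h3 with h3 | rfl
      · exact Finset.mem_union_left _ (Finset.mem_erase.mpr ⟨(h2 t (by omega)).symm,
          mem_pending.mpr ⟨h1, fun j hj => h2 j (by omega), j, h3, h4, h5, h6⟩⟩)
      · exact Finset.mem_union_right _ (Finset.mem_filter.mpr ⟨h1, h2, h6⟩)
    have hYsub : Y ⊆ U.filter (C (O t)) := fun y hy => by
      rw [hY, Finset.mem_filter] at hy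
      exact Finset.mem_filter.mpr ⟨hy.1, hy.2.2⟩
    refine (Finset.card_le_card hsub).trans ((Finset.card_union_le _ _).trans ?_)
    by_cases hne : (pending U C O c r κ t).Nonempty
    · have h1 := hO hne
      obtain ⟨-, -, j, hj, -, -, hCj⟩ := mem_pending.mp h1
      have h2 : Y ⊆ (U.filter (C (O t))).erase (O j) := fun y hy => by
        refine Finset.mem_erase.mpr ⟨?_, hYsub hy⟩
        rw [hY, Finset.mem_filter] at hy
        exact (hy.2.1 j (by omega)).symm
      have h3 := Finset.card_le_card h2
      rw [Finset.card_erase_of_mem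
        (Finset.mem_filter.mpr ⟨hU j (by omega), hC _ _ hCj⟩)] at h3
      have h4 := hdeg _ (hU t htm)
      rw [Finset.card_erase_of_mem h1]
      omega
    · rw [Finset.not_nonempty_iff_eq_empty.mp hne]
      have h4 := hdeg _ (hU t htm)
      have := Finset.card_le_card hYsub
      simp only [Finset.erase_empty, Finset.card_empty]
      omega

/-- Elements that are not leaders add nothing to the set, and each takes one pending element if
there is one. -/
theorem card_pending_filler
    (hO : ∀ t < m, (pending U C O c r (t / c) t).Nonempty → O t ∈ pending U C O c r (t / c) t)
    (hm : κ * c + c ≤ m) (h0 : (pending U C O c r κ (κ * c + r)).card ≤ 2) {b : ℕ}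
    (hb : r + b ≤ c) : (pending U C O c r κ (κ * c + (r + b))).card ≤ 2 - b := by
  induction b with
  | zero => exact h0
  | succ b ih =>
    have ih := ih (by omega)
    set t := κ * c + (r + b) with ht
    have htc : t / c = κ := chunk_div (by omega)
    have htr : t % c = r + b := chunk_mod (by omega)
    have hO := hO t (by omega)
    rw [htc] at hO
    have hsub : pending U C O c r κ (κ * c + (r + (b + 1))) ⊆
        (pending U C O c r κ t).erase (O t) := by
      intro y hy
      obtain ⟨h1, h2, j, h3, h4, h5, h6⟩ := mem_pending.mp hy
      rw [← add_assoc r, ← add_assoc (κ * c), ← ht] at h2 h3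
      rcases Nat.lt_succ_iff_lt_or_eq.mp h3 with h3 | rfl
      · exact Finset.mem_erase.mpr ⟨(h2 t (by omega)).symm,
          mem_pending.mpr ⟨h1, fun j hj => h2 j (by omega), j, h3, h4, h5, h6⟩⟩
      · omega
    refine (Finset.card_le_card hsub).trans ?_
    by_cases hne : (pending U C O c r κ t).Nonempty
    · rw [Finset.card_erase_of_mem (hO hne)]
      omega
    · rw [Finset.not_nonempty_iff_eq_empty.mp hne]
      simp

open scoped Classical in
-- At most two elements are pending after the leaders of a chunk, and at least two fillers follow.
-- So nothing is pending at the end of the chunk, and no later element is joined to one of its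
-- leaders.
theorem not_joined_of_order (hC : ∀ x y, C x y → C y x)
    (hdeg : ∀ x ∈ U, (U.filter (C x)).card ≤ 2) (hU : ∀ t < m, O t ∈ U)
    (hinj : ∀ t < m, ∀ j < t, O j ≠ O t)
    (hO : ∀ t < m, (pending U C O c r (t / c) t).Nonempty → O t ∈ pending U C O c r (t / c) t)
    (hrc : r + 2 ≤ c) (hm : κ * c + c ≤ m) {b t : ℕ} (hb : b < r) (ht : κ * c + c ≤ t)
    (htm : t < m) : ¬ C (O (κ * c + b)) (O t) := by
  intro h
  have h1 : (pending U C O c r κ (κ * c + (r + (c - r)))).card ≤ 2 - (c - r) :=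
    card_pending_filler hO hm
      (card_pending_le_two hC hdeg hU hO hm le_rfl (by omega)) (by omega)
  rw [show r + (c - r) = c by omega, show 2 - (c - r) = 0 by omega, Nat.le_zero,
    Finset.card_eq_zero] at h1
  have h2 : O t ∈ pending U C O c r κ (κ * c + c) := mem_pending.mpr ⟨hU t htm,
    fun j hj => hinj t htm j (by omega), κ * c + b, by omega, chunk_div (by omega),
    by rw [chunk_mod (by omega)]; exact hb, h⟩
  rw [h1] at h2
  exact absurd h2 (Finset.notMem_empty _)

end Order

/-! ### Ordering the edges of a matching. -/

section OrderedPairs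

variable {n m : ℕ} {G : SimpleGraph (Fin n)} {f : Fin n → Fin n} {O : ℕ → Fin n}

/-- The smaller ends of the edges of a matching. -/
def lowEnds (f : Fin n → Fin n) : Finset (Fin n) := Finset.univ.filter fun x => x < f x

theorem mem_lowEnds {x : Fin n} : x ∈ lowEnds f ↔ x < f x := by simp [lowEnds]

theorem IsMate.matched_eq (hf : IsMate G f) : matched f = 2 * (lowEnds f).card := by
  classical
  have h : (Finset.univ.filter fun x => f x ≠ x) = lowEnds f ∪ (lowEnds f).image f := by
    ext x
    simp only [Finset.mem_filter, Finset.mem_univ, true_and, Finset.mem_union, Finset.mem_image,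
      mem_lowEnds]
    constructor
    · intro hx
      rcases lt_or_gt_of_ne hx with h | h
      · exact Or.inr ⟨f x, by rwa [hf.invol], hf.invol x⟩
      · exact Or.inl h
    · rintro (h | ⟨y, h, rfl⟩)
      · exact h.ne'
      · rw [hf.invol]
        exact h.ne
  rw [matched, h, Finset.card_union_of_disjoint, Finset.card_image_of_injective _ hf.injective]
  · ring
  · rw [Finset.disjoint_left]
    intro x hx hx'
    obtain ⟨y, hy, rfl⟩ := Finset.mem_image.mp hx'
    rw [mem_lowEnds] at hx hy
    rw [hf.invol] at hx
    exact absurd hx hy.asymm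

/-- The edges of a matching in the order `O`. -/
def orderedPairs (hf : IsMate G f) (hO : ∀ t < m, O t ∈ lowEnds f)
    (hinj : ∀ t < m, ∀ j < t, O j ≠ O t) : Pairs G m where
  e t x := if x then O t else f (O t)
  inj i hi j hj x y h := by
    have hlt : ∀ t < m, O t < f (O t) := fun t ht => mem_lowEnds.mp (hO t ht)
    have h0 : O i = O j → i = j := fun h => by
      rcases lt_trichotomy i j with h' | h' | h'
      · exact absurd h (hinj j hj i h')
      · exact h'
      · exact absurd h.symm (hinj i hi j h')
    cases x <;> cases y
    · exact ⟨h0 (hf.injective (by simpa using h)), rfl⟩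
    · have h : f (O i) = O j := by simpa using h
      have h1 := hlt j hj
      rw [← h, hf.invol] at h1
      exact absurd (hlt i hi) h1.asymm
    · have h : O i = f (O j) := by simpa using h
      have h1 := hlt i hi
      rw [h, hf.invol] at h1
      exact absurd (hlt j hj) h1.asymm
    · exact ⟨h0 (by simpa using h), rfl⟩
  adj i hi := by
    simpa using hf.adj (O i) (mem_lowEnds.mp (hO i hi)).ne'

/-- There is an edge between the edges of `x` and `y`. -/
def Joined (G : SimpleGraph (Fin n)) (f : Fin n → Fin n) (x y : Fin n) : Prop :=
  (G.Adj x y ∨ G.Adj x (f y)) ∨ (G.Adj (f x) y ∨ G.Adj (f x) (f y))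

theorem Joined.symm {x y : Fin n} (h : Joined G f x y) : Joined G f y x := by
  unfold Joined at *
  simp only [G.adj_comm y, G.adj_comm (f y)]
  tauto

open scoped Classical in
-- With maximum degree 2, each end of an edge of the matching has at most one neighbour besides its
-- mate, so the edge is joined to at most two others.
theorem card_joined_le [DecidableRel G.Adj] (hf : IsMate G f) (hdeg : ∀ x, G.degree x ≤ 2)
    {x : Fin n} (hx : x ∈ lowEnds f) :
    ((lowEnds f).filter fun y => x ≠ y ∧ Joined G f x y).card ≤ 2 := by
  rw [mem_lowEnds] at hx
  have hadj := hf.adj x hx.ne'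
  set low : Fin n → Fin n := fun z => if z < f z then z else f z with hlow
  have hlow1 : ∀ y, y < f y → low y = y := fun y hy => if_pos hy
  have hlow2 : ∀ y, y < f y → low (f y) = y := fun y hy => by
    rw [hlow]
    simp only [hf.invol, if_neg hy.asymm]
  have hsub : ((lowEnds f).filter fun y => x ≠ y ∧ Joined G f x y) ⊆
      (((G.neighborFinset x).erase (f x)) ∪ ((G.neighborFinset (f x)).erase x)).image low := by
    intro y hy
    simp only [Finset.mem_filter, mem_lowEnds] at hy
    obtain ⟨hy, hne, h⟩ := hy
    have h1 : y ≠ f x := fun h => by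
      rw [h, hf.invol] at hy
      exact absurd hx hy.asymm
    have h2 : f y ≠ x := fun h => h1 (by rw [← h, hf.invol])
    have h3 : f y ≠ f x := fun h => hne (hf.injective h).symm
    rw [Finset.mem_image]
    simp only [Finset.mem_union, Finset.mem_erase, SimpleGraph.mem_neighborFinset]
    rcases h with (h | h) | (h | h)
    · exact ⟨y, Or.inl ⟨h1, h⟩, hlow1 y hy⟩
    · exact ⟨f y, Or.inl ⟨h3, h⟩, hlow2 y hy⟩
    · exact ⟨y, Or.inr ⟨hne.symm, h⟩, hlow1 y hy⟩
    · exact ⟨f y, Or.inr ⟨h2, h⟩, hlow2 y hy⟩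
  refine (Finset.card_le_card hsub).trans (Finset.card_image_le.trans
    ((Finset.card_union_le _ _).trans ?_))
  rw [Finset.card_erase_of_mem ((G.mem_neighborFinset _ _).mpr hadj),
    Finset.card_erase_of_mem ((G.mem_neighborFinset _ _).mpr hadj.symm),
    G.card_neighborFinset_eq_degree, G.card_neighborFinset_eq_degree]
  have := hdeg x
  have := hdeg (f x)
  omega

/-- The order prefers edges that are joined to an earlier leader of the same chunk. -/
def Prefer (G : SimpleGraph (Fin n)) (f : Fin n → Fin n) (O : ℕ → Fin n) (c r t : ℕ) (w : Fin n) :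
    Prop := (w < f w ∧ ∀ j < t, O j ≠ w) ∧ ∃ j < t, j / c = t / c ∧ j % c < r ∧ Joined G f (O j) w

/-- `Prefer` is membership in `pending` for the relation of distinct joined edges, and an edge of
`G` between any of their ends makes two edges joined. -/
theorem noCross_orderedPairs [DecidableRel G.Adj] (hf : IsMate G f) (hO : ∀ t < m, O t ∈ lowEnds f)
    (hinj : ∀ t < m, ∀ j < t, O j ≠ O t) (hdeg : ∀ x, G.degree x ≤ 2) {r c s B : ℕ}
    (hpref : ∀ t < m, (∃ w, Prefer G f O c r t w) → Prefer G f O c r t (O t))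
    (hrc : r + 2 ≤ c) (hm : B * s * c ≤ m) : NoCross (orderedPairs hf hO hinj) r c s B := by
  classical
  intro β hβ κ κ' h1 h2 h3 b hb b' hb' x y h
  have hκ' : κ' < B * s := by
    refine h3.trans_le ?_
    calc β * s + s = (β + 1) * s := by ring
      _ ≤ B * s := Nat.mul_le_mul_right s hβ
  have hlt : κ' * c + b' < m := by
    refine lt_of_lt_of_le ?_ hm
    calc κ' * c + b' < (κ' + 1) * c := by rw [add_mul]; omega
      _ ≤ B * s * c := Nat.mul_le_mul_right c hκ'
  have hle : κ * c + c ≤ κ' * c := by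
    calc κ * c + c = (κ + 1) * c := by ring
      _ ≤ κ' * c := Nat.mul_le_mul_right c h2
  have hne : O (κ * c + b) ≠ O (κ' * c + b') := hinj _ hlt _ (by omega)
  have hmem : ∀ t, ∀ w, Prefer G f O c r t w ↔ w ∈ pending (lowEnds f)
      (fun x y => x ≠ y ∧ Joined G f x y) O c r (t / c) t := by
    intro t w
    rw [mem_pending, Prefer, mem_lowEnds]
    constructor
    · rintro ⟨⟨h4, h5⟩, j, h6, h7, h8, h9⟩
      exact ⟨h4, h5, j, h6, h7, h8, h5 j h6, h9⟩
    · rintro ⟨h4, h5, j, h6, h7, h8, -, h9⟩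
      exact ⟨⟨h4, h5⟩, j, h6, h7, h8, h9⟩
  refine not_joined_of_order (U := lowEnds f) (C := fun x y => x ≠ y ∧ Joined G f x y) (O := O)
    (r := r) (m := m)
    (fun x y h => ⟨h.1.symm, h.2.symm⟩) (fun x hx => ?_) hO hinj
    (fun t ht hne => ?_) hrc (κ := κ) (by omega) hb (t := κ' * c + b') (by omega) hlt ⟨hne, ?_⟩
  · convert card_joined_le hf hdeg hx
  · obtain ⟨w, hw⟩ := hne
    exact (hmem _ _).mp (hpref t ht ⟨w, (hmem _ _).mpr hw⟩)
  · cases x <;> cases y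
    · exact Or.inr (Or.inr h)
    · exact Or.inr (Or.inl h)
    · exact Or.inl (Or.inr h)
    · exact Or.inl (Or.inl h)

/-- Edges remain as long as not all of them have been ordered. -/
theorem exists_unused (hm : m = (lowEnds f).card) {t : ℕ} (ht : t < m) (O : ℕ → Fin n) :
    ∃ w, w < f w ∧ ∀ j < t, O j ≠ w := by
  classical
  by_contra! h
  have hsub : lowEnds f ⊆ (Finset.range t).image O := fun w hw => by
    obtain ⟨j, hj, rfl⟩ := h w (mem_lowEnds.mp hw)
    exact Finset.mem_image_of_mem _ (Finset.mem_range.mpr hj)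
  have := (Finset.card_le_card hsub).trans Finset.card_image_le
  rw [Finset.card_range] at this
  omega

end OrderedPairs

/-! ### Arrays that are not read -/

/-- The expression does not read the array `x`. -/
def Expr.Avoids (x : ℕ) : Expr → Prop
  | .var _ => True
  | .const _ => True
  | .add e f => e.Avoids x ∧ f.Avoids x
  | .sub e f => e.Avoids x ∧ f.Avoids x
  | .read a e => a ≠ x ∧ e.Avoids x
  | .ite c e f => c.Avoids x ∧ e.Avoids x ∧ f.Avoids x
  | .sum _ e => e.Avoids x

theorem Expr.eval_congr {x : ℕ} {A A' : ℕ → ℕ → ℕ} (hA : ∀ b, b ≠ x → A b = A' b) (e : Expr) :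
    e.Avoids x → ∀ v, e.eval v A = e.eval v A' := by
  induction e with
  | var _ => exact fun _ _ => rfl
  | const _ => exact fun _ _ => rfl
  | add e f ihe ihf => exact fun h v => by rw [eval, eval, ihe h.1, ihf h.2]
  | sub e f ihe ihf => exact fun h v => by rw [eval, eval, ihe h.1, ihf h.2]
  | read a e ihe => exact fun h v => by rw [eval, eval, ihe h.2, hA a h.1]
  | ite c e f ihc ihe ihf => exact fun h v => by rw [eval, eval, ihc h.1, ihe h.2.1, ihf h.2.2]
  | sum y e ihe => exact fun h v => Finset.sum_congr rfl fun j _ => ihe h _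

/-- The statement does not read the array `x`. -/
def Stmt.Avoids (x : ℕ) : Stmt → Prop
  | .write _ e f => e.Avoids x ∧ f.Avoids x
  | .seq p q => p.Avoids x ∧ q.Avoids x
  | .ite c p q => c.Avoids x ∧ p.Avoids x ∧ q.Avoids x
  | .forN _ p => p.Avoids x

/-- Applied to array `1`, it shows that the matching and the order of its edges are the same for all
random bits. -/
theorem Stmt.run_congr {x : ℕ} (p : Stmt) : p.Avoids x → ∀ (v : ℕ → ℕ) (A A' : ℕ → ℕ → ℕ),
    (∀ b, b ≠ x → A b = A' b) → ∀ b, b ≠ x → p.run v A b = p.run v A' b := by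
  induction p with
  | write a e f =>
    intro h v A A' hA b hb
    rw [run, run, Expr.eval_congr hA e h.1, Expr.eval_congr hA f h.2]
    by_cases hab : b = a
    · subst hab
      rw [Function.update_self, Function.update_self, hA b hb]
    · rw [Function.update_of_ne hab, Function.update_of_ne hab, hA b hb]
  | seq p q ihp ihq => exact fun h v A A' hA => ihq h.2 v _ _ (ihp h.1 v A A' hA)
  | ite c p q ihp ihq =>
    intro h v A A' hA
    rw [run, run, Expr.eval_congr hA c h.1]
    split_ifs
    · exact ihp h.2.1 v A A' hA
    · exact ihq h.2.2 v A A' hA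
  | forN y p ih =>
    intro h v A A' hA
    rw [run, run]
    generalize v 0 = m
    induction m with
    | zero => exact hA
    | succ m ihm =>
      rw [List.range_succ, List.foldl_append, List.foldl_append]
      exact ih h _ _ _ ihm

theorem avoids_insAll (T : List (ℕ × ℕ)) : (insAll T).Avoids 1 := by
  induction T using List.reverseRecOn with
  | nil => simp [insAll, copy, Stmt.fill, Stmt.Avoids, Expr.Avoids]
  | append_singleton T p ih =>
    have e : insAll (T ++ [p]) = .seq (insAll T) (Stmt.fill 1 4 (insE p.1 p.2)) := by
      simp [insAll, List.foldl_append]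
    rw [e]
    exact ⟨ih, by simp [insE, adjE, Stmt.fill, Stmt.Avoids, Expr.Avoids, Expr.eq, Expr.or]⟩

theorem avoids_matchStmt (c : ℕ) : (matchStmt c).Avoids 1 := by
  have h : ∀ d T, (searchStmt d T).Avoids 1 := by
    intro d
    induction d with
    | zero =>
      refine fun T => ⟨avoids_insAll T, ?_⟩
      simp [matchedE, copy, Stmt.skip, Stmt.fill, Stmt.Avoids, Expr.Avoids, Expr.lt, Expr.eq,
        Expr.not, Expr.count]
    | succ d ih => exact fun T => ih _
  exact ⟨by simp [Stmt.fill, Stmt.Avoids, Expr.Avoids], h c []⟩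

/-! ### The parameters of the layout -/

section Parameters

variable {n k : ℕ} {G : SimpleGraph (Fin n)} {f : Fin n → Fin n} {v : ℕ → ℕ}
  {A B : ℕ → ℕ → ℕ}

/-- The store holds the input and the matching `f`. -/
structure State (G : SimpleGraph (Fin n)) (k : ℕ) (f : Fin n → Fin n) (v : ℕ → ℕ)
    (A : ℕ → ℕ → ℕ) : Prop where
  v0 : v 0 = n
  v1 : v 1 = k
  graph : HasGraph G A
  mate : Rep A 3 f
  pos : 0 < k
  le : k ≤ n

theorem State.update (S : State G k f v A) {x : ℕ} (hx : 2 ≤ x) (j : ℕ) :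
    State G k f (Function.update v x j) A where
  v0 := by rw [Function.update_of_ne (by omega), S.v0]
  v1 := by rw [Function.update_of_ne (by omega), S.v1]
  graph := S.graph
  mate := S.mate
  pos := S.pos
  le := S.le

theorem State.congr (S : State G k f v A) (h0 : B 0 = A 0) (h3 : B 3 = A 3) :
    State G k f v B where
  v0 := S.v0
  v1 := S.v1
  graph := by rw [HasGraph, h0]; exact S.graph
  mate := fun i => by rw [h3]; exact S.mate i
  pos := S.pos
  le := S.le

theorem State.val_mate (S : State G k f v A) {e : Expr} {i : Fin n} (he : Val v A e i) :
    Val v A (.read 3 e) (f i) := by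
  rw [← S.mate i]
  exact he.read 3

/-- The maximum degree. -/
def maxDegE : Expr := .count 1 (.sum 2 (.lt (.var 3) (.count 3 (adjE (.var 4) (.var 5)))))

theorem State.val_maxDeg [DecidableRel G.Adj] (S : State G k f v A) :
    Val v A maxDegE G.maxDegree := by
  classical
  have h : Val v A maxDegE (Finset.univ.filter fun j : Fin n => ∃ x, (j : ℕ) < G.degree x).card := by
    refine Val.count S.v0 fun j => Tests.exists (S.update (by norm_num) _).v0 fun x =>
      Val.lt (Val.var (by norm_num) (by simp)) ?_
    rw [← G.card_neighborFinset_eq_degree, G.neighborFinset_eq_filter]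
    have S' := (S.update (x := 1 + 2) (by norm_num) j).update (x := 2 + 2) (by norm_num) x
    refine Val.count S'.v0 fun y => Tests.adj S.graph (S'.update (by norm_num) _).v0 ?_ ?_
    · exact Val.var (by norm_num) (by simp)
    · exact Val.var (by norm_num) (by simp)
  convert h using 1
  have hn : 0 < n := S.pos.trans_le S.le
  have : Nonempty (Fin n) := ⟨⟨0, hn⟩⟩
  obtain ⟨x₀, hx₀⟩ := G.exists_maximal_degree_vertex
  have hlt : G.maxDegree < n := by
    have := G.maxDegree_lt_card_verts
    rwa [Fintype.card_fin] at this
  -- The numbers below some degree are those below the maximum degree, and this is less than `n`, so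
  -- the count is not cut off.
  have e : (Finset.univ.filter fun j : Fin n => ∃ x, (j : ℕ) < G.degree x) =
      Finset.Iio ⟨G.maxDegree, hlt⟩ := by
    ext j
    simp only [Finset.mem_filter, Finset.mem_univ, true_and, Finset.mem_Iio, Fin.lt_def]
    exact ⟨fun ⟨x, hx⟩ => hx.trans_le (G.degree_le_maxDegree x), fun h => ⟨x₀, by rwa [← hx₀]⟩⟩
  rw [e, Fin.card_Iio]

/-- The number of edges of the matching. -/
def edgesE : Expr := .count 1 (.lt (.var 3) (.read 3 (.var 3)))

theorem State.val_edges (S : State G k f v A) : Val v A edgesE (lowEnds f).card := by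
  refine Val.count S.v0 fun j => ?_
  have h : Val (Function.update v (1 + 2) j) A (.var 3) j := Val.var (by norm_num) (by simp)
  exact (Val.lt h ((S.update (by norm_num) _).val_mate h)).congr Fin.lt_def.symm

theorem State.val_k (S : State G k f v A) : Val v A (.var 1) k := Val.var (by norm_num) S.v1

/-- The number of leaders of a chunk. -/
def leadersE : Expr :=
  .ite (.eq maxDegE (.const 2))
    (.ite (.eq (.var 1) (.const 5)) (.const 1) <| .ite (.eq (.var 1) (.const 6)) (.const 2) <|
      .ite (.eq (.var 1) (.const 7)) (.const 1) <| .ite (.eq (.var 1) (.const 8)) (.const 2) <|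
      .ite (.eq (.var 1) (.const 9)) (.const 3) <| .ite (.eq (.var 1) (.const 10)) (.const 2)
      (.var 1)) (.var 1)

variable [DecidableRel G.Adj]

theorem State.val_leaders (S : State G k f v A) :
    Val v A leadersE (leadersPer G.maxDegree k) := by
  have h : ∀ {a a' i : ℕ} {e : Expr}, Val v A e a → Val v A (.ite (.eq (.var 1) (.const i))
      (.const a') e) (if k = i then a' else a) := fun he =>
    Val.ite (S.val_k.eq (Val.const _)) (fun _ => Val.const _) fun _ => he
  exact Val.ite (S.val_maxDeg.eq (Val.const 2))
    (fun _ => h (h (h (h (h (h S.val_k)))))) fun _ => S.val_k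

/-- The number of chunks of a group. -/
def chunksE : Expr := divE (.var 1) leadersE

theorem leadersPer_pos {D : ℕ} (hk : 0 < k) : 0 < leadersPer D k := (isShape_groups hk D 0).pos

theorem State.val_chunks (S : State G k f v A) : Val v A chunksE (chunksPer G.maxDegree k) :=
  S.val_k.div S.v0 S.val_leaders (leadersPer_pos S.pos) ((Nat.div_le_self _ _).trans S.le)

/-- The number of edges of a chunk. -/
def sizeE : Expr := divE (.add (.var 1) leadersE) (.const 2)

theorem leadersPer_le {D : ℕ} (hk : 0 < k) : leadersPer D k ≤ k := by
  have h := isShape_groups hk D 0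
  have := h.le
  have := h.add
  omega

theorem State.val_size (S : State G k f v A) : Val v A sizeE (chunkSize G.maxDegree k) := by
  have := leadersPer_le (D := G.maxDegree) S.pos
  have := S.le
  exact (S.val_k.add S.val_leaders).div S.v0 (Val.const 2) (by norm_num) (by omega)

/-- The number of groups. -/
def groupsE : Expr := divE edgesE (mulE chunksE sizeE)

theorem card_lowEnds_le (f : Fin n → Fin n) : (lowEnds f).card ≤ n := by
  simpa using Finset.card_le_univ (lowEnds f)

theorem chunkSize_pos {D : ℕ} (hk : 0 < k) : 0 < chunkSize D k := (isShape_groups hk D 0).c_pos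

theorem chunksPer_pos {D : ℕ} (hk : 0 < k) : 0 < chunksPer D k :=
  Nat.div_pos (leadersPer_le hk) (leadersPer_pos hk)

theorem State.val_groups (S : State G k f v A) :
    Val v A groupsE (groups G.maxDegree k (lowEnds f).card) := by
  refine S.val_edges.div S.v0 (S.val_chunks.mul S.v0 S.val_size ?_)
    (Nat.mul_pos (chunksPer_pos S.pos) (chunkSize_pos S.pos))
    ((Nat.div_le_self _ _).trans (card_lowEnds_le f))
  exact (Nat.div_le_self _ _).trans S.le

/-- Whether the leaders are scattered. -/
def scatteredE : Expr :=
  .or (.and (.lt (.const 2) maxDegE) (.lt (.const 5) (.var 1)))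
    (.and (.eq maxDegE (.const 2)) (.lt (.const 10) (.var 1)))

theorem State.tests_scattered (S : State G k f v A) :
    Tests v A scatteredE (Scattered G.maxDegree k) :=
  (Tests.and ((Val.const 2).lt S.val_maxDeg) fun _ => (Val.const 5).lt S.val_k).or
    (Tests.and (S.val_maxDeg.eq (Val.const 2)) fun _ => (Val.const 10).lt S.val_k)

/-! ### The order of the edges -/

/-- The edge with the end in the variable `4` is not among the first edges; their number is the
variable `2`. -/
def candE : Expr := .and (.lt (.var 4) (.read 3 (.var 4)))
  (.not (.sum 1 (.and (.lt (.var 3) (.var 2)) (.eq (.read 5 (.var 3)) (.var 4)))))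

/-- Whether the edges of the workers `x` and `y` are joined. -/
def joinedE (x y : Expr) : Expr :=
  .or (.or (adjE x y) (adjE x (.read 3 y))) (.or (adjE (.read 3 x) y) (adjE (.read 3 x) (.read 3 y)))

omit [DecidableRel G.Adj] in
theorem State.tests_joined (S : State G k f v A) {x y : Expr} {i j : Fin n} (hx : Val v A x i)
    (hy : Val v A y j) : Tests v A (joinedE x y) (Joined G f i j) :=
  ((Tests.adj S.graph S.v0 hx hy).or (Tests.adj S.graph S.v0 hx (S.val_mate hy))).or
    ((Tests.adj S.graph S.v0 (S.val_mate hx) hy).or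
      (Tests.adj S.graph S.v0 (S.val_mate hx) (S.val_mate hy)))

/-- The edge with the end in the variable `4` is preferred. -/
def preferE : Expr := .and candE (.sum 1 (.and (.lt (.var 3) (.var 2))
  (.and (.eq (divE (.var 3) sizeE) (divE (.var 2) sizeE))
    (.and (.lt (modE (.var 3) sizeE) leadersE) (joinedE (.read 5 (.var 3)) (.var 4))))))

/-- The next edge. -/
def orderE : Expr := .ite (.sum 2 preferE) (firstE 3 2 preferE) (firstE 3 2 candE)

variable {O : ℕ → Fin n} {t : ℕ}

theorem exists_fin_lt {t : ℕ} (ht : t ≤ n) {p : ℕ → Prop} :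
    (∃ j : Fin n, (j : ℕ) < t ∧ p j) ↔ ∃ j < t, p j :=
  ⟨fun ⟨j, h⟩ => ⟨j, h⟩, fun ⟨j, h1, h2⟩ => ⟨⟨j, by omega⟩, h1, h2⟩⟩

omit [DecidableRel G.Adj] in
theorem State.tests_cand (S : State G k f v A) (ht : t ≤ n) (hO : ∀ j < t, A 5 j = O j)
    (h2 : v 2 = t) {w : Fin n} (h4 : v 4 = w) :
    Tests v A candE (w < f w ∧ ∀ j < t, O j ≠ w) := by
  have hw : Val v A (.var 4) w := Val.var (by norm_num) h4
  refine (Tests.and (hw.lt (S.val_mate hw)) fun _ => Tests.not (Tests.exists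
    (p := fun j : Fin n => (j : ℕ) < t ∧ O j = w) S.v0 fun j => ?_)).congr ?_
  · have hj : Val (Function.update v (1 + 2) j) A (.var 3) j := Val.var (by norm_num) (by simp)
    refine Tests.and (hj.lt (Val.var (by norm_num) (by simp [h2]))) fun hjt => ?_
    refine ((hj.read 5).eq (Val.var (a := w) (by norm_num) (by simp [h4]))).congr ?_
    rw [hO j hjt, Fin.val_inj]
  · rw [exists_fin_lt (p := fun j => O j = w) ht, Fin.lt_def]
    push Not
    rfl

theorem State.tests_prefer (S : State G k f v A) (ht : t ≤ n) (hO : ∀ j < t, A 5 j = O j)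
    (h2 : v 2 = t) {w : Fin n} (h4 : v 4 = w) : Tests v A preferE
      (Prefer G f O (chunkSize G.maxDegree k) (leadersPer G.maxDegree k) t w) := by
  set c := chunkSize G.maxDegree k
  set r := leadersPer G.maxDegree k
  refine (Tests.and (S.tests_cand ht hO h2 h4) fun _ => Tests.exists
    (p := fun j : Fin n => (j : ℕ) < t ∧ (j : ℕ) / c = t / c ∧ (j : ℕ) % c < r ∧
      Joined G f (O j) w) S.v0 fun j => ?_).congr ?_
  · have S' := S.update (x := 1 + 2) (by norm_num) j
    have hj : Val (Function.update v (1 + 2) j) A (.var 3) j := Val.var (by norm_num) (by simp)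
    have htv : Val (Function.update v (1 + 2) j) A (.var 2) t :=
      Val.var (by norm_num) (by simp [h2])
    have hc : 0 < c := chunkSize_pos S.pos
    have hjn : (j : ℕ) / c ≤ n := (Nat.div_le_self _ _).trans j.isLt.le
    refine Tests.and (hj.lt htv) fun hjt => Tests.and
      ((hj.div S'.v0 S'.val_size hc hjn).eq
        (htv.div S'.v0 S'.val_size hc ((Nat.div_le_self _ _).trans ht))) fun _ => Tests.and
      ((hj.mod S'.v0 S'.val_size hc hjn).lt S'.val_leaders) fun _ => S'.tests_joined ?_ ?_
    · rw [← hO j hjt]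
      exact hj.read 5
    · exact Val.var (by norm_num) (by simp [h4])
  · rw [exists_fin_lt (p := fun j => j / c = t / c ∧ j % c < r ∧ Joined G f (O j) w) ht]
    rfl

theorem State.val_order (S : State G k f v A) (ht : t ≤ n) (hO : ∀ j < t, A 5 j = O j)
    (h2 : v 2 = t) (hex : ∃ w, w < f w ∧ ∀ j < t, O j ≠ w) :
    ∃ o : Fin n, Val v A orderE o ∧ (o < f o ∧ ∀ j < t, O j ≠ o) ∧
      ((∃ w, Prefer G f O (chunkSize G.maxDegree k) (leadersPer G.maxDegree k) t w) →
        Prefer G f O (chunkSize G.maxDegree k) (leadersPer G.maxDegree k) t o) := by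
  classical
  set p := Prefer G f O (chunkSize G.maxDegree k) (leadersPer G.maxDegree k) t
  have hp : Tests v A (.sum 2 preferE) (∃ w, p w) := Tests.exists S.v0 fun w =>
    (S.update (by norm_num) _).tests_prefer ht hO (by simp [h2]) (by simp)
  have hp1 : Val v A (firstE 3 2 preferE) _ := Val.first S.v0 (by norm_num) (by norm_num)
    (by norm_num) (p := p) fun i w => ((S.update (by norm_num) _).update
      (by norm_num) _).tests_prefer ht hO (by simp [h2]) (by simp)
  have hc1 : Val v A (firstE 3 2 candE) _ := Val.first S.v0 (by norm_num) (by norm_num)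
    (by norm_num) (p := fun w => w < f w ∧ ∀ j < t, O j ≠ w) fun i w =>
      ((S.update (by norm_num) _).update (by norm_num) _).tests_cand ht hO (by simp [h2]) (by simp)
  have h := Val.ite hp (fun _ => hp1) fun _ => hc1
  by_cases hpw : ∃ w, p w
  · rw [if_pos hpw] at h
    obtain ⟨o, ho, ho'⟩ := exists_firstIndex_eq hpw
    exact ⟨o, by rwa [ho'] at h, ho.1, fun _ => ho⟩
  · rw [if_neg hpw] at h
    obtain ⟨o, ho, ho'⟩ := exists_firstIndex_eq hex
    exact ⟨o, by rwa [ho'] at h, ho, fun h => absurd h hpw⟩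

/-- Put the edges in order. -/
def orderStmt : Stmt := Stmt.fill 0 5 orderE

theorem avoids_orderStmt : orderStmt.Avoids 1 := by
  simp [orderStmt, orderE, preferE, candE, joinedE, adjE, sizeE, leadersE, maxDegE, firstE, modE,
    divE, mulE, Stmt.fill, Stmt.Avoids, Expr.Avoids, Expr.eq, Expr.or, Expr.and, Expr.not, Expr.lt,
    Expr.count]

/-- Strong induction on the position: the entries written so far are the first edges of the order,
which is all that the next choice looks at. -/
theorem State.run_order (S : State G k f v A) : (∀ b, b ≠ 5 → orderStmt.run v A b = A b) ∧
    ∃ O : ℕ → Fin n, ∀ t < (lowEnds f).card, orderStmt.run v A 5 t = O t ∧ O t ∈ lowEnds f ∧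
      (∀ j < t, O j ≠ O t) ∧
      ((∃ w, Prefer G f O (chunkSize G.maxDegree k) (leadersPer G.maxDegree k) t w) →
        Prefer G f O (chunkSize G.maxDegree k) (leadersPer G.maxDegree k) t (O t)) := by
  obtain ⟨R, h1, -, h3⟩ := Stmt.run_fill 0 5 orderE v A
  rw [orderStmt, h1]
  refine ⟨fun b hb => Function.update_of_ne hb _ _, ?_⟩
  have hn : 0 < n := S.pos.trans_le S.le
  have hm := card_lowEnds_le f
  set O : ℕ → Fin n := fun t => if h : R t < n then ⟨R t, h⟩ else ⟨0, hn⟩ with hO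
  refine ⟨O, fun t => ?_⟩
  rw [Function.update_self]
  induction t using Nat.strong_induction_on with
  | _ t ih =>
    intro ht
    have S' : State G k f (Function.update v (0 + 2) t)
        (Function.update A 5 fun j => if j < t then R j else A 5 j) :=
      (S.congr (Function.update_of_ne (by norm_num) _ _)
        (Function.update_of_ne (by norm_num) _ _)).update (by norm_num) t
    obtain ⟨o, ho1, ho2, ho3⟩ := S'.val_order (O := O) (t := t) (by omega) (fun j hj => by
      rw [Function.update_self, if_pos hj, (ih j hj (by omega)).1]) (by simp)
      (exists_unused rfl ht O)
    have hR : R t = o := by rw [h3 t (by rw [S.v0]; omega), ho1.eval]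
    have hOt : O t = o := by
      rw [hO]
      simp only [hR, o.isLt, dif_pos]
    rw [hOt, mem_lowEnds]
    exact ⟨hR, ho2.1, ho2.2, ho3⟩

end Parameters

/-! ### From random bits to the assignment. -/

section Output

variable {n k : ℕ} {G : SimpleGraph (Fin n)} {f : Fin n → Fin n} {v : ℕ → ℕ}
  {A : ℕ → ℕ → ℕ}

/-! ### The keys of the leaders -/

/-- Compute the powers of two. -/
def powStmt : Stmt := Stmt.fill 0 7 (.ite (.eq (.var 2) (.const 0)) (.const 1)
  (.add (.read 7 (.sub (.var 2) (.const 1))) (.read 7 (.sub (.var 2) (.const 1)))))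

theorem run_powStmt (hv : v 0 = n) : (∀ b, b ≠ 7 → powStmt.run v A b = A b) ∧
    ∀ i < n, powStmt.run v A 7 i = 2 ^ i := by
  obtain ⟨R, h1, -, h3⟩ := Stmt.run_fill 0 7 (.ite (.eq (.var 2) (.const 0)) (.const 1)
    (.add (.read 7 (.sub (.var 2) (.const 1))) (.read 7 (.sub (.var 2) (.const 1))))) v A
  rw [powStmt, h1]
  refine ⟨fun b hb => Function.update_of_ne hb _ _, fun i => ?_⟩
  rw [Function.update_self]
  induction i with
  | zero =>
    intro hi
    rw [h3 0 (by omega)]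
    simp
  | succ i ih =>
    intro hi
    rw [h3 (i + 1) (by omega)]
    have := ih (by omega)
    simp [this, pow_succ]
    omega

/-- Read the keys off the random bits. -/
def keyStmt : Stmt := Stmt.fill 0 8 (.sum 1 (.ite
  (.read 1 (.add (.add (.var 0) (mulE (.var 2) (.var 0))) (.var 3))) (.read 7 (.var 3)) (.const 0)))

/-- The number with given binary digits. -/
def binaryValue (b : Fin n → Bool) : ℕ := ∑ i : Fin n, if b i = true then 2 ^ (i : ℕ) else 0

theorem binaryValue_injective : Function.Injective (binaryValue (n := n)) := by
  intro b b' h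
  have e : ∀ b : Fin n → Bool, binaryValue b =
      ∑ i ∈ ((Finset.univ.filter fun i => b i = true).map Fin.valEmbedding), 2 ^ i := by
    intro b
    rw [Finset.sum_map, Finset.sum_filter]
    rfl
  rw [e, e] at h
  have h := Finset.map_injective _ (Finset.geomSum_injective le_rfl h)
  funext i
  have hi := Finset.ext_iff.mp h i
  simp only [Finset.mem_filter, Finset.mem_univ, true_and] at hi
  exact Bool.eq_iff_iff.mpr hi

theorem run_keyStmt (hv : v 0 = n) (h7 : ∀ i < n, A 7 i = 2 ^ i) {bits : ℕ → Bool}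
    (h1 : ∀ i, A 1 i ≠ 0 ↔ bits i = true) : (∀ b, b ≠ 8 → keyStmt.run v A b = A b) ∧
    ∀ l < n, keyStmt.run v A 8 l = binaryValue fun i : Fin n => bits (n + l * n + i) := by
  have h := Stmt.run_fill_of_forall (x := 0) (a := 8) (v := v) (A := A) (e := .sum 1 (.ite
    (.read 1 (.add (.add (.var 0) (mulE (.var 2) (.var 0))) (.var 3))) (.read 7 (.var 3))
      (.const 0))) (F := fun l => binaryValue fun i : Fin n => bits (n + l * n + i)) ?_
  · rw [hv] at h
    exact ⟨h.2, h.1⟩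
  · intro l hl B hB _
    rw [hv] at hl
    refine Val.eval (Val.sum (by simp [hv]) fun i => ?_)
    have hi : Val (Function.update (Function.update v (0 + 2) l) (1 + 2) i) B (.var 3) i :=
      Val.var (by norm_num) (by simp)
    have h0 : Val (Function.update (Function.update v (0 + 2) l) (1 + 2) i) B (.var 0) n :=
      Val.var (by norm_num) (by simp [hv])
    have hl' : Val (Function.update (Function.update v (0 + 2) l) (1 + 2) i) B (.var 2) l :=
      Val.var (by norm_num) (by simp)
    refine Val.ite ((Tests.of_val (((h0.add (hl'.mul (by simp [hv]) h0 hl.le)).add hi).read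
      1)).congr ?_) (fun _ => ?_) fun _ => Val.const 0
    · rw [hB 1 (by norm_num), h1]
    · rw [← h7 i i.isLt, ← hB 7 (by norm_num)]
      exact hi.read 7

/-! ### The order of the workers -/

/-- Find the edges of the workers. -/
def indexStmt : Stmt := Stmt.fill 0 10 (firstE 3 2 (.and (.lt (.var 4) edgesE)
  (.or (.eq (.read 5 (.var 4)) (.var 2)) (.eq (.read 3 (.read 5 (.var 4))) (.var 2)))))

theorem State.run_indexStmt (S : State G k f v A) {O : ℕ → Fin n}
    (hO : ∀ t < (lowEnds f).card, A 5 t = O t) : (∀ b, b ≠ 10 → indexStmt.run v A b = A b) ∧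
    (∀ w : Fin n, (∃ t < (lowEnds f).card, (O t = w ∨ f (O t) = w) ∧ indexStmt.run v A 10 w = t) ∨
      ((∀ t < (lowEnds f).card, O t ≠ w ∧ f (O t) ≠ w) ∧ indexStmt.run v A 10 w = n)) := by
  classical
  set m := (lowEnds f).card with hm
  have hmn : m ≤ n := card_lowEnds_le f
  set F : ℕ → ℕ := fun w => firstIndex fun j : Fin n => (j : ℕ) < m ∧
    ((O j : ℕ) = w ∨ (f (O j) : ℕ) = w)
  have h := Stmt.run_fill_of_forall (x := 0) (a := 10) (v := v) (A := A)
    (e := firstE 3 2 (.and (.lt (.var 4) edgesE)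
      (.or (.eq (.read 5 (.var 4)) (.var 2)) (.eq (.read 3 (.read 5 (.var 4))) (.var 2)))))
    (F := F) ?_
  · rw [S.v0] at h
    refine ⟨h.2, fun w => ?_⟩
    rw [indexStmt, h.1 w w.isLt]
    by_cases hex : ∃ j : Fin n, (j : ℕ) < m ∧ ((O j : ℕ) = w ∨ (f (O j) : ℕ) = w)
    · obtain ⟨j, ⟨h1, h2⟩, h3⟩ := exists_firstIndex_eq hex
      exact Or.inl ⟨j, h1, h2.imp Fin.ext Fin.ext, h3⟩
    · refine Or.inr ⟨fun t ht => ?_, firstIndex_of_not hex⟩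
      push Not at hex
      obtain ⟨h1, h2⟩ := hex ⟨t, by omega⟩ ht
      exact ⟨fun h => h1 (congrArg Fin.val h), fun h => h2 (congrArg Fin.val h)⟩
  · intro w hw B hB _
    have S' : State G k f (Function.update v (0 + 2) w) B :=
      (S.congr (hB 0 (by norm_num)) (hB 3 (by norm_num))).update (by norm_num) w
    refine Val.eval (Val.first (x := 3) (y := 2) S'.v0 (by norm_num) (by norm_num) (by norm_num)
      fun i j => ?_)
    have S'' := (S'.update (x := 3 + 2) (by norm_num) i).update (x := 2 + 2) (by norm_num) j
    have hj : Val (Function.update (Function.update (Function.update v (0 + 2) w) (3 + 2) i)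
        (2 + 2) j) B (.var 4) j := Val.var (by norm_num) (by simp)
    have hw' : Val (Function.update (Function.update (Function.update v (0 + 2) w) (3 + 2) i)
        (2 + 2) j) B (.var 2) w := Val.var (by norm_num) (by simp)
    refine Tests.and (hj.lt S''.val_edges) fun hjm => ?_
    have h5 := hj.read 5
    rw [hB 5 (by norm_num), hO j hjm] at h5
    exact (h5.eq hw').or ((S''.val_mate h5).eq hw')

/-- The index of the edge of the worker in the variable `2`. -/
def indexE : Expr := .read 10 (.var 2)

/-- The index of the key of the worker in the variable `2`. -/
def keyIndexE : Expr := .add (mulE (divE indexE sizeE) leadersE) (modE indexE sizeE)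

/-- The end in the variable `2` of its edge is selected by the random bit of the edge. -/
def selectedE : Expr :=
  .or (.and (.eq (.var 2) (.read 5 indexE)) (.read 1 indexE))
    (.and (.not (.eq (.var 2) (.read 5 indexE))) (.not (.read 1 indexE)))

/-- Compute the values by which the workers are sorted. -/
def valueStmt : Stmt := Stmt.fill 0 9
  (.ite (.lt indexE (mulE (mulE groupsE chunksE) sizeE))
    (.ite (.and selectedE (.lt (modE indexE sizeE) leadersE))
      (.add (.add (.var 0) (.const 1)) (.ite scatteredE (.read 8 keyIndexE) keyIndexE))
      (.sub (.sub (mulE groupsE chunksE) (.const 1)) (divE indexE sizeE)))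
    (.var 0))

open scoped Classical in
theorem State.run_valueStmt [DecidableRel G.Adj] (S : State G k f v A)
    (h10 : ∀ w < n, A 10 w ≤ n) : (∀ b, b ≠ 9 → valueStmt.run v A b = A b) ∧
    ∀ w < n, valueStmt.run v A 9 w = layoutVal n (leadersPer G.maxDegree k)
      (chunkSize G.maxDegree k) (chunksPer G.maxDegree k)
      (groups G.maxDegree k (lowEnds f).card)
      (fun l => if Scattered G.maxDegree k then A 8 l else l) (A 10 w)
      (decide (w = A 5 (A 10 w) ↔ A 1 (A 10 w) ≠ 0)) := by
  have h := Stmt.run_fill_of_forall (x := 0) (a := 9) (v := v) (A := A)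
    (e := .ite (.lt indexE (mulE (mulE groupsE chunksE) sizeE))
      (.ite (.and selectedE (.lt (modE indexE sizeE) leadersE))
        (.add (.add (.var 0) (.const 1)) (.ite scatteredE (.read 8 keyIndexE) keyIndexE))
        (.sub (.sub (mulE groupsE chunksE) (.const 1)) (divE indexE sizeE)))
      (.var 0)) (F := fun w => layoutVal n (leadersPer G.maxDegree k)
      (chunkSize G.maxDegree k) (chunksPer G.maxDegree k)
      (groups G.maxDegree k (lowEnds f).card)
      (fun l => if Scattered G.maxDegree k then A 8 l else l) (A 10 w)
      (decide (w = A 5 (A 10 w) ↔ A 1 (A 10 w) ≠ 0))) ?_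
  · rw [S.v0] at h
    exact ⟨h.2, h.1⟩
  · intro w hw B hB _
    rw [S.v0] at hw
    have S' : State G k f (Function.update v (0 + 2) w) B :=
      (S.congr (hB 0 (by norm_num)) (hB 3 (by norm_num))).update (by norm_num) w
    have hw' : Val (Function.update v (0 + 2) w) B (.var 2) w := Val.var (by norm_num) (by simp)
    have hT : Val (Function.update v (0 + 2) w) B indexE (A 10 w) := by
      rw [← hB 10 (by norm_num)]
      exact hw'.read 10
    have hTn := h10 w hw
    set T := A 10 w
    have hc := chunkSize_pos (D := G.maxDegree) S.pos
    have hTc : T / chunkSize G.maxDegree k ≤ n := (Nat.div_le_self _ _).trans hTn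
    have hshape := (isShape_groups S.pos G.maxDegree (lowEnds f).card)
    have hBs : groups G.maxDegree k (lowEnds f).card * chunksPer G.maxDegree k ≤ n :=
      ((Nat.le_mul_of_pos_right _ hc).trans hshape.le_m).trans (card_lowEnds_le f)
    have hgn : groups G.maxDegree k (lowEnds f).card ≤ n :=
      (Nat.le_mul_of_pos_right _ (chunksPer_pos S.pos)).trans hBs
    have hgs := S'.val_groups.mul S'.v0 S'.val_chunks hgn
    have hdiv := hT.div S'.v0 S'.val_size hc hTc
    have hmod := hT.mod S'.v0 S'.val_size hc hTc
    have hkey := (hdiv.mul S'.v0 S'.val_leaders hTc).add hmod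
    have h5 := hT.read 5
    rw [hB 5 (by norm_num)] at h5
    have h1 := Tests.of_val (hT.read 1)
    rw [hB 1 (by norm_num)] at h1
    have h8 := hkey.read 8
    rw [hB 8 (by norm_num)] at h8
    have hsel : Tests (Function.update v (0 + 2) w) B selectedE
        (decide (w = A 5 T ↔ A 1 T ≠ 0) = true) := by
      refine ((Tests.and (hw'.eq h5) fun _ => h1).or
        (Tests.and (hw'.eq h5).not fun _ => h1.not)).congr ?_
      rw [decide_eq_true_iff]
      tauto
    exact Val.eval (Val.ite (hT.lt (hgs.mul S'.v0 S'.val_size hBs)) (fun _ =>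
      Val.ite (Tests.and hsel fun _ => hmod.lt S'.val_leaders)
        (fun _ => ((Val.var (by norm_num) S'.v0).add (Val.const 1)).add
          (Val.ite S'.tests_scattered (fun _ => h8) fun _ => hkey))
        fun _ => (hgs.sub (Val.const 1)).sub hdiv) fun _ => Val.var (by norm_num) S'.v0)

/-- Assign the workers in the order of their values. -/
def outputStmt : Stmt := Stmt.fill 0 2 (divE (.count 1
  (.or (.lt (.read 9 (.var 3)) (.read 9 (.var 2)))
    (.and (.eq (.read 9 (.var 3)) (.read 9 (.var 2))) (.lt (.var 3) (.var 2))))) (.var 1))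

theorem State.run_outputStmt (S : State G k f v A) (w : Fin n) :
    outputStmt.run v A 2 w = sortPos (fun x : Fin n => A 9 x) w / k := by
  classical
  have h := Stmt.run_fill_of_forall (x := 0) (a := 2) (v := v) (A := A) (e := divE (.count 1
    (.or (.lt (.read 9 (.var 3)) (.read 9 (.var 2)))
      (.and (.eq (.read 9 (.var 3)) (.read 9 (.var 2))) (.lt (.var 3) (.var 2))))) (.var 1))
    (F := fun w => if h : w < n then sortPos (fun x : Fin n => A 9 x) ⟨w, h⟩ / k else 0) ?_
  · rw [outputStmt, h.1 w (by rw [S.v0]; exact w.isLt), dif_pos w.isLt]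
  · intro w hw B hB _
    rw [S.v0] at hw
    rw [dif_pos hw]
    have S' : State G k f (Function.update v (0 + 2) w) B :=
      (S.congr (hB 0 (by norm_num)) (hB 3 (by norm_num))).update (by norm_num) w
    refine Val.eval (Val.div S'.v0 ?_ S'.val_k S.pos
      ((Nat.div_le_self _ _).trans (sortPos_lt _ _).le))
    refine Val.count S'.v0 fun x => ?_
    have hx : Val (Function.update (Function.update v (0 + 2) w) (1 + 2) x) B (.var 3) x :=
      Val.var (by norm_num) (by simp)
    have hw' : Val (Function.update (Function.update v (0 + 2) w) (1 + 2) x) B (.var 2) w :=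
      Val.var (by norm_num) (by simp)
    have hx9 := hx.read 9
    have hw9 := hw'.read 9
    rw [hB 9 (by norm_num)] at hx9 hw9
    exact (hx9.lt hw9).or (Tests.and (hx9.eq hw9) fun _ => hx.lt hw')

end Output

/-! ### The algorithm and the theorem. -/

section Algorithm

variable {n k : ℕ} {G : SimpleGraph (Fin n)} [DecidableRel G.Adj]

/-- The whole algorithm. -/
def algorithm : Stmt :=
  -- By `LocallyOptimal.matched_ge` with `c = 4003`, the sizes satisfy `4002 * opt ≤ 4004 * m`, and
  -- `m ≥ 2001` unless the matching is maximum.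
  .seq (matchStmt 4003) <| .seq orderStmt <| .seq powStmt <| .seq keyStmt <| .seq indexStmt <|
    .seq valueStmt outputStmt

theorem leadersPer_add_two_le (h5 : 5 ≤ k) (h10 : k ≤ 10) :
    leadersPer 2 k + 2 ≤ chunkSize 2 k := by
  interval_cases k <;> decide

/-- The matching and the order of its edges do not depend on the random bits. -/
theorem run_algorithm (hk : 0 < k) (hkn : k ≤ n) {A₀ : ℕ → ℕ → ℕ} (hA₀ : HasGraph G A₀) :
    ∃ f, IsMate G f ∧ LocallyOptimal G 4003 f ∧ ∃ P : Pairs G (lowEnds f).card,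
      (G.maxDegree = 2 → 5 ≤ k → k ≤ 10 → NoCross P (leadersPer G.maxDegree k)
        (chunkSize G.maxDegree k) (chunksPer G.maxDegree k)
        (groups G.maxDegree k (lowEnds f).card)) ∧
      ∀ (A : ℕ → ℕ → ℕ) (bits : ℕ → Bool), (∀ b, b ≠ 1 → A b = A₀ b) →
        (∀ i, A 1 i ≠ 0 ↔ bits i = true) → ∃ (key : ℕ → ℕ) (val : Fin n → ℕ),
          (∀ l < n, key l = binaryValue fun i : Fin n => bits (n + l * n + i)) ∧
          (Scattered G.maxDegree k → IsLayout P (leadersPer G.maxDegree k)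
            (chunkSize G.maxDegree k) (chunksPer G.maxDegree k)
            (groups G.maxDegree k (lowEnds f).card) key bits val) ∧
          (¬ Scattered G.maxDegree k → IsLayout P (leadersPer G.maxDegree k)
            (chunkSize G.maxDegree k) (chunksPer G.maxDegree k)
            (groups G.maxDegree k (lowEnds f).card) id bits val) ∧
          ∀ w : Fin n, algorithm.run (Stmt.input n k) A 2 w = sortPos val w / k := by
  classical
  have hv : Stmt.input n k 0 = n := rfl
  have hv1 : Stmt.input n k 1 = k := rfl
  set v := Stmt.input n k
  obtain ⟨f, hf, hopt, hrep, hother⟩ := run_matchStmt 4003 hv hA₀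
  have S : State G k f v ((matchStmt 4003).run v A₀) :=
    ⟨hv, hv1, by rw [HasGraph, hother 0 (by norm_num) (by norm_num)]; exact hA₀, hrep, hk, hkn⟩
  obtain ⟨hother', O, hO⟩ := S.run_order
  set m := (lowEnds f).card with hm
  set P := orderedPairs hf (fun t ht => (hO t ht).2.1) (fun t ht => (hO t ht).2.2.1) with hP
  have hPt : ∀ i, P.e i true = O i := fun i => rfl
  have hPf : ∀ i, P.e i false = f (O i) := fun i => rfl
  refine ⟨f, hf, hopt, P, ?_, ?_⟩
  · intro hD h5 h10
    refine noCross_orderedPairs hf _ _ (fun x => ?_) (fun t ht => (hO t ht).2.2.2) ?_ ?_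
    · rw [← hD]
      exact G.degree_le_maxDegree x
    · rw [hD]
      exact leadersPer_add_two_le h5 h10
    · exact (isShape_groups hk _ _).le_m
  · intro A bits hA hbits
    set A₂ := orderStmt.run v ((matchStmt 4003).run v A) with hA₂
    -- Neither the search nor the ordering reads the random bits, so `f` and `P` can be fixed before
    -- the bits are known.
    have hcongr : ∀ b, b ≠ 1 → A₂ b = orderStmt.run v ((matchStmt 4003).run v A₀) b :=
      Stmt.run_congr _ avoids_orderStmt v _ _ (Stmt.run_congr _ (avoids_matchStmt _) v _ _ hA)
    have hAg : HasGraph G A := by rw [HasGraph, hA 0 (by norm_num)]; exact hA₀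
    have hA1 : A₂ 1 = A 1 := by
      obtain ⟨f', -, -, hrep', ho'⟩ := run_matchStmt 4003 hv hAg
      have S' : State G k f' v ((matchStmt 4003).run v A) :=
        ⟨hv, hv1, by rw [HasGraph, ho' 0 (by norm_num) (by norm_num)]; exact hAg, hrep', hk, hkn⟩
      rw [hA₂, S'.run_order.1 1 (by norm_num), ho' 1 (by norm_num) (by norm_num)]
    have S₂ : State G k f v A₂ := S.congr
      (by rw [hcongr 0 (by norm_num), hother' 0 (by norm_num)])
      (by rw [hcongr 3 (by norm_num), hother' 3 (by norm_num)])
    have hO₂ : ∀ t < m, A₂ 5 t = O t := fun t ht => by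
      rw [hcongr 5 (by norm_num), (hO t ht).1]
    obtain ⟨h7, h7'⟩ := run_powStmt (A := A₂) hv
    set A₃ := powStmt.run v A₂
    obtain ⟨h8, h8'⟩ := run_keyStmt (A := A₃) hv h7' (bits := bits)
      (fun i => by rw [h7 1 (by norm_num), hA1]; exact hbits i)
    set A₄ := keyStmt.run v A₃
    have S₄ : State G k f v A₄ := S₂.congr
      (by rw [h8 0 (by norm_num), h7 0 (by norm_num)])
      (by rw [h8 3 (by norm_num), h7 3 (by norm_num)])
    have hO₄ : ∀ t < m, A₄ 5 t = O t := fun t ht => by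
      rw [h8 5 (by norm_num), h7 5 (by norm_num), hO₂ t ht]
    obtain ⟨h10, h10'⟩ := S₄.run_indexStmt hO₄
    set A₅ := indexStmt.run v A₄
    have S₅ : State G k f v A₅ := S₄.congr (h10 0 (by norm_num)) (h10 3 (by norm_num))
    have hmn : m ≤ n := card_lowEnds_le f
    obtain ⟨h9, h9'⟩ := S₅.run_valueStmt fun w hw => by
      rcases h10' ⟨w, hw⟩ with ⟨t, ht, -, h⟩ | ⟨-, h⟩
      · exact h.trans_le (by omega)
      · exact h.le
    set A₆ := valueStmt.run v A₅
    have S₆ : State G k f v A₆ := S₅.congr (h9 0 (by norm_num)) (h9 3 (by norm_num))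
    have hL : ∀ key' : ℕ → ℕ, (∀ l, key' l = if Scattered G.maxDegree k then A₅ 8 l else l) →
        IsLayout P (leadersPer G.maxDegree k) (chunkSize G.maxDegree k)
          (chunksPer G.maxDegree k) (groups G.maxDegree k m) key' bits
          (fun w : Fin n => A₆ 9 w) := by
      intro key' hkey'
      obtain rfl : key' = fun l => if Scattered G.maxDegree k then A₅ 8 l else l := funext hkey'
      have hle : groups G.maxDegree k m * chunksPer G.maxDegree k * chunkSize G.maxDegree k ≤ m :=
        (isShape_groups hk _ _).le_m
      refine ⟨fun i hi x => ?_, fun w hw => ?_⟩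
      · have hidx : A₅ 10 (P.e i x) = i := by
          rcases h10' (P.e i x) with ⟨t, ht, h, h'⟩ | ⟨h, -⟩
          · rw [h']
            rcases h with h | h
            · exact (P.inj t ht i hi true x h).1
            · exact (P.inj t ht i hi false x h).1
          · cases x
            · exact absurd rfl (h i hi).2
            · exact absurd rfl (h i hi).1
        have hbit : A₅ 1 i ≠ 0 ↔ bits i = true := by
          rw [h10 1 (by norm_num), h8 1 (by norm_num), h7 1 (by norm_num), hA1]
          exact hbits i
        have h5 : A₅ 5 i = P.e i true := by
          rw [h10 5 (by norm_num), hO₄ i hi]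
          rfl
        have hx : (P.e i x : ℕ) = P.e i true ↔ x = true := by
          rw [Fin.val_inj]
          exact ⟨fun h => (P.inj i hi i hi x true h).2, fun h => by rw [h]⟩
        rw [h9' _ (P.e i x).isLt, hidx]
        congr 1
        rw [Bool.eq_iff_iff, decide_eq_true_iff, hbit, h5, hx]
        cases x <;> cases bits i <;> simp
      · have hidx : A₅ 10 w = n := by
          rcases h10' w with ⟨t, ht, h, -⟩ | ⟨-, h⟩
          · rcases h with h | h
            · exact absurd h (hw t ht true)
            · exact absurd h (hw t ht false)
          · exact h
        show A₆ 9 w = n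
        rw [h9' _ w.isLt, hidx, layoutVal, if_neg (not_lt.mpr (hle.trans hmn))]
    refine ⟨A₅ 8, fun w => A₆ 9 w, fun l hl => ?_, fun hs => hL _ fun l => ?_,
      fun hs => hL _ fun l => ?_, S₆.run_outputStmt⟩
    · rw [h10 8 (by norm_num), h8' l hl]
    · rw [if_pos hs]
    · rw [if_neg hs]
      rfl

/-- Comparison with the involution of `M`; halving the numbers of matched workers turns the bounds
for `c = 4003` into those for edges. -/
theorem largeMatching_of_locallyOptimal {f : Fin n → Fin n} (hf : IsMate G f)
    (ho : LocallyOptimal G 4003 f) {M : G.Subgraph} (hM : M.IsMatching) {D q : ℕ}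
    (hq : k * (2 * D * q) ≤ M.edgeSet.ncard) : LargeMatching k D q (lowEnds f).card := by
  obtain ⟨g, hg, hgM⟩ := exists_mate_of_isMatching hM
  have h := ho.matched_ge (by norm_num) hf hg
  rw [hf.matched_eq] at h
  obtain ⟨h1, h2⟩ := h
  exact ⟨by omega, by omega⟩

theorem hasGraph_inputStore {m : ℕ} (r : Fin m → Bool) :
    HasGraph G (inputStore G k r).arr := by
  intro i j
  have h : (∃ u v : Fin n, (i : ℕ) * n + j = u * n + v ∧ G.Adj u v) ↔ G.Adj i j := by
    constructor
    · rintro ⟨u, v, h1, h2⟩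
      have hu : i = u := by
        have h3 := congrArg (· / n) h1
        simp only [chunk_div j.isLt, chunk_div v.isLt] at h3
        exact Fin.ext h3
      have hv : j = v := by
        have h3 := congrArg (· % n) h1
        simp only [chunk_mod j.isLt, chunk_mod v.isLt] at h3
        exact Fin.ext h3
      rwa [hu, hv]
    · exact fun h => ⟨i, j, rfl, h⟩
  simp only [inputStore, if_true, h]
  split_ifs with h' <;> simp [h']

theorem inputStore_bit {m : ℕ} (r : Fin m → Bool) (i : ℕ) :
    (inputStore G k r).arr 1 i ≠ 0 ↔ bit r i = true := by
  by_cases h : i < m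
  · simp [inputStore, bit, h]
  · simp [inputStore, bit, h]

theorem expectedOutOfBusiness_nonneg [NeZero n] {nf : ℕ} (rank : Fin n ≃ Fin n)
    (P : PMF (Assignment n nf)) : 0 ≤ expectedOutOfBusiness G k rank P :=
  Finset.sum_nonneg fun _ _ =>
    mul_nonneg ENNReal.toReal_nonneg (integral_nonneg fun _ => Nat.cast_nonneg _)

end Algorithm

end JobMarket

open JobMarket in
theorem mainTheorem4 :
    ∃ (p : JobMarket.Prog) (bits time : Polynomial ℕ),
      ∀ (k n nf : ℕ) [NeZero n], 0 < k → n = k * nf →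
      ∀ (G : SimpleGraph (Fin n)) [DecidableRel G.Adj],
      ∃ P : PMF (JobMarket.Assignment n nf),
        (∀ μ ∈ P.support, JobMarket.IsMatching k μ ∧ JobMarket.IsComplete μ) ∧
        JobMarket.Samples p G k (bits.eval n) (time.eval n) P ∧
        ∀ M : G.Subgraph, JobMarket.IsMaximumMatching M →
        ∀ rank : Fin n ≃ Fin n,
          (⌊(M.edgeSet.ncard : ℝ) / ((k : ℝ) * (2 * (G.maxDegree : ℝ)))⌋₊ : ℝ)
              * (1 / (2 ^ k * (k.factorial : ℝ) * (2 * (G.maxDegree : ℝ) - 1) ^ k))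
            ≤ JobMarket.expectedOutOfBusiness G k rank P := by
  obtain ⟨p, T, hp⟩ := Stmt.exists_prog algorithm
  -- There are at most `n` orientation bits and at most `n` keys of `n` bits each.
  refine ⟨p, Polynomial.X + Polynomial.X * Polynomial.X, T, ?_⟩
  intro k n nf _ hk hn G _
  have hM : (Polynomial.X + Polynomial.X * Polynomial.X : Polynomial ℕ).eval n = n + n * n := by simp
  rw [hM]
  have hkn : k ≤ n := Nat.le_of_dvd (NeZero.pos n) ⟨nf, hn⟩
  -- The run without random bits serves as the reference for the matching and its order.
  obtain ⟨f, hf, hopt, P, hcross, hrun⟩ := run_algorithm (G := G) hk hkn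
    (hasGraph_inputStore (k := k) fun _ : Fin 0 => false)
  choose t ht final hexec hfinal using
    fun r : Fin (n + n * n) → Bool => hp n k G (n + n * n) r
  have hrun' := fun r : Fin (n + n * n) → Bool => hrun (inputStore G k r).arr (bit r)
    (fun b hb => by funext i; simp [inputStore, hb]) (inputStore_bit r)
  choose key val hkey hL hL' hout using hrun'
  have hsort : ∀ r, output n nf (final r) = sortAssign k nf (val r) := by
    intro r
    funext w
    rw [output, hfinal r]
    simp only [hout r w]
    rfl
  refine ⟨(PMF.uniformOfFintype (Fin (n + n * n) → Bool)).map fun r => output n nf (final r),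
    ?_, ⟨final, fun r => ⟨t r, ht r, hexec r⟩, rfl⟩, ?_⟩
  · intro μ hμ
    rw [PMF.support_map] at hμ
    obtain ⟨r, -, rfl⟩ := hμ
    simp only [hsort r]
    exact ⟨isMatching_sortAssign hk hn _, isComplete_sortAssign hn _⟩
  · intro M hMmax rank
    set q := ⌊(M.edgeSet.ncard : ℝ) / ((k : ℝ) * (2 * (G.maxDegree : ℝ)))⌋₊ with hq
    -- For `q = 0` the bound is trivial, and this includes graphs without edges.
    rcases Nat.eq_zero_or_pos q with hq0 | hq0
    · rw [hq0, Nat.cast_zero, zero_mul]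
      exact expectedOutOfBusiness_nonneg rank _
    -- Maximum degree 0 would make the denominator 0, hence the quotient 0 by convention, and so `q
    -- = 0`.
    · have hD : 0 < G.maxDegree := by
        by_contra! h
        rw [Nat.le_zero.mp h] at hq
        simp at hq
        omega
      have hle : k * (2 * G.maxDegree * q) ≤ M.edgeSet.ncard := by
        have h1 : (q : ℝ) ≤ (M.edgeSet.ncard : ℝ) / ((k : ℝ) * (2 * (G.maxDegree : ℝ))) :=
          Nat.floor_le (by positivity)
        rw [le_div_iff₀ (by positivity)] at h1
        have h2 : q * (k * (2 * G.maxDegree)) ≤ M.edgeSet.ncard := by exact_mod_cast h1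
        calc k * (2 * G.maxDegree * q) = q * (k * (2 * G.maxDegree)) := by ring
          _ ≤ _ := h2
      rw [expectedOutOfBusiness_map]
      simp only [hsort]
      exact le_expect_of_layout hk hn hD G.degree_le_maxDegree
        (largeMatching_of_locallyOptimal hf hopt hMmax.1 hle) hq0 le_rfl binaryValue_injective
        key hkey val (fun hs r => hL r hs) (fun hs r => hL' r hs) hcross rank
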